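/- **Setting.** Let $p\ge 2$, let $q\in\mathbb C$ be a primitive root of unity of order $2p$, and let $s=q^{1/2}$ be a square root of $q$; write $\hat q=q-q^{-1}$, $[n]=(q^n-q^{-n})/\hat q$ and $[m]!=[1]\cdots[m]$. The restricted quantum group $\overline U_q=\overline U_q(\mathfrak{sl}(2))$ is the $\mathbb C$-algebra generated by $E,F,K$ with relations $$K^{2p}=1,\quad E^p=F^p=0,\quad KE=q^2EK,\quad KF=q^{-2}FK,\quad EF-FE=\frac{K-K^{-1}}{q-q^{-1}},$$ with the Hopf algebra structure $\Delta(E)=1\otimes E+E\otimes K$, $\Delta(F)=F\otimes 1+K^{-1}\otimes F$, $\Delta(K)=K\otimes K$, $\varepsilon(E)=\varepsilon(F)=0$, $\varepsilon(K)=1$, $S(E)=-EK^{-1}$, $S(F)=-KF$, $S(K)=K^{-1}$. Let $\overline U_q^{1/2}\supset\overline U_q$ be the Hopf algebra obtained by adding a square root $k=K^{1/2}$, with $k^{4p}=1$, $kE=qEk$, $kF=q^{-1}Fk$, $\Delta(k)=k\otimes k$. It contains the R-matrix $$R=\frac1{4p}\sum_{n,j=0}^{4p-1}s^{-nj}\,k^n\otimes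 k^j\ \cdot\ \sum_{m=0}^{p-1}\frac{\hat q^{\,m}}{[m]!}\,q^{m(m-1)/2}\,E^m\otimes F^m\ \in\ \overline U_q^{1/2}\otimes\overline U_q^{1/2}.$$ Write $R=\sum_i a_i\otimes b_i$, $R'=\sum_i b_i\otimes a_i$ and $u=\sum_i S(b_i)a_i$. The ribbon element $v\in\overline U_q$ is defined by $u=K^{p+1}v$; it is invertible. Let $\mathcal O=\overline U_q^{*}$ be the dual algebra, $(\varphi\psi)(x)=(\varphi\otimes\psi)(\Delta x)$, let $\mathcal Z(\overline U_q)$ be the center, and let $$\mathrm{SLF}(\overline U_q)=\{\psi\in\overline U_q^{*}\ :\ \psi(xy)=\psi(yx)\ \text{for all}\ x,y\}.$$ Below, $I$ and $J$ run through the finite-dimensional $\overline U_q^{1/2}$-modules (with bases) whose restriction to $\overline U_q$ is simple or indecomposable projective. Let $T^I$ be the matrix of matrix coefficients of $I$. For $X\in\overline U_q^{1/2}\otimes\overline U_q^{1/2}$, write $X_{12}$ for the matrix by which $X$ acts on $I\otimes J$. For matrices $M^I$, $M^J$, put $M_1=M^I\otimes 1$, $M_2=1\otimes M^J$ and $M_{12}=M^{I\otimes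 J}$. * The loop algebra $\mathcal L_{0,1}$ is the unital algebra generated by the vector space $\overline U_q^{*}$, where $M^I$ is the matrix of the generators given by the entries of $T^I|_{\overline U_q}$, and $M^{I\otimes J}$ is the same for $I\otimes J$. The relations are $\varepsilon=1$ (that is, $M$ of the trivial module is $1$) and the fusion relations $M_{12}R'_{12}=M_1R'_{12}M_2$. There is a unique isomorphism of algebras $\Psi:\mathcal L_{0,1}\to\overline U_q$ with $\Psi(M^I)=(T^I\otimes\mathrm{id})(RR')$ for all $I$. * The handle algebra $\mathcal L_{1,0}$ is the quotient of the free product of two copies of $\mathcal L_{0,1}$, with morphisms $j_B:M\mapsto B$ and $j_A:M\mapsto A$, by the exchange relations $R_{12}B_1R'_{12}A_2=A_2R_{12}B_1R_{12}^{-1}$. It acts on $\overline U_q^{*}$: there is a unique representation $\triangleright$ under which $A^I$ acts as $L^{(+)}L^{(-)-1}$ and $B^I$ as $L^{(+)}T^IL^{(-)-1}$, where $L^{(+)}=(T^I\otimes \mathrm{id})(R)$, $L^{(-)-1}=(T^I\otimes\mathrm{id})(R')$, elements $h$ act by $h\triangleright\psi=\psi(?\,h)$, and linear forms $\varphi$ act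 by $\varphi\triangleright\psi=\varphi\psi$. (The three factors act on $(\overline U_q^{1/2})^{*}$; their products descend to $\overline U_q^{*}$ along restriction of linear forms.) * Put $v_A^{-1}=j_A(\Psi^{-1}(v^{-1}))$ and $v_B^{-1}=j_B(\Psi^{-1}(v^{-1}))$. The operators $v_A^{-1}\triangleright$ and $v_B^{-1}\triangleright$ restrict to invertible operators $\rho_{\mathrm{SLF}}(v_A^{-1})$ and $\rho_{\mathrm{SLF}}(v_B^{-1})$ of $\mathrm{SLF}(\overline U_q)$. * $\theta_{\mathrm{SLF}}:\mathrm{SL}_2(\mathbb Z)\to\mathrm{PGL}(\mathrm{SLF}(\overline U_q))$ is the projective representation with $\theta_{\mathrm{SLF}}(\tau_a)=[\rho_{\mathrm{SLF}}(v_A^{-1})]$ and $\theta_{\mathrm{SLF}}(\tau_b)=[\rho_{\mathrm{SLF}}(v_B^{-1})]$, where $\tau_a=\begin{pmatrix}1&1\\0&1\end{pmatrix}$ and $\tau_b=\begin{pmatrix}1&0\\-1&1\end{pmatrix}$ are the Dehn twists of the torus. **Proposition 6.4.** (1) $S(z)=z$ for every $z\in\mathcal Z(\overline U_q)$. (2)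 $S(\psi)=\psi\circ S=\psi$ for every $\psi\in\mathrm{SLF}(\overline U_q)$. (3) The projective representation $\theta_{\mathrm{SLF}}$ of $\mathrm{SL}_2(\mathbb Z)$ described above exists and is unique (this includes the existence of the objects used to define it), and it factors through $\mathrm{PSL}_2(\mathbb Z)=\mathrm{SL}_2(\mathbb Z)/\{\pm1\}$, that is, it is in fact a projective representation of $\mathrm{PSL}_2(\mathbb Z)$. -/

import Mathlib

open scoped TensorProduct

namespace RestrictedQG

/-- Parameters of a restricted quantum group of `sl(2)`: `q` is a primitive `2p`-th root of unity,
and the Cartan generator is an `r`-th root of the usual one, with `t ^ r = q²`. Only the two cases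
`r = 1`, `t = q²` and `r = 2`, `t = q` are used. -/
structure QParam where
  p : ℕ
  r : ℕ
  q : ℂ
  t : ℂ
  two_le_p : 2 ≤ p
  one_le_r : 1 ≤ r
  prim : IsPrimitiveRoot q (2 * p)
  t_pow : t ^ r = q ^ 2

/-- The generators. -/
inductive Gen
  | E
  | F
  | K

open FreeAlgebra in
/-- The relations `K^(2pr) = 1`, `E^p = F^p = 0`, `K E = t E K`, `K F = t⁻¹ F K`,
`E F - F E = (K^r - K^(-r)) / (q - q⁻¹)`, where `K⁻¹ = K^(2pr-1)`. -/
inductive Rel (D : QParam) : FreeAlgebra ℂ Gen → FreeAlgebra ℂ Gen → Prop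
  | K_pow : Rel D (ι ℂ Gen.K ^ (2 * D.p * D.r)) 1
  | E_pow : Rel D (ι ℂ Gen.E ^ D.p) 0
  | F_pow : Rel D (ι ℂ Gen.F ^ D.p) 0
  | K_E : Rel D (ι ℂ Gen.K * ι ℂ Gen.E) (D.t • (ι ℂ Gen.E * ι ℂ Gen.K))
  | K_F : Rel D (ι ℂ Gen.K * ι ℂ Gen.F) (D.t⁻¹ • (ι ℂ Gen.F * ι ℂ Gen.K))
  | E_F : Rel D (ι ℂ Gen.E * ι ℂ Gen.F - ι ℂ Gen.F * ι ℂ Gen.E)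
      ((D.q - D.q⁻¹)⁻¹ • (ι ℂ Gen.K ^ D.r - (ι ℂ Gen.K ^ (2 * D.p * D.r - 1)) ^ D.r))

/-- The algebra with these generators and relations. -/
def U (D : QParam) : Type := RingQuot (Rel D)

noncomputable instance (D : QParam) : Ring (U D) := inferInstanceAs (Ring (RingQuot (Rel D)))
noncomputable instance (D : QParam) : Algebra ℂ (U D) :=
  inferInstanceAs (Algebra ℂ (RingQuot (Rel D)))

namespace U
variable (D : QParam)

noncomputable section

/-- The canonical projection. -/
def mk : FreeAlgebra ℂ Gen →ₐ[ℂ] U D := RingQuot.mkAlgHom ℂ (Rel D)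

theorem mk_rel {x y : FreeAlgebra ℂ Gen} (h : Rel D x y) : mk D x = mk D y :=
  RingQuot.mkAlgHom_rel ℂ h

theorem mk_surjective : Function.Surjective (mk D) := RingQuot.mkAlgHom_surjective ℂ (Rel D)

/-- The images of the generators. -/
def gen (x : Gen) : U D := mk D (FreeAlgebra.ι ℂ x)
/-- The generator `E`. -/
def E : U D := gen D Gen.E
/-- The generator `F`. -/
def F : U D := gen D Gen.F
/-- The generator `K`. -/
def K : U D := gen D Gen.K
/-- The inverse of `K`. -/
def Kinv : U D := K D ^ (2 * D.p * D.r - 1)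

/-- The elements `e`, `f`, `k` of an algebra satisfy the defining relations. -/
structure Sat {B : Type*} [Ring B] [Algebra ℂ B] (e f k : B) : Prop where
  K_pow : k ^ (2 * D.p * D.r) = 1
  E_pow : e ^ D.p = 0
  F_pow : f ^ D.p = 0
  K_E : k * e = D.t • (e * k)
  K_F : k * f = D.t⁻¹ • (f * k)
  E_F : e * f - f * e = (D.q - D.q⁻¹)⁻¹ • (k ^ D.r - (k ^ (2 * D.p * D.r - 1)) ^ D.r)

theorem sat : Sat D (E D) (F D) (K D) where
  K_pow := by simpa [K, gen] using mk_rel D (Rel.K_pow (D := D))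
  E_pow := by simpa [E, gen] using mk_rel D (Rel.E_pow (D := D))
  F_pow := by simpa [F, gen] using mk_rel D (Rel.F_pow (D := D))
  K_E := by simpa [K, E, gen] using mk_rel D (Rel.K_E (D := D))
  K_F := by simpa [K, F, gen] using mk_rel D (Rel.K_F (D := D))
  E_F := by simpa [K, E, F, gen] using mk_rel D (Rel.E_F (D := D))

variable {D}
variable {B : Type*} [Ring B] [Algebra ℂ B]

/-- The map on generators with values `e`, `f`, `k`. -/
def genImage (e f k : B) : Gen → B
  | Gen.E => e
  | Gen.F => f
  | Gen.K => k

/-- The algebra morphism with given values on the generators. -/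
def lift {e f k : B} (h : Sat D e f k) : U D →ₐ[ℂ] B :=
  RingQuot.liftAlgHom ℂ (s := Rel D) ⟨FreeAlgebra.lift ℂ (genImage e f k), by
    intro x y hxy
    cases hxy with
    | K_pow => simpa [genImage] using h.K_pow
    | E_pow => simpa [genImage] using h.E_pow
    | F_pow => simpa [genImage] using h.F_pow
    | K_E => simpa [genImage] using h.K_E
    | K_F => simpa [genImage] using h.K_F
    | E_F => simpa [genImage] using h.E_F⟩

theorem lift_mk {e f k : B} (h : Sat D e f k) (x : FreeAlgebra ℂ Gen) :
    lift h (mk D x) = FreeAlgebra.lift ℂ (genImage e f k) x :=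
  RingQuot.liftAlgHom_mkAlgHom_apply ℂ _ _ x

@[simp] theorem lift_E {e f k : B} (h : Sat D e f k) : lift h (E D) = e := by
  simp [E, gen, genImage, lift_mk]
@[simp] theorem lift_F {e f k : B} (h : Sat D e f k) : lift h (F D) = f := by
  simp [F, gen, genImage, lift_mk]
@[simp] theorem lift_K {e f k : B} (h : Sat D e f k) : lift h (K D) = k := by
  simp [K, gen, genImage, lift_mk]

theorem algHom_ext {f g : U D →ₐ[ℂ] B} (hE : f (E D) = g (E D)) (hF : f (F D) = g (F D))
    (hK : f (K D) = g (K D)) : f = g := by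
  have h : f.comp (mk D) = g.comp (mk D) := by
    apply FreeAlgebra.hom_ext
    funext x
    cases x with
    | E => exact hE
    | F => exact hF
    | K => exact hK
  ext x
  obtain ⟨y, rfl⟩ := mk_surjective D x
  exact DFunLike.congr_fun h y

theorem induction {P : U D → Prop} (h1 : ∀ c : ℂ, P (algebraMap ℂ _ c)) (hE : P (E D))
    (hF : P (F D)) (hK : P (K D)) (hadd : ∀ x y, P x → P y → P (x + y))
    (hmul : ∀ x y, P x → P y → P (x * y)) (x : U D) : P x := by
  obtain ⟨y, rfl⟩ := mk_surjective D x
  induction y using FreeAlgebra.induction with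
  | grade0 c => simpa using h1 c
  | grade1 g => cases g with
    | E => exact hE
    | F => exact hF
    | K => exact hK
  | mul a b ha hb => simpa using hmul _ _ ha hb
  | add a b ha hb => simpa using hadd _ _ ha hb

end
end U

/-! The `q`-binomial formula, needed for `Δ(E)^p = Δ(F)^p = 0`. -/

section qbinom
variable {A : Type*} [Ring A] [Algebra ℂ A]

/-- Gaussian binomial coefficients. -/
noncomputable def gauss (w : ℂ) : ℕ → ℕ → ℂ
  | 0, 0 => 1
  | 0, _ + 1 => 0
  | n + 1, 0 => gauss w n 0
  | n + 1, k + 1 => gauss w n k + w ^ (k + 1) * gauss w n (k + 1)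

theorem gauss_prod (w : ℂ) (n : ℕ) : ∀ k,
    (∏ i ∈ Finset.range k, (1 - w ^ (i + 1))) * gauss w n k
      = ∏ i ∈ Finset.range k, (1 - w ^ (n - i)) := by
  induction n with
  | zero =>
    intro k
    cases k with
    | zero => simp [gauss]
    | succ k => simp [gauss, Finset.prod_range_succ']
  | succ n ih =>
    intro k
    cases k with
    | zero => simpa [gauss] using ih 0
    | succ k =>
      have h1 := ih k
      have h2 := ih (k + 1)
      rw [Finset.prod_range_succ' (fun i => 1 - w ^ (n + 1 - i))]
      simp only [Nat.add_sub_add_right, Nat.sub_zero, gauss]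
      rw [mul_add, ← mul_assoc, mul_comm _ (w ^ (k+1)), mul_assoc, h2,
        Finset.prod_range_succ, mul_right_comm, h1, Finset.prod_range_succ]
      by_cases hk : k ≤ n
      · have : w ^ (n + 1) = w ^ (k + 1) * w ^ (n - k) := by
          rw [← pow_add]; congr 1; omega
        rw [this]; ring
      · have : ∏ i ∈ Finset.range k, (1 - w ^ (n - i)) = 0 :=
          Finset.prod_eq_zero (i := n) (by simp; omega) (by simp)
        rw [this]; ring

theorem gauss_eq_zero {w : ℂ} {p k : ℕ} (hw : IsPrimitiveRoot w p) (hk : 0 < k) (hkp : k < p) :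
    gauss w p k = 0 := by
  have h := gauss_prod w p k
  have hz : ∏ i ∈ Finset.range k, (1 - w ^ (p - i)) = 0 :=
    Finset.prod_eq_zero (i := 0) (by simpa using hk) (by simp [hw.pow_eq_one])
  rw [hz] at h
  rcases mul_eq_zero.1 h with h | h
  · obtain ⟨i, hi, h⟩ := Finset.prod_eq_zero_iff.1 h
    simp only [Finset.mem_range] at hi
    exact absurd (sub_eq_zero.1 h).symm (hw.pow_ne_one_of_pos_of_lt (by omega) (by omega))
  · exact h

theorem gauss_gt (w : ℂ) (n : ℕ) : ∀ k, n < k → gauss w n k = 0 := by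
  induction n with
  | zero => intro k hk; cases k with
    | zero => omega
    | succ k => rfl
  | succ n ih => intro k hk; cases k with
    | zero => omega
    | succ k => simp [gauss, ih k (by omega), ih (k + 1) (by omega)]

theorem gauss_zero (w : ℂ) (n : ℕ) : gauss w n 0 = 1 := by
  induction n with
  | zero => rfl
  | succ n ih => simpa [gauss] using ih

theorem gauss_self (w : ℂ) (n : ℕ) : gauss w n n = 1 := by
  induction n with
  | zero => rfl
  | succ n ih => simp [gauss, ih, gauss_gt w n (n + 1) (by omega)]

theorem y_mul_pow {x y : A} {w : ℂ} (h : y * x = w • (x * y)) (k : ℕ) :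
    y * x ^ k = w ^ k • (x ^ k * y) := by
  induction k with
  | zero => simp
  | succ k ih =>
    rw [pow_succ, ← mul_assoc, ih, smul_mul_assoc, mul_assoc, h, mul_smul_comm, smul_smul,
      ← mul_assoc, ← pow_succ]

theorem add_pow_q {x y : A} {w : ℂ} (h : y * x = w • (x * y)) (n : ℕ) :
    (x + y) ^ n = ∑ k ∈ Finset.range (n + 1), gauss w n k • (x ^ k * y ^ (n - k)) := by
  induction n with
  | zero => simp [gauss]
  | succ n ih =>
    rw [pow_succ', ih, add_mul, Finset.mul_sum, Finset.mul_sum,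
      Finset.sum_range_succ' _ (n + 1), gauss_zero]
    have hy : ∑ k ∈ Finset.range (n + 1), y * gauss w n k • (x ^ k * y ^ (n - k))
        = ∑ k ∈ Finset.range (n + 1), (w ^ k * gauss w n k) • (x ^ k * y ^ (n + 1 - k)) := by
      apply Finset.sum_congr rfl
      intro k hk
      simp only [Finset.mem_range] at hk
      rw [mul_smul_comm, ← mul_assoc, y_mul_pow h, smul_mul_assoc, smul_smul, mul_assoc,
        ← pow_succ', mul_comm (gauss w n k)]
      congr 4; omega
    rw [hy]
    have hy2 : ∑ k ∈ Finset.range (n + 1), (w ^ k * gauss w n k) • (x ^ k * y ^ (n + 1 - k))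
        = ∑ k ∈ Finset.range (n + 1),
          (w ^ (k + 1) * gauss w n (k + 1)) • (x ^ (k + 1) * y ^ (n + 1 - (k + 1)))
          + y ^ (n + 1) := by
      have := Finset.sum_range_succ
        (fun k => (w ^ k * gauss w n k) • (x ^ k * y ^ (n + 1 - k))) (n + 1)
      rw [gauss_gt w n (n + 1) (by omega)] at this
      simp only [mul_zero, zero_smul, add_zero] at this
      rw [← this, Finset.sum_range_succ', gauss_zero]
      simp
    rw [hy2, ← add_assoc, ← Finset.sum_add_distrib]
    congr 1
    · apply Finset.sum_congr rfl
      intro k _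
      rw [mul_smul_comm, ← mul_assoc, ← pow_succ', Nat.add_sub_add_right, gauss, add_smul]
    · simp

theorem add_pow_eq_zero {x y : A} {w : ℂ} {p : ℕ} (hw : IsPrimitiveRoot w p)
    (h : y * x = w • (x * y)) (hx : x ^ p = 0) (hy : y ^ p = 0) : (x + y) ^ p = 0 := by
  rw [add_pow_q h]
  apply Finset.sum_eq_zero
  intro k hk
  simp only [Finset.mem_range] at hk
  rcases Nat.eq_zero_or_pos k with rfl | h0
  · simp [hy]
  · rcases Nat.lt_or_ge k p with h1 | h1
    · simp [gauss_eq_zero hw h0 h1]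
    · obtain rfl : k = p := by omega
      simp [hx]
end qbinom

namespace U
noncomputable section

section Consequences
variable {D : QParam} {B : Type*} [Ring B] [Algebra ℂ B] {e f k : B}

theorem _root_.RestrictedQG.QParam.N_pos (D : QParam) : 0 < 2 * D.p * D.r :=
  Nat.mul_pos (Nat.mul_pos two_pos (by have := D.two_le_p; omega)) D.one_le_r

theorem _root_.RestrictedQG.QParam.q_ne (D : QParam) : D.q ≠ 0 :=
  D.prim.ne_zero (by have := D.two_le_p; omega)

theorem _root_.RestrictedQG.QParam.t_ne (D : QParam) : D.t ≠ 0 := by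
  intro h
  have := D.t_pow
  rw [h, zero_pow (by have := D.one_le_r; omega)] at this
  exact pow_ne_zero 2 D.q_ne this.symm

theorem _root_.RestrictedQG.QParam.prim_sq (D : QParam) : IsPrimitiveRoot (D.q ^ 2) D.p :=
  D.prim.pow (by have := D.two_le_p; omega) rfl

namespace Sat
theorem k_kinv (h : Sat D e f k) : k * k ^ (2 * D.p * D.r - 1) = 1 := by
  rw [← pow_succ', Nat.sub_add_cancel D.N_pos, h.K_pow]

theorem kinv_k (h : Sat D e f k) : k ^ (2 * D.p * D.r - 1) * k = 1 := by
  rw [← pow_succ, Nat.sub_add_cancel D.N_pos, h.K_pow]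

theorem g_ginv (h : Sat D e f k) : k ^ D.r * (k ^ (2 * D.p * D.r - 1)) ^ D.r = 1 := by
  rw [← Commute.mul_pow (Commute.self_pow k _), h.k_kinv, one_pow]

theorem ginv_g (h : Sat D e f k) :
    (k ^ (2 * D.p * D.r - 1)) ^ D.r * k ^ D.r = 1 := by
  rw [← Commute.mul_pow (Commute.pow_self k _), h.kinv_k, one_pow]

theorem kinv_e (h : Sat D e f k) :
    k ^ (2 * D.p * D.r - 1) * e = D.t⁻¹ • (e * k ^ (2 * D.p * D.r - 1)) := by
  have h1 : e * k = D.t⁻¹ • (k * e) := by rw [h.K_E, smul_smul, inv_mul_cancel₀ D.t_ne, one_smul]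
  calc k ^ (2 * D.p * D.r - 1) * e
      = k ^ (2 * D.p * D.r - 1) * (e * k) * k ^ (2 * D.p * D.r - 1) := by
        rw [mul_assoc _ (e * k), mul_assoc e, h.k_kinv, mul_one]
    _ = _ := by
        rw [h1, mul_smul_comm, ← mul_assoc, h.kinv_k, one_mul, smul_mul_assoc]

theorem kinv_f (h : Sat D e f k) :
    k ^ (2 * D.p * D.r - 1) * f = D.t • (f * k ^ (2 * D.p * D.r - 1)) := by
  have h1 : f * k = D.t • (k * f) := by rw [h.K_F, smul_smul, mul_inv_cancel₀ D.t_ne, one_smul]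
  calc k ^ (2 * D.p * D.r - 1) * f
      = k ^ (2 * D.p * D.r - 1) * (f * k) * k ^ (2 * D.p * D.r - 1) := by
        rw [mul_assoc _ (f * k), mul_assoc f, h.k_kinv, mul_one]
    _ = _ := by
        rw [h1, mul_smul_comm, ← mul_assoc, h.kinv_k, one_mul, smul_mul_assoc]

theorem pow_comm {x y : B} {w : ℂ} (hxy : x * y = w • (y * x)) (n : ℕ) :
    x ^ n * y = w ^ n • (y * x ^ n) := by
  induction n with
  | zero => simp
  | succ n ih =>
    rw [pow_succ, mul_assoc, hxy, mul_smul_comm, ← mul_assoc, ih, smul_mul_assoc, smul_smul,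
      mul_assoc, ← pow_succ, ← pow_succ']

theorem g_e (h : Sat D e f k) : k ^ D.r * e = D.q ^ 2 • (e * k ^ D.r) := by
  rw [pow_comm h.K_E, D.t_pow]
theorem g_f (h : Sat D e f k) : k ^ D.r * f = (D.q ^ 2)⁻¹ • (f * k ^ D.r) := by
  rw [pow_comm h.K_F, inv_pow, D.t_pow]
theorem ginv_e (h : Sat D e f k) :
    (k ^ (2 * D.p * D.r - 1)) ^ D.r * e
    = (D.q ^ 2)⁻¹ • (e * (k ^ (2 * D.p * D.r - 1)) ^ D.r) := by
  rw [pow_comm h.kinv_e, inv_pow, D.t_pow]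
theorem ginv_f (h : Sat D e f k) :
    (k ^ (2 * D.p * D.r - 1)) ^ D.r * f
    = D.q ^ 2 • (f * (k ^ (2 * D.p * D.r - 1)) ^ D.r) := by
  rw [pow_comm h.kinv_f, D.t_pow]

end Sat

theorem mul_pow_eq_zero {x y : B} {w : ℂ} (h : y * x = w • (x * y)) {n : ℕ} (hx : x ^ n = 0) :
    (x * y) ^ n = 0 := by
  have key : ∀ n, ∃ c : ℂ, (x * y) ^ n = c • (x ^ n * y ^ n) := by
    intro n
    induction n with
    | zero => exact ⟨1, by simp⟩
    | succ n ih =>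
      obtain ⟨c, hc⟩ := ih
      refine ⟨c * w ^ n, ?_⟩
      rw [pow_succ, hc, smul_mul_assoc, mul_assoc, ← mul_assoc (y ^ n), Sat.pow_comm h,
        smul_mul_assoc, mul_smul_comm, smul_smul, mul_assoc x, ← pow_succ, ← mul_assoc,
        ← pow_succ]
  obtain ⟨c, hc⟩ := key n
  rw [hc, hx, zero_mul, smul_zero]

end Consequences

variable (D : QParam)

theorem sat_comul : Sat D
    ((1 : U D) ⊗ₜ[ℂ] E D + E D ⊗ₜ[ℂ] (K D ^ D.r))
    (F D ⊗ₜ[ℂ] (1 : U D) + (Kinv D ^ D.r) ⊗ₜ[ℂ] F D)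
    (K D ⊗ₜ[ℂ] K D) where
  K_pow := by
    rw [Algebra.TensorProduct.tmul_pow, (sat D).K_pow, Algebra.TensorProduct.one_def]
  E_pow := by
    apply add_pow_eq_zero D.prim_sq
    · simp only [Algebra.TensorProduct.tmul_mul_tmul, one_mul, mul_one, (sat D).g_e,
        TensorProduct.tmul_smul]
    · rw [Algebra.TensorProduct.tmul_pow, (sat D).E_pow, TensorProduct.tmul_zero]
    · rw [Algebra.TensorProduct.tmul_pow, (sat D).E_pow, TensorProduct.zero_tmul]
  F_pow := by
    rw [add_comm]
    rw [add_comm]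
    apply add_pow_eq_zero D.prim_sq
    · simp only [Algebra.TensorProduct.tmul_mul_tmul, one_mul, mul_one, Kinv, (sat D).ginv_f,
        TensorProduct.smul_tmul']
    · rw [Algebra.TensorProduct.tmul_pow, (sat D).F_pow, TensorProduct.zero_tmul]
    · rw [Algebra.TensorProduct.tmul_pow, (sat D).F_pow, TensorProduct.tmul_zero]
  K_E := by
    simp only [mul_add, add_mul, Algebra.TensorProduct.tmul_mul_tmul, one_mul, mul_one,
      (sat D).K_E, TensorProduct.tmul_smul, ← TensorProduct.smul_tmul', smul_add]
    rw [← pow_succ, ← pow_succ']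
  K_F := by
    simp only [mul_add, add_mul, Algebra.TensorProduct.tmul_mul_tmul, one_mul, mul_one,
      (sat D).K_F, TensorProduct.tmul_smul, ← TensorProduct.smul_tmul', smul_add]
    rw [Kinv, ((Commute.self_pow (K D) (2 * D.p * D.r - 1)).pow_right D.r).eq]
  E_F := by
    have hG : (K D ⊗ₜ[ℂ] K D) ^ D.r = (K D ^ D.r) ⊗ₜ[ℂ] (K D ^ D.r) :=
      Algebra.TensorProduct.tmul_pow _ _ _
    have hGi : ((K D ⊗ₜ[ℂ] K D) ^ (2 * D.p * D.r - 1)) ^ D.r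
        = (Kinv D ^ D.r) ⊗ₜ[ℂ] (Kinv D ^ D.r) := by
      rw [Algebra.TensorProduct.tmul_pow, Algebra.TensorProduct.tmul_pow]; rfl
    rw [hG, hGi]
    have hEF : E D * F D = F D * E D + (D.q - D.q⁻¹)⁻¹ • (K D ^ D.r - Kinv D ^ D.r) := by
      rw [← sub_eq_iff_eq_add']; exact (sat D).E_F
    have h1 := (sat D).g_f
    have h2 : Kinv D ^ D.r * E D = (D.q ^ 2)⁻¹ • (E D * Kinv D ^ D.r) := (sat D).ginv_e
    simp only [mul_add, add_mul, Algebra.TensorProduct.tmul_mul_tmul, one_mul, mul_one, h1, h2,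
      hEF, TensorProduct.tmul_smul, ← TensorProduct.smul_tmul', smul_sub,
      TensorProduct.tmul_add, TensorProduct.add_tmul, TensorProduct.tmul_sub,
      TensorProduct.sub_tmul]
    abel

/-- The coproduct: `Δ E = 1 ⊗ E + E ⊗ K^r`, `Δ F = F ⊗ 1 + K^(-r) ⊗ F`, `Δ K = K ⊗ K`. -/
def comulHom : U D →ₐ[ℂ] U D ⊗[ℂ] U D := lift (sat_comul D)

theorem sat_counit : Sat D (0 : ℂ) (0 : ℂ) (1 : ℂ) where
  K_pow := one_pow _
  E_pow := zero_pow (by have := D.two_le_p; omega)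
  F_pow := zero_pow (by have := D.two_le_p; omega)
  K_E := by simp
  K_F := by simp
  E_F := by simp

/-- The counit: `ε E = ε F = 0`, `ε K = 1`. -/
def counitHom : U D →ₐ[ℂ] ℂ := lift (sat_counit D)

open MulOpposite in
theorem sat_antipode : Sat D
    (op (-(E D * Kinv D ^ D.r))) (op (-(K D ^ D.r * F D))) (op (Kinv D)) where
  K_pow := by
    rw [← op_pow, Kinv, ← pow_mul, mul_comm, pow_mul, (sat D).K_pow, one_pow, op_one]
  E_pow := by
    rw [← op_pow, neg_pow, Kinv,
      mul_pow_eq_zero (w := (D.q ^ 2)⁻¹) (sat D).ginv_e (sat D).E_pow, mul_zero, op_zero]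
  F_pow := by
    rw [← op_pow, neg_pow, (sat D).g_f, smul_pow,
      mul_pow_eq_zero (w := (D.q ^ 2)⁻¹) (sat D).g_f (sat D).F_pow,
      smul_zero, mul_zero, op_zero]
  K_E := by
    rw [← op_mul, ← op_mul, ← op_smul]
    congr 1
    have h : Kinv D * E D = D.t⁻¹ • (E D * Kinv D) := (sat D).kinv_e
    rw [mul_neg, ← mul_assoc, h, smul_mul_assoc, smul_neg, smul_smul, mul_inv_cancel₀ D.t_ne,
      one_smul, neg_mul, mul_assoc, mul_assoc, ← pow_succ, ← pow_succ']
  K_F := by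
    rw [← op_mul, ← op_mul, ← op_smul]
    congr 1
    have h : Kinv D * F D = D.t • (F D * Kinv D) := (sat D).kinv_f
    have hc : Kinv D * K D ^ D.r = K D ^ D.r * Kinv D :=
      ((Commute.pow_self (K D) (2 * D.p * D.r - 1)).pow_right D.r).eq
    rw [mul_neg, ← mul_assoc, hc, mul_assoc, h, mul_smul_comm, smul_neg, smul_smul,
      inv_mul_cancel₀ D.t_ne, one_smul, neg_mul, mul_assoc]
  E_F := by
    have hinv : Kinv D ^ (2 * D.p * D.r - 1) = K D := by
      have h1 : Kinv D ^ (2 * D.p * D.r - 1) * Kinv D = 1 := by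
        rw [← pow_succ, Nat.sub_add_cancel D.N_pos, Kinv, ← pow_mul, mul_comm, pow_mul,
          (sat D).K_pow, one_pow]
      calc Kinv D ^ (2 * D.p * D.r - 1)
          = Kinv D ^ (2 * D.p * D.r - 1) * (Kinv D * K D) := by
            rw [Kinv, (sat D).kinv_k, mul_one]
        _ = K D := by rw [← mul_assoc, h1, one_mul]
    rw [← op_mul, ← op_mul, ← op_sub, ← op_pow, ← op_pow, ← op_pow, hinv, ← op_sub, ← op_smul]
    congr 1
    have hEF : E D * F D - F D * E D = (D.q - D.q⁻¹)⁻¹ • (K D ^ D.r - Kinv D ^ D.r) := (sat D).E_F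
    have hgf := (sat D).g_f
    have hge := (sat D).g_e
    have h1 : K D ^ D.r * F D * (E D * Kinv D ^ D.r) = F D * E D := by
      have : K D ^ D.r * F D * E D = F D * E D * K D ^ D.r := by
        rw [hgf, smul_mul_assoc, mul_assoc, hge, mul_smul_comm, smul_smul,
          inv_mul_cancel₀ (pow_ne_zero 2 D.q_ne), one_smul, mul_assoc]
      rw [← mul_assoc, this, mul_assoc, Kinv, (sat D).g_ginv, mul_one]
    have h2 : E D * Kinv D ^ D.r * (K D ^ D.r * F D) = E D * F D := by
      rw [mul_assoc, ← mul_assoc _ _ (F D), Kinv, (sat D).ginv_g, one_mul]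
    rw [neg_mul_neg, neg_mul_neg, h1, h2, ← neg_sub (E D * F D), hEF, ← smul_neg, neg_sub]

/-- The antipode: `S E = - E K^(-r)`, `S F = - K^r F`, `S K = K⁻¹`, as a morphism to the opposite
algebra. -/
def antipodeHom : U D →ₐ[ℂ] (U D)ᵐᵒᵖ := lift (sat_antipode D)

/-- The bialgebra structure. -/
instance instBialgebra : Bialgebra ℂ (U D) :=
  Bialgebra.ofAlgHom (comulHom D) (counitHom D)
    (by
      have hGi : comulHom D (Kinv D) = Kinv D ⊗ₜ[ℂ] Kinv D := by
        simp [comulHom, Kinv, Algebra.TensorProduct.tmul_pow]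
      apply algHom_ext
      · simp [comulHom, TensorProduct.tmul_add, TensorProduct.add_tmul,
          Algebra.TensorProduct.tmul_pow, Algebra.TensorProduct.one_def, add_assoc]
      · simp only [AlgHom.comp_apply]
        rw [show comulHom D (F D) = _ from lift_F _]
        simp only [map_add, Algebra.TensorProduct.map_tmul, AlgHom.coe_id, id_eq, map_pow, hGi,
          map_one]
        simp [comulHom, TensorProduct.tmul_add, TensorProduct.add_tmul, add_assoc,
          Algebra.TensorProduct.tmul_pow, Algebra.TensorProduct.one_def]
      · simp [comulHom])
    (by
      apply algHom_ext <;>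
        simp [comulHom, counitHom, Kinv])
    (by
      apply algHom_ext <;>
        simp [comulHom, counitHom, Kinv])

@[simp] theorem comul_E : Coalgebra.comul (R := ℂ) (E D)
    = (1 : U D) ⊗ₜ[ℂ] E D + E D ⊗ₜ[ℂ] (K D ^ D.r) := lift_E (sat_comul D)
@[simp] theorem comul_F : Coalgebra.comul (R := ℂ) (F D)
    = F D ⊗ₜ[ℂ] (1 : U D) + (Kinv D ^ D.r) ⊗ₜ[ℂ] F D := lift_F (sat_comul D)
@[simp] theorem comul_K : Coalgebra.comul (R := ℂ) (K D) = K D ⊗ₜ[ℂ] K D := lift_K (sat_comul D)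
@[simp] theorem counit_E : Coalgebra.counit (R := ℂ) (E D) = 0 := lift_E (sat_counit D)
@[simp] theorem counit_F : Coalgebra.counit (R := ℂ) (F D) = 0 := lift_F (sat_counit D)
@[simp] theorem counit_K : Coalgebra.counit (R := ℂ) (K D) = 1 := lift_K (sat_counit D)

/-- The antipode as a linear map. -/
def antipodeLin : U D →ₗ[ℂ] U D :=
  (MulOpposite.opLinearEquiv ℂ).symm.toLinearMap ∘ₗ (antipodeHom D).toLinearMap

theorem antipodeLin_mul (x y : U D) :
    antipodeLin D (x * y) = antipodeLin D y * antipodeLin D x := by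
  simp [antipodeLin]
theorem antipodeLin_algebraMap (c : ℂ) :
    antipodeLin D (algebraMap ℂ _ c) = algebraMap ℂ _ c := by
  simp only [antipodeLin, LinearMap.comp_apply, AlgHom.toLinearMap_apply, AlgHom.commutes]
  rfl
theorem antipodeLin_one : antipodeLin D 1 = 1 := by
  simpa using antipodeLin_algebraMap D 1
theorem antipodeLin_E : antipodeLin D (E D) = -(E D * Kinv D ^ D.r) := by
  simp [antipodeLin, antipodeHom]
theorem antipodeLin_F : antipodeLin D (F D) = -(K D ^ D.r * F D) := by
  simp [antipodeLin, antipodeHom]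
theorem antipodeLin_K : antipodeLin D (K D) = Kinv D := by
  simp [antipodeLin, antipodeHom]
theorem antipodeLin_pow (x : U D) (n : ℕ) : antipodeLin D (x ^ n) = antipodeLin D x ^ n := by
  induction n with
  | zero => simp [antipodeLin_one]
  | succ n ih => rw [pow_succ, antipodeLin_mul, ih, ← pow_succ']

theorem rT_mul (X : U D ⊗[ℂ] U D) (a b : U D) :
    LinearMap.mul' ℂ _ ((antipodeLin D).rTensor _ (X * a ⊗ₜ b))
      = antipodeLin D a * LinearMap.mul' ℂ _ ((antipodeLin D).rTensor _ X) * b := by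
  induction X using TensorProduct.induction_on with
  | zero => simp
  | tmul x y => simp [antipodeLin_mul, mul_assoc]
  | add x y hx hy => simp [add_mul, mul_add, hx, hy]

theorem lT_mul (X : U D ⊗[ℂ] U D) (a b : U D) :
    LinearMap.mul' ℂ _ ((antipodeLin D).lTensor _ (a ⊗ₜ b * X))
      = a * LinearMap.mul' ℂ _ ((antipodeLin D).lTensor _ X) * antipodeLin D b := by
  induction X using TensorProduct.induction_on with
  | zero => simp
  | tmul x y => simp [antipodeLin_mul, mul_assoc]
  | add x y hx hy => simp [add_mul, mul_add, hx, hy]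

theorem antipode_left (x : U D) :
    LinearMap.mul' ℂ _ ((antipodeLin D).rTensor _ (Coalgebra.comul x))
      = algebraMap ℂ _ (Coalgebra.counit x) := by
  induction x using induction with
  | h1 c => simp [Algebra.TensorProduct.algebraMap_apply, antipodeLin_algebraMap]
  | hE =>
    simp only [comul_E, map_add, LinearMap.rTensor_tmul, antipodeLin_one, antipodeLin_E,
      LinearMap.mul'_apply, counit_E, map_zero, one_mul, neg_mul]
    rw [mul_assoc (E D), Kinv, (sat D).ginv_g, mul_one, add_neg_cancel]
  | hF =>
    have h := (sat D).ginv_g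
    have h' := (sat D).g_ginv
    have hk : antipodeLin D (Kinv D) = K D := by
      have h1 : antipodeLin D (Kinv D) * Kinv D = 1 := by
        rw [Kinv, antipodeLin_pow, antipodeLin_K, ← Kinv, ← pow_succ,
          Nat.sub_add_cancel D.N_pos, Kinv, ← pow_mul, mul_comm, pow_mul,
          (sat D).K_pow, one_pow]
      calc antipodeLin D (Kinv D) = antipodeLin D (Kinv D) * (Kinv D * K D) := by
            rw [Kinv, (sat D).kinv_k, mul_one]
        _ = K D := by rw [← mul_assoc, h1, one_mul]
    simp [antipodeLin_F, antipodeLin_pow, hk]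
  | hK => simp [antipodeLin_K, Kinv, (sat D).kinv_k]
  | hadd x y hx hy => simp [hx, hy]
  | hmul x y hx hy =>
    have key : ∀ Y : U D ⊗[ℂ] U D,
        LinearMap.mul' ℂ _ ((antipodeLin D).rTensor _ (Coalgebra.comul x * Y))
          = algebraMap ℂ _ (Coalgebra.counit x)
            * LinearMap.mul' ℂ _ ((antipodeLin D).rTensor _ Y) := by
      intro Y
      induction Y using TensorProduct.induction_on with
      | zero => simp
      | tmul a b =>
        rw [rT_mul, hx, ← Algebra.commutes, mul_assoc]
        simp
      | add a b ha hb => simp only [mul_add, map_add, ha, hb]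
    rw [Bialgebra.comul_mul, key, hy, Bialgebra.counit_mul, map_mul]

theorem antipode_right (x : U D) :
    LinearMap.mul' ℂ _ ((antipodeLin D).lTensor _ (Coalgebra.comul x))
      = algebraMap ℂ _ (Coalgebra.counit x) := by
  induction x using induction with
  | h1 c => simp [Algebra.TensorProduct.algebraMap_apply, antipodeLin_one]
  | hE => simp [antipodeLin_E, antipodeLin_K, antipodeLin_pow]
  | hF =>
    simp only [comul_F, map_add, LinearMap.lTensor_tmul, antipodeLin_one, antipodeLin_F,
      LinearMap.mul'_apply, counit_F, map_zero, mul_one, mul_neg]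
    rw [← mul_assoc, Kinv, (sat D).ginv_g, one_mul, add_neg_cancel]
  | hK => simp [antipodeLin_K, Kinv, (sat D).k_kinv]
  | hadd x y hx hy => simp [hx, hy]
  | hmul x y hx hy =>
    have key : ∀ Y : U D ⊗[ℂ] U D,
        LinearMap.mul' ℂ _ ((antipodeLin D).lTensor _ (Y * Coalgebra.comul y))
          = LinearMap.mul' ℂ _ ((antipodeLin D).lTensor _ Y)
            * algebraMap ℂ _ (Coalgebra.counit y) := by
      intro Y
      induction Y using TensorProduct.induction_on with
      | zero => simp
      | tmul a b =>
        rw [lT_mul, hy, mul_assoc, Algebra.commutes, ← mul_assoc]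
        simp
      | add a b ha hb => simp only [add_mul, map_add, ha, hb]
    rw [Bialgebra.comul_mul, key, hx, Bialgebra.counit_mul, map_mul]

/-- The Hopf algebra structure. -/
instance instHopfAlgebra : HopfAlgebra ℂ (U D) where
  antipode := antipodeLin D
  mul_antipode_rTensor_comul := LinearMap.ext (antipode_left D)
  mul_antipode_lTensor_comul := LinearMap.ext (antipode_right D)

end
end U
end RestrictedQG

namespace RestrictedQG
noncomputable section
open Module

section General

/-- The space of symmetric linear forms on `H`: the `ψ` with `ψ (x y) = ψ (y x)`. -/
def SLF (H : Type) [Ring H] [Algebra ℂ H] : Submodule ℂ (Dual ℂ H) where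
  carrier := {ψ | ∀ x y : H, ψ (x * y) = ψ (y * x)}
  add_mem' hφ hψ x y := by simp [hφ x y, hψ x y]
  zero_mem' x y := by simp
  smul_mem' c ψ hψ x y := by simp [hψ x y]

/-- The product of the dual algebra: `(φ ψ)(x) = φ (x') ψ (x'')` where `Δ x = x' ⊗ x''`. -/
def dualMul {H : Type} [Ring H] [HopfAlgebra ℂ H] (φ ψ : Dual ℂ H) : Dual ℂ H :=
  LinearMap.mul' ℂ ℂ ∘ₗ TensorProduct.map φ ψ ∘ₗ Coalgebra.comul

/-- The action `φ ▷ ψ = φ ψ` of a linear form on the dual. -/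
def dualMulLeft {H : Type} [Ring H] [HopfAlgebra ℂ H] (φ : Dual ℂ H) : End ℂ (Dual ℂ H) where
  toFun ψ := dualMul φ ψ
  map_add' ψ ψ' := by ext x; simp [dualMul, TensorProduct.map_add_right]
  map_smul' c ψ := by ext x; simp [dualMul, TensorProduct.map_smul_right]

/-- The action `h ▷ ψ = ψ (? h)` of an element of `H` on the dual. Together with `dualMulLeft`
it is the (faithful) representation on the dual of the Heisenberg double of the dual. -/
def rightTranslate {H : Type} [Ring H] [HopfAlgebra ℂ H] (h : H) : End ℂ (Dual ℂ H) :=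
  (LinearMap.mulRight ℂ h).dualMap

/-- Matrix representations of an algebra, that is, modules with a chosen finite basis. -/
abbrev MatRep (A : Type) [Ring A] [Algebra ℂ A] (n : ℕ) : Type :=
  A →ₐ[ℂ] Matrix (Fin n) (Fin n) ℂ

/-- The column vectors `ℂⁿ`, as the module of the matrix representation `I`. -/
def RepSpace {A : Type} [Ring A] [Algebra ℂ A] {n : ℕ} (_ : MatRep A n) : Type := Fin n → ℂ

instance {A : Type} [Ring A] [Algebra ℂ A] {n : ℕ} (I : MatRep A n) :
    AddCommGroup (RepSpace I) := inferInstanceAs (AddCommGroup (Fin n → ℂ))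

instance {A : Type} [Ring A] [Algebra ℂ A] {n : ℕ} (I : MatRep A n) : Module A (RepSpace I) :=
  Module.compHom (Fin n → ℂ)
    ((Matrix.toLinAlgEquiv' : Matrix (Fin n) (Fin n) ℂ ≃ₐ[ℂ] _).toAlgHom.comp I).toRingHom

theorem repSpace_smul {A : Type} [Ring A] [Algebra ℂ A] {n : ℕ} (I : MatRep A n) (x : A)
    (w : RepSpace I) : x • w = (I x).mulVec w := rfl

/-- Principal indecomposable modules: indecomposable projective modules. -/
def IsPIM (A M : Type) [Ring A] [AddCommGroup M] [Module A M] : Prop :=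
  Module.Projective A M ∧ Nontrivial M ∧
    ∀ N N' : Submodule A M, IsCompl N N' → N = ⊥ ∨ N' = ⊥

/-- The matrix coefficients `T^I_{ab}` of a representation, which are linear forms. -/
def coeff {A : Type} [Ring A] [Algebra ℂ A] {n : ℕ} (I : MatRep A n) (a b : Fin n) : Dual ℂ A :=
  Matrix.entryLinearMap ℂ ℂ a b ∘ₗ I.toLinearMap

/-- The matrix by which `X ∈ A ⊗ A` acts on `I ⊗ J`. -/
def rep₂ {A : Type} [Ring A] [Algebra ℂ A] {m n : ℕ} (I : MatRep A m) (J : MatRep A n)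
    (X : A ⊗[ℂ] A) : Matrix (Fin m × Fin n) (Fin m × Fin n) ℂ :=
  Matrix.of fun x y =>
    LinearMap.mul' ℂ ℂ (TensorProduct.map (coeff I x.1 y.1) (coeff J x.2 y.2) X)

/-- `tensorFlip R = R'`, the element `R` with its two legs exchanged. -/
def tensorFlip {A : Type} [Ring A] [Algebra ℂ A] (X : A ⊗[ℂ] A) : A ⊗[ℂ] A := TensorProduct.comm ℂ A A X

/-- The matrix `(T^I ⊗ id)(X)` with entries in `A`. For `X = R` it is `L^(+)`, and for `X = R'` it
is the inverse of `L^(-)`. -/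
def leftLeg {A : Type} [Ring A] [Algebra ℂ A] {n : ℕ} (I : MatRep A n) (X : A ⊗[ℂ] A) :
    Matrix (Fin n) (Fin n) A :=
  Matrix.of fun a b => TensorProduct.lid ℂ A (TensorProduct.map (coeff I a b) LinearMap.id X)

/-- The Drinfeld element `u = S(b_i) a_i` of `R = a_i ⊗ b_i`. -/
def drinfeldElement {A : Type} [Ring A] [HopfAlgebra ℂ A] (R : A ⊗[ℂ] A) : A :=
  LinearMap.mul' ℂ A (TensorProduct.map (HopfAlgebra.antipode ℂ) LinearMap.id (tensorFlip R))

/-! Below, `ι : H → Ht` is an inclusion of Hopf algebras, and `R ∈ Ht ⊗ Ht` is the R-matrix of the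
bigger one. -/

variable {H Ht : Type} [Ring H] [HopfAlgebra ℂ H] [Ring Ht] [HopfAlgebra ℂ Ht]
  (ι : H →ₐ[ℂ] Ht) (R : Ht ⊗[ℂ] Ht)

/-- The representation `I` of `Ht` lifts a simple or a principal indecomposable `H`-module. -/
def IsLifting {n : ℕ} (I : MatRep Ht n) : Prop :=
  IsSimpleModule H (RepSpace (I.comp ι)) ∨ IsPIM H (RepSpace (I.comp ι))

open Kronecker in
/-- `X₁ = X ⊗ 1`. -/
def first {A : Type} [Semiring A] {m : ℕ} (n : ℕ) (X : Matrix (Fin m) (Fin m) A) :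
    Matrix (Fin m × Fin n) (Fin m × Fin n) A := X ⊗ₖ (1 : Matrix (Fin n) (Fin n) A)

open Kronecker in
/-- `X₂ = 1 ⊗ X`. -/
def second {A : Type} [Semiring A] {n : ℕ} (m : ℕ) (X : Matrix (Fin n) (Fin n) A) :
    Matrix (Fin m × Fin n) (Fin m × Fin n) A := (1 : Matrix (Fin m) (Fin m) A) ⊗ₖ X

/-- A complex matrix, seen with entries in the algebra `A`. -/
def scal (A : Type) [Semiring A] [Algebra ℂ A] {m n : ℕ}
    (X : Matrix (Fin m × Fin n) (Fin m × Fin n) ℂ) :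
    Matrix (Fin m × Fin n) (Fin m × Fin n) A := X.map (algebraMap ℂ A)

/-- The matrix `M^I` of the degree one elements `T^I_{ab}` of the tensor algebra of the dual. -/
def TMat {n : ℕ} (I : MatRep Ht n) : Matrix (Fin n) (Fin n) (TensorAlgebra ℂ (Dual ℂ H)) :=
  Matrix.of fun a b => TensorAlgebra.ι ℂ (coeff (I.comp ι) a b)

/-- The matrix `M^{I ⊗ J}`; the matrix coefficients of `I ⊗ J` are the products of those of `I`
and of `J` in the dual algebra. -/
def TMat₂ {m n : ℕ} (I : MatRep Ht m) (J : MatRep Ht n) :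
    Matrix (Fin m × Fin n) (Fin m × Fin n) (TensorAlgebra ℂ (Dual ℂ H)) :=
  Matrix.of fun x y =>
    TensorAlgebra.ι ℂ (dualMul (coeff (I.comp ι) x.1 y.1) (coeff (J.comp ι) x.2 y.2))

/-- The fusion relations `M₁₂ R'₁₂ = M₁ R'₁₂ M₂` of the loop algebra, where `M` of the trivial
representation is the unit. -/
inductive FusionRel : TensorAlgebra ℂ (Dual ℂ H) → TensorAlgebra ℂ (Dual ℂ H) → Prop
  | unit : FusionRel (TensorAlgebra.ι ℂ (Coalgebra.counit : H →ₗ[ℂ] ℂ)) 1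
  | fusion {m n : ℕ} (I : MatRep Ht m) (J : MatRep Ht n) (hI : IsLifting ι I)
      (hJ : IsLifting ι J) (x y : Fin m × Fin n) :
      FusionRel
        ((TMat₂ ι I J * scal (TensorAlgebra ℂ (Dual ℂ H)) (rep₂ I J (tensorFlip R))) x y)
        ((first n (TMat ι I) * scal (TensorAlgebra ℂ (Dual ℂ H)) (rep₂ I J (tensorFlip R))
          * second m (TMat ι J)) x y)

/-- The loop algebra `L_{0,1}`. -/
def L01 : Type := RingQuot (FusionRel ι R)

instance : Ring (L01 ι R) := inferInstanceAs (Ring (RingQuot (FusionRel ι R)))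
instance : Algebra ℂ (L01 ι R) := inferInstanceAs (Algebra ℂ (RingQuot (FusionRel ι R)))

/-- The canonical projection onto the loop algebra. -/
def L01.mk : TensorAlgebra ℂ (Dual ℂ H) →ₐ[ℂ] L01 ι R := RingQuot.mkAlgHom ℂ (FusionRel ι R)

/-- The matrices `M^I` with entries in the loop algebra. -/
def L01.M {n : ℕ} (I : MatRep Ht n) : Matrix (Fin n) (Fin n) (L01 ι R) :=
  (TMat ι I).map (L01.mk ι R)

/-- The free product of two copies of the loop algebra. -/
abbrev FreeL : Type := LinearAlgebra.FreeProduct ℂ (fun _ : Fin 2 => L01 ι R)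

/-- The first copy of the loop algebra, with matrices `B^I`. -/
def freeB : L01 ι R →ₐ[ℂ] FreeL ι R := LinearAlgebra.FreeProduct.ι ℂ (fun _ : Fin 2 => L01 ι R) 0
/-- The second copy of the loop algebra, with matrices `A^I`. -/
def freeA : L01 ι R →ₐ[ℂ] FreeL ι R := LinearAlgebra.FreeProduct.ι ℂ (fun _ : Fin 2 => L01 ι R) 1

/-- The exchange relations `R₁₂ B₁ R'₁₂ A₂ R₁₂ = A₂ R₁₂ B₁` of the handle algebra. -/
inductive ExchangeRel : FreeL ι R → FreeL ι R → Prop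
  | exchange {m n : ℕ} (I : MatRep Ht m) (J : MatRep Ht n) (hI : IsLifting ι I)
      (hJ : IsLifting ι J) (x y : Fin m × Fin n) :
      ExchangeRel
        ((scal (FreeL ι R) (rep₂ I J R) * first n ((L01.M ι R I).map (freeB ι R))
          * scal (FreeL ι R) (rep₂ I J (tensorFlip R)) * second m ((L01.M ι R J).map (freeA ι R))
          * scal (FreeL ι R) (rep₂ I J R)) x y)
        ((second m ((L01.M ι R J).map (freeA ι R)) * scal (FreeL ι R) (rep₂ I J R)
          * first n ((L01.M ι R I).map (freeB ι R))) x y)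

/-- The handle algebra `L_{1,0}`. -/
def L10 : Type := RingQuot (ExchangeRel ι R)

instance : Semiring (L10 ι R) := inferInstanceAs (Semiring (RingQuot (ExchangeRel ι R)))
instance : Algebra ℂ (L10 ι R) := inferInstanceAs (Algebra ℂ (RingQuot (ExchangeRel ι R)))

/-- The canonical projection onto the handle algebra. -/
def L10.mk : FreeL ι R →ₐ[ℂ] L10 ι R := RingQuot.mkAlgHom ℂ (ExchangeRel ι R)
/-- The morphism `j_B : M ↦ B` from the loop algebra to the handle algebra. -/
def L10.jB : L01 ι R →ₐ[ℂ] L10 ι R := (L10.mk ι R).comp (freeB ι R)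
/-- The morphism `j_A : M ↦ A` from the loop algebra to the handle algebra. -/
def L10.jA : L01 ι R →ₐ[ℂ] L10 ι R := (L10.mk ι R).comp (freeA ι R)

/-- `Ψ` is the Reshetikhin-Semenov-Tian-Shansky-Drinfeld morphism `L_{0,1} → H`,
`M^I ↦ (T^I ⊗ id)(R R')`. -/
def IsRSD (Ψ : L01 ι R →ₐ[ℂ] H) : Prop :=
  ∀ (n : ℕ) (I : MatRep Ht n), IsLifting ι I → ∀ a b : Fin n,
    ι (Ψ (L01.M ι R I a b)) =
      TensorProduct.lid ℂ Ht (TensorProduct.map (coeff I a b) LinearMap.id (R * tensorFlip R))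

/-- The matrix `L^(+)`, its entries acting on the dual of `Ht`. -/
def opLplus {n : ℕ} (I : MatRep Ht n) : Matrix (Fin n) (Fin n) (End ℂ (Dual ℂ Ht)) :=
  (leftLeg I R).map rightTranslate

/-- The inverse of the matrix `L^(-)`, its entries acting on the dual of `Ht`. -/
def opLminusInv {n : ℕ} (I : MatRep Ht n) : Matrix (Fin n) (Fin n) (End ℂ (Dual ℂ Ht)) :=
  (leftLeg I (tensorFlip R)).map rightTranslate

/-- The matrix `T`, its entries acting on the dual of `Ht`. -/
def opT {n : ℕ} (I : MatRep Ht n) : Matrix (Fin n) (Fin n) (End ℂ (Dual ℂ Ht)) :=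
  Matrix.of fun a b => dualMulLeft (coeff I a b)

/-- `Φ` is the action of the handle algebra on the dual of `H` obtained from its morphism to the
Heisenberg double, `B ↦ L^(+) T L^(-)⁻¹` and `A ↦ L^(+) L^(-)⁻¹`. The entries of the single
factors belong to `Ht`, so that these products are computed on the dual of `Ht`; they are compared
with the action on the dual of `H` through the restriction `ψ ↦ ψ ∘ ι`. -/
def IsHandleRep (Φ : L10 ι R →ₐ[ℂ] End ℂ (Dual ℂ H)) : Prop :=
  ∀ (n : ℕ) (I : MatRep Ht n), IsLifting ι I → ∀ (a b : Fin n) (ψ : Dual ℂ Ht),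
    Φ (L10.jB ι R (L01.M ι R I a b)) (ψ ∘ₗ ι.toLinearMap)
        = ((opLplus R I * opT I * opLminusInv R I) a b ψ) ∘ₗ ι.toLinearMap ∧
    Φ (L10.jA ι R (L01.M ι R I a b)) (ψ ∘ₗ ι.toLinearMap)
        = ((opLplus R I * opLminusInv R I) a b ψ) ∘ₗ ι.toLinearMap

end General

section Projective

/-- The subgroup `ℂˣ id` of `GL(V)`. -/
def scalars (V : Type) [AddCommGroup V] [Module ℂ V] : Subgroup (End ℂ V)ˣ :=
  (Units.map (algebraMap ℂ (End ℂ V)).toMonoidHom).range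

instance (V : Type) [AddCommGroup V] [Module ℂ V] : (scalars V).Normal where
  conj_mem := by
    rintro _ ⟨c, rfl⟩ g
    refine ⟨c, ?_⟩
    rw [eq_mul_inv_iff_mul_eq]
    ext1
    exact Algebra.commutes (c : ℂ) (g : End ℂ V)

/-- The projective linear group `PGL(V)`. A projective representation of a group on `V` is a
morphism to it. -/
abbrev ProjGL (V : Type) [AddCommGroup V] [Module ℂ V] : Type := (End ℂ V)ˣ ⧸ scalars V

open scoped MatrixGroups in
/-- The Dehn twist about the loop `a` of the torus, `a ↦ a`, `b ↦ b a`, acting on homology. -/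
def τa : SL(2, ℤ) := ⟨!![1, 1; 0, 1], by simp⟩

open scoped MatrixGroups in
/-- The Dehn twist about the loop `b` of the torus, `a ↦ b⁻¹ a`, `b ↦ b`, acting on homology. -/
def τb : SL(2, ℤ) := ⟨!![1, 0; -1, 1], by simp⟩

end Projective

section Restricted

variable {p : ℕ} {q : ℂ} (hp : 2 ≤ p) (hq : IsPrimitiveRoot q (2 * p))

/-- The parameters of the restricted quantum group. -/
def barParam : QParam := ⟨p, 1, q, q ^ 2, hp, le_rfl, hq, pow_one _⟩

/-- The parameters of its extension by a square root of `K`. -/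
def halfParam : QParam := ⟨p, 2, q, q, hp, one_le_two, hq, rfl⟩

/-- The restricted quantum group of `sl(2)` at `q`: generators `E`, `F`, `K`, and relations
`K^(2p) = 1`, `E^p = F^p = 0`, `K E = q² E K`, `K F = q⁻² F K`,
`E F - F E = (K - K⁻¹) / (q - q⁻¹)`. -/
abbrev Ubar : Type := U (barParam hp hq)

/-- The extension of the restricted quantum group by a square root `k` of `K`: generators `E`,
`F`, `k`, and relations `k^(4p) = 1`, `E^p = F^p = 0`, `k E = q E k`, `k F = q⁻¹ F k`,
`E F - F E = (k² - k⁻²) / (q - q⁻¹)`. -/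
abbrev Uhalf : Type := U (halfParam hp hq)

theorem sat_incl : U.Sat (barParam hp hq) (U.E (halfParam hp hq)) (U.F (halfParam hp hq))
    (U.K (halfParam hp hq) ^ 2) where
  K_pow := by
    have h : U.K (halfParam hp hq) ^ (2 * p * 2) = 1 := (U.sat (halfParam hp hq)).K_pow
    change (U.K (halfParam hp hq) ^ 2) ^ (2 * p * 1) = 1
    rw [← pow_mul, mul_one, mul_comm 2 (2 * p), h]
  E_pow := (U.sat (halfParam hp hq)).E_pow
  F_pow := (U.sat (halfParam hp hq)).F_pow
  K_E := (U.sat (halfParam hp hq)).g_e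
  K_F := (U.sat (halfParam hp hq)).g_f
  E_F := by
    have h := (U.sat (halfParam hp hq)).E_F
    have hN : U.K (halfParam hp hq) ^ (2 * p * 2) = 1 := (U.sat (halfParam hp hq)).K_pow
    rw [h]
    change (q - q⁻¹)⁻¹ • (U.K (halfParam hp hq) ^ 2 - (U.K (halfParam hp hq) ^ (2 * p * 2 - 1)) ^ 2)
      = (q - q⁻¹)⁻¹ • ((U.K (halfParam hp hq) ^ 2) ^ 1
        - ((U.K (halfParam hp hq) ^ 2) ^ (2 * p * 1 - 1)) ^ 1)
    have e : (2 * p * 2 - 1) * 2 = 2 * (2 * p * 1 - 1) + 2 * p * 2 := by omega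
    rw [pow_one, pow_one, ← pow_mul, ← pow_mul, e, pow_add, hN, mul_one]

/-- The inclusion of the restricted quantum group, `E ↦ E`, `F ↦ F`, `K ↦ k²`. -/
def incl : Ubar hp hq →ₐ[ℂ] Uhalf hp hq := U.lift (sat_incl hp hq)

/-- The `q`-integers `[n] = (q^n - q^(-n)) / (q - q⁻¹)`. -/
def qInt (q : ℂ) (n : ℕ) : ℂ := (q ^ n - (q⁻¹) ^ n) / (q - q⁻¹)

/-- The `q`-factorials `[m]! = [1] [2] ... [m]`. -/
def qFact (q : ℂ) (m : ℕ) : ℂ := ∏ i ∈ Finset.range m, qInt q (i + 1)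

/-- The factor `q^(H ⊗ H / 2) = 1/(4p) ∑ s^(-n j) k^n ⊗ k^j`, the sum over `0 ≤ n, j < 4p`, of the
R-matrix, where `s` is a square root of `q`. -/
def cartanPart (s : ℂ) : Uhalf hp hq ⊗[ℂ] Uhalf hp hq :=
  (1 / (4 * p : ℂ)) • ∑ n ∈ Finset.range (4 * p), ∑ j ∈ Finset.range (4 * p),
    (s⁻¹) ^ (n * j) • (U.K (halfParam hp hq) ^ n) ⊗ₜ[ℂ] (U.K (halfParam hp hq) ^ j)

/-- The R-matrix
`q^(H ⊗ H / 2) ∑ (q - q⁻¹)^m / [m]! q^(m (m - 1) / 2) E^m ⊗ F^m`, the sum over `0 ≤ m < p`. -/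
def RMatrix (s : ℂ) : Uhalf hp hq ⊗[ℂ] Uhalf hp hq :=
  cartanPart hp hq s * ∑ m ∈ Finset.range p,
    ((q - q⁻¹) ^ m / qFact q m * q ^ (m * (m - 1) / 2)) •
      (U.E (halfParam hp hq) ^ m) ⊗ₜ[ℂ] (U.F (halfParam hp hq) ^ m)

/-- `v` is the ribbon element for which `K^(p+1) = u v⁻¹` is the balancing element. -/
def IsRibbon (s : ℂ) (v : Ubar hp hq) : Prop :=
  drinfeldElement (RMatrix hp hq s) = incl hp hq (U.K (barParam hp hq) ^ (p + 1) * v)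

open scoped MatrixGroups in
/-- `θ` is the projective representation of `SL(2, ℤ)`, the mapping class group of the torus, on the
symmetric linear forms that sends the Dehn twists `τa` and `τb` to the classes of the actions of
`v_A⁻¹` and `v_B⁻¹`. Here `v_A⁻¹` and `v_B⁻¹` are the images under `j_A` and `j_B` of the element of
the loop algebra that the isomorphism `Ψ` sends to `v⁻¹`. All of `v`, `Ψ`, `Φ`, `a`, `b` are determined
by the conditions on them. -/
def IsThetaSLF (s : ℂ) (θ : SL(2, ℤ) →* ProjGL (SLF (Ubar hp hq))) : Prop :=
  ∃ (v : (Ubar hp hq)ˣ)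
    (Ψ : L01 (incl hp hq) (RMatrix hp hq s) ≃ₐ[ℂ] Ubar hp hq)
    (Φ : L10 (incl hp hq) (RMatrix hp hq s) →ₐ[ℂ] End ℂ (Dual ℂ (Ubar hp hq)))
    (a b : (End ℂ (SLF (Ubar hp hq)))ˣ),
    IsRibbon hp hq s v ∧ IsRSD _ _ Ψ.toAlgHom ∧ IsHandleRep _ _ Φ ∧
    (∀ ψ : SLF (Ubar hp hq), (a.val ψ : Dual ℂ (Ubar hp hq)) =
      Φ (L10.jA _ _ (Ψ.symm v⁻¹.val)) (ψ : Dual ℂ (Ubar hp hq))) ∧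
    (∀ ψ : SLF (Ubar hp hq), (b.val ψ : Dual ℂ (Ubar hp hq)) =
      Φ (L10.jB _ _ (Ψ.symm v⁻¹.val)) (ψ : Dual ℂ (Ubar hp hq))) ∧
    θ τa = QuotientGroup.mk a ∧ θ τb = QuotientGroup.mk b

end Restricted
end
end RestrictedQG
open RestrictedQG
open scoped MatrixGroups

/-! Write `A` for the restricted quantum group, `R` for the R-matrix of the extension by `k`, `Q =
R'R` for the monodromy, and `S` for the antipode. Everything rests on `A` being a ribbon
factorizable Hopf algebra, although `R` itself only lives in the extension. The ribbon element `v`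
lies in `A`, `Q = Δ(v⁻¹)(v ⊗ v)` lies in `A ⊗ A`, and `f ↦ (id ⊗ f)(Q)` is a linear bijection `A* →
A` (`monodromy_bijective`). With a two-sided cointegral `Λ`, these facts form the structure
`IsFactorizable`, and most of the argument uses nothing else.

Part (2) is proved by hand (`U.SLF_antipode`). A symmetric form vanishes on the monomials `K^m F^a
E^c` with `a ≠ c`. On a weight projector `e_w`, the elements `F^a E^a` become polynomials in the
Casimir element `C`, which `S` fixes, while `S` exchanges `e_w` and `e_{w⁻¹}`. Cyclicity identifies
the values at `P(C) e_w` and `P(C) e_{wq²}` when `P` is divisible by one linear factor. The circle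
of weights can be walked from `q^{-n}` to `q^n` in two ways, with coprime products of factors, so a
Bézout relation identifies the values at `w` and `w⁻¹` for every `P`.

Part (1) follows. The form corresponding to `Λ` under `Q` is an integral; twisted by the pivot `g =
K^{p+1}` it becomes a nondegenerate symmetric form `λ`, invariant under `S` by (2). For central `z`
the form `λ(z ·)` is symmetric, hence also invariant, and nondegeneracy gives `S(z) = z`
(`IsFactorizable.antipode_central`).

For part (3), let `D(φ) = (id ⊗ φ(g ·))(Q)`, which is central and multiplicative on symmetric forms.
On symmetric forms `v_A⁻¹` acts as `a`, multiplication by `v⁻¹`, and `v_B⁻¹` acts as `c⁻¹ a L a⁻¹`,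
where `L` is convolution with `λ(v ·)` and `D(λ(v ·)) = c v⁻¹`. The product `W = a L a` turns out to
be `ψ ↦ λ(D(ψ) ·)`; multiplicativity of `D` gives `W L = c a W`, and `W² = λ(Λ)`
(`IsFactorizable.modular_relations`). In the projective group this is the braid relation together
with `(τ_a τ_b)³ = 1` (`exists_twist_units`). These relations suffice to define a morphism from
`SL₂(ℤ)` (`exists_modular_hom`), and `(τ_a τ_b)³ = -1` then makes it factor through `PSL₂(ℤ)`.

The objects themselves exist because the fusion and exchange relations are consequences of the
Yang-Baxter equation and of the commutation of translations with multiplications in the Heisenberg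
double (`fusion_pairing`, `fusion_handle`, `exchange_handle`). They are checked on the dual of the
extension and descend to `A*`. Injectivity of `Ψ` uses that the degree one generators already
exhaust the loop algebra (`L01.exists_eq`). Uniqueness, and this exhaustion, use that the
coefficients of liftings of principal indecomposable modules restrict to all of `A*`
(`hasEnoughLiftings`). -/

open scoped TensorProduct
namespace RestrictedQG
open scoped MatrixGroups

/-! ### The presentation of the modular group by the Dehn twists. -/

section ModularGroup

/-- The matrix of order `6` of the modular group. -/
def matY : Matrix (Fin 2) (Fin 2) ℤ := !![0, 1; -1, 1]

/-- The matrix of order `4` of the modular group. -/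
def matX : Matrix (Fin 2) (Fin 2) ℤ := !![0, 1; -1, 0]

theorem matY_cubed : matY ^ 3 = -1 := by
  ext i j; fin_cases i <;> fin_cases j <;> simp [pow_succ, matY]

theorem matX_mul_self : matX * matX = -1 := by
  ext i j; fin_cases i <;> fin_cases j <;> simp [matX]

theorem coe_τa_mul_τb : (τa * τb).1 = matY := by
  change (!![1, 1; 0, 1] : Matrix (Fin 2) (Fin 2) ℤ) * !![1, 0; -1, 1] = _
  ext i j; fin_cases i <;> fin_cases j <;> simp [matY]

theorem coe_τa_mul_τb_mul_τa : (τa * τb * τa).1 = matX := by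
  rw [Matrix.SpecialLinearGroup.coe_mul, coe_τa_mul_τb]
  change _ * (!![1, 1; 0, 1] : Matrix (Fin 2) (Fin 2) ℤ) = _
  ext i j; fin_cases i <;> fin_cases j <;> simp [matY, matX]

/-- The standard generators are words in the twists: `T = τa` and `S` is the inverse of `τa τb τa`.
-/
theorem τ_closure : Subgroup.closure {τa, τb} = ⊤ := by
  rw [eq_top_iff, ← SpecialLinearGroup.SL2Z_generators, Subgroup.closure_le]
  have ha : τa ∈ Subgroup.closure {τa, τb} := Subgroup.subset_closure (by simp)
  have hb : τb ∈ Subgroup.closure {τa, τb} := Subgroup.subset_closure (by simp)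
  rintro g (rfl | rfl)
  · have : ModularGroup.S * (τa * τb * τa) = 1 := by
      apply Subtype.ext
      rw [Matrix.SpecialLinearGroup.coe_mul, coe_τa_mul_τb_mul_τa]
      ext i j; fin_cases i <;> fin_cases j <;> simp [ModularGroup.S, matX]
    rw [SetLike.mem_coe, eq_inv_of_mul_eq_one_left this]
    exact inv_mem (mul_mem (mul_mem ha hb) ha)
  · have : ModularGroup.T = τa := by
      ext i j; fin_cases i <;> fin_cases j <;> simp [ModularGroup.T, τa]
    rw [SetLike.mem_coe, this]
    exact ha

/-- The pairs of corresponding products of the elements `X Y`, `X Y²` of the modular group and of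
elements of `G`. -/
inductive PosWord {G : Type*} [Group G] (x y : G) : Matrix (Fin 2) (Fin 2) ℤ → G → Prop
  | one : PosWord x y 1 1
  | left {M g} : PosWord x y M g → PosWord x y (!![-1, 1; 0, -1] * M) (x * y * g)
  | right {M g} : PosWord x y M g → PosWord x y (!![-1, 0; 1, -1] * M) (x * y ^ 2 * g)

/-- Both letters, up to sign, add one row to the other in absolute value, with a fixed pattern of
signs, so nothing cancels. The off-diagonal bound `1 ≤ b + c` is what keeps a nonempty word away
from `± 1`; this is the linear form of the statement that `X` and `Y` generate a free product modulo
sign. -/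
theorem PosWord.shape {G : Type*} [Group G] {x y : G} {M g} (h : PosWord x y M g) :
    (M = 1 ∧ g = 1) ∨ ∃ (s : ℤ) (a b c d : ℕ), (s = 1 ∨ s = -1) ∧ 1 ≤ a ∧ 1 ≤ d ∧ 1 ≤ b + c ∧
      M = !![s * a, - s * b; - s * c, s * d] := by
  induction h with
  | one => exact Or.inl ⟨rfl, rfl⟩
  | left _ ih =>
    right
    rcases ih with ⟨rfl, rfl⟩ | ⟨s, a, b, c, d, hs, ha, hd, hbc, rfl⟩
    · exact ⟨-1, 1, 1, 0, 1, by simp, by simp, by simp, by simp, by simp⟩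
    · refine ⟨-s, a + c, b + d, c, d, by omega, by omega, hd, by omega, ?_⟩
      ext i j; fin_cases i <;> fin_cases j <;> simp <;> ring
  | right _ ih =>
    right
    rcases ih with ⟨rfl, rfl⟩ | ⟨s, a, b, c, d, hs, ha, hd, hbc, rfl⟩
    · exact ⟨-1, 1, 0, 1, 1, by simp, by simp, by simp, by simp, by simp⟩
    · refine ⟨-s, a, b, a + c, b + d, by omega, ha, by omega, by omega, ?_⟩
      ext i j; fin_cases i <;> fin_cases j <;> simp <;> ring

/-- Normal forms `± Y^e P X^f` of pairs of corresponding elements. -/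
def NormalForm {G : Type*} [Group G] (x y : G) (M : Matrix (Fin 2) (Fin 2) ℤ) (g : G) : Prop :=
  ∃ (s : ℤ) (e : Fin 3) (f : Fin 2) (P : Matrix (Fin 2) (Fin 2) ℤ) (k : G), (s = 1 ∨ s = -1) ∧
    PosWord x y P k ∧ M = s • (matY ^ (e : ℕ) * P * matX ^ (f : ℕ)) ∧
      g = y ^ (e : ℕ) * k * x ^ (f : ℕ)

section
variable {G : Type*} [Group G] {x y : G}

theorem NormalForm.mulY (hy : y ^ 3 = 1) {M g} (h : NormalForm x y M g) :
    NormalForm x y (matY * M) (y * g) := by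
  obtain ⟨s, e, f, P, k, hs, hP, rfl, rfl⟩ := h
  by_cases he : (e : ℕ) = 2
  · refine ⟨-s, 0, f, P, k, by omega, hP, ?_, ?_⟩
    · rw [he, Matrix.mul_smul, ← mul_assoc, ← mul_assoc, ← pow_succ', matY_cubed]
      simp
    · rw [he, ← mul_assoc, ← mul_assoc, ← pow_succ', hy]; simp
  · refine ⟨s, ⟨e + 1, by omega⟩, f, P, k, hs, hP, ?_, ?_⟩
    · rw [Matrix.mul_smul, ← mul_assoc, ← mul_assoc, ← pow_succ']
    · rw [← mul_assoc, ← mul_assoc, ← pow_succ']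

theorem NormalForm.neg {M g} (h : NormalForm x y M g) : NormalForm x y (-M) g := by
  obtain ⟨s, e, f, P, k, hs, hP, rfl, rfl⟩ := h
  exact ⟨-s, e, f, P, k, by omega, hP, by simp, rfl⟩

/-- If the exponent of `Y` is positive, `X Y^e` is a new letter. If it is zero, `X` either cancels
against the first letter, using `X² = -1`, or changes the exponent of the final `X` when there is no
letter. -/
theorem NormalForm.mulX (hx : x ^ 2 = 1) {M g} (h : NormalForm x y M g) :
    NormalForm x y (matX * M) (x * g) := by
  obtain ⟨s, e, f, P, k, hs, hP, rfl, rfl⟩ := h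
  have hx' : x * x = 1 := by rw [← pow_two, hx]
  have h1 : matX * matY = !![-1, 1; 0, -1] := by
    ext i j; fin_cases i <;> fin_cases j <;> simp [matX, matY]
  have h2 : matX * matY ^ 2
      = !![-1, 0; 1, -1] := by
    ext i j; fin_cases i <;> fin_cases j <;> simp [pow_succ, matX, matY]
  fin_cases e
  · cases hP with
    | one =>
      fin_cases f
      · exact ⟨s, 0, 1, 1, 1, hs, .one, by
          rcases hs with rfl | rfl <;> simp, by simp⟩
      · refine ⟨-s, 0, 0, 1, 1, by omega, .one, ?_, by simp [hx']⟩
        simp [-zsmul_eq_mul, matX_mul_self]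
    | @left P' k' hP' =>
      refine ⟨-s, 1, f, P', k', by omega, hP', ?_, ?_⟩
      · rw [← h1]
        simp [-zsmul_eq_mul, ← mul_assoc, matX_mul_self]
      · simp [-zsmul_eq_mul, ← mul_assoc, hx']
    | @right P' k' hP' =>
      refine ⟨-s, 2, f, P', k', by omega, hP', ?_, ?_⟩
      · rw [← h2]
        simp [-zsmul_eq_mul, ← mul_assoc, matX_mul_self]
      · simp [-zsmul_eq_mul, ← mul_assoc, hx']
  · refine ⟨s, 0, f, _, _, hs, .left hP, ?_, ?_⟩
    · rw [← h1]
      simp [-zsmul_eq_mul, ← mul_assoc]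
    · simp [-zsmul_eq_mul, ← mul_assoc]
  · refine ⟨s, 0, f, _, _, hs, .right hP, ?_, ?_⟩
    · rw [← h2]
      simp [-zsmul_eq_mul, ← mul_assoc]
    · simp [-zsmul_eq_mul, ← mul_assoc]

/-- If the word is empty, `± Y^e X^f = 1` forces `e = f = 0`. If not, the pattern of signs
contradicts each of the possible equations between entries. -/
theorem NormalForm.eq_one {g : G} (h : NormalForm x y 1 g) : g = 1 := by
  obtain ⟨s, e, f, P, k, hs, hP, hM, rfl⟩ := h
  have e00 := congr_fun (congr_fun hM 0) 0
  have e01 := congr_fun (congr_fun hM 0) 1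
  have e10 := congr_fun (congr_fun hM 1) 0
  have e11 := congr_fun (congr_fun hM 1) 1
  rcases hP.shape with ⟨rfl, rfl⟩ | ⟨t, a, b, c, d, ht, ha, hd, hbc, rfl⟩
  · rcases hs with rfl | rfl <;> fin_cases e <;> fin_cases f <;>
      simp [pow_succ, matX, matY] at e00 e01 e10 e11 ⊢
  · exfalso
    rcases hs with rfl | rfl <;> rcases ht with rfl | rfl <;> fin_cases e <;> fin_cases f <;>
      simp [pow_succ, matX, matY] at e00 e01 e10 e11 <;> omega

/-- The subgroup of `SL₂(ℤ) × G` generated by the two pairs of corresponding elements is the graph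
of the morphism: it projects onto `SL₂(ℤ)` because the twists generate, and injectively because
normal forms over the identity matrix are trivial. -/
theorem exists_modular_hom {a b : G} (h1 : a * b * a = b * a * b) (h2 : (a * b) ^ 3 = 1) :
    ∃ θ : SL(2, ℤ) →* G, θ τa = a ∧ θ τb = b := by
  obtain ⟨x, hxdef⟩ : ∃ x, x = a * b * a := ⟨_, rfl⟩
  obtain ⟨y, hydef⟩ : ∃ y, y = a * b := ⟨_, rfl⟩
  rw [← hydef] at h2
  have hx' : x * x = 1 := by
    have : x * x = a * b * a * (b * a * b) := by rw [← h1, hxdef]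
    rw [this, ← h2, hydef]
    simp only [pow_succ, pow_zero, one_mul, mul_assoc]
  have hx : x ^ 2 = 1 := by rw [pow_two, hx']
  have ha : a = y ^ 2 * x := by
    have : y * a = x := by rw [hxdef, hydef]
    rw [← this, ← mul_assoc, ← pow_succ, h2, one_mul]
  have hb : b = x * y ^ 2 := by
    have h4 : x * b = y ^ 2 := by simp only [hxdef, hydef, pow_two, mul_assoc]
    rw [← h4, ← mul_assoc, hx', one_mul]
  let D : Subgroup (SL(2, ℤ) × G) := Subgroup.closure {(τa, a), (τb, b)}
  -- In `G` one has `a = y² x` and `b = x y²`, but the matrices satisfy this only up to sign; this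
  -- is why normal forms carry a sign that is invisible in `G`.
  have mA : ((τa : SL(2, ℤ)) : Matrix (Fin 2) (Fin 2) ℤ)
      = -(matY * (matY * matX)) := by
    ext i j; fin_cases i <;> fin_cases j <;> simp [τa, matX, matY]
  have mB : ((τb : SL(2, ℤ)) : Matrix (Fin 2) (Fin 2) ℤ)
      = -(matX * (matY * matY)) := by
    ext i j; fin_cases i <;> fin_cases j <;> simp [τb, matX, matY]
  have mA' : (τa⁻¹ : SL(2, ℤ)).1 = matX * matY * (-1) := by
    change Matrix.adjugate !![1, 1; 0, 1] = _
    rw [Matrix.adjugate_fin_two_of]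
    ext i j; fin_cases i <;> fin_cases j <;> simp [matX, matY]
  have mB' : (τb⁻¹ : SL(2, ℤ)).1 = matY * matX * (-1) := by
    change Matrix.adjugate !![1, 0; -1, 1] = _
    rw [Matrix.adjugate_fin_two_of]
    ext i j; fin_cases i <;> fin_cases j <;> simp [matX, matY]
  have hxi : x⁻¹ = x := by rw [inv_eq_iff_mul_eq_one, hx']
  have hy' : (y ^ 2)⁻¹ = y := by rw [inv_eq_iff_mul_eq_one, ← pow_succ, h2]
  -- The set of normal forms is stable under left multiplication by every element of the graph;
  -- applied to the trivial form it puts each pair `(1, g)` of the graph in normal form.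
  have key : ∀ d ∈ D, ∀ M g, NormalForm x y M g → NormalForm x y ((d.1 : SL(2, ℤ)).1 * M) (d.2 * g) := by
    intro d hd
    induction hd using Subgroup.closure_induction'' with
    | one => intro M g h; simpa using h
    | mem d hd =>
      intro M g h
      rcases hd with rfl | rfl
      · have := ((h.mulX hx).mulY h2).mulY h2
        have := this.neg
        rw [show ((τa, a) : SL(2, ℤ) × G).1.1 = _ from mA, show ((τa, a) : SL(2, ℤ) × G).2 = _ from ha]
        convert this using 1
        · simp only [neg_mul, mul_assoc]
        · simp only [pow_two, mul_assoc]
      · have := ((h.mulY h2).mulY h2).mulX hx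
        have := this.neg
        rw [show ((τb, b) : SL(2, ℤ) × G).1.1 = _ from mB, show ((τb, b) : SL(2, ℤ) × G).2 = _ from hb]
        convert this using 1
        · simp only [neg_mul, mul_assoc]
        · simp only [pow_two, mul_assoc]
    | inv_mem d hd =>
      intro M g h
      rcases hd with rfl | rfl
      · have := (h.mulY h2).mulX hx
        have := this.neg
        rw [show ((τa, a)⁻¹ : SL(2, ℤ) × G).1.1 = _ from mA',
          show ((τa, a)⁻¹ : SL(2, ℤ) × G).2 = x * y by
            change a⁻¹ = _
            rw [ha, mul_inv_rev, hxi, hy']]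
        convert this using 1
        · simp [mul_assoc]
        · simp only [mul_assoc]
      · have := (h.mulX hx).mulY h2
        have := this.neg
        rw [show ((τb, b)⁻¹ : SL(2, ℤ) × G).1.1 = _ from mB',
          show ((τb, b)⁻¹ : SL(2, ℤ) × G).2 = y * x by
            change b⁻¹ = _
            rw [hb, mul_inv_rev, hxi, hy']]
        convert this using 1
        · simp [mul_assoc]
        · simp only [mul_assoc]
    | mul d d' _ _ h h' =>
      intro M g hM
      have := h _ _ (h' _ _ hM)
      simpa [mul_assoc] using this
  have hone : NormalForm x y 1 1 := ⟨1, 0, 0, 1, 1, by simp, .one, by simp, by simp⟩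
  let π : D →* SL(2, ℤ) := (MonoidHom.fst _ _).comp D.subtype
  have inj : Function.Injective π := by
    rw [injective_iff_map_eq_one]
    rintro ⟨⟨M, g⟩, hd⟩ h
    have hM : M = 1 := h
    subst hM
    have := key _ hd 1 1 hone
    simp only [Matrix.SpecialLinearGroup.coe_one, mul_one] at this
    have := this.eq_one
    subst this
    rfl
  have surj : Function.Surjective π := by
    rw [← MonoidHom.range_eq_top, eq_top_iff, ← τ_closure, Subgroup.closure_le]
    rintro g (rfl | rfl)
    · exact ⟨⟨(τa, a), Subgroup.subset_closure (by simp)⟩, rfl⟩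
    · exact ⟨⟨(τb, b), Subgroup.subset_closure (by simp)⟩, rfl⟩
  let e := MulEquiv.ofBijective π ⟨inj, surj⟩
  refine ⟨((MonoidHom.snd _ _).comp D.subtype).comp e.symm.toMonoidHom, ?_, ?_⟩
  · have : e.symm τa = ⟨(τa, a), Subgroup.subset_closure (by simp)⟩ := by
      rw [MulEquiv.symm_apply_eq]; rfl
    simp [this]
  · have : e.symm τb = ⟨(τb, b), Subgroup.subset_closure (by simp)⟩ := by
      rw [MulEquiv.symm_apply_eq]; rfl
    simp [this]

theorem modular_hom_ext {θ θ' : SL(2, ℤ) →* G} (ha : θ τa = θ' τa) (hb : θ τb = θ' τb) :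
    θ = θ' := by
  refine MonoidHom.eq_of_eqOn_dense τ_closure ?_
  rintro g (rfl | rfl)
  exacts [ha, hb]

/-- The center consists of `± 1`, and `-1 = (τa τb)³`. -/
theorem exists_projective_factor {θ : SL(2, ℤ) →* G} (h : (θ τa * θ τb) ^ 3 = 1) :
    ∃ θ' : PSL(2, ℤ) →* G, ∀ g : SL(2, ℤ), θ' (QuotientGroup.mk g) = θ g := by
  refine ⟨QuotientGroup.lift _ θ ?_, fun g => rfl⟩
  intro c hc
  obtain ⟨r, hr, hc⟩ := Matrix.SpecialLinearGroup.mem_center_iff.1 hc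
  have hr2 : r = 1 ∨ r = -1 := by
    rw [Fintype.card_fin] at hr
    exact sq_eq_one_iff.1 hr
  rcases hr2 with rfl | rfl
  · have : c = 1 := by
      apply Subtype.ext
      rw [← hc]; simp
    rw [this, MonoidHom.mem_ker, map_one]
  · have : c = (τa * τb) ^ 3 := by
      apply Subtype.ext
      rw [← hc, Matrix.SpecialLinearGroup.coe_pow, coe_τa_mul_τb, matY_cubed]; simp
    rw [this, MonoidHom.mem_ker, map_pow, map_mul, h]

end
end ModularGroup
end RestrictedQG

open scoped TensorProduct
namespace RestrictedQG
noncomputable section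
open Coalgebra HopfAlgebra

/-! ### Quasitriangular Hopf algebras and the Yang-Baxter equation. -/

section Legs
variable {M N B : Type*} [AddCommGroup M] [Module ℂ M] [AddCommGroup N] [Module ℂ N]
  [Ring B] [Algebra ℂ B]

/-- The linear map `x ⊗ y ↦ f x * g y`. -/
def leg (f : M →ₗ[ℂ] B) (g : N →ₗ[ℂ] B) : M ⊗[ℂ] N →ₗ[ℂ] B :=
  LinearMap.mul' ℂ B ∘ₗ TensorProduct.map f g

/-- The linear map `x ⊗ y ↦ g y * f x`. -/
def gel (f : M →ₗ[ℂ] B) (g : N →ₗ[ℂ] B) : M ⊗[ℂ] N →ₗ[ℂ] B :=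
  leg g f ∘ₗ (TensorProduct.comm ℂ M N).toLinearMap

@[simp] theorem leg_tmul (f : M →ₗ[ℂ] B) (g : N →ₗ[ℂ] B) (x : M) (y : N) :
    leg f g (x ⊗ₜ y) = f x * g y := by simp [leg]

@[simp] theorem gel_tmul (f : M →ₗ[ℂ] B) (g : N →ₗ[ℂ] B) (x : M) (y : N) :
    gel f g (x ⊗ₜ y) = g y * f x := by simp [gel]

end Legs

section Hopf
variable {A : Type} [Ring A] [HopfAlgebra ℂ A] {V : Type*} [AddCommGroup V] [Module ℂ V]

/-- The antipode axiom in a form that replaces Sweedler calculus: an expression seeing `x ⊗ y` only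
through `S(x) y` collapses on a coproduct. -/
theorem apply_comul_of_antipode_mul (F : A ⊗[ℂ] A →ₗ[ℂ] V) (L : A →ₗ[ℂ] V)
    (h : ∀ x y, F (x ⊗ₜ y) = L (antipode ℂ x * y)) (c : A) :
    F (comul c) = counit (R := ℂ) c • L 1 := by
  have : F = L ∘ₗ (LinearMap.mul' ℂ A ∘ₗ (antipode ℂ).rTensor A) := by
    ext x y; simp [h]
  rw [this, LinearMap.comp_apply, LinearMap.comp_apply, mul_antipode_rTensor_comul_apply,
    Algebra.algebraMap_eq_smul_one, map_smul]

theorem apply_comul_of_mul_antipode (F : A ⊗[ℂ] A →ₗ[ℂ] V) (L : A →ₗ[ℂ] V)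
    (h : ∀ x y, F (x ⊗ₜ y) = L (x * antipode ℂ y)) (c : A) :
    F (comul c) = counit (R := ℂ) c • L 1 := by
  have : F = L ∘ₗ (LinearMap.mul' ℂ A ∘ₗ (antipode ℂ).lTensor A) := by
    ext x y; simp [h]
  rw [this, LinearMap.comp_apply, LinearMap.comp_apply, mul_antipode_lTensor_comul_apply,
    Algebra.algebraMap_eq_smul_one, map_smul]

theorem exists_comul (c : A) :
    ∃ S : Finset (A × A), comul (R := ℂ) c = ∑ i ∈ S, i.1 ⊗ₜ[ℂ] i.2 :=
  TensorProduct.exists_finset _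

section Sweedler
variable {c : A} {S : Finset (A × A)} (hc : comul (R := ℂ) c = ∑ i ∈ S, i.1 ⊗ₜ[ℂ] i.2)
include hc

theorem sum_counit_left : ∑ i ∈ S, counit (R := ℂ) i.1 • i.2 = c := by
  have := congrArg (TensorProduct.lid ℂ A) (rTensor_counit_comul (R := ℂ) c)
  rw [hc] at this
  simpa using this

theorem sum_counit_right : ∑ i ∈ S, counit (R := ℂ) i.2 • i.1 = c := by
  have := congrArg (TensorProduct.rid ℂ A) (lTensor_counit_comul (R := ℂ) c)
  rw [hc] at this
  simpa using this

theorem sum_coassoc : ∑ i ∈ S, TensorProduct.assoc ℂ A A A (comul (R := ℂ) i.1 ⊗ₜ[ℂ] i.2)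
    = ∑ i ∈ S, i.1 ⊗ₜ[ℂ] comul (R := ℂ) i.2 := by
  have := coassoc_apply (R := ℂ) c
  rw [hc] at this
  simpa using this

end Sweedler

theorem antipode_mul (x y : A) : antipode ℂ (x * y) = antipode ℂ y * antipode ℂ x :=
  antipode_mul_antidistrib ..

variable {I : Type} [Fintype I]

/-- The family `a i ⊗ b i` is an R-matrix: it is a quasitriangular structure. -/
structure IsRMatrix (a b : I → A) : Prop where
  comul_a : ∑ i, comul (R := ℂ) (a i) ⊗ₜ[ℂ] b i = ∑ i, ∑ j, (a i ⊗ₜ[ℂ] a j) ⊗ₜ[ℂ] (b i * b j)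
  comul_b : ∑ i, a i ⊗ₜ[ℂ] comul (R := ℂ) (b i) = ∑ i, ∑ j, (a i * a j) ⊗ₜ[ℂ] (b j ⊗ₜ[ℂ] b i)
  quasi : ∀ x : A, (∑ i, a i ⊗ₜ[ℂ] b i) * comul (R := ℂ) x
    = TensorProduct.comm ℂ A A (comul (R := ℂ) x) * ∑ i, a i ⊗ₜ[ℂ] b i
  counit_a : ∑ i, counit (R := ℂ) (a i) • b i = 1
  counit_b : ∑ i, counit (R := ℂ) (b i) • a i = 1

variable {B : Type*} [Ring B] [Algebra ℂ B]

/-- The convolution of two morphisms with commuting images. -/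
def convHom (f g : A →ₐ[ℂ] B) (h : ∀ x y, Commute (f x) (g y)) : A →ₐ[ℂ] B :=
  (Algebra.TensorProduct.lift f g h).comp (Bialgebra.comulAlgHom ℂ A)

theorem convHom_apply (f g : A →ₐ[ℂ] B) (h : ∀ x y, Commute (f x) (g y)) (x : A) :
    convHom f g h x = leg f.toLinearMap g.toLinearMap (comul x) := by
  have : (Algebra.TensorProduct.lift f g h).toLinearMap = leg f.toLinearMap g.toLinearMap := by
    ext x y; simp
  rw [convHom, AlgHom.comp_apply, ← this]; rfl

/-- The element `∑ f (a i) * g (b i)`. -/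
def pairing (a b : I → A) (f g : A →ₐ[ℂ] B) : B := ∑ i, f (a i) * g (b i)

namespace IsRMatrix
variable {a b : I → A} (R : IsRMatrix a b)
include R

/-- A pairing is the R-matrix with its legs placed in two copies of `A` inside one algebra. For
three commuting copies this is the image of `(Δ ⊗ id)(R) = R₁₃ R₂₃`, and the next lemma is the image
of `(id ⊗ Δ)(R) = R₁₃ R₁₂`. The same computation then serves matrices, operators and mixtures of
both. -/
theorem pairing_convHom_left {f g k : A →ₐ[ℂ] B} (hfg : ∀ x y, Commute (f x) (g y))
    (hgk : ∀ x y, Commute (g x) (k y)) :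
    pairing a b (convHom f g hfg) k = pairing a b f k * pairing a b g k := by
  have := congrArg (leg (leg f.toLinearMap g.toLinearMap) k.toLinearMap) R.comul_a
  simp only [map_sum, leg_tmul, AlgHom.toLinearMap_apply] at this
  simp only [pairing, convHom_apply, this, Finset.sum_mul_sum]
  refine Finset.sum_congr rfl fun i _ => Finset.sum_congr rfl fun j _ => ?_
  rw [map_mul, mul_assoc, mul_assoc, ← mul_assoc (g _), (hgk (a j) (b i)).eq]
  simp only [mul_assoc]

theorem pairing_convHom_right {f g k : A →ₐ[ℂ] B} (hgk : ∀ x y, Commute (g x) (k y))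
    (hfk : ∀ x y, Commute (f x) (k y)) :
    pairing a b f (convHom g k hgk) = pairing a b f k * pairing a b f g := by
  have := congrArg (leg f.toLinearMap (leg g.toLinearMap k.toLinearMap)) R.comul_b
  simp only [map_sum, leg_tmul, AlgHom.toLinearMap_apply] at this
  simp only [pairing, convHom_apply, this, Finset.sum_mul_sum]
  refine Finset.sum_congr rfl fun i _ => Finset.sum_congr rfl fun j _ => ?_
  rw [map_mul, (hgk (b j) (b i)).eq, mul_assoc, mul_assoc, ← mul_assoc _ (k _), (hfk (a j) (b i)).eq]
  simp only [mul_assoc]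

theorem pairing_mul_convHom {f g : A →ₐ[ℂ] B} (hfg : ∀ x y, Commute (f x) (g y))
    (hgf : ∀ x y, Commute (g x) (f y)) (x : A) :
    pairing a b f g * convHom f g hfg x = convHom g f hgf x * pairing a b f g := by
  have h := congrArg (Algebra.TensorProduct.lift f g hfg) (R.quasi x)
  have h1 : Algebra.TensorProduct.lift f g hfg (∑ i, a i ⊗ₜ[ℂ] b i) = pairing a b f g := by
    simp [pairing]
  have h2 : ∀ X : A ⊗[ℂ] A, Algebra.TensorProduct.lift f g hfg (TensorProduct.comm ℂ A A X)
      = Algebra.TensorProduct.lift g f hgf X := by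
    intro X
    induction X using TensorProduct.induction_on with
    | zero => simp
    | tmul x y => simp [(hfg y x).eq]
    | add x y hx hy => simp only [map_add, hx, hy]
  rw [map_mul, map_mul, h1, h2] at h
  exact h

/-- `R₁₃ R₂₃` is `(Δ ⊗ id)(R)`, and conjugation by `R₁₂` replaces `Δ` by the opposite coproduct,
which reverses the two factors. -/
theorem yang_baxter {f g k : A →ₐ[ℂ] B} (hfg : ∀ x y, Commute (f x) (g y))
    (hfk : ∀ x y, Commute (f x) (k y)) (hgk : ∀ x y, Commute (g x) (k y)) :
    pairing a b f g * pairing a b f k * pairing a b g k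
      = pairing a b g k * pairing a b f k * pairing a b f g := by
  have hgf : ∀ x y, Commute (g x) (f y) := fun x y => (hfg y x).symm
  rw [mul_assoc, ← R.pairing_convHom_left hfg hgk, ← R.pairing_convHom_left hgf hfk]
  rw [pairing, pairing, pairing, Finset.mul_sum, Finset.sum_mul]
  refine Finset.sum_congr rfl fun i _ => ?_
  have h1 : Commute (k (b i)) (∑ j, f (a j) * g (b j)) :=
    Commute.sum_right _ _ _ fun j _ => ((hfk _ _).symm).mul_right (hgk _ _).symm
  rw [mul_assoc, h1.eq, ← mul_assoc, ← mul_assoc]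
  congr 1
  exact R.pairing_mul_convHom hfg hgf (a i)

/-! ### The antipode of the R-matrix -/

theorem antipode_a_mul : ∑ i, ∑ j, (antipode ℂ (a i) * a j) ⊗ₜ[ℂ] (b i * b j) = 1 := by
  have := congrArg (TensorProduct.map (leg (antipode ℂ) LinearMap.id) (LinearMap.id (M := A)))
    R.comul_a
  simp only [map_sum, TensorProduct.map_tmul, leg_tmul, LinearMap.id_apply] at this
  rw [← this]
  have h : ∀ i, leg (antipode ℂ) LinearMap.id (comul (a i)) ⊗ₜ[ℂ] b i
      = (1 : A) ⊗ₜ[ℂ] (counit (R := ℂ) (a i) • b i) := fun i => by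
    rw [apply_comul_of_antipode_mul _ LinearMap.id (by simp), TensorProduct.smul_tmul]; rfl
  simp only [h, ← TensorProduct.tmul_sum, R.counit_a, Algebra.TensorProduct.one_def]

theorem mul_antipode_a : ∑ i, ∑ j, (a i * antipode ℂ (a j)) ⊗ₜ[ℂ] (b i * b j) = 1 := by
  have := congrArg (TensorProduct.map (leg LinearMap.id (antipode ℂ)) (LinearMap.id (M := A)))
    R.comul_a
  simp only [map_sum, TensorProduct.map_tmul, leg_tmul, LinearMap.id_apply] at this
  rw [← this]
  have h : ∀ i, leg LinearMap.id (antipode ℂ) (comul (a i)) ⊗ₜ[ℂ] b i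
      = (1 : A) ⊗ₜ[ℂ] (counit (R := ℂ) (a i) • b i) := fun i => by
    rw [apply_comul_of_mul_antipode _ LinearMap.id (by simp), TensorProduct.smul_tmul]; rfl
  simp only [h, ← TensorProduct.tmul_sum, R.counit_a, Algebra.TensorProduct.one_def]

theorem antipode_b_mul : ∑ i, ∑ j, (a i * a j) ⊗ₜ[ℂ] (antipode ℂ (b j) * b i) = 1 := by
  have := congrArg (TensorProduct.map (LinearMap.id (M := A)) (leg (antipode ℂ) LinearMap.id))
    R.comul_b
  simp only [map_sum, TensorProduct.map_tmul, leg_tmul, LinearMap.id_apply] at this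
  rw [← this]
  have h : ∀ i, a i ⊗ₜ[ℂ] leg (antipode ℂ) LinearMap.id (comul (b i))
      = (counit (R := ℂ) (b i) • a i) ⊗ₜ[ℂ] (1 : A) := fun i => by
    rw [apply_comul_of_antipode_mul _ LinearMap.id (by simp), TensorProduct.smul_tmul]; rfl
  simp only [h, ← TensorProduct.sum_tmul, R.counit_b, Algebra.TensorProduct.one_def]

theorem mul_antipode_b : ∑ i, ∑ j, (a i * a j) ⊗ₜ[ℂ] (b j * antipode ℂ (b i)) = 1 := by
  have := congrArg (TensorProduct.map (LinearMap.id (M := A)) (leg LinearMap.id (antipode ℂ)))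
    R.comul_b
  simp only [map_sum, TensorProduct.map_tmul, leg_tmul, LinearMap.id_apply] at this
  rw [← this]
  have h : ∀ i, a i ⊗ₜ[ℂ] leg LinearMap.id (antipode ℂ) (comul (b i))
      = (counit (R := ℂ) (b i) • a i) ⊗ₜ[ℂ] (1 : A) := fun i => by
    rw [apply_comul_of_mul_antipode _ LinearMap.id (by simp), TensorProduct.smul_tmul]; rfl
  simp only [h, ← TensorProduct.sum_tmul, R.counit_b, Algebra.TensorProduct.one_def]

/-- `R` and `(S ⊗ S)(R)` are both left inverses of `(S ⊗ id)(R)`, and `R` is also a right inverse.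
-/
theorem antipode_antipode : ∑ i, antipode ℂ (a i) ⊗ₜ[ℂ] antipode ℂ (b i) = ∑ i, a i ⊗ₜ[ℂ] b i := by
  have h1 : (∑ i, a i ⊗ₜ[ℂ] b i) * (∑ i, antipode ℂ (a i) ⊗ₜ[ℂ] b i) = 1 := by
    rw [← R.mul_antipode_a]; simp [Finset.sum_mul_sum]
  have h2 : (∑ i, antipode ℂ (a i) ⊗ₜ[ℂ] b i) * (∑ i, a i ⊗ₜ[ℂ] b i) = 1 := by
    rw [← R.antipode_a_mul]; simp [Finset.sum_mul_sum]
  have h3 : (∑ i, antipode ℂ (a i) ⊗ₜ[ℂ] antipode ℂ (b i)) * (∑ i, antipode ℂ (a i) ⊗ₜ[ℂ] b i)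
      = 1 := by
    have := congrArg (TensorProduct.map (antipode ℂ) (LinearMap.id (M := A))) R.antipode_b_mul
    simp only [map_sum, TensorProduct.map_tmul, antipode_mul, LinearMap.id_apply,
      Algebra.TensorProduct.one_def, antipode_one] at this
    rw [Algebra.TensorProduct.one_def, ← this, Finset.sum_comm]
    simp [Finset.sum_mul_sum]
  rw [← mul_one (∑ i, antipode ℂ (a i) ⊗ₜ[ℂ] antipode ℂ (b i)), ← h2, ← mul_assoc, h3, one_mul]

theorem sum_antipode {W : Type*} [AddCommGroup W] [Module ℂ W] (F : A →ₗ[ℂ] A →ₗ[ℂ] W) :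
    ∑ i, F (antipode ℂ (a i)) (antipode ℂ (b i)) = ∑ i, F (a i) (b i) := by
  have := congrArg (TensorProduct.lift F) R.antipode_antipode
  simpa using this

end IsRMatrix
end Hopf
end
end RestrictedQG

open scoped TensorProduct
namespace RestrictedQG
noncomputable section
open Coalgebra HopfAlgebra

/-! ### The Drinfeld element: square of the antipode, inverse, coproduct. -/

section Drinfeld
variable {A : Type} [Ring A] [HopfAlgebra ℂ A] {I : Type} [Fintype I]

namespace IsRMatrix
variable {a b : I → A} (R : IsRMatrix a b)

/-- The Drinfeld element of an R-matrix. -/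
def elt (_ : IsRMatrix a b) : A := ∑ i, antipode ℂ (b i) * a i

include R

/-- Apply `p ⊗ q ↦ S(q) p` to `R Δ(x₁) = Δ^op(x₁) R` and multiply by `S²(x₂)` on the left. One side
is `S(x₂ S(x₃)) u x₁ = u x`; on the other, `S(x₁) x₂` collapses and leaves `S²(x) u`. -/
theorem elt_mul (x : A) : R.elt * x = antipode ℂ (antipode ℂ x) * R.elt := by
  obtain ⟨S, hS⟩ := exists_comul x
  set G : A ⊗[ℂ] A →ₗ[ℂ] A := gel LinearMap.id (antipode ℂ) with hG
  set S2 : A →ₗ[ℂ] A := antipode ℂ ∘ₗ antipode ℂ with hS2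
  have e : ∑ i ∈ S, S2 i.2 * G ((∑ k, a k ⊗ₜ[ℂ] b k) * comul (R := ℂ) i.1)
      = ∑ i ∈ S, S2 i.2 * G (TensorProduct.comm ℂ A A (comul (R := ℂ) i.1)
        * ∑ k, a k ⊗ₜ[ℂ] b k) := by simp only [R.quasi]
  have h1 : G ∘ₗ LinearMap.mulLeft ℂ (∑ k, a k ⊗ₜ[ℂ] b k)
      = gel (LinearMap.mulLeft ℂ R.elt) (antipode ℂ) := by
    ext p q
    simp [hG, Finset.sum_mul, elt, antipode_mul, Finset.mul_sum, mul_assoc]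
  have hL : ∑ i ∈ S, S2 i.2 * G ((∑ k, a k ⊗ₜ[ℂ] b k) * comul (R := ℂ) i.1) = R.elt * x := by
    have h2 := congrArg (gel (LinearMap.mulLeft ℂ R.elt) (gel (antipode ℂ) S2)) (sum_coassoc hS)
    simp only [map_sum, gel_tmul] at h2
    have h3 : gel (LinearMap.mulLeft ℂ R.elt) (gel (antipode ℂ) S2)
        ∘ₗ (TensorProduct.assoc ℂ A A A).toLinearMap
        = gel (gel (LinearMap.mulLeft ℂ R.elt) (antipode ℂ)) S2 := by
      ext p q t; simp [mul_assoc]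
    have h4 : ∀ i, gel (antipode ℂ) S2 (comul i) = counit (R := ℂ) i • (1 : A) := fun i => by
      rw [apply_comul_of_mul_antipode _ (antipode ℂ)
        (by intro x y; simp [hS2, antipode_mul]), antipode_one]
    simp only [h4, smul_mul_assoc, one_mul] at h2
    calc _ = ∑ i ∈ S, gel (gel (LinearMap.mulLeft ℂ R.elt) (antipode ℂ)) S2
          (comul (R := ℂ) i.1 ⊗ₜ i.2) := by
          refine Finset.sum_congr rfl fun i _ => ?_
          rw [gel_tmul, ← h1]; rfl
      _ = ∑ i ∈ S, counit (R := ℂ) i.2 • LinearMap.mulLeft ℂ R.elt i.1 := by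
          rw [← h2]
          refine Finset.sum_congr rfl fun i _ => ?_
          rw [← h3]; rfl
      _ = R.elt * x := by
          rw [← LinearMap.mulLeft_apply (R := ℂ), ← sum_counit_right hS]
          simp only [map_sum, map_smul]
  have hR : ∀ c, G (TensorProduct.comm ℂ A A (comul (R := ℂ) c) * ∑ k, a k ⊗ₜ[ℂ] b k)
      = counit (R := ℂ) c • R.elt := by
    intro c
    have := apply_comul_of_antipode_mul (G ∘ₗ LinearMap.mulRight ℂ (∑ k, a k ⊗ₜ[ℂ] b k)
      ∘ₗ (TensorProduct.comm ℂ A A).toLinearMap)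
      (∑ k, LinearMap.mulLeft ℂ (antipode ℂ (b k)) ∘ₗ LinearMap.mulRight ℂ (a k))
      (by intro x y; simp [hG, Finset.mul_sum, antipode_mul, mul_assoc]) c
    simpa [elt] using this
  rw [← hL, e]
  simp only [hR]
  rw [← LinearMap.comp_apply, ← hS2, ← sum_counit_left hS]
  simp only [map_sum, map_smul, Finset.sum_mul, mul_smul_comm, smul_mul_assoc]

/-- Moving `u` past `b_j` and using the invariance of `R` under `S ⊗ S` gives `u w = S(b_j) u
S(a_j)`, summed over `j`, which is `1` because `(S ⊗ id)(R)` is inverse to `R`. The same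
intertwining turns this right inverse into a left inverse, `S²(w) u = u w = 1`. -/
theorem exists_elt_inv : ∃ w : A, R.elt * w = 1 ∧ w * R.elt = 1 ∧
    w = ∑ i, b i * antipode ℂ (antipode ℂ (a i)) := by
  set w := ∑ i, b i * antipode ℂ (antipode ℂ (a i)) with hw
  have h1 : R.elt * w = 1 := by
    have e1 : R.elt * w = ∑ j, antipode ℂ (antipode ℂ (b j)) * R.elt
        * antipode ℂ (antipode ℂ (a j)) := by
      rw [hw, Finset.mul_sum]
      refine Finset.sum_congr rfl fun j _ => ?_
      rw [← mul_assoc, R.elt_mul]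
    rw [e1]
    have e2 := R.sum_antipode (LinearMap.mk₂ ℂ (fun x y => antipode ℂ y * R.elt * antipode ℂ x)
      (by intros; simp [mul_add]) (by intros; simp) (by intros; simp [add_mul])
      (by intros; simp))
    simp only [LinearMap.mk₂_apply] at e2
    rw [e2]
    have e3 := congrArg (gel LinearMap.id (antipode ℂ)) R.mul_antipode_a
    simp only [map_sum, gel_tmul, LinearMap.id_apply, antipode_mul,
      Algebra.TensorProduct.one_def, antipode_one, mul_one] at e3
    rw [← e3, Finset.sum_comm]
    refine Finset.sum_congr rfl fun j _ => ?_
    rw [elt, Finset.mul_sum, Finset.sum_mul]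
    refine Finset.sum_congr rfl fun i _ => ?_
    simp only [mul_assoc]
  have h2 : antipode ℂ (antipode ℂ w) * R.elt = 1 := by rw [← R.elt_mul, h1]
  have h3 : antipode ℂ (antipode ℂ w) = w := by
    rw [← mul_one (antipode ℂ (antipode ℂ w)), ← h1, ← mul_assoc, h2, one_mul]
  exact ⟨w, h1, by rw [← h3, h2], rfl⟩

/-- `R' R`. -/
def Q (_ : IsRMatrix a b) : A ⊗[ℂ] A := (∑ i, b i ⊗ₜ[ℂ] a i) * ∑ i, a i ⊗ₜ[ℂ] b i

theorem quasi_flip (x : A) : (∑ i, b i ⊗ₜ[ℂ] a i) * TensorProduct.comm ℂ A A (comul (R := ℂ) x)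
    = comul (R := ℂ) x * ∑ i, b i ⊗ₜ[ℂ] a i := by
  have h : ∀ X Y : A ⊗[ℂ] A, TensorProduct.comm ℂ A A (X * Y)
      = TensorProduct.comm ℂ A A X * TensorProduct.comm ℂ A A Y :=
    fun X Y => map_mul (Algebra.TensorProduct.comm ℂ A A) X Y
  have := congrArg (TensorProduct.comm ℂ A A) (R.quasi x)
  simpa [h, map_sum] using this

theorem Q_comul (x : A) : R.Q * comul (R := ℂ) x = comul (R := ℂ) x * R.Q := by
  rw [Q, mul_assoc, R.quasi, ← mul_assoc, R.quasi_flip, mul_assoc]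

/-- Since `Q` commutes with coproducts, `Q` can be moved inside `Δ(S(b)) Δ(a)`. Expanding `Δ(a)`,
then `Δ(S(b))`, by the hexagon axioms frees one Drinfeld element in each factor, and the remaining
R-matrices cancel in pairs. -/
theorem comul_elt_mul_Q (hS : ∀ x : A, comul (R := ℂ) (antipode ℂ x)
      = TensorProduct.map (antipode ℂ) (antipode ℂ) (TensorProduct.comm ℂ A A (comul (R := ℂ) x))) :
    comul (R := ℂ) R.elt * R.Q = R.elt ⊗ₜ R.elt := by
  set Rf : A ⊗[ℂ] A := ∑ i, b i ⊗ₜ[ℂ] a i with hRf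
  set Rt : A ⊗[ℂ] A := ∑ i, a i ⊗ₜ[ℂ] b i with hRt
  set T : A ⊗[ℂ] A →ₗ[ℂ] A ⊗[ℂ] A := TensorProduct.map (antipode ℂ) (antipode ℂ)
    ∘ₗ (TensorProduct.comm ℂ A A).toLinearMap with hT
  have T_tmul : ∀ x y : A, T (x ⊗ₜ y) = antipode ℂ y ⊗ₜ antipode ℂ x := fun x y => by simp [hT]
  have T_mul : ∀ X Y, T (X * Y) = T Y * T X := by
    intro X Y
    induction X using TensorProduct.induction_on with
    | zero => simp
    | add X X' h h' => simp only [add_mul, mul_add, map_add, h, h']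
    | tmul x y =>
      induction Y using TensorProduct.induction_on with
      | zero => simp
      | add X X' h h' => simp only [add_mul, mul_add, map_add, h, h']
      | tmul z w => simp [T_tmul, antipode_mul]
  have e1 : comul (R := ℂ) R.elt * R.Q
      = (∑ i, T (comul (b i)) * Rf * TensorProduct.comm ℂ A A (comul (a i))) * Rt := by
    rw [elt, map_sum, Finset.sum_mul, Finset.sum_mul]
    refine Finset.sum_congr rfl fun i _ => ?_
    rw [Bialgebra.comul_mul, mul_assoc, ← R.Q_comul, hS, Q, mul_assoc (∑ i, b i ⊗ₜ[ℂ] a i),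
      R.quasi]
    simp only [hT, hRf, hRt, mul_assoc]; rfl
  have e2 : ∑ i, T (comul (b i)) * Rf * TensorProduct.comm ℂ A A (comul (a i))
      = ∑ i, ∑ j, T (comul (b j)) * (T (comul (b i)) * Rf * ((1 : A) ⊗ₜ a i)) * (a j ⊗ₜ (1 : A)) := by
    have := congrArg (gel (LinearMap.mulLeft ℂ Rf ∘ₗ (TensorProduct.comm ℂ A A).toLinearMap)
      (T ∘ₗ comul)) R.comul_a
    simp only [map_sum, gel_tmul, LinearMap.comp_apply, LinearEquiv.coe_coe,
      LinearMap.mulLeft_apply, TensorProduct.comm_tmul] at this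
    simp only [mul_assoc, this]
    refine Finset.sum_congr rfl fun i _ => Finset.sum_congr rfl fun j _ => ?_
    rw [Bialgebra.comul_mul, T_mul, mul_assoc, Algebra.TensorProduct.tmul_mul_tmul]
    simp
  -- The flipped R-matrix meets its inverse `S(b) ⊗ a` here, leaving the second Drinfeld element.
  have e3 : ∑ i, T (comul (b i)) * Rf * ((1 : A) ⊗ₜ[ℂ] a i) = (1 : A) ⊗ₜ[ℂ] R.elt := by
    have := congrArg (gel (LinearMap.mulLeft ℂ Rf ∘ₗ TensorProduct.mk ℂ A A 1) T) R.comul_b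
    simp only [map_sum, gel_tmul, LinearMap.comp_apply,
      LinearMap.mulLeft_apply, TensorProduct.mk_apply, T_tmul] at this
    simp only [mul_assoc, this]
    rw [Finset.sum_comm]
    have h0 := congrArg (TensorProduct.comm ℂ A A) R.antipode_b_mul
    simp only [map_sum, TensorProduct.comm_tmul, Algebra.TensorProduct.one_def] at h0
    have h1 : ∀ j, ∑ i, (antipode ℂ (b i) ⊗ₜ[ℂ] antipode ℂ (b j)) * (Rf * ((1 : A) ⊗ₜ[ℂ] (a i * a j)))
        = ((1 : A) ⊗ₜ antipode ℂ (b j)) * ((1 : A) ⊗ₜ[ℂ] (1 : A)) * ((1 : A) ⊗ₜ a j) := by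
      intro j
      rw [← h0]
      simp only [hRf, Finset.mul_sum, Finset.sum_mul, Algebra.TensorProduct.tmul_mul_tmul, one_mul,
        mul_one, mul_assoc]
      rw [Finset.sum_comm]
    simp only [h1]
    simp [elt, TensorProduct.tmul_sum]
  have e4 : ∑ j, T (comul (b j)) * ((1 : A) ⊗ₜ[ℂ] R.elt) * (a j ⊗ₜ[ℂ] (1 : A))
      = (R.elt ⊗ₜ[ℂ] (1 : A)) * (∑ j, a j ⊗ₜ[ℂ] antipode ℂ (b j)) * ((1 : A) ⊗ₜ[ℂ] R.elt) := by
    have := congrArg (gel (LinearMap.mulLeft ℂ ((1 : A) ⊗ₜ[ℂ] R.elt)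
      ∘ₗ (TensorProduct.mk ℂ A A).flip 1) T) R.comul_b
    simp only [map_sum, gel_tmul, LinearMap.comp_apply, LinearMap.flip_apply,
      LinearMap.mulLeft_apply, TensorProduct.mk_apply, T_tmul] at this
    simp only [mul_assoc, this]
    simp only [Finset.mul_sum, Finset.sum_mul, Algebra.TensorProduct.tmul_mul_tmul, one_mul,
        mul_one]
    rw [Finset.sum_comm]
    refine Finset.sum_congr rfl fun j _ => ?_
    rw [elt, Finset.sum_mul, TensorProduct.sum_tmul]
    simp only [mul_assoc]
  -- Moving `1 ⊗ u` past `R` applies `S²` to the second leg, and `(id ⊗ S²)(R)` is inverse to `(id ⊗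
  -- S)(R)`.
  have e5 : (∑ j, a j ⊗ₜ[ℂ] antipode ℂ (b j)) * ((1 : A) ⊗ₜ[ℂ] R.elt) * Rt
      = (1 : A) ⊗ₜ[ℂ] R.elt := by
    have h0 := congrArg (TensorProduct.map LinearMap.id (antipode ℂ)) R.antipode_b_mul
    simp only [map_sum, TensorProduct.map_tmul, antipode_mul, LinearMap.id_apply,
      Algebra.TensorProduct.one_def, antipode_one] at h0
    have h1 : ((1 : A) ⊗ₜ[ℂ] R.elt) * Rt
        = (∑ j, a j ⊗ₜ[ℂ] antipode ℂ (antipode ℂ (b j))) * ((1 : A) ⊗ₜ[ℂ] R.elt) := by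
      simp [hRt, Finset.mul_sum, Finset.sum_mul, R.elt_mul]
    rw [mul_assoc, h1, ← mul_assoc]
    convert one_mul _
    rw [Algebra.TensorProduct.one_def, ← h0]
    simp [Finset.sum_mul_sum]
  rw [e1, e2, Finset.sum_comm]
  simp only [← Finset.sum_mul, ← Finset.mul_sum, e3, e4]
  rw [mul_assoc _ (_ : A ⊗[ℂ] A) ((1 : A) ⊗ₜ[ℂ] R.elt), mul_assoc, e5]
  simp

end IsRMatrix
end Drinfeld
end
end RestrictedQG

open scoped TensorProduct
namespace RestrictedQG
noncomputable section
open Coalgebra HopfAlgebra Module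

/-! ### Contractions, pivots, symmetric forms and integrals. -/

section Slices
variable {M N : Type*} [AddCommGroup M] [Module ℂ M] [AddCommGroup N] [Module ℂ N]

/-- Contraction of the left factor. -/
def sliceL (f : Dual ℂ M) : M ⊗[ℂ] N →ₗ[ℂ] N :=
  (TensorProduct.lid ℂ N).toLinearMap ∘ₗ TensorProduct.map f LinearMap.id

/-- Contraction of the right factor. -/
def sliceR (f : Dual ℂ N) : M ⊗[ℂ] N →ₗ[ℂ] M :=
  (TensorProduct.rid ℂ M).toLinearMap ∘ₗ TensorProduct.map LinearMap.id f

@[simp] theorem sliceL_tmul (f : Dual ℂ M) (x : M) (y : N) : sliceL f (x ⊗ₜ y) = f x • y := by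
  simp [sliceL]
@[simp] theorem sliceR_tmul (f : Dual ℂ N) (x : M) (y : N) : sliceR f (x ⊗ₜ y) = f y • x := by
  simp [sliceR]

theorem leg_eq_sliceL (f : Dual ℂ M) (g : Dual ℂ N) (X : M ⊗[ℂ] N) :
    leg f g X = g (sliceL f X) := by
  have : leg f g = g ∘ₗ sliceL f := by ext x y; simp
  rw [this]; rfl

theorem leg_eq_sliceR (f : Dual ℂ M) (g : Dual ℂ N) (X : M ⊗[ℂ] N) :
    leg f g X = f (sliceR g X) := by
  have : leg f g = f ∘ₗ sliceR g := by ext x y; simp [mul_comm]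
  rw [this]; rfl

end Slices

section Pivot
variable {A : Type} [Ring A] [HopfAlgebra ℂ A]

theorem dualMul_apply (φ ψ : Dual ℂ A) (x : A) : dualMul φ ψ x = leg φ ψ (comul x) := rfl

/-- The tensor product of two symmetric forms is a symmetric form on `A ⊗ A`; since `Δ` is
multiplicative, the symmetric forms are therefore closed under the product of the dual. -/
theorem leg_mul_comm {φ ψ : Dual ℂ A} (hφ : φ ∈ SLF A) (hψ : ψ ∈ SLF A) (X Y : A ⊗[ℂ] A) :
    leg φ ψ (X * Y) = leg φ ψ (Y * X) := by
  induction X using TensorProduct.induction_on with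
  | zero => simp
  | add X X' h h' => simp only [add_mul, mul_add, map_add, h, h']
  | tmul x y =>
    induction Y using TensorProduct.induction_on with
    | zero => simp
    | add X X' h h' => simp only [add_mul, mul_add, map_add, h, h']
    | tmul z w => simp [hφ x z, hψ y w]

theorem dualMul_mem_SLF {φ ψ : Dual ℂ A} (hφ : φ ∈ SLF A) (hψ : ψ ∈ SLF A) :
    dualMul φ ψ ∈ SLF A := fun x y => by
  rw [dualMul_apply, dualMul_apply, Bialgebra.comul_mul, Bialgebra.comul_mul, leg_mul_comm hφ hψ]

theorem comp_mulLeft_mem_SLF {φ : Dual ℂ A} (hφ : φ ∈ SLF A) {z : A} (hz : ∀ x, z * x = x * z) :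
    φ ∘ₗ LinearMap.mulLeft ℂ z ∈ SLF A := fun x y => by
  simp only [LinearMap.comp_apply, LinearMap.mulLeft_apply]
  rw [← mul_assoc, hφ, ← mul_assoc, ← hz, mul_assoc]

/-- `g` is a grouplike element, with inverse `g'`, that implements the square of the antipode. -/
structure IsPivot (g g' : A) : Prop where
  mul_inv : g * g' = 1
  inv_mul : g' * g = 1
  comul : comul (R := ℂ) g = g ⊗ₜ g
  counit : counit (R := ℂ) g = 1
  sq : ∀ x, antipode ℂ (antipode ℂ x) = g * x * g'

section Sweedler
variable {c : A} {S : Finset (A × A)} (hc : comul (R := ℂ) c = ∑ i ∈ S, i.1 ⊗ₜ[ℂ] i.2)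
include hc

/-- In Sweedler notation this is `c₁ ⊗ c₂ S(c₃) = c ⊗ 1`, and the next lemma is `S(c₁) c₂ ⊗ c₃ = 1 ⊗
c`. They allow an element in one leg to be traded for a coproduct and an antipode in the other. -/
theorem sum_comul_mul_antipode :
    ∑ i ∈ S, comul (R := ℂ) i.1 * ((1 : A) ⊗ₜ[ℂ] antipode ℂ i.2) = c ⊗ₜ 1 := by
  have h := congrArg (TensorProduct.map LinearMap.id (leg LinearMap.id (antipode ℂ)))
    (sum_coassoc hc)
  have h2 : ∀ i : A × A, leg LinearMap.id (antipode ℂ) (comul i.2)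
      = counit (R := ℂ) i.2 • (1 : A) := fun i => by
    rw [apply_comul_of_mul_antipode _ LinearMap.id (by simp)]; rfl
  simp only [map_sum, TensorProduct.map_tmul, h2, LinearMap.id_apply] at h
  have h3 : ∀ (X : A ⊗[ℂ] A) (t : A), X * ((1 : A) ⊗ₜ[ℂ] antipode ℂ t)
      = TensorProduct.map LinearMap.id (leg LinearMap.id (antipode ℂ))
        (TensorProduct.assoc ℂ A A A (X ⊗ₜ[ℂ] t)) := by
    intro X t
    induction X using TensorProduct.induction_on with
    | zero => simp
    | add X X' h h' => simp only [add_mul, TensorProduct.add_tmul, map_add, h, h']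
    | tmul x y => simp
  simp only [h3, h, ← TensorProduct.smul_tmul]
  rw [← TensorProduct.sum_tmul, sum_counit_right hc]

theorem sum_antipode_mul_comul :
    ∑ i ∈ S, (antipode ℂ i.1 ⊗ₜ[ℂ] (1 : A)) * comul (R := ℂ) i.2 = 1 ⊗ₜ c := by
  have h := congrArg (TensorProduct.map (leg (antipode ℂ) LinearMap.id) LinearMap.id
    ∘ₗ (TensorProduct.assoc ℂ A A A).symm.toLinearMap) (sum_coassoc hc)
  have h2 : ∀ i : A × A, leg (antipode ℂ) LinearMap.id (comul i.1)
      = counit (R := ℂ) i.1 • (1 : A) := fun i => by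
    rw [apply_comul_of_antipode_mul _ LinearMap.id (by simp)]; rfl
  simp only [map_sum, LinearMap.comp_apply, LinearEquiv.coe_coe, LinearEquiv.symm_apply_apply,
    TensorProduct.map_tmul, h2, LinearMap.id_apply] at h
  have h3 : ∀ (X : A ⊗[ℂ] A) (t : A), (antipode ℂ t ⊗ₜ[ℂ] (1 : A)) * X
      = TensorProduct.map (leg (antipode ℂ) LinearMap.id) LinearMap.id
        ((TensorProduct.assoc ℂ A A A).symm (t ⊗ₜ[ℂ] X)) := by
    intro X t
    induction X using TensorProduct.induction_on with
    | zero => simp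
    | add X X' h h' => simp only [mul_add, TensorProduct.tmul_add, map_add, h, h']
    | tmul x y => simp
  simp only [h3, ← h, TensorProduct.smul_tmul]
  rw [← TensorProduct.tmul_sum, sum_counit_left hc]

end Sweedler

namespace IsPivot
variable {g g' : A} (G : IsPivot g g')
include G

theorem antipode_eq : antipode ℂ g = g' := by
  have := mul_antipode_rTensor_comul_apply (R := ℂ) g
  rw [G.comul, G.counit] at this
  simp only [LinearMap.rTensor_tmul, LinearMap.mul'_apply, map_one] at this
  rw [← mul_one (antipode ℂ g), ← G.mul_inv, ← mul_assoc, this, one_mul]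

theorem comul_inv : Coalgebra.comul (R := ℂ) g' = g' ⊗ₜ g' := by
  have h1 : Coalgebra.comul (R := ℂ) g' * (g ⊗ₜ g) = 1 := by
    rw [← G.comul, ← Bialgebra.comul_mul, G.inv_mul, Bialgebra.comul_one]
  have h2 : (g ⊗ₜ[ℂ] g) * (g' ⊗ₜ[ℂ] g') = 1 := by
    rw [Algebra.TensorProduct.tmul_mul_tmul, G.mul_inv]; rfl
  rw [← mul_one (Coalgebra.comul (R := ℂ) g'), ← h2, ← mul_assoc, h1, one_mul]

theorem mul_eq (x : A) : g * x = antipode ℂ (antipode ℂ x) * g := by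
  rw [G.sq, mul_assoc, G.inv_mul, mul_one]

theorem inv_mul_sq (x : A) : g' * antipode ℂ (antipode ℂ x) = x * g' := by
  rw [G.sq, ← mul_assoc, ← mul_assoc, G.inv_mul, one_mul]

theorem antipode_injective : Function.Injective (antipode ℂ : A → A) := by
  intro x y h
  have h : g * x * g' = g * y * g' := by rw [← G.sq, ← G.sq, h]
  calc x = g' * (g * x * g') * g := by
        simp only [← mul_assoc, G.inv_mul, one_mul]; rw [mul_assoc, G.inv_mul, mul_one]
    _ = y := by
        rw [h]
        simp only [← mul_assoc, G.inv_mul, one_mul]; rw [mul_assoc, G.inv_mul, mul_one]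

theorem antipode_surjective : Function.Surjective (antipode ℂ : A → A) := by
  intro x
  refine ⟨antipode ℂ (g' * x * g), ?_⟩
  rw [G.sq]
  simp only [← mul_assoc, G.mul_inv, one_mul]; rw [mul_assoc, G.mul_inv, mul_one]

/-- The pivot turns `S(c₃) g c₂` into `S(c₃) S²(c₂) g = S(S(c₂) c₃) g`, so that the antipode axiom
applies although the factors come in the wrong order. -/
theorem sum_antipode_pivot_comul {c : A} {S : Finset (A × A)}
    (hc : Coalgebra.comul (R := ℂ) c = ∑ i ∈ S, i.1 ⊗ₜ[ℂ] i.2) :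
    ∑ i ∈ S, ((1 : A) ⊗ₜ[ℂ] (antipode ℂ i.2 * g)) * Coalgebra.comul (R := ℂ) i.1 = c ⊗ₜ g := by
  have h := congrArg (TensorProduct.map LinearMap.id (gel (antipode ℂ ∘ₗ antipode ℂ) (antipode ℂ)))
    (sum_coassoc hc)
  have h2 : ∀ i : A × A, gel (antipode ℂ ∘ₗ antipode ℂ) (antipode ℂ) (Coalgebra.comul i.2)
      = Coalgebra.counit (R := ℂ) i.2 • (1 : A) := fun i => by
    rw [apply_comul_of_antipode_mul _ (antipode ℂ) (by simp [antipode_mul]), antipode_one]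
  simp only [map_sum, TensorProduct.map_tmul, h2, LinearMap.id_apply] at h
  have h3 : ∀ (X : A ⊗[ℂ] A) (t : A), ((1 : A) ⊗ₜ[ℂ] (antipode ℂ t * g)) * X
      = TensorProduct.map LinearMap.id (gel (antipode ℂ ∘ₗ antipode ℂ) (antipode ℂ))
        (TensorProduct.assoc ℂ A A A (X ⊗ₜ[ℂ] t)) * (1 ⊗ₜ g) := by
    intro X t
    induction X using TensorProduct.induction_on with
    | zero => simp
    | add X X' h h' => simp only [mul_add, add_mul, TensorProduct.add_tmul, map_add, h, h']
    | tmul x y => simp [mul_assoc, G.mul_eq]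
  simp only [h3, ← Finset.sum_mul, h, ← TensorProduct.smul_tmul]
  rw [← TensorProduct.sum_tmul, sum_counit_right hc]
  simp

/-- Contractions of invariant elements with symmetric linear forms are central. -/
theorem sliceR_central {φ : Dual ℂ A} (hφ : φ ∈ SLF A) {X : A ⊗[ℂ] A}
    (hX : ∀ c, X * Coalgebra.comul (R := ℂ) c = Coalgebra.comul (R := ℂ) c * X) (x : A) :
    x * sliceR (φ ∘ₗ LinearMap.mulLeft ℂ g) X = sliceR (φ ∘ₗ LinearMap.mulLeft ℂ g) X * x := by
  obtain ⟨S, hS⟩ := exists_comul x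
  have h1 : ∀ (x : A) (Y : A ⊗[ℂ] A), sliceR (φ ∘ₗ LinearMap.mulLeft ℂ g) Y * x
      = sliceR (φ ∘ₗ LinearMap.mulLeft ℂ g) (Y * (x ⊗ₜ 1)) := by
    intro x Y
    induction Y using TensorProduct.induction_on with
    | zero => simp
    | add X X' h h' => simp only [add_mul, map_add, h, h']
    | tmul p q => simp
  have h2 : ∀ (x : A) (Y : A ⊗[ℂ] A), x * sliceR (φ ∘ₗ LinearMap.mulLeft ℂ g) Y
      = sliceR φ ((x ⊗ₜ g) * Y) := by
    intro x Y
    induction Y using TensorProduct.induction_on with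
    | zero => simp
    | add X X' h h' => simp only [mul_add, map_add, h, h']
    | tmul p q => simp
  have h3 : ∀ (t : A) (Y : A ⊗[ℂ] A), sliceR (φ ∘ₗ LinearMap.mulLeft ℂ g) (Y * (1 ⊗ₜ t))
      = sliceR φ ((1 ⊗ₜ (t * g)) * Y) := by
    intro t Y
    induction Y using TensorProduct.induction_on with
    | zero => simp
    | add X X' h h' => simp only [mul_add, add_mul, map_add, h, h']
    | tmul p q => simp [← mul_assoc, hφ _ t]
  -- One side uses `x ⊗ 1 = Δ(x₁)(1 ⊗ S(x₂))`, the other `x ⊗ g = (1 ⊗ S(x₂) g) Δ(x₁)`. They agree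
  -- because `X` commutes with `Δ(x₁)` and `φ` is cyclic in the second leg.
  rw [h1, h2, ← sum_comul_mul_antipode hS, ← G.sum_antipode_pivot_comul hS]
  simp only [Finset.mul_sum, Finset.sum_mul, map_sum]
  refine Finset.sum_congr rfl fun i _ => ?_
  rw [← mul_assoc, hX, h3, mul_assoc]

end IsPivot

/-! ### Integrals -/

section Integral
variable {g g' : A} (G : IsPivot g g') {μ lam : Dual ℂ A}
  (hμ : ∀ x, sliceR μ (comul (R := ℂ) x) = μ x • (1 : A))

-- Replace `1 ⊗ c` by `S(c₁) c₂ ⊗ c₃`; then `c₂ ⊗ c₃` merges with `Δ(x)` into a coproduct, on which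
-- the integral property applies.
include hμ in
theorem sliceR_integral {c : A} {S : Finset (A × A)}
    (hc : comul (R := ℂ) c = ∑ i ∈ S, i.1 ⊗ₜ[ℂ] i.2) (x : A) :
    sliceR (μ ∘ₗ LinearMap.mulLeft ℂ c) (comul (R := ℂ) x)
      = ∑ i ∈ S, μ (i.2 * x) • antipode ℂ i.1 := by
  have h1 : ∀ Y : A ⊗[ℂ] A, sliceR (μ ∘ₗ LinearMap.mulLeft ℂ c) Y = sliceR μ ((1 ⊗ₜ c) * Y) := by
    intro Y
    induction Y using TensorProduct.induction_on with
    | zero => simp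
    | add X X' h h' => simp only [mul_add, map_add, h, h']
    | tmul p q => simp
  have h2 : ∀ (t : A) (Y : A ⊗[ℂ] A), sliceR μ ((t ⊗ₜ 1) * Y) = t * sliceR μ Y := by
    intro t Y
    induction Y using TensorProduct.induction_on with
    | zero => simp
    | add X X' h h' => simp only [mul_add, map_add, h, h']
    | tmul p q => simp
  rw [h1, ← sum_antipode_mul_comul hc, Finset.sum_mul, map_sum]
  refine Finset.sum_congr rfl fun i _ => ?_
  rw [mul_assoc, ← Bialgebra.comul_mul, h2, hμ]
  simp

variable (hS : ∀ x : A, comul (R := ℂ) (antipode ℂ x)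
      = TensorProduct.map (antipode ℂ) (antipode ℂ) (TensorProduct.comm ℂ A A (comul (R := ℂ) x)))
  (hlam : lam ∈ SLF A) (hlS : lam ∘ₗ antipode ℂ = lam) (hlμ : ∀ x, lam x = μ (g' * x))

-- An antipode exchanges left and right integrals. Here it is absorbed because the twisted form
-- `lam` is symmetric and invariant: `lam (g' S(y)) = lam (S(y g)) = μ y`.
include G hμ hS hlam hlS hlμ in
theorem sliceL_integral (x : A) :
    sliceL (lam ∘ₗ LinearMap.mulLeft ℂ g') (comul (R := ℂ) x) = lam (g' * x) • (1 : A) := by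
  obtain ⟨y, rfl⟩ := G.antipode_surjective x
  have h0 : ∀ y, lam (g' * antipode ℂ y) = μ y := by
    intro y
    rw [← G.antipode_eq, ← antipode_mul]
    change (lam ∘ₗ antipode ℂ) _ = _
    rw [hlS, hlam, hlμ, ← mul_assoc, G.inv_mul, one_mul]
  have h1 : ∀ Y : A ⊗[ℂ] A, sliceL (lam ∘ₗ LinearMap.mulLeft ℂ g')
      (TensorProduct.map (antipode ℂ) (antipode ℂ) (TensorProduct.comm ℂ A A Y))
      = antipode ℂ (sliceR μ Y) := by
    intro Y
    induction Y using TensorProduct.induction_on with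
    | zero => simp
    | add X X' h h' => simp only [map_add, h, h']
    | tmul p q => simp [h0]
  rw [hS, h1, hμ, h0, map_smul, antipode_one]

include G hμ hS hlam hlS hlμ in
theorem sliceL_mul_tmul_one (x : A) {z : A} {S : Finset (A × A)}
    (hz : comul (R := ℂ) z = ∑ i ∈ S, i.1 ⊗ₜ[ℂ] i.2) :
    sliceL lam (comul (R := ℂ) x * (z ⊗ₜ 1))
      = ∑ i ∈ S, lam (x * i.1) • (g' * antipode ℂ i.2) := by
  -- The components of `Δ(z g)` are those of `Δ(z)` multiplied by the invertible `g`; injectivity is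
  -- needed only because the sums run over finite sets of pairs.
  have hz' : comul (R := ℂ) (z * g)
      = ∑ i ∈ S.map ⟨fun i => (i.1 * g, i.2 * g), fun i j h => by
          have h1 := congrArg (fun i : A × A => (i.1 * g', i.2 * g')) h
          simpa [mul_assoc, G.mul_inv, Prod.ext_iff] using h1⟩, i.1 ⊗ₜ[ℂ] i.2 := by
    rw [Bialgebra.comul_mul, hz, G.comul]; simp [Finset.sum_mul]; rfl
  have h1 : ∀ Y : A ⊗[ℂ] A, sliceL lam (Y * (z ⊗ₜ 1))
      = sliceL (lam ∘ₗ LinearMap.mulLeft ℂ g') (Y * ((z * g) ⊗ₜ 1)) := by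
    intro Y
    induction Y using TensorProduct.induction_on with
    | zero => simp
    | add X X' h h' => simp only [add_mul, map_add, h, h']
    | tmul p q =>
      simp only [Algebra.TensorProduct.tmul_mul_tmul, sliceL_tmul, LinearMap.comp_apply,
        LinearMap.mulLeft_apply]
      rw [hlam g', mul_assoc, mul_assoc, G.mul_inv, mul_one, mul_one]
  have h2 : ∀ (t : A) (Y : A ⊗[ℂ] A), sliceL (lam ∘ₗ LinearMap.mulLeft ℂ g') (Y * (1 ⊗ₜ t))
      = sliceL (lam ∘ₗ LinearMap.mulLeft ℂ g') Y * t := by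
    intro t Y
    induction Y using TensorProduct.induction_on with
    | zero => simp
    | add X X' h h' => simp only [add_mul, map_add, h, h']
    | tmul p q => simp
  rw [h1, ← sum_comul_mul_antipode hz', Finset.mul_sum, map_sum, Finset.sum_map]
  refine Finset.sum_congr rfl fun i _ => ?_
  change sliceL _ (_ * (comul (i.1 * g) * (1 ⊗ₜ antipode ℂ (i.2 * g)))) = _
  rw [← mul_assoc, ← Bialgebra.comul_mul, h2, sliceL_integral G hμ hS hlam hlS hlμ, antipode_mul,
    G.antipode_eq, smul_mul_assoc, one_mul, hlam, mul_assoc, mul_assoc, G.mul_inv, mul_one]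

end Integral
end Pivot
end
end RestrictedQG

open scoped TensorProduct
namespace RestrictedQG
noncomputable section
open Coalgebra HopfAlgebra Module

/-! ### Factorizable ribbon Hopf algebras and their modular relations. -/

section
variable {A : Type} [Ring A] [HopfAlgebra ℂ A]

theorem leg_comul_mul_antipode (c : A) :
    leg (B := A ⊗[ℂ] A) comul (TensorProduct.mk ℂ A A 1 ∘ₗ antipode ℂ) (comul c) = c ⊗ₜ 1 := by
  obtain ⟨S, hS⟩ := exists_comul c
  rw [hS, ← sum_comul_mul_antipode hS]
  simp

theorem leg_antipode_mul_comul (c : A) :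
    leg (B := A ⊗[ℂ] A) ((TensorProduct.mk ℂ A A).flip 1 ∘ₗ antipode ℂ) comul (comul c)
      = 1 ⊗ₜ c := by
  obtain ⟨S, hS⟩ := exists_comul c
  rw [hS, ← sum_antipode_mul_comul hS]
  simp

section SliceRules
variable {M N : Type*} [Ring M] [Algebra ℂ M] [Ring N] [Algebra ℂ N]

theorem sliceR_mulLeft (f : Dual ℂ N) (t : N) (X : M ⊗[ℂ] N) :
    sliceR (f ∘ₗ LinearMap.mulLeft ℂ t) X = sliceR f ((1 ⊗ₜ t) * X) := by
  induction X using TensorProduct.induction_on with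
  | zero => simp
  | add X X' h h' => simp only [mul_add, map_add, h, h']
  | tmul p q => simp

theorem sliceR_mulRight (f : Dual ℂ N) (t : N) (X : M ⊗[ℂ] N) :
    sliceR (f ∘ₗ LinearMap.mulRight ℂ t) X = sliceR f (X * (1 ⊗ₜ t)) := by
  induction X using TensorProduct.induction_on with
  | zero => simp
  | add X X' h h' => simp only [add_mul, map_add, h, h']
  | tmul p q => simp

theorem sliceR_tmul_one_mul (f : Dual ℂ N) (t : M) (X : M ⊗[ℂ] N) :
    sliceR f ((t ⊗ₜ 1) * X) = t * sliceR f X := by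
  induction X using TensorProduct.induction_on with
  | zero => simp
  | add X X' h h' => simp only [mul_add, map_add, h, h']
  | tmul p q => simp

theorem sliceR_mul_tmul_one (f : Dual ℂ N) (t : M) (X : M ⊗[ℂ] N) :
    sliceR f (X * (t ⊗ₜ 1)) = sliceR f X * t := by
  induction X using TensorProduct.induction_on with
  | zero => simp
  | add X X' h h' => simp only [add_mul, map_add, h, h']
  | tmul p q => simp

theorem sliceL_mulLeft (f : Dual ℂ M) (t : M) (X : M ⊗[ℂ] N) :
    sliceL (f ∘ₗ LinearMap.mulLeft ℂ t) X = sliceL f ((t ⊗ₜ 1) * X) := by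
  induction X using TensorProduct.induction_on with
  | zero => simp
  | add X X' h h' => simp only [mul_add, map_add, h, h']
  | tmul p q => simp

theorem sliceR_map_id {P : Type*} [AddCommGroup P] [Module ℂ P] (f : Dual ℂ P) (G : N →ₗ[ℂ] P)
    (X : M ⊗[ℂ] N) : sliceR f (TensorProduct.map LinearMap.id G X) = sliceR (f ∘ₗ G) X := by
  induction X using TensorProduct.induction_on with
  | zero => simp
  | add X X' h h' => simp only [map_add, h, h']
  | tmul p q => simp

theorem sliceL_map_id {P : Type*} [AddCommGroup P] [Module ℂ P] (f : Dual ℂ M) (G : N →ₗ[ℂ] P)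
    (X : M ⊗[ℂ] N) : sliceL f (TensorProduct.map LinearMap.id G X) = G (sliceL f X) := by
  induction X using TensorProduct.induction_on with
  | zero => simp
  | add X X' h h' => simp only [map_add, h, h']
  | tmul p q => simp

theorem eq_of_forall_dual {x y : M} (h : ∀ f : Dual ℂ M, f x = f y) : x = y := by
  rw [← sub_eq_zero, ← forall_dual_apply_eq_zero_iff ℂ]
  intro f; rw [map_sub, h, sub_self]

end SliceRules

theorem sliceL_antipode (f : Dual ℂ A) (X : A ⊗[ℂ] A) :
    sliceL f (TensorProduct.map (antipode ℂ) (antipode ℂ) (TensorProduct.comm ℂ A A X))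
      = antipode ℂ (sliceR (f ∘ₗ antipode ℂ) X) := by
  induction X using TensorProduct.induction_on with
  | zero => simp
  | add X X' h h' => simp only [map_add, h, h']
  | tmul p q => simp

/-- The linear form `φ` on a Hopf algebra, paired with `Q` after multiplication by the pivot. -/
def drinfeldMap (g : A) (Q : A ⊗[ℂ] A) (φ : Dual ℂ A) : A :=
  sliceR (φ ∘ₗ LinearMap.mulLeft ℂ g) Q

/-- A ribbon factorizable structure, recorded through the monodromy element `Q`, together with a
two-sided cointegral `Λ`. -/
structure IsFactorizable (g g' v vi Λ : A) (Q : A ⊗[ℂ] A) : Prop extends IsPivot g g' where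
  comul_antipode : ∀ x : A, Coalgebra.comul (R := ℂ) (antipode ℂ x)
    = TensorProduct.map (antipode ℂ) (antipode ℂ) (TensorProduct.comm ℂ A A
      (Coalgebra.comul (R := ℂ) x))
  v_comm : ∀ x, v * x = x * v
  vi_comm : ∀ x, vi * x = x * vi
  v_mul : v * vi = 1
  counit_v : Coalgebra.counit (R := ℂ) v = 1
  Q_eq : Q = Coalgebra.comul (R := ℂ) vi * (v ⊗ₜ v)
  bijective : Function.Bijective fun f : Dual ℂ A => sliceR f Q
  slice_comul : ∀ f : Dual ℂ A, (∀ x, sliceR f Q * x = x * sliceR f Q) →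
    TensorProduct.map LinearMap.id (sliceR f ∘ₗ Coalgebra.comul) Q = (sliceR f Q ⊗ₜ 1) * Q
  slice_inv : ∀ φ ∈ SLF A, antipode ℂ (drinfeldMap g (Coalgebra.comul (R := ℂ) v * (vi ⊗ₜ vi)) φ)
    = antipode ℂ (antipode ℂ (drinfeldMap g Q φ))
  SLF_antipode : ∀ φ ∈ SLF A, φ ∘ₗ antipode ℂ = φ
  mul_int : ∀ x, x * Λ = Coalgebra.counit (R := ℂ) x • Λ
  int_mul : ∀ x, Λ * x = Coalgebra.counit (R := ℂ) x • Λ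
  int_ne : Λ ≠ 0

namespace IsFactorizable
variable {g g' v vi Λ : A} {Q : A ⊗[ℂ] A} (D : IsFactorizable g g' v vi Λ Q)
include D

theorem mul_v : vi * v = 1 := by rw [D.vi_comm, D.v_mul]

theorem Q_comul (c : A) : Q * Coalgebra.comul (R := ℂ) c = Coalgebra.comul (R := ℂ) c * Q := by
  have h : ∀ X : A ⊗[ℂ] A, (v ⊗ₜ[ℂ] v) * X = X * (v ⊗ₜ v) := by
    intro X
    induction X using TensorProduct.induction_on with
    | zero => simp
    | add X X' h h' => simp only [mul_add, add_mul, h, h']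
    | tmul p q => simp [D.v_comm]
  rw [D.Q_eq, mul_assoc, h, ← mul_assoc, ← mul_assoc, ← Bialgebra.comul_mul, D.vi_comm,
    Bialgebra.comul_mul]

theorem counit_Q : sliceL Coalgebra.counit Q = 1 := by
  have h : ∀ X : A ⊗[ℂ] A, sliceL Coalgebra.counit (X * (v ⊗ₜ v))
      = Coalgebra.counit (R := ℂ) v • (sliceL Coalgebra.counit X * v) := by
    intro X
    induction X using TensorProduct.induction_on with
    | zero => simp
    | add X X' h h' => simp only [add_mul, map_add, smul_add, h, h']
    | tmul p q => simp [smul_smul, mul_comm]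
  have h2 : sliceL Coalgebra.counit (Coalgebra.comul (R := ℂ) vi) = vi := by
    have := congrArg (TensorProduct.lid ℂ A) (rTensor_counit_comul (R := ℂ) vi)
    rw [TensorProduct.lid_tmul, one_smul] at this
    exact this
  rw [D.Q_eq, h, h2, D.mul_v, D.counit_v, one_smul]

theorem drinfeldMap_comm {φ : Dual ℂ A} (hφ : φ ∈ SLF A) (x : A) :
    x * drinfeldMap g Q φ = drinfeldMap g Q φ * x :=
  D.toIsPivot.sliceR_central hφ D.Q_comul x

theorem drinfeldMap_injective : Function.Injective (drinfeldMap g Q) := by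
  intro φ ψ h
  have := D.bijective.1 h
  ext x
  have h2 := LinearMap.congr_fun this (g' * x)
  simpa [← mul_assoc, D.mul_inv] using h2

/-- Contraction of a leg of `Q` through a coproduct factors once the inner contraction is central,
and it is central as soon as `ψ` is symmetric. Nothing is required of `φ`. -/
theorem drinfeldMap_dualMul {φ ψ : Dual ℂ A} (hψ : ψ ∈ SLF A) :
    drinfeldMap g Q (dualMul φ ψ) = drinfeldMap g Q φ * drinfeldMap g Q ψ := by
  have h := D.slice_comul (ψ ∘ₗ LinearMap.mulLeft ℂ g) fun x => (D.drinfeldMap_comm hψ x).symm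
  have h1 := congrArg (sliceR (φ ∘ₗ LinearMap.mulLeft ℂ g)) h
  rw [sliceR_map_id, sliceR_tmul_one_mul] at h1
  rw [D.drinfeldMap_comm hψ]
  refine Eq.trans ?_ h1
  rw [drinfeldMap]
  congr 2
  ext x
  simp only [LinearMap.comp_apply, LinearMap.mulLeft_apply, dualMul_apply, Bialgebra.comul_mul,
    D.comul]
  rw [sliceR_mulLeft]
  generalize Coalgebra.comul (R := ℂ) x = X
  induction X using TensorProduct.induction_on with
  | zero => simp
  | add X X' h h' => simp only [mul_add, map_add, h, h']
  | tmul p q => simp [mul_comm]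

/-! ### The integral -/

/-- The integral that corresponds to the cointegral. -/
theorem exists_integral : ∃ μ : Dual ℂ A, sliceR μ Q = Λ ∧ μ ≠ 0 ∧
    ∀ x, sliceR μ (Coalgebra.comul (R := ℂ) x) = μ x • (1 : A) := by
  obtain ⟨μ, hμ⟩ := D.bijective.2 Λ
  simp only at hμ
  refine ⟨μ, hμ, fun h => D.int_ne (by rw [← hμ, h]; simp [sliceR]), fun x => ?_⟩
  -- The cointegral is central since both multiplications act by the counit. Contracting `Q` through
  -- the coproduct thus gives `(Λ ⊗ 1) Q = Λ ⊗ 1`, and injectivity of the contraction, tested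
  -- against all `f`, converts this into the integral property of `μ`.
  have h := D.slice_comul μ fun x => by rw [hμ, D.mul_int, D.int_mul]
  have h1 : ∀ X : A ⊗[ℂ] A, (Λ ⊗ₜ (1 : A)) * X = Λ ⊗ₜ sliceL Coalgebra.counit X := by
    intro X
    induction X using TensorProduct.induction_on with
    | zero => simp
    | add X X' h h' => simp only [mul_add, map_add, TensorProduct.tmul_add, h, h']
    | tmul p q => simp [D.int_mul, TensorProduct.smul_tmul]
  rw [hμ, h1, D.counit_Q] at h
  refine eq_of_forall_dual fun f => ?_
  have h2 := congrArg (sliceR f) h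
  rw [sliceR_map_id, sliceR_tmul, ← hμ] at h2
  have h3 : (fun f : Dual ℂ A => sliceR f Q) (f 1 • μ) = f 1 • sliceR μ Q := by
    simp [sliceR, TensorProduct.map_smul_right]
  have h4 := D.bijective.1 (h2.trans h3.symm)
  have := LinearMap.congr_fun h4 x
  simpa [mul_comm] using this

section Mu
variable {μ : Dual ℂ A} (hμQ : sliceR μ Q = Λ)
include hμQ

/-- The adjoint action on `μ` is carried through `Q` to the adjoint action on `Λ`: writing `1 ⊗ c₁`
as `(S(c₁) ⊗ 1) Δ(c₂)` and commuting `Δ(c₂)` with `Q` yields `S(c₁) Λ c₂`, which is `ε(c) Λ`. -/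
theorem integral_adjoint {c : A} {S : Finset (A × A)}
    (hc : Coalgebra.comul (R := ℂ) c = ∑ i ∈ S, i.1 ⊗ₜ[ℂ] i.2) (y : A) :
    ∑ i ∈ S, μ (i.1 * y * antipode ℂ i.2) = Coalgebra.counit (R := ℂ) c * μ y := by
  set N : A ⊗[ℂ] (A ⊗[ℂ] A) →ₗ[ℂ] A := leg (antipode ℂ) (sliceR μ ∘ₗ LinearMap.mulLeft ℂ Q ∘ₗ
    leg (B := A ⊗[ℂ] A) Coalgebra.comul (TensorProduct.mk ℂ A A 1 ∘ₗ antipode ℂ)) with hN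
  have h1 : ∀ x z, N (TensorProduct.assoc ℂ A A A (Coalgebra.comul (R := ℂ) x ⊗ₜ z))
      = sliceR μ ((1 ⊗ₜ x) * (Q * (1 ⊗ₜ antipode ℂ z))) := by
    intro x z
    rw [← leg_antipode_mul_comul x]
    obtain ⟨T, hT⟩ := exists_comul x
    rw [hT]
    simp only [hN, TensorProduct.sum_tmul, map_sum, TensorProduct.assoc_tmul, leg_tmul,
      LinearMap.comp_apply, LinearMap.mulLeft_apply, TensorProduct.mk_apply, LinearMap.flip_apply,
      Finset.sum_mul]
    refine Finset.sum_congr rfl fun j _ => ?_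
    rw [← mul_assoc Q, D.Q_comul, mul_assoc (_ ⊗ₜ[ℂ] _), sliceR_tmul_one_mul, mul_assoc]
  have h2 : ∑ i ∈ S, sliceR μ ((1 ⊗ₜ i.1) * (Q * (1 ⊗ₜ antipode ℂ i.2)))
      = Coalgebra.counit (R := ℂ) c • Λ := by
    simp only [← h1]
    rw [← map_sum, sum_coassoc hc, map_sum]
    simp only [hN, leg_tmul, LinearMap.comp_apply, leg_comul_mul_antipode, LinearMap.mulLeft_apply,
      sliceR_mul_tmul_one, hμQ, D.int_mul, mul_smul_comm]
    simp only [← smul_mul_assoc, ← Finset.sum_mul]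
    have := congrArg (antipode ℂ) (sum_counit_right hc)
    simp only [map_sum, map_smul] at this
    rw [this, D.mul_int, counit_antipode]
  have h3 : (fun f : Dual ℂ A => sliceR f Q)
      (∑ i ∈ S, μ ∘ₗ LinearMap.mulLeft ℂ i.1 ∘ₗ LinearMap.mulRight ℂ (antipode ℂ i.2))
      = (fun f : Dual ℂ A => sliceR f Q) (Coalgebra.counit (R := ℂ) c • μ) := by
    have h4 : sliceR (Coalgebra.counit (R := ℂ) c • μ) Q
        = Coalgebra.counit (R := ℂ) c • sliceR μ Q := by
      simp [sliceR, TensorProduct.map_smul_right]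
    have h5 : sliceR (∑ i ∈ S, μ ∘ₗ LinearMap.mulLeft ℂ i.1
        ∘ₗ LinearMap.mulRight ℂ (antipode ℂ i.2)) Q
        = ∑ i ∈ S, sliceR (μ ∘ₗ LinearMap.mulLeft ℂ i.1
        ∘ₗ LinearMap.mulRight ℂ (antipode ℂ i.2)) Q := by
      generalize Q = X
      induction X using TensorProduct.induction_on with
      | zero => simp
      | add X X' h h' => simp only [map_add, h, h', Finset.sum_add_distrib]
      | tmul p q => simp [Finset.sum_smul]
    simp only [h4, h5, hμQ, ← h2]
    refine Finset.sum_congr rfl fun i _ => ?_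
    rw [← LinearMap.comp_assoc, sliceR_mulRight, sliceR_mulLeft]
  have h6 := LinearMap.congr_fun (D.bijective.1 h3) y
  simpa [mul_assoc] using h6

/-- Evaluate `μ(h₁ y S²(h₃) S(h₂))` in two ways: the last two factors form `S(h₂ S(h₃))` and
collapse, or adjoint invariance removes the pair `h₁`, `S(h₂)`. -/
theorem integral_mul (h y : A) : μ (h * y) = μ (y * antipode ℂ (antipode ℂ h)) := by
  obtain ⟨S, hS⟩ := exists_comul h
  set N : A ⊗[ℂ] (A ⊗[ℂ] A) →ₗ[ℂ] ℂ := μ ∘ₗ leg LinearMap.id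
    (LinearMap.mulLeft ℂ y ∘ₗ antipode ℂ ∘ₗ leg LinearMap.id (antipode ℂ)) with hN
  have h1 : ∀ x z, N (TensorProduct.assoc ℂ A A A (Coalgebra.comul (R := ℂ) x ⊗ₜ z))
      = Coalgebra.counit (R := ℂ) x * μ (y * antipode ℂ (antipode ℂ z)) := by
    intro x z
    obtain ⟨T, hT⟩ := exists_comul x
    rw [← D.integral_adjoint hμQ hT, hT]
    simp [hN, TensorProduct.sum_tmul, antipode_mul, mul_assoc]
  have h2 : ∀ z, leg LinearMap.id (antipode ℂ) (Coalgebra.comul (R := ℂ) z)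
      = Coalgebra.counit (R := ℂ) z • (1 : A) := fun z => by
    rw [apply_comul_of_mul_antipode _ LinearMap.id (by simp)]; rfl
  have h3 := congrArg N (sum_coassoc hS)
  simp only [map_sum, h1] at h3
  simp only [hN, LinearMap.comp_apply, leg_tmul, h2, map_smul, LinearMap.mulLeft_apply,
    antipode_one, mul_one, LinearMap.id_apply, mul_smul_comm] at h3
  have h4 := congrArg (fun t => μ (t * y)) (sum_counit_right hS)
  have h5 := congrArg (fun t => μ (y * antipode ℂ (antipode ℂ t))) (sum_counit_left hS)
  simp only [map_sum, map_smul, Finset.sum_mul, Finset.mul_sum, smul_mul_assoc,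
    mul_smul_comm, smul_eq_mul] at h4 h5 h3
  rw [← h4, ← h5, h3]

end Mu

theorem comp_mulLeft_inv {φ : Dual ℂ A} (hφ : φ ∈ SLF A) :
    (φ ∘ₗ LinearMap.mulLeft ℂ g') ∘ₗ antipode ℂ = φ ∘ₗ LinearMap.mulLeft ℂ g := by
  ext x
  simp only [LinearMap.comp_apply, LinearMap.mulLeft_apply]
  rw [← D.toIsPivot.antipode_eq, ← antipode_mul, hφ g]
  exact LinearMap.congr_fun (D.SLF_antipode _ hφ) _

section Lam
variable [FiniteDimensional ℂ A]

/-- The symmetric integral. -/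
theorem exists_symmetric_integral : ∃ lam ∈ SLF A, drinfeldMap g Q lam = Λ ∧
    (∀ x, sliceR (lam ∘ₗ LinearMap.mulLeft ℂ g) (Coalgebra.comul (R := ℂ) x)
      = lam (g * x) • (1 : A)) ∧ ∀ y, (∀ x, lam (x * y) = 0) → y = 0 := by
  obtain ⟨μ, hμQ, hμ0, hμ⟩ := D.exists_integral
  have hl : (μ ∘ₗ LinearMap.mulLeft ℂ g') ∘ₗ LinearMap.mulLeft ℂ g = μ := by
    ext x; simp [← mul_assoc, D.inv_mul]
  -- The integral is a trace twisted by `S²`, and `g` implements `S²`; multiplying by `g⁻¹` untwists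
  -- it.
  refine ⟨μ ∘ₗ LinearMap.mulLeft ℂ g', fun x y => ?_, by rw [drinfeldMap, hl, hμQ], fun x => ?_,
    fun y hy => ?_⟩
  · simp only [LinearMap.comp_apply, LinearMap.mulLeft_apply]
    have h1 : μ (g' * (x * y)) = μ (y * x * g') := by
      rw [← mul_assoc, D.integral_mul hμQ, D.sq]
      simp only [← mul_assoc]
      rw [mul_assoc y g, D.mul_inv, mul_one]
    rw [h1, D.integral_mul hμQ g', D.sq, D.mul_inv, one_mul]
  · rw [hl, hμ]
    simp [← mul_assoc, D.inv_mul]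
  -- The radical of the pairing `μ(x y)` is stable under contracting the coproduct, because the
  -- contraction formula for integrals only involves values `μ(x₂ y)`.
  · have hJ : ∀ y, (∀ x, μ (x * y) = 0) → ∀ f : Dual ℂ A, ∀ x,
        μ (x * sliceL f (Coalgebra.comul (R := ℂ) y)) = 0 := by
      intro y hy f x
      obtain ⟨S, hS⟩ := exists_comul x
      have h := sliceR_integral hμ hS y
      simp only [hy, zero_smul, Finset.sum_const_zero] at h
      have := congrArg f h
      rw [← leg_eq_sliceR, leg_eq_sliceL, map_zero] at this
      exact this
    -- On the radical, `S(y₁) y₂ = ε(y)` gives `ε(y) μ = 0`, so the counit vanishes there. Applied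
    -- to all contractions of `Δ(y)`, whose counit is `f(y)`, this yields `y = 0`.
    have hJ2 : ∀ y, (∀ x, μ (x * y) = 0) → Coalgebra.counit (R := ℂ) y = 0 := by
      intro y hy
      by_contra hne
      refine hμ0 (LinearMap.ext fun x => ?_)
      let e := Module.finBasis ℂ A
      have hX : ∀ X : A ⊗[ℂ] A, X = ∑ k, e k ⊗ₜ sliceL (e.coord k) X := by
        intro X
        induction X using TensorProduct.induction_on with
        | zero => simp
        | add X X' h h' =>
          simp only [map_add, TensorProduct.tmul_add, Finset.sum_add_distrib]
          rw [← h, ← h']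
        | tmul p q =>
          simp only [sliceL_tmul, ← TensorProduct.smul_tmul, ← TensorProduct.sum_tmul]
          congr 1
          exact (e.sum_repr p).symm
      have h1 := mul_antipode_rTensor_comul_apply (R := ℂ) y
      rw [hX (Coalgebra.comul y)] at h1
      simp only [map_sum, LinearMap.rTensor_tmul, LinearMap.mul'_apply] at h1
      have h2 := congrArg (fun t => μ (x * t)) h1
      simp only [Finset.mul_sum, map_sum, ← mul_assoc, hJ y hy, Finset.sum_const_zero,
        Algebra.algebraMap_eq_smul_one, mul_smul_comm, mul_one, map_smul, smul_eq_mul] at h2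
      simpa [hne] using h2.symm
    refine eq_of_forall_dual fun f => ?_
    have hy' : ∀ x, μ (x * y) = 0 := fun x => by
      have := hy (g * x)
      simpa [← mul_assoc, D.inv_mul] using this
    have h := hJ2 _ (hJ y hy' f)
    rw [← leg_eq_sliceL, leg_eq_sliceR] at h
    have h4 : sliceR Coalgebra.counit (Coalgebra.comul (R := ℂ) y) = y := by
      have := congrArg (TensorProduct.rid ℂ A) (lTensor_counit_comul (R := ℂ) y)
      rw [TensorProduct.rid_tmul, one_smul] at this
      exact this
    rw [h4] at h
    rw [h, map_zero]

/-- The antipode fixes the center. -/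
theorem antipode_central {z : A} (hz : ∀ x, z * x = x * z) : antipode ℂ z = z := by
  obtain ⟨lam, hl, -, -, hnd⟩ := D.exists_symmetric_integral
  obtain ⟨w, rfl⟩ := D.toIsPivot.antipode_surjective z
  have hS : ∀ x, lam (antipode ℂ x) = lam x := fun x => LinearMap.congr_fun (D.SLF_antipode _ hl) x
  -- With `z = S(w)`, both `lam` and `lam(z ·)` are symmetric, hence invariant under `S`. Thus
  -- `lam(x z) = lam(z S(x)) = lam(S(x w)) = lam(x w)` for all `x`.
  have h : antipode ℂ w - w = 0 := by
    refine hnd _ fun x => ?_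
    have h1 : lam (x * antipode ℂ w) = lam (x * w) := by
      have := LinearMap.congr_fun (D.SLF_antipode _ (comp_mulLeft_mem_SLF hl hz)) x
      simp only [LinearMap.comp_apply, LinearMap.mulLeft_apply] at this
      rw [← hz, ← this, ← antipode_mul, hS]
    rw [mul_sub, map_sub, h1, sub_self]
  rw [sub_eq_zero.1 h, sub_eq_zero.1 h]

/-- `Q` is built from a coproduct and central elements, all fixed by `S`; this symmetry exchanges
left and right contractions. -/
theorem map_antipode_Q : TensorProduct.map (antipode ℂ) (antipode ℂ) (TensorProduct.comm ℂ A A Q)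
    = Q := by
  have h : ∀ X : A ⊗[ℂ] A, TensorProduct.map (antipode ℂ) (antipode ℂ)
      (TensorProduct.comm ℂ A A (X * (v ⊗ₜ v)))
      = TensorProduct.map (antipode ℂ) (antipode ℂ) (TensorProduct.comm ℂ A A X) * (v ⊗ₜ v) := by
    intro X
    induction X using TensorProduct.induction_on with
    | zero => simp
    | add X X' h h' => simp only [add_mul, map_add, h, h']
    | tmul p q => simp [antipode_mul, D.antipode_central D.v_comm, D.v_comm]
  rw [D.Q_eq, h, ← D.comul_antipode, D.antipode_central D.vi_comm]

theorem sliceL_Q {φ : Dual ℂ A} (hφ : φ ∈ SLF A) :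
    sliceL (φ ∘ₗ LinearMap.mulLeft ℂ g') Q = drinfeldMap g Q φ := by
  rw [← D.map_antipode_Q, sliceL_antipode, D.comp_mulLeft_inv hφ, D.map_antipode_Q]
  exact D.antipode_central fun x => (D.drinfeldMap_comm hφ x).symm

/-- `Δ(v)(v⁻¹ ⊗ v⁻¹)` is the inverse of `Q`. The two contractions are related by one application of
the antipode, which is trivial on the center. -/
theorem drinfeldMap_Q_inv {φ : Dual ℂ A} (hφ : φ ∈ SLF A) :
    drinfeldMap g (Coalgebra.comul (R := ℂ) v * (vi ⊗ₜ vi)) φ = drinfeldMap g Q φ := by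
  rw [D.toIsPivot.antipode_injective (D.slice_inv φ hφ)]
  exact D.antipode_central fun x => (D.drinfeldMap_comm hφ x).symm

/-- The antipode, trivial on the center, reflects the left contraction of the coproduct into a right
one. There the central factor `D(φ)` comes out of `Q` and is absorbed into `ψ`. -/
theorem sliceL_comul_drinfeldMap {φ ψ : Dual ℂ A} (hφ : φ ∈ SLF A) (hψ : ψ ∈ SLF A) :
    sliceL (φ ∘ₗ LinearMap.mulLeft ℂ g') (Coalgebra.comul (R := ℂ) (drinfeldMap g Q ψ))
      = drinfeldMap g Q (ψ ∘ₗ LinearMap.mulLeft ℂ (drinfeldMap g Q φ)) := by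
  have hz := fun x => (D.drinfeldMap_comm hφ x).symm
  rw [← D.antipode_central fun x => (D.drinfeldMap_comm hψ x).symm, D.comul_antipode,
    sliceL_antipode, D.comp_mulLeft_inv hφ, ← D.sliceL_Q hψ,
    ← LinearMap.comp_apply (sliceR _) Coalgebra.comul, ← sliceL_map_id, D.slice_comul _ hz,
    ← sliceL_mulLeft]
  have e : (ψ ∘ₗ LinearMap.mulLeft ℂ g') ∘ₗ
      LinearMap.mulLeft ℂ (sliceR (φ ∘ₗ LinearMap.mulLeft ℂ g) Q)
      = (ψ ∘ₗ LinearMap.mulLeft ℂ (drinfeldMap g Q φ)) ∘ₗ LinearMap.mulLeft ℂ g' := by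
    ext x
    simp only [LinearMap.comp_apply, LinearMap.mulLeft_apply, ← mul_assoc]
    rw [hz g']; rfl
  rw [e, D.sliceL_Q (comp_mulLeft_mem_SLF hψ hz)]
  exact D.antipode_central fun x =>
    (D.drinfeldMap_comm (comp_mulLeft_mem_SLF hψ hz) x).symm

/-- The action of a central element on symmetric linear forms. -/
def slfMul {z : A} (hz : ∀ x, z * x = x * z) : End ℂ (SLF A) where
  toFun ψ := ⟨ψ.1 ∘ₗ LinearMap.mulLeft ℂ z, comp_mulLeft_mem_SLF ψ.2 hz⟩
  map_add' _ _ := rfl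
  map_smul' _ _ := rfl

/-- The action of a symmetric linear form on symmetric linear forms. -/
def slfConv {φ : Dual ℂ A} (hφ : φ ∈ SLF A) : End ℂ (SLF A) where
  toFun ψ := ⟨dualMul φ ψ.1, dualMul_mem_SLF hφ ψ.2⟩
  map_add' ψ ψ' := Subtype.ext (map_add (dualMulLeft φ) ψ.1 ψ'.1)
  map_smul' c ψ := Subtype.ext (map_smul (dualMulLeft φ) c ψ.1)

section Modular
variable {lam : Dual ℂ A} (hl : lam ∈ SLF A) (hlΛ : drinfeldMap g Q lam = Λ)
  (hμ : ∀ x, sliceR (lam ∘ₗ LinearMap.mulLeft ℂ g) (Coalgebra.comul (R := ℂ) x)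
      = lam (g * x) • (1 : A))
  (hnd : ∀ y, (∀ x, lam (x * y) = 0) → y = 0)

-- This identifies `a L a`, where `a` multiplies by `v⁻¹` and `L` convolves with `lam(v ·)`: the
-- integral formula moves `Δ(v)` out of the convolution, and the three ribbon factors assemble into
-- `Q⁻¹`, which has the same symmetric contractions as `Q`.
include hl hμ in
theorem twist_conv_twist {ψ : Dual ℂ A} (hψ : ψ ∈ SLF A) (x : A) :
    dualMul (lam ∘ₗ LinearMap.mulLeft ℂ v) (ψ ∘ₗ LinearMap.mulLeft ℂ vi) (vi * x)
      = lam (drinfeldMap g Q ψ * x) := by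
  obtain ⟨S, hS⟩ := exists_comul v
  have h1 := sliceL_mul_tmul_one D.toIsPivot hμ D.comul_antipode hl (D.SLF_antipode _ hl)
    (fun x => by simp [← mul_assoc, D.mul_inv]) (vi * x) hS
  have h2 : sliceL (lam ∘ₗ LinearMap.mulLeft ℂ v) (Coalgebra.comul (R := ℂ) (vi * x))
      = sliceL lam (Coalgebra.comul (R := ℂ) (vi * x) * (v ⊗ₜ 1)) := by
    generalize Coalgebra.comul (R := ℂ) (vi * x) = X
    induction X using TensorProduct.induction_on with
    | zero => simp
    | add X X' h h' => simp only [add_mul, map_add, h, h']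
    | tmul p q => simp [D.v_comm]
  rw [dualMul_apply, leg_eq_sliceL, h2, h1]
  have h3 : ∀ t, ψ (vi * (g' * antipode ℂ t)) = ψ (g * (t * vi)) := by
    intro t
    rw [← D.antipode_central D.vi_comm, ← D.toIsPivot.antipode_eq, ← antipode_mul, ← antipode_mul,
      D.antipode_central D.vi_comm, ← hψ (t * vi) g, mul_assoc t vi, D.vi_comm g, ← mul_assoc]
    exact LinearMap.congr_fun (D.SLF_antipode _ hψ) _
  rw [← D.drinfeldMap_Q_inv hψ, drinfeldMap, hS, Finset.sum_mul, map_sum, map_sum]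
  simp only [Algebra.TensorProduct.tmul_mul_tmul, sliceR_tmul, LinearMap.comp_apply,
    LinearMap.mulLeft_apply, map_smul, Finset.sum_mul, map_sum, smul_mul_assoc, h3]
  refine Finset.sum_congr rfl fun i _ => ?_
  rw [hl (vi * x), ← mul_assoc, smul_eq_mul, smul_eq_mul, mul_comm]

-- Computed with `Q⁻¹ = Δ(v)(v⁻¹ ⊗ v⁻¹)`: the twist in the form cancels one factor `v⁻¹`, and what
-- remains is the integral of `Δ(v)`.
include hl hμ in
theorem drinfeldMap_twist : drinfeldMap g Q (lam ∘ₗ LinearMap.mulLeft ℂ v) = lam (g * v) • vi := by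
  rw [← D.drinfeldMap_Q_inv (comp_mulLeft_mem_SLF hl D.v_comm)]
  have : drinfeldMap g (Coalgebra.comul (R := ℂ) v * (vi ⊗ₜ vi)) (lam ∘ₗ LinearMap.mulLeft ℂ v)
      = sliceR (lam ∘ₗ LinearMap.mulLeft ℂ g) (Coalgebra.comul (R := ℂ) v) * vi := by
    rw [drinfeldMap]
    generalize Coalgebra.comul (R := ℂ) v = X
    induction X using TensorProduct.induction_on with
    | zero => simp
    | add X X' h h' => simp only [add_mul, map_add, h, h']
    | tmul p q =>
      simp only [Algebra.TensorProduct.tmul_mul_tmul, sliceR_tmul, LinearMap.comp_apply,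
        LinearMap.mulLeft_apply, smul_mul_assoc]
      rw [← mul_assoc v, ← mul_assoc, D.v_comm g, mul_assoc, mul_assoc, ← mul_assoc v,
        D.v_comm q, mul_assoc, D.v_mul, mul_one]
  rw [this, hμ, smul_mul_assoc, one_mul]

-- The integral transfers convolution by `φ` to a contraction of the coproduct of the central
-- element `D(ψ)`. This is what makes the square of `ψ ↦ lam(D(ψ) ·)` computable.
include hμ in
theorem conv_drinfeldMap {φ ψ : Dual ℂ A} (hφ : φ ∈ SLF A) (hψ : ψ ∈ SLF A) :
    dualMul φ (lam ∘ₗ LinearMap.mulLeft ℂ (drinfeldMap g Q ψ))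
      = lam ∘ₗ LinearMap.mulLeft ℂ
        (drinfeldMap g Q (ψ ∘ₗ LinearMap.mulLeft ℂ (drinfeldMap g Q φ))) := by
  ext x
  rw [← D.sliceL_comul_drinfeldMap hφ hψ]
  set z := drinfeldMap g Q ψ
  obtain ⟨S, hS⟩ := exists_comul (g' * z)
  have h1 := sliceR_integral hμ hS x
  have e : (lam ∘ₗ LinearMap.mulLeft ℂ g) ∘ₗ LinearMap.mulLeft ℂ (g' * z)
      = lam ∘ₗ LinearMap.mulLeft ℂ z := by
    ext x; simp [← mul_assoc, D.mul_inv]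
  have h3 : ∀ t, φ (antipode ℂ t) = φ t := LinearMap.congr_fun (D.SLF_antipode _ hφ)
  rw [e] at h1
  rw [dualMul_apply, leg_eq_sliceR, h1, map_sum]
  simp only [map_smul, smul_eq_mul, h3, LinearMap.comp_apply, LinearMap.mulLeft_apply]
  have h4 : Coalgebra.comul (R := ℂ) z = (g ⊗ₜ g) * ∑ i ∈ S, i.1 ⊗ₜ[ℂ] i.2 := by
    rw [← hS, ← D.comul, ← Bialgebra.comul_mul, ← mul_assoc, D.mul_inv, one_mul]
  rw [h4, Finset.mul_sum, map_sum, Finset.sum_mul, map_sum]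
  refine Finset.sum_congr rfl fun i _ => ?_
  simp [← mul_assoc, D.inv_mul, mul_comm]

include hl hlΛ hμ hnd in
/-- The relations between the twist and the convolution with the twisted integral. -/
theorem modular_relations : ∃ (c d : ℂ) (a L W : End ℂ (SLF A)), c ≠ 0 ∧ d ≠ 0 ∧
    a = slfMul D.vi_comm ∧ L = slfConv (comp_mulLeft_mem_SLF hl D.v_comm) ∧
    drinfeldMap g Q (lam ∘ₗ LinearMap.mulLeft ℂ v) = c • vi ∧
    a * L * a = W ∧ W * L = c • (a * W) ∧ W * W = d • 1 := by
  obtain ⟨a, ha⟩ : ∃ a, a = slfMul D.vi_comm := ⟨_, rfl⟩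
  obtain ⟨L, hL⟩ : ∃ L, L = slfConv (comp_mulLeft_mem_SLF hl D.v_comm) := ⟨_, rfl⟩
  obtain ⟨W, hWd⟩ : ∃ W, a * L * a = W := ⟨_, rfl⟩
  have hW : ∀ ψ : SLF A, (W ψ : Dual ℂ A) = lam ∘ₗ LinearMap.mulLeft ℂ (drinfeldMap g Q ψ) :=
    fun ψ => LinearMap.ext fun x => by
      rw [← hWd, ha, hL]; exact D.twist_conv_twist hl hμ ψ.2 x
  have hLa : ∀ ψ : SLF A, (L ψ : Dual ℂ A) = dualMul (lam ∘ₗ LinearMap.mulLeft ℂ v) ψ :=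
    fun ψ => by rw [hL]; rfl
  have haa : ∀ ψ : SLF A, (a ψ : Dual ℂ A) = ψ.1 ∘ₗ LinearMap.mulLeft ℂ vi :=
    fun ψ => by rw [ha]; rfl
  have hconv_counit : ∀ φ : Dual ℂ A, dualMul φ Coalgebra.counit = φ := by
    intro φ; ext x
    obtain ⟨S, hS⟩ := exists_comul x
    rw [dualMul_apply, hS, ← congrArg φ (sum_counit_right hS)]
    simp [mul_comm]
  -- The scalar `c = lam(g v)` comes from `D(lam(v ·)) = c v⁻¹` and is nonzero by injectivity of
  -- `D`. The scalar `d = lam Λ` comes from `lam(Λ ·) = lam(Λ) ε`, where `ε` is the unit of the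
  -- dual, and is nonzero by nondegeneracy.
  refine ⟨lam (g * v), lam Λ, a, L, W, ?_, ?_, ha, hL, D.drinfeldMap_twist hl hμ, hWd, ?_, ?_⟩
  · intro h
    have h1 := D.drinfeldMap_twist hl hμ
    rw [h, zero_smul] at h1
    have h2 : lam ∘ₗ LinearMap.mulLeft ℂ v = 0 := D.drinfeldMap_injective (by rw [h1]; simp [drinfeldMap, sliceR])
    refine D.int_ne (hnd Λ fun x => ?_)
    have := LinearMap.congr_fun h2 (vi * (x * Λ))
    simpa [← mul_assoc, D.v_mul] using this
  · intro h
    refine D.int_ne (hnd Λ fun x => ?_)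
    rw [D.mul_int, map_smul, h, smul_zero]
  · ext ψ x
    change (W (L ψ) : Dual ℂ A) x = lam (g * v) * (a (W ψ) : Dual ℂ A) x
    rw [hW, hLa, haa, hW, D.drinfeldMap_dualMul ψ.2, D.drinfeldMap_twist hl hμ]
    simp only [LinearMap.comp_apply, LinearMap.mulLeft_apply, smul_mul_assoc, map_smul, smul_eq_mul]
    rw [← mul_assoc, D.vi_comm]
  · ext ψ x
    change (W (W ψ) : Dual ℂ A) x = lam Λ * (ψ : Dual ℂ A) x
    rw [hW, hW]
    have h2 := D.conv_drinfeldMap hμ ψ.2 hl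
    have h3 := D.drinfeldMap_comm ψ.2
    have e : lam ∘ₗ LinearMap.mulLeft ℂ Λ = lam Λ • Coalgebra.counit := by
      ext x; simp [D.int_mul, mul_comm]
    rw [← h2, hlΛ, e]
    have h4 := map_smul (dualMulLeft ψ.1) (lam Λ) (Coalgebra.counit : A →ₗ[ℂ] ℂ)
    have h5 : dualMul ψ.1 (lam Λ • Coalgebra.counit) = lam Λ • ψ.1 :=
      h4.trans (congrArg (lam Λ • ·) (hconv_counit ψ.1))
    rw [h5]; rfl

end Modular

end Lam
end IsFactorizable
end

/-! ### From operator identities to relations in the projective linear group. -/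

section ProjectiveRelations
variable {V : Type} [AddCommGroup V] [Module ℂ V]

theorem projGL_mk_eq {x y : (End ℂ V)ˣ} {c : ℂ} (hc : c ≠ 0) (h : y.val = c • x.val) :
    (QuotientGroup.mk x : ProjGL V) = QuotientGroup.mk y := by
  rw [QuotientGroup.eq]
  refine ⟨Units.mk0 c hc, ?_⟩
  rw [eq_inv_mul_iff_mul_eq]
  ext1
  simp only [Units.val_mul, Units.coe_map, Units.val_mk0]
  rw [h]
  change x.val * algebraMap ℂ (End ℂ V) c = _
  rw [Algebra.algebraMap_eq_smul_one, mul_smul_comm, mul_one]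

/-- Invertibility of `W`, hence of `L`, comes from `W² = d`. Up to scalars, with `W = a L a`, the
hypotheses read `a L a L = a a L a` and `(a L a)² = 1`; a conjugate of `L` by `a` then satisfies the
braid relation and the cubic relation with `a`. -/
theorem exists_twist_units {c d : ℂ} (hc : c ≠ 0) (hd : d ≠ 0) (a : (End ℂ V)ˣ) {L W : End ℂ V}
    (h1 : a.val * L * a.val = W) (h2 : W * L = c • (a.val * W)) (h3 : W * W = d • 1) :
    ∃ b : (End ℂ V)ˣ, b.val * a.val = c⁻¹ • (a.val * L) ∧
      (QuotientGroup.mk a * QuotientGroup.mk b * QuotientGroup.mk a : ProjGL V)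
        = QuotientGroup.mk b * QuotientGroup.mk a * QuotientGroup.mk b ∧
      ((QuotientGroup.mk a * QuotientGroup.mk b : ProjGL V)) ^ 3 = 1 := by
  have hWu : W * (d⁻¹ • W) = 1 := by
    rw [mul_smul_comm, h3, smul_smul, inv_mul_cancel₀ hd, one_smul]
  have hWu' : (d⁻¹ • W) * W = 1 := by
    rw [smul_mul_assoc, h3, smul_smul, inv_mul_cancel₀ hd, one_smul]
  let w : (End ℂ V)ˣ := ⟨W, d⁻¹ • W, hWu, hWu'⟩
  let l : (End ℂ V)ˣ := a⁻¹ * w * a⁻¹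
  have hl : l.val = L := by
    change a⁻¹.val * W * a⁻¹.val = L
    rw [← h1]; simp [mul_assoc]
  let s : (End ℂ V)ˣ := Units.map (algebraMap ℂ (End ℂ V)).toMonoidHom (Units.mk0 c hc)
  have hs : ∀ x : (End ℂ V)ˣ, (s * x).val = c • x.val := fun x => by
    change algebraMap ℂ (End ℂ V) c * x.val = _
    rw [Algebra.algebraMap_eq_smul_one, smul_mul_assoc, one_mul]
  have hsm : (QuotientGroup.mk s : ProjGL V) = 1 :=
    (QuotientGroup.eq_one_iff s).2 ⟨_, rfl⟩
  have hwd : (QuotientGroup.mk (w * w) : ProjGL V) = 1 :=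
    (projGL_mk_eq hd (x := 1) (by simpa using h3)).symm
  have hal : a * l * a = w := by ext1; simpa [hl] using h1
  have hwl : w * l = s * (a * w) := by
    ext1; rw [hs]; simpa [hl] using h2
  -- The conjugate by `a`, rather than `L` itself, and the scalar `c⁻¹` are dictated by the operator
  -- `v_B⁻¹`, which is to be matched exactly and not only projectively.
  refine ⟨s⁻¹ * (a * l * a⁻¹), ?_, ?_, ?_⟩
  · have e : s⁻¹ * (a * l * a⁻¹) * a = s⁻¹ * (a * l) := by group
    have e2 : (a * l).val = c • (s⁻¹ * (a * l)).val := by rw [← hs]; simp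
    rw [← Units.val_mul, e, ← hl, ← Units.val_mul, e2, smul_smul, inv_mul_cancel₀ hc, one_smul]
  all_goals
    have q1 := congrArg (QuotientGroup.mk : (End ℂ V)ˣ → ProjGL V) hwl
    rw [← hal] at q1 hwd
    simp only [QuotientGroup.mk_mul, QuotientGroup.mk_inv, hsm, one_mul, inv_one] at q1 hwd ⊢
    generalize (QuotientGroup.mk a : ProjGL V) = x at *
    generalize (QuotientGroup.mk l : ProjGL V) = y at *
  · calc x * (x * y * x⁻¹) * x = x * (x * y * x) * x⁻¹ := by group
      _ = _ := by rw [← q1]; group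
  · calc (x * (x * y * x⁻¹)) ^ 3 = x * (x * y * x * y * (x * y)) * x⁻¹ := by
          simp only [pow_succ, pow_zero]; group
      _ = x * (x * y * x * (x⁻¹ * (x * y * x * y))) * x⁻¹ := by group
      _ = x * (x * y * x * (x * y * x)) * x⁻¹ := by rw [q1]; group
      _ = 1 := by rw [hwd]; group

end ProjectiveRelations
end
end RestrictedQG

open scoped TensorProduct
namespace RestrictedQG
noncomputable section
open Coalgebra HopfAlgebra Module

/-! ### The monodromy and the ribbon element of an R-matrix. -/

section
variable {A : Type} [Ring A] [HopfAlgebra ℂ A] {I : Type} [Fintype I] {a b : I → A}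

namespace IsRMatrix
variable (R : IsRMatrix a b)
include R

theorem Q_eq_sum : R.Q = ∑ i, ∑ j, (b i * a j) ⊗ₜ[ℂ] (a i * b j) := by
  simp [Q, Finset.sum_mul_sum]

/-- Both hexagon axioms split the coproduct of the second leg of `R'R` so that an inner copy of
`R'R` is contracted with `f` and sandwiched between an outer `R'` and `R`. -/
theorem map_comul_Q (f : Dual ℂ A) :
    TensorProduct.map LinearMap.id (sliceR f ∘ₗ comul) R.Q
      = ∑ i, ∑ j, (b i * sliceR f R.Q * a j) ⊗ₜ[ℂ] (a i * b j) := by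
  have h1 : ∀ j, ∑ i, (b i * a j) ⊗ₜ[ℂ] sliceR f (comul (a i) * comul (b j))
      = ∑ i, ∑ i', (b i * b i' * a j) ⊗ₜ[ℂ] sliceR f ((a i ⊗ₜ a i') * comul (b j)) := by
    intro j
    have := congrArg (leg (B := A ⊗[ℂ] A) (TensorProduct.mk ℂ A A 1 ∘ₗ sliceR f
      ∘ₗ LinearMap.mulRight ℂ (comul (R := ℂ) (b j)))
      ((TensorProduct.mk ℂ A A).flip 1 ∘ₗ LinearMap.mulRight ℂ (a j))) R.comul_a
    simpa using this
  have h2 : ∀ i i', ∑ j, (b i * b i' * a j) ⊗ₜ[ℂ] sliceR f ((a i ⊗ₜ a i') * comul (b j))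
      = ∑ j, ∑ j', (b i * b i' * (a j * a j')) ⊗ₜ[ℂ] sliceR f ((a i ⊗ₜ a i') * (b j' ⊗ₜ b j)) := by
    intro i i'
    have := congrArg (leg (B := A ⊗[ℂ] A)
      ((TensorProduct.mk ℂ A A).flip 1 ∘ₗ LinearMap.mulLeft ℂ (b i * b i'))
      (TensorProduct.mk ℂ A A 1 ∘ₗ sliceR f ∘ₗ LinearMap.mulLeft ℂ (a i ⊗ₜ a i'))) R.comul_b
    simpa [mul_assoc] using this
  have h3 : ∀ i j', b i * sliceR f R.Q * a j'
      = ∑ i', ∑ j, f (a i' * b j) • (b i * b i' * (a j * a j')) := by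
    intro i j'
    simp only [R.Q_eq_sum, map_sum, sliceR_tmul, Finset.mul_sum, Finset.sum_mul, mul_smul_comm,
      smul_mul_assoc, mul_assoc]
  have h0 : TensorProduct.map LinearMap.id (sliceR f ∘ₗ comul) R.Q
      = ∑ i, ∑ j, (b i * a j) ⊗ₜ[ℂ] sliceR f (comul (a i) * comul (b j)) := by
    rw [R.Q_eq_sum]
    simp only [map_sum, TensorProduct.map_tmul, LinearMap.comp_apply, Bialgebra.comul_mul,
      LinearMap.id_apply]
  rw [h0, Finset.sum_comm]
  simp only [h1]
  rw [Finset.sum_comm]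
  refine Finset.sum_congr rfl fun i _ => ?_
  rw [Finset.sum_comm]
  simp only [h2, h3, TensorProduct.sum_tmul, Algebra.TensorProduct.tmul_mul_tmul, sliceR_tmul,
    ← TensorProduct.smul_tmul']
  simp only [TensorProduct.tmul_smul]
  have e : ∀ i', ∑ j, ∑ j', f (a i' * b j) • (b i * b i' * (a j * a j')) ⊗ₜ[ℂ] (a i * b j')
      = ∑ j', ∑ j, f (a i' * b j) • (b i * b i' * (a j * a j')) ⊗ₜ[ℂ] (a i * b j') :=
    fun i' => Finset.sum_comm
  simp only [e]
  exact Finset.sum_comm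

/-- A central contraction pulls out of the coproduct. -/
theorem map_comul_Q_of_central {f : Dual ℂ A} (hf : ∀ x, sliceR f R.Q * x = x * sliceR f R.Q) :
    TensorProduct.map LinearMap.id (sliceR f ∘ₗ comul) R.Q = (sliceR f R.Q ⊗ₜ 1) * R.Q := by
  rw [R.map_comul_Q]
  conv_rhs => arg 2; rw [R.Q_eq_sum]
  simp only [← hf, Finset.mul_sum, Algebra.TensorProduct.tmul_mul_tmul, one_mul, mul_assoc]

theorem counit_elt : counit (R := ℂ) R.elt = 1 := by
  have h := congrArg (counit (R := ℂ)) R.counit_b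
  simp only [map_sum, map_smul, smul_eq_mul, Bialgebra.counit_one] at h
  simpa [elt, mul_comm] using h

variable {g g' : A} (G : IsPivot g g')
include G

/-- The ribbon element `g⁻¹ u`, its inverse and its relation with the monodromy. -/
theorem exists_ribbon (hS : ∀ x : A, comul (R := ℂ) (antipode ℂ x)
      = TensorProduct.map (antipode ℂ) (antipode ℂ) (TensorProduct.comm ℂ A A (comul (R := ℂ) x))) :
    ∃ v vi : A, R.elt = g * v ∧ (∀ x, v * x = x * v) ∧ (∀ x, vi * x = x * vi) ∧ v * vi = 1 ∧
      counit (R := ℂ) v = 1 ∧ R.Q = comul (R := ℂ) vi * (v ⊗ₜ v) ∧ vi = ∑ i, b i * g * a i := by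
  obtain ⟨w, h1, h2, h3⟩ := R.exists_elt_inv
  -- The pivot and the Drinfeld element implement the same automorphism `S²`, so their quotient is
  -- central.
  have hv : ∀ x, (g' * R.elt) * x = x * (g' * R.elt) := fun x => by
    rw [mul_assoc, R.elt_mul, ← mul_assoc, G.inv_mul_sq, mul_assoc]
  have hm : (g' * R.elt) * (w * g) = 1 := by
    rw [mul_assoc, ← mul_assoc R.elt, h1, one_mul, G.inv_mul]
  have hm' : (w * g) * (g' * R.elt) = 1 := by
    rw [mul_assoc, ← mul_assoc g, G.mul_inv, one_mul, h2]
  have hc : counit (R := ℂ) g' = 1 := by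
    have := congrArg (counit (R := ℂ)) G.inv_mul
    simpa [G.counit] using this
  have hgg : (g' ⊗ₜ[ℂ] g') * (g ⊗ₜ[ℂ] g) = 1 := by
    rw [Algebra.TensorProduct.tmul_mul_tmul, G.inv_mul]; rfl
  refine ⟨g' * R.elt, w * g, by rw [← mul_assoc, G.mul_inv, one_mul], hv, fun x => ?_, hm, ?_, ?_,
    ?_⟩
  · calc w * g * x = w * g * (x * (g' * R.elt)) * (w * g) := by
          rw [mul_assoc (w * g), mul_assoc x, hm, mul_one]
      _ = _ := by rw [← hv, ← mul_assoc (w * g), hm', one_mul]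
  · rw [Bialgebra.counit_mul, hc, R.counit_elt, one_mul]
  · have h4 : comul (R := ℂ) (g' * R.elt) * R.Q = (g' * R.elt) ⊗ₜ (g' * R.elt) := by
      rw [Bialgebra.comul_mul, mul_assoc, R.comul_elt_mul_Q hS, G.comul_inv,
        Algebra.TensorProduct.tmul_mul_tmul]
    rw [← h4, ← mul_assoc, ← Bialgebra.comul_mul, hm', Bialgebra.comul_one, one_mul]
  · rw [h3, Finset.sum_mul]
    refine Finset.sum_congr rfl fun i _ => ?_
    rw [mul_assoc, mul_assoc, G.mul_eq]

/-- The inverse of `Q` is `S(a_i) b_j ⊗ b_i S(a_j)`. After one antipode on the first leg, cyclicity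
of `φ` and the invariance of `R` under `S ⊗ S`, applied twice, turn it into `S²` of the contraction
of `Q`; the pivot absorbs the remaining `S²` inside `φ`. -/
theorem antipode_drinfeldMap_inv {Qi : A ⊗[ℂ] A} (hQi : Qi * R.Q = 1) {φ : Dual ℂ A}
    (hφ : φ ∈ SLF A) : antipode ℂ (drinfeldMap g Qi φ)
      = antipode ℂ (antipode ℂ (drinfeldMap g R.Q φ)) := by
  have h1 : (∑ i, a i ⊗ₜ[ℂ] b i) * (∑ i, antipode ℂ (a i) ⊗ₜ[ℂ] b i) = 1 := by
    rw [← R.mul_antipode_a]; simp [Finset.sum_mul_sum]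
  have h2 : (∑ i, b i ⊗ₜ[ℂ] a i) * (∑ i, b i ⊗ₜ[ℂ] antipode ℂ (a i)) = 1 := by
    have := congrArg (TensorProduct.comm ℂ A A) R.mul_antipode_a
    simp only [map_sum, TensorProduct.comm_tmul, Algebra.TensorProduct.one_def] at this
    rw [Algebra.TensorProduct.one_def, ← this]
    simp [Finset.sum_mul_sum]
  have h3 : Qi = ∑ i, ∑ j, (antipode ℂ (a i) * b j) ⊗ₜ[ℂ] (b i * antipode ℂ (a j)) := by
    have e : R.Q * ((∑ i, antipode ℂ (a i) ⊗ₜ[ℂ] b i) * (∑ i, b i ⊗ₜ[ℂ] antipode ℂ (a i))) = 1 := by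
      rw [Q, mul_assoc, ← mul_assoc _ _ (∑ i, b i ⊗ₜ[ℂ] antipode ℂ (a i)), h1, one_mul, h2]
    rw [← mul_one Qi, ← e, ← mul_assoc, hQi, one_mul]
    simp [Finset.sum_mul_sum]
  have key : ∀ i, ∑ j, φ (g * (b i * antipode ℂ (a j))) • (antipode ℂ (b j)
        * antipode ℂ (antipode ℂ (a i)))
      = ∑ j, φ (g * (a j * b i)) • (antipode ℂ (antipode ℂ (b j))
        * antipode ℂ (antipode ℂ (a i))) := by
    intro i
    let Fn : A →ₗ[ℂ] A →ₗ[ℂ] A := LinearMap.mk₂ ℂ (fun x y => φ (x * (g * b i)) •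
      (y * antipode ℂ (antipode ℂ (a i)))) (by intros; simp [add_mul, add_smul])
      (by intros; simp [mul_smul]) (by intros; simp [add_mul]) (by intros; simp [smul_smul, mul_comm])
    have e1 := R.sum_antipode Fn
    have e2 := R.sum_antipode (Fn.compl₁₂ (antipode ℂ) (antipode ℂ))
    simp only [LinearMap.compl₁₂_apply] at e2
    rw [e1] at e2
    simp only [Fn, LinearMap.mk₂_apply] at e1 e2
    have e3 : ∀ j, φ (g * (b i * antipode ℂ (a j))) = φ (antipode ℂ (a j) * (g * b i)) := fun j => by
      rw [← mul_assoc, hφ]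
    have e4 : ∀ j, φ (antipode ℂ (antipode ℂ (a j)) * (g * b i)) = φ (g * (a j * b i)) := fun j => by
      rw [← mul_assoc, ← G.mul_eq, mul_assoc]
    simp only [e3, e1, ← e2, e4]
  rw [drinfeldMap, drinfeldMap, h3, R.Q_eq_sum, Finset.sum_comm (γ := I) (f := fun i j =>
    (b i * a j) ⊗ₜ[ℂ] (a i * b j))]
  simp only [map_sum, sliceR_tmul, LinearMap.comp_apply, LinearMap.mulLeft_apply, map_smul,
    antipode_mul]
  exact Finset.sum_congr rfl fun i _ => key i

omit G in
/-- The twisted convolution with a symmetric linear form. -/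
theorem sum_conv_twist {ψ₀ ψ : Dual ℂ A} (hψ₀ : ψ₀ ∈ SLF A) (hψ : ψ ∈ SLF A) {v vi : A}
    (hv : ∀ x, v * x = x * v) (hvi : ∀ x, vi * x = x * vi) (hm : v * vi = 1)
    (hQ : R.Q = comul (R := ℂ) vi * (v ⊗ₜ v)) (hw : vi = ∑ i, b i * g * a i) (x : A) :
    leg (ψ₀ ∘ₗ LinearMap.mulLeft ℂ g) ψ
        ((∑ i, (a i ⊗ₜ[ℂ] 1) * comul (R := ℂ) (x * b i)) * ∑ j, b j ⊗ₜ[ℂ] a j)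
      = dualMul ψ₀ (ψ ∘ₗ LinearMap.mulLeft ℂ v) (vi * x) := by
  have h1 : ∀ Y, leg (ψ₀ ∘ₗ LinearMap.mulLeft ℂ g) ψ Y = leg ψ₀ ψ ((g ⊗ₜ 1) * Y) := by
    intro Y
    induction Y using TensorProduct.induction_on with
    | zero => simp
    | add X X' h h' => simp only [mul_add, map_add, h, h']
    | tmul p q => simp
  -- The second hexagon axiom isolates the sum `b g a`, which is the inverse ribbon element.
  have h2 : ∑ i, TensorProduct.comm ℂ A A (comul (R := ℂ) (b i)) * ((g * a i) ⊗ₜ[ℂ] 1)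
      = (vi ⊗ₜ[ℂ] 1) * ∑ i, a i ⊗ₜ[ℂ] b i := by
    have := congrArg (gel (B := A ⊗[ℂ] A) ((TensorProduct.mk ℂ A A).flip 1 ∘ₗ LinearMap.mulLeft ℂ g)
      (TensorProduct.comm ℂ A A).toLinearMap) R.comul_b
    simp only [map_sum, gel_tmul, LinearMap.comp_apply, LinearMap.flip_apply,
      LinearMap.mulLeft_apply, TensorProduct.mk_apply, LinearEquiv.coe_coe,
      TensorProduct.comm_tmul, Algebra.TensorProduct.tmul_mul_tmul, mul_one] at this
    rw [this, hw, Finset.sum_comm, TensorProduct.sum_tmul, Finset.mul_sum]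
    refine Finset.sum_congr rfl fun k _ => ?_
    simp [Finset.sum_mul, mul_assoc]
  have h3 : ∀ i, leg ψ₀ ψ ((g ⊗ₜ 1) * ((a i ⊗ₜ[ℂ] 1) * comul (R := ℂ) (x * b i)
        * ∑ j, b j ⊗ₜ[ℂ] a j))
      = leg ψ₀ ψ (comul (R := ℂ) x * ((∑ j, b j ⊗ₜ[ℂ] a j) *
        (TensorProduct.comm ℂ A A (comul (R := ℂ) (b i)) * ((g * a i) ⊗ₜ[ℂ] 1)))) := by
    intro i
    rw [mul_assoc, ← mul_assoc (g ⊗ₜ 1), Algebra.TensorProduct.tmul_mul_tmul, mul_one,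
      leg_mul_comm hψ₀ hψ, Bialgebra.comul_mul, ← mul_assoc (∑ j, b j ⊗ₜ[ℂ] a j), R.quasi_flip]
    simp only [mul_assoc]
  rw [h1, Finset.sum_mul, Finset.mul_sum, map_sum]
  simp only [h3]
  rw [← map_sum, ← Finset.mul_sum, ← Finset.mul_sum, h2, ← mul_assoc (∑ j, b j ⊗ₜ[ℂ] a j)]
  have h4 : (∑ j, b j ⊗ₜ[ℂ] a j) * (vi ⊗ₜ[ℂ] 1) = (vi ⊗ₜ[ℂ] 1) * ∑ j, b j ⊗ₜ[ℂ] a j := by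
    simp [Finset.sum_mul, Finset.mul_sum, hvi]
  have h5 : ∀ X : A ⊗[ℂ] A, (vi ⊗ₜ[ℂ] 1) * (X * (v ⊗ₜ v)) = X * (1 ⊗ₜ v) := by
    intro X
    induction X using TensorProduct.induction_on with
    | zero => simp
    | add X X' h h' => simp only [mul_add, add_mul, h, h']
    | tmul p q => simp [← mul_assoc, hvi p, mul_assoc p, ← hv vi, hm]
  have h6 : ∀ X : A ⊗[ℂ] A, leg ψ₀ ψ (X * (1 ⊗ₜ v)) = leg ψ₀ (ψ ∘ₗ LinearMap.mulLeft ℂ v) X := by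
    intro X
    induction X using TensorProduct.induction_on with
    | zero => simp
    | add X X' h h' => simp only [add_mul, map_add, h, h']
    | tmul p q => simp [hv]
  -- The remaining product is `R' (v⁻¹ ⊗ 1) R = (v⁻¹ ⊗ 1) Q = Δ(v⁻¹)(1 ⊗ v)`.
  rw [h4, mul_assoc, show (∑ j, b j ⊗ₜ[ℂ] a j) * (∑ i, a i ⊗ₜ[ℂ] b i) = R.Q from rfl, hQ, h5, ← mul_assoc, h6, dualMul_apply, hvi, Bialgebra.comul_mul]

end IsRMatrix
end
end
end RestrictedQG

open scoped TensorProduct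
namespace RestrictedQG
noncomputable section
open Coalgebra HopfAlgebra Module

/-! ### Matrix-valued copies of the algebra and the Heisenberg double. -/

section MatrixHoms
variable {A B κ : Type} [Ring A] [Algebra ℂ A] [Ring B] [Algebra ℂ B] [Fintype κ] [DecidableEq κ]

/-- A matrix representation, seen with entries in the algebra `B`. -/
def scalHom (B : Type) [Ring B] [Algebra ℂ B] (P : A →ₐ[ℂ] Matrix κ κ ℂ) : A →ₐ[ℂ] Matrix κ κ B :=
  (Algebra.ofId ℂ B).mapMatrix.comp P

/-- The scalar matrices with entries the values of an algebra morphism. -/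
def diagHom (κ : Type) [Fintype κ] [DecidableEq κ] (f : A →ₐ[ℂ] B) : A →ₐ[ℂ] Matrix κ κ B :=
  (Matrix.scalarAlgHom κ ℂ).comp f

theorem scalHom_apply (P : A →ₐ[ℂ] Matrix κ κ ℂ) (x : A) :
    scalHom B P x = (P x).map (algebraMap ℂ B) := rfl

theorem diagHom_apply (f : A →ₐ[ℂ] B) (x : A) : diagHom κ f x = Matrix.scalar κ (f x) := rfl

theorem commute_scalHom_diagHom (P : A →ₐ[ℂ] Matrix κ κ ℂ) (f : A →ₐ[ℂ] B) (x y : A) :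
    Commute (scalHom B P x) (diagHom κ f y) := by
  ext i j
  simp [scalHom_apply, diagHom_apply, Matrix.scalar_apply, Algebra.commutes]

theorem commute_scalHom {P P' : A →ₐ[ℂ] Matrix κ κ ℂ} (h : ∀ x y, Commute (P x) (P' y)) (x y : A) :
    Commute (scalHom B P x) (scalHom B P' y) :=
  (h x y).map ((Algebra.ofId ℂ B).mapMatrix)

/-- `x ↦ I x ⊗ 1`. -/
def firstHom {m : ℕ} (n : ℕ) (I : MatRep A m) : A →ₐ[ℂ] Matrix (Fin m × Fin n) (Fin m × Fin n) ℂ :=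
  AlgHom.ofLinearMap
    { toFun := fun x => first n (I x)
      map_add' := fun x y => by simp [first, Matrix.add_kronecker]
      map_smul' := fun c x => by simp [first, Matrix.smul_kronecker] }
    (by simp [first])
    (fun x y => by
      change first n (I (x * y)) = first n (I x) * first n (I y)
      rw [first, first, first, ← Matrix.mul_kronecker_mul, map_mul, mul_one])

/-- `x ↦ 1 ⊗ J x`. -/
def secondHom {n : ℕ} (m : ℕ) (J : MatRep A n) :
    A →ₐ[ℂ] Matrix (Fin m × Fin n) (Fin m × Fin n) ℂ :=
  AlgHom.ofLinearMap
    { toFun := fun x => second m (J x)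
      map_add' := fun x y => by simp [second, Matrix.kronecker_add]
      map_smul' := fun c x => by simp [second, Matrix.kronecker_smul] }
    (by simp [second])
    (fun x y => by
      change second m (J (x * y)) = second m (J x) * second m (J y)
      rw [second, second, second, ← Matrix.mul_kronecker_mul, map_mul, mul_one])

theorem commute_first_second {m n : ℕ} (I : MatRep A m) (J : MatRep A n) (x y : A) :
    Commute (firstHom n I x) (secondHom m J y) := by
  change first n (I x) * second m (J y) = second m (J y) * first n (I x)
  rw [first, second, ← Matrix.mul_kronecker_mul, ← Matrix.mul_kronecker_mul]; simp

/-- The matrix coefficients of a representation on an arbitrary finite index set. -/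
def entry (P : A →ₐ[ℂ] Matrix κ κ ℂ) (x y : κ) : Dual ℂ A :=
  Matrix.entryLinearMap ℂ ℂ x y ∘ₗ P.toLinearMap

@[simp] theorem entry_apply (P : A →ₐ[ℂ] Matrix κ κ ℂ) (x y : κ) (h : A) :
    entry P x y h = P h x y := rfl

end MatrixHoms

section Pairings
variable {A B κ : Type} [Ring A] [HopfAlgebra ℂ A] [Ring B] [Algebra ℂ B] [Fintype κ] [DecidableEq κ]
variable {I : Type} [Fintype I] {a b : I → A}

/-- With `f` the action by translations these are the entries of `L^(+)`, and those of the next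
lemma are the entries of the inverse of `L^(-)`. -/
theorem pairing_scal_diag_apply (P : A →ₐ[ℂ] Matrix κ κ ℂ) (f : A →ₐ[ℂ] B) (x y : κ) :
    pairing a b (scalHom B P) (diagHom κ f) x y = f (sliceL (entry P x y) (∑ i, a i ⊗ₜ[ℂ] b i)) := by
  simp [pairing, Matrix.sum_apply, scalHom_apply, diagHom_apply, Matrix.scalar_apply,
    Algebra.smul_def]

theorem pairing_diag_scal_apply (P : A →ₐ[ℂ] Matrix κ κ ℂ) (f : A →ₐ[ℂ] B) (x y : κ) :
    pairing a b (diagHom κ f) (scalHom B P) x y = f (sliceL (entry P x y) (∑ i, b i ⊗ₜ[ℂ] a i)) := by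
  simp [pairing, Matrix.sum_apply, scalHom_apply, diagHom_apply, Matrix.scalar_apply,
    Algebra.smul_def, Algebra.commutes]

theorem pairing_mul_pairing_apply (P : A →ₐ[ℂ] Matrix κ κ ℂ) (f : A →ₐ[ℂ] B) (x y : κ) :
    (pairing a b (scalHom B P) (diagHom κ f) * pairing a b (diagHom κ f) (scalHom B P)) x y
      = f (sliceL (entry P x y) ((∑ i, a i ⊗ₜ[ℂ] b i) * ∑ i, b i ⊗ₜ[ℂ] a i)) := by
  simp only [Matrix.mul_apply, pairing_scal_diag_apply, pairing_diag_scal_apply,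
    Finset.sum_mul_sum, map_sum, sliceL_tmul, Algebra.TensorProduct.tmul_mul_tmul, map_smul,
    entry_apply, map_mul, Finset.sum_smul, smul_mul_smul_comm]
  rw [Finset.sum_comm]
  refine Finset.sum_congr rfl fun i _ => ?_
  rw [Finset.sum_comm]


/-- The representation of the dual by right translations. -/
def translateHom (A : Type) [Ring A] [HopfAlgebra ℂ A] : A →ₐ[ℂ] End ℂ (Dual ℂ A) :=
  AlgHom.ofLinearMap
    { toFun := rightTranslate
      map_add' := fun x y => by ext ψ z; simp [rightTranslate, mul_add]
      map_smul' := fun c x => by ext ψ z; simp [rightTranslate] }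
    (by ext ψ z; simp [rightTranslate])
    (fun x y => by ext ψ z; simp [rightTranslate, mul_assoc])

@[simp] theorem translateHom_apply (x : A) (ψ : Dual ℂ A) (y : A) :
    translateHom A x ψ y = ψ (y * x) := rfl

theorem dualMul_assoc (φ ψ χ : Dual ℂ A) :
    dualMul (dualMul φ ψ) χ = dualMul φ (dualMul ψ χ) := by
  ext x
  obtain ⟨S, hS⟩ := exists_comul x
  have h := congrArg (leg φ (leg ψ χ)) (sum_coassoc hS)
  have h2 : ∀ X : A ⊗[ℂ] A, ∀ t, leg φ (leg ψ χ) (TensorProduct.assoc ℂ A A A (X ⊗ₜ t))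
      = leg φ ψ X * χ t := by
    intro X t
    induction X using TensorProduct.induction_on with
    | zero => simp
    | add X X' h h' => simp only [TensorProduct.add_tmul, map_add, add_mul, h, h']
    | tmul p q => simp [mul_assoc]
  simp only [map_sum, h2, leg_tmul] at h
  rw [dualMul_apply, hS, dualMul_apply, hS]
  simpa [dualMul_apply] using h

/-- The matrix of the operators of multiplication by the matrix coefficients. -/
def coeffOp (P : A →ₐ[ℂ] Matrix κ κ ℂ) : Matrix κ κ (End ℂ (Dual ℂ A)) :=
  Matrix.of fun x y => dualMulLeft (entry P x y)

/-- This is the defining relation of the Heisenberg double, `h T = T (h₁ ⊗ h₂)`, where `h₁` acts as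
a matrix and `h₂` as a translation. It follows from the multiplicativity of the coproduct and of the
representation. -/
theorem translate_coeffOp (P : A →ₐ[ℂ] Matrix κ κ ℂ) (h : A) :
    diagHom κ (translateHom A) h * coeffOp P = coeffOp P * convHom (scalHom (End ℂ (Dual ℂ A)) P)
      (diagHom κ (translateHom A)) (commute_scalHom_diagHom P (translateHom A)) h := by

  have h1 : ∀ (x y : κ) (χ : Dual ℂ A) (X Y : A ⊗[ℂ] A), leg (entry P x y) χ (X * Y)
      = ∑ z, leg (entry P x z) ((leg (scalHom (End ℂ (Dual ℂ A)) P).toLinearMap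
        (diagHom κ (translateHom A)).toLinearMap Y) z y χ) X := by
    intro x y χ X Y
    induction Y using TensorProduct.induction_on with
    | zero => simp [leg]
    | add Y Y' h h' =>
      simp only [mul_add, map_add, h, h', Matrix.add_apply, LinearMap.add_apply,
        ← Finset.sum_add_distrib]
      refine Finset.sum_congr rfl fun z _ => ?_
      simp [leg, TensorProduct.map_add_right]
    | tmul p q =>
      induction X using TensorProduct.induction_on with
      | zero => simp
      | add X X' h h' => simp only [add_mul, map_add, h, h', Finset.sum_add_distrib]
      | tmul m n =>
        have e : ∀ z, leg (scalHom (End ℂ (Dual ℂ A)) P).toLinearMap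
            (diagHom κ (translateHom A)).toLinearMap (p ⊗ₜ q) z y χ
            = P p z y • translateHom A q χ := fun z => by
          rw [leg_tmul, AlgHom.toLinearMap_apply, AlgHom.toLinearMap_apply, diagHom_apply,
            Matrix.scalar_apply, Matrix.mul_diagonal]
          rfl
        simp only [e]
        simp only [leg_tmul, Algebra.TensorProduct.tmul_mul_tmul, entry_apply, map_mul,
          Matrix.mul_apply, Finset.sum_mul, LinearMap.smul_apply, translateHom_apply, smul_eq_mul,
          mul_assoc]
  refine Matrix.ext fun x y => LinearMap.ext fun χ => LinearMap.ext fun t => ?_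
  have h2 : (diagHom κ (translateHom A) h * coeffOp P) x y χ t
      = leg (entry P x y) χ (comul t * comul h) := by
    rw [← Bialgebra.comul_mul, diagHom_apply, Matrix.scalar_apply, Matrix.diagonal_mul]
    rfl
  rw [h2, h1, Matrix.mul_apply, LinearMap.sum_apply, LinearMap.sum_apply, convHom_apply]
  rfl

/-- Used for the other tensor factor: the operators `T₁` commute with complex matrices acting in the
second matrix space. -/
theorem coeffOp_commute {P : A →ₐ[ℂ] Matrix κ κ ℂ} {M : Matrix κ κ ℂ} (h : ∀ x, Commute (P x) M) :
    Commute (coeffOp P) (M.map (algebraMap ℂ (End ℂ (Dual ℂ A)))) := by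
  have hl : ∀ (φ χ : Dual ℂ A) (c : ℂ), c • dualMul φ χ = dualMul (c • φ) χ := fun φ χ c => by
    ext x; simp [dualMul, TensorProduct.map_smul_left]
  have hs : ∀ (f : κ → Dual ℂ A) (χ : Dual ℂ A), ∑ z, dualMul (f z) χ = dualMul (∑ z, f z) χ := by
    intro f χ
    ext x
    simp only [LinearMap.sum_apply, dualMul_apply]
    generalize (comul x : A ⊗[ℂ] A) = X
    induction X using TensorProduct.induction_on with
    | zero => simp
    | add X X' h h' => simp only [map_add, ← h, ← h', Finset.sum_add_distrib]
    | tmul p q => simp [Finset.sum_mul]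
  ext x y χ : 3
  have e : ∑ z, M z y • entry P x z = ∑ z, M x z • entry P z y := by
    ext t
    have := congrFun (congrFun (h t).eq x) y
    simpa [Matrix.mul_apply, mul_comm] using this
  have e1 : (coeffOp P * M.map (algebraMap ℂ (End ℂ (Dual ℂ A)))) x y χ
      = dualMul (∑ z, M z y • entry P x z) χ := by
    rw [← hs]
    simp only [Matrix.mul_apply, LinearMap.sum_apply, ← hl]
    refine Finset.sum_congr rfl fun z _ => ?_
    simp only [Matrix.map_apply, coeffOp, Matrix.of_apply, Module.End.mul_apply,
      Module.algebraMap_end_apply, map_smul]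
    rfl
  have e2 : (M.map (algebraMap ℂ (End ℂ (Dual ℂ A))) * coeffOp P) x y χ
      = dualMul (∑ z, M x z • entry P z y) χ := by
    rw [← hs]
    simp only [Matrix.mul_apply, LinearMap.sum_apply, ← hl]
    refine Finset.sum_congr rfl fun z _ => ?_
    simp only [Matrix.map_apply, coeffOp, Matrix.of_apply, Module.End.mul_apply,
      Module.algebraMap_end_apply]
    rfl
  rw [e1, e2, e]

end Pairings

/-! ### The fusion and exchange relations for three commuting copies. -/

section Relations
variable {A B : Type} [Ring A] [HopfAlgebra ℂ A] [Ring B] [Algebra ℂ B] {I : Type} [Fintype I]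
  {a b : I → A} (R : IsRMatrix a b) {f₁ f₂ f₃ : A →ₐ[ℂ] B} {T₁ T₂ : B}
  (h12 : ∀ x y, Commute (f₁ x) (f₂ y)) (h13 : ∀ x y, Commute (f₁ x) (f₃ y))
  (h23 : ∀ x y, Commute (f₂ x) (f₃ y))
  (hT1 : ∀ h, f₃ h * T₁ = T₁ * convHom f₁ f₃ h13 h) (hT1' : ∀ h, Commute T₁ (f₂ h))
  (hT2 : ∀ h, f₃ h * T₂ = T₂ * convHom f₂ f₃ h23 h) (hT2' : ∀ h, Commute T₂ (f₁ h))

-- Indices `1` and `2` are the matrix spaces and `3` is the algebra in which the entries live. This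
-- is the fusion relation for `M ↦ R₁₃ R₃₁`; two Yang-Baxter moves bring `R₂₁` between the factors.
include R h13 h23 in
theorem fusion_pairing :
    pairing a b (convHom f₁ f₂ h12) f₃ * pairing a b f₃ (convHom f₁ f₂ h12) * pairing a b f₂ f₁
      = pairing a b f₁ f₃ * pairing a b f₃ f₁ * pairing a b f₂ f₁
        * (pairing a b f₂ f₃ * pairing a b f₃ f₂) := by
  have s12 := fun x y => (h12 y x).symm
  have s13 := fun x y => (h13 y x).symm
  have s23 := fun x y => (h23 y x).symm
  rw [R.pairing_convHom_left h12 h23, R.pairing_convHom_right h12 s23]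
  have e1 := R.yang_baxter s23 s13 s12
  have e2 := R.yang_baxter h23 s12 s13
  simp only [mul_assoc] at e1 e2 ⊢
  rw [e1, ← mul_assoc (pairing a b f₂ f₁), ← mul_assoc (pairing a b f₂ f₃), e2]
  simp only [mul_assoc]

-- The Heisenberg relation inserts a coproduct in the third leg, and the hexagon axiom splits it,
-- producing an extra R-matrix between the two matrix spaces.
include R h23 hT1 hT1' in
theorem pairing23_mul : pairing a b f₂ f₃ * T₁
    = T₁ * (pairing a b f₂ f₃ * pairing a b f₂ f₁) := by
  rw [← R.pairing_convHom_right h13 h23, pairing, pairing, Finset.sum_mul, Finset.mul_sum]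
  refine Finset.sum_congr rfl fun i _ => ?_
  rw [mul_assoc, hT1, ← mul_assoc, ← (hT1' _).eq, mul_assoc]

include R h23 hT1 hT1' in
theorem pairing32_mul : pairing a b f₃ f₂ * T₁
    = T₁ * (pairing a b f₁ f₂ * pairing a b f₃ f₂) := by
  rw [← R.pairing_convHom_left h13 fun x y => (h23 y x).symm, pairing, pairing, Finset.sum_mul,
    Finset.mul_sum]
  refine Finset.sum_congr rfl fun i _ => ?_
  rw [mul_assoc, ← (hT1' _).eq, ← mul_assoc, hT1, mul_assoc]

-- Fusion for `B = R₁₃ T₁ R₃₁`. The R-matrices created when `T₁` and `T₂` are moved are exactly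
-- those that the Yang-Baxter equation needs.
include R h12 hT1 hT1' hT2 hT2' in
theorem fusion_handle :
    pairing a b (convHom f₁ f₂ h12) f₃ * (T₁ * T₂) * pairing a b f₃ (convHom f₁ f₂ h12)
        * pairing a b f₂ f₁
      = pairing a b f₁ f₃ * T₁ * pairing a b f₃ f₁ * pairing a b f₂ f₁
        * (pairing a b f₂ f₃ * T₂ * pairing a b f₃ f₂) := by
  have s12 := fun x y => (h12 y x).symm
  have s13 := fun x y => (h13 y x).symm
  have s23 := fun x y => (h23 y x).symm
  rw [R.pairing_convHom_left h12 h23, R.pairing_convHom_right h12 s23]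
  have e1 := R.yang_baxter s23 s13 s12
  have e2 := R.yang_baxter h23 s12 s13
  have m1 := pairing23_mul R h13 h23 hT1 hT1'
  have m2 := pairing32_mul R h23 h13 hT2 hT2'
  simp only [mul_assoc] at e1 e2 m1 m2 ⊢
  rw [e1, ← mul_assoc (pairing a b f₂ f₃) T₁, m1, ← mul_assoc (pairing a b f₃ f₁),
    ← mul_assoc (pairing a b f₃ f₁ * _), mul_assoc (pairing a b f₃ f₁), ← e2]
  simp only [mul_assoc]
  rw [← mul_assoc (pairing a b f₃ f₁) T₂, m2]
  simp only [mul_assoc]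

-- Exchange between `B = R₁₃ T₁ R₃₁` and `A = R₂₃ R₃₂`. The operator `T₁` is passed once in each
-- direction, and four instances of the Yang-Baxter equation reorder the rest.
include R h12 h23 hT1 hT1' in
theorem exchange_handle :
    pairing a b f₁ f₂ * (pairing a b f₁ f₃ * T₁ * pairing a b f₃ f₁) * pairing a b f₂ f₁
        * (pairing a b f₂ f₃ * pairing a b f₃ f₂) * pairing a b f₁ f₂
      = pairing a b f₂ f₃ * pairing a b f₃ f₂ * pairing a b f₁ f₂
        * (pairing a b f₁ f₃ * T₁ * pairing a b f₃ f₁) := by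
  have s12 := fun x y => (h12 y x).symm
  have s13 := fun x y => (h13 y x).symm
  have s23 := fun x y => (h23 y x).symm
  have e1 := R.yang_baxter h23 s12 s13
  have e2 := R.yang_baxter h12 h13 h23
  have e3 := R.yang_baxter s13 s23 h12
  have e4 := R.yang_baxter h13 h12 s23
  have m1 := pairing23_mul R h13 h23 hT1 hT1'
  have m2 := pairing32_mul R h13 h23 hT1 hT1'
  generalize pairing a b f₁ f₂ = x12 at *
  generalize pairing a b f₂ f₁ = x21 at *
  generalize pairing a b f₁ f₃ = x13 at *
  generalize pairing a b f₃ f₁ = x31 at *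
  generalize pairing a b f₂ f₃ = x23 at *
  generalize pairing a b f₃ f₂ = x32 at *
  calc x12 * (x13 * T₁ * x31) * x21 * (x23 * x32) * x12
      = x12 * x13 * T₁ * (x31 * x21 * x23) * x32 * x12 := by simp only [mul_assoc]
    _ = x12 * x13 * (T₁ * (x23 * x21)) * x31 * x32 * x12 := by rw [← e1]; simp only [mul_assoc]
    _ = (x12 * x13 * x23) * T₁ * (x31 * x32 * x12) := by rw [← m1]; simp only [mul_assoc]
    _ = x23 * x13 * x12 * (T₁ * (x12 * x32)) * x31 := by rw [e2, e3]; simp only [mul_assoc]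
    _ = x23 * (x13 * x12 * x32) * T₁ * x31 := by rw [← m2]; simp only [mul_assoc]
    _ = _ := by rw [e4]; simp only [mul_assoc]

end Relations
end
end RestrictedQG

open scoped TensorProduct
namespace RestrictedQG
noncomputable section
open Coalgebra HopfAlgebra Module

/-! ### Tensor products of representations as convolutions. -/

section PairingsOfReps
variable {A : Type} [Ring A] [HopfAlgebra ℂ A] {I : Type} [Fintype I] {a b : I → A}
  {m n : ℕ} (U : MatRep A m) (V : MatRep A n)

theorem entry_firstHom (x y : Fin m × Fin n) :
    entry (firstHom n U) x y = (1 : Matrix (Fin n) (Fin n) ℂ) x.2 y.2 • coeff U x.1 y.1 := by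
  ext h
  change U h x.1 y.1 * (1 : Matrix (Fin n) (Fin n) ℂ) x.2 y.2 = _ * U h x.1 y.1
  rw [mul_comm]

theorem entry_secondHom (x y : Fin m × Fin n) :
    entry (secondHom m V) x y = (1 : Matrix (Fin m) (Fin m) ℂ) x.1 y.1 • coeff V x.2 y.2 := rfl

/-- The representation on `U ⊗ V`. -/
def tensorHom : A →ₐ[ℂ] Matrix (Fin m × Fin n) (Fin m × Fin n) ℂ :=
  convHom (firstHom n U) (secondHom m V) (commute_first_second U V)

theorem first_mul_second (x y : A) (i j : Fin m × Fin n) :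
    (firstHom n U x * secondHom m V y) i j = U x i.1 j.1 * V y i.2 j.2 := by
  change (first n (U x) * second m (V y)) i j = _
  rw [first, second, ← Matrix.mul_kronecker_mul, mul_one, one_mul]; rfl

theorem entry_tensorHom (x y : Fin m × Fin n) :
    entry (tensorHom U V) x y = dualMul (coeff U x.1 y.1) (coeff V x.2 y.2) := by
  ext h
  rw [entry_apply, tensorHom, convHom_apply, dualMul_apply]
  generalize (comul h : A ⊗[ℂ] A) = X
  induction X using TensorProduct.induction_on with
  | zero => simp
  | add X X' h h' => simp only [map_add, Matrix.add_apply, h, h']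
  | tmul p q => rw [leg_tmul, leg_tmul]; exact first_mul_second U V p q x y

theorem scalHom_tensorHom (B : Type) [Ring B] [Algebra ℂ B] :
    scalHom B (tensorHom U V) = convHom (scalHom B (firstHom n U)) (scalHom B (secondHom m V))
      (commute_scalHom (commute_first_second U V)) := by
  ext h : 1
  rw [convHom_apply]
  change ((Algebra.ofId ℂ B).mapMatrix).toLinearMap (tensorHom U V h) = _
  rw [tensorHom, convHom_apply]
  generalize (comul h : A ⊗[ℂ] A) = X
  induction X using TensorProduct.induction_on with
  | zero => simp
  | add X X' h h' => simp only [map_add, h, h']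
  | tmul p q => simp [scalHom]

theorem scal_rep₂ (B : Type) [Ring B] [Algebra ℂ B] :
    scal B (rep₂ U V (∑ i, a i ⊗ₜ[ℂ] b i))
      = pairing a b (scalHom B (firstHom n U)) (scalHom B (secondHom m V)) := by
  have h : rep₂ U V (∑ i, a i ⊗ₜ[ℂ] b i) = ∑ i, firstHom n U (a i) * secondHom m V (b i) := by
    ext x y
    rw [Matrix.sum_apply]
    simp only [first_mul_second, rep₂, Matrix.of_apply, map_sum]
    rfl
  change (Algebra.ofId ℂ B).mapMatrix _ = _
  rw [h, map_sum, pairing]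
  simp [scalHom]

theorem scal_rep₂_flip (B : Type) [Ring B] [Algebra ℂ B] :
    scal B (rep₂ U V (tensorFlip (∑ i, a i ⊗ₜ[ℂ] b i)))
      = pairing a b (scalHom B (secondHom m V)) (scalHom B (firstHom n U)) := by
  have : tensorFlip (∑ i, a i ⊗ₜ[ℂ] b i) = ∑ i, b i ⊗ₜ[ℂ] a i := by simp [tensorFlip]
  rw [this, scal_rep₂, pairing, pairing]
  exact Finset.sum_congr rfl fun i _ => (commute_scalHom (commute_first_second U V) _ _).eq

end PairingsOfReps

/-! ### Morphisms out of the loop algebra and the handle algebra. -/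

section Handle
variable {H Ht : Type} [Ring H] [HopfAlgebra ℂ H] [Ring Ht] [HopfAlgebra ℂ Ht]
  (ι : H →ₐ[ℂ] Ht)

/-- The matrix of values of a linear map on the matrix coefficients. -/
def coeffMat {B κ : Type} [Ring B] [Algebra ℂ B] [Fintype κ] [DecidableEq κ]
    (G : Dual ℂ H →ₗ[ℂ] B) (P : Ht →ₐ[ℂ] Matrix κ κ ℂ) : Matrix κ κ B :=
  Matrix.of fun x y => G (entry P x y ∘ₗ ι.toLinearMap)

section
variable {B : Type} [Ring B] [Algebra ℂ B] (G : Dual ℂ H →ₗ[ℂ] B) {m n : ℕ} (U : MatRep Ht m)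
  (V : MatRep Ht n)

theorem coeffMat_firstHom : coeffMat ι G (firstHom n U) = first n (coeffMat ι G U) := by
  ext x y
  change G (entry (firstHom n U) x y ∘ₗ _) = G (entry U x.1 y.1 ∘ₗ _)
    * (1 : Matrix (Fin n) (Fin n) B) x.2 y.2
  rw [entry_firstHom, LinearMap.smul_comp, map_smul, Matrix.one_apply, Matrix.one_apply]
  split_ifs
  · simp; rfl
  · simp

theorem coeffMat_secondHom : coeffMat ι G (secondHom m V) = second m (coeffMat ι G V) := by
  ext x y
  change G (entry (secondHom m V) x y ∘ₗ _) = (1 : Matrix (Fin m) (Fin m) B) x.1 y.1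
    * G (entry V x.2 y.2 ∘ₗ _)
  rw [entry_secondHom, LinearMap.smul_comp, map_smul, Matrix.one_apply, Matrix.one_apply]
  split_ifs
  · simp; rfl
  · simp

end

theorem map_first {B C : Type} [Semiring B] [Algebra ℂ B] [Semiring C] [Algebra ℂ C] (f : B →ₐ[ℂ] C) {m : ℕ}
    (n : ℕ) (X : Matrix (Fin m) (Fin m) B) : f.mapMatrix (first n X) = first n (X.map f) := by
  ext x y
  change f (X x.1 y.1 * (1 : Matrix (Fin n) (Fin n) B) x.2 y.2) = f (X x.1 y.1)
    * (1 : Matrix (Fin n) (Fin n) C) x.2 y.2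
  rw [Matrix.one_apply, Matrix.one_apply]
  split_ifs <;> simp

theorem map_second {B C : Type} [Semiring B] [Algebra ℂ B] [Semiring C] [Algebra ℂ C] (f : B →ₐ[ℂ] C) {n : ℕ}
    (m : ℕ) (X : Matrix (Fin n) (Fin n) B) : f.mapMatrix (second m X) = second m (X.map f) := by
  ext x y
  change f ((1 : Matrix (Fin m) (Fin m) B) x.1 y.1 * X x.2 y.2)
    = (1 : Matrix (Fin m) (Fin m) C) x.1 y.1 * f (X x.2 y.2)
  rw [Matrix.one_apply, Matrix.one_apply]
  split_ifs <;> simp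

theorem map_scal {B C : Type} [Semiring B] [Algebra ℂ B] [Semiring C] [Algebra ℂ C] (f : B →ₐ[ℂ] C)
    {m n : ℕ} (X : Matrix (Fin m × Fin n) (Fin m × Fin n) ℂ) :
    f.mapMatrix (scal B X) = scal C X := by
  ext x y
  simp [scal]

variable {I : Type} [Fintype I] {a b : I → Ht}

/-- The coproduct is compatible with the inclusion. -/
structure IsHopfIncl : Prop where
  injective : Function.Injective ι
  comul : ∀ x, Coalgebra.comul (R := ℂ) (ι x)
    = TensorProduct.map ι.toLinearMap ι.toLinearMap (Coalgebra.comul (R := ℂ) x)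
  counit : ∀ x, Coalgebra.counit (R := ℂ) (ι x) = Coalgebra.counit (R := ℂ) x

variable {ι}

theorem IsHopfIncl.dualMul_comp (hι : IsHopfIncl ι) (φ ψ : Dual ℂ Ht) :
    dualMul φ ψ ∘ₗ ι.toLinearMap = dualMul (φ ∘ₗ ι.toLinearMap) (ψ ∘ₗ ι.toLinearMap) := by
  ext x
  rw [LinearMap.comp_apply, dualMul_apply, dualMul_apply, AlgHom.toLinearMap_apply, hι.comul]
  generalize (Coalgebra.comul x : H ⊗[ℂ] H) = X
  induction X using TensorProduct.induction_on with
  | zero => simp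
  | add X X' h h' => simp only [map_add, h, h']
  | tmul p q => simp

variable (Rt : Ht ⊗[ℂ] Ht)

/-- A criterion for the fusion relations. -/
theorem exists_L01_lift (hι : IsHopfIncl ι) {B : Type} [Ring B] [Algebra ℂ B]
    (G : Dual ℂ H →ₗ[ℂ] B) (h1 : G Coalgebra.counit = 1)
    (hG : ∀ {m n : ℕ} (U : MatRep Ht m) (V : MatRep Ht n),
      coeffMat ι G (tensorHom U V) * scal B (rep₂ U V (tensorFlip Rt))
        = coeffMat ι G (firstHom n U) * scal B (rep₂ U V (tensorFlip Rt))
          * coeffMat ι G (secondHom m V)) :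
    ∃ Ψ : L01 ι Rt →ₐ[ℂ] B, ∀ f, Ψ (L01.mk ι Rt (TensorAlgebra.ι ℂ f)) = G f := by
  refine ⟨RingQuot.liftAlgHom ℂ ⟨TensorAlgebra.lift ℂ G, ?_⟩, fun f => ?_⟩
  · intro X Y hXY
    cases hXY with
    | unit => simpa using h1
    | @fusion m n U V hU hV x y =>
      have h := congrFun (congrFun (hG U V) x) y
      set θ := TensorAlgebra.lift ℂ G
      have e1 : θ.mapMatrix (TMat₂ ι U V) = coeffMat ι G (tensorHom U V) := by
        ext x y
        simp only [coeffMat, Matrix.of_apply, entry_tensorHom, hι.dualMul_comp]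
        exact TensorAlgebra.lift_ι_apply _ _
      have e2 : ∀ {k : ℕ} (W : MatRep Ht k), (TMat ι W).map θ = coeffMat ι G W := by
        intro k W; ext x y
        exact TensorAlgebra.lift_ι_apply _ _
      rw [coeffMat_firstHom, coeffMat_secondHom, ← e1, ← e2, ← e2, ← map_first, ← map_second,
        ← map_scal θ, ← map_mul, ← map_mul, ← map_mul] at h
      exact h
  · exact (RingQuot.liftAlgHom_mkAlgHom_apply ℂ _ _ _).trans (TensorAlgebra.lift_ι_apply _ _)


/-- A criterion for the exchange relations. -/
theorem exists_L10_lift {B : Type} [Ring B] [Algebra ℂ B] (ΦB ΦA : L01 ι Rt →ₐ[ℂ] B)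
    (GB GA : Dual ℂ H →ₗ[ℂ] B)
    (hB : ∀ f, ΦB (L01.mk ι Rt (TensorAlgebra.ι ℂ f)) = GB f)
    (hA : ∀ f, ΦA (L01.mk ι Rt (TensorAlgebra.ι ℂ f)) = GA f)
    (hG : ∀ {m n : ℕ} (U : MatRep Ht m) (V : MatRep Ht n),
      scal B (rep₂ U V Rt) * coeffMat ι GB (firstHom n U) * scal B (rep₂ U V (tensorFlip Rt))
        * coeffMat ι GA (secondHom m V) * scal B (rep₂ U V Rt)
      = coeffMat ι GA (secondHom m V) * scal B (rep₂ U V Rt) * coeffMat ι GB (firstHom n U)) :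
    ∃ Φ : L10 ι Rt →ₐ[ℂ] B, Φ.comp (L10.jB ι Rt) = ΦB ∧ Φ.comp (L10.jA ι Rt) = ΦA := by
  let θ : FreeL ι Rt →ₐ[ℂ] B := LinearAlgebra.FreeProduct.lift ℂ
    (fun _ : Fin 2 => L01 ι Rt) (fun {i} => if i = 0 then ΦB else ΦA)
  have hθB : ∀ x, θ (freeB ι Rt x) = ΦB x := fun x => by
    have := LinearAlgebra.FreeProduct.lift_comp_ι ℂ (fun _ : Fin 2 => L01 ι Rt)
      (fun {i} => if i = 0 then ΦB else ΦA) (i := 0)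
    exact AlgHom.congr_fun this x
  have hθA : ∀ x, θ (freeA ι Rt x) = ΦA x := fun x => by
    have := LinearAlgebra.FreeProduct.lift_comp_ι ℂ (fun _ : Fin 2 => L01 ι Rt)
      (fun {i} => if i = 0 then ΦB else ΦA) (i := 1)
    exact AlgHom.congr_fun this x
  refine ⟨RingQuot.liftAlgHom ℂ ⟨θ, ?_⟩, ?_, ?_⟩
  · intro X Y hXY
    cases hXY with
    | @exchange m n U V hU hV x y =>
      have h := congrFun (congrFun (hG U V) x) y
      have eB : ∀ {k : ℕ} (W : MatRep Ht k),
          ((L01.M ι Rt W).map (freeB ι Rt)).map θ = coeffMat ι GB W := by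
        intro k W; ext x y
        exact (hθB _).trans (hB _)
      have eA : ∀ {k : ℕ} (W : MatRep Ht k),
          ((L01.M ι Rt W).map (freeA ι Rt)).map θ = coeffMat ι GA W := by
        intro k W; ext x y
        exact (hθA _).trans (hA _)
      rw [coeffMat_firstHom, coeffMat_secondHom, ← eB, ← eA, ← map_first, ← map_second,
        ← map_scal θ, ← map_scal θ, ← map_mul, ← map_mul, ← map_mul, ← map_mul, ← map_mul,
        ← map_mul] at h
      exact h
  · ext x
    exact (RingQuot.liftAlgHom_mkAlgHom_apply ℂ _ _ _).trans (hθB x)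
  · ext x
    exact (RingQuot.liftAlgHom_mkAlgHom_apply ℂ _ _ _).trans (hθA x)

/-- The span of the coefficients of the liftings of simple and principal indecomposable modules. -/
def liftSpan (ι : H →ₐ[ℂ] Ht) : Submodule ℂ (Dual ℂ Ht) :=
  Submodule.span ℂ {f | ∃ (n : ℕ) (U : MatRep Ht n) (_ : IsLifting ι U) (x y : Fin n),
    f = coeff U x y}

/-- The coefficients of the liftings separate the elements of the smaller algebra. -/
def HasEnoughLiftings (ι : H →ₐ[ℂ] Ht) : Prop :=
  ∀ f : Dual ℂ H, ∃ φ ∈ liftSpan ι, φ ∘ₗ ι.toLinearMap = f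

theorem liftSpan_mulRight {φ : Dual ℂ Ht} (hφ : φ ∈ liftSpan ι) (t : Ht) :
    φ ∘ₗ LinearMap.mulRight ℂ t ∈ liftSpan ι := by
  have : liftSpan ι ≤ (liftSpan ι).comap (LinearMap.mulRight ℂ t).dualMap := by
    refine Submodule.span_le.2 ?_
    rintro _ ⟨n, U, hU, x, y, rfl⟩
    have e : coeff U x y ∘ₗ LinearMap.mulRight ℂ t = ∑ z, U t z y • coeff U x z := by
      ext h
      simp [coeff, Matrix.mul_apply, mul_comm]
    change coeff U x y ∘ₗ LinearMap.mulRight ℂ t ∈ liftSpan ι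
    rw [e]
    exact Submodule.sum_mem _ fun z _ => Submodule.smul_mem _ _
      (Submodule.subset_span ⟨n, U, hU, x, z, rfl⟩)
  exact this hφ

theorem liftSpan_mulLeft {φ : Dual ℂ Ht} (hφ : φ ∈ liftSpan ι) (t : Ht) :
    φ ∘ₗ LinearMap.mulLeft ℂ t ∈ liftSpan ι := by
  have : liftSpan ι ≤ (liftSpan ι).comap (LinearMap.mulLeft ℂ t).dualMap := by
    refine Submodule.span_le.2 ?_
    rintro _ ⟨n, U, hU, x, y, rfl⟩
    have e : coeff U x y ∘ₗ LinearMap.mulLeft ℂ t = ∑ z, U t x z • coeff U z y := by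
      ext h
      simp [coeff, Matrix.mul_apply]
    change coeff U x y ∘ₗ LinearMap.mulLeft ℂ t ∈ liftSpan ι
    rw [e]
    exact Submodule.sum_mem _ fun z _ => Submodule.smul_mem _ _
      (Submodule.subset_span ⟨n, U, hU, z, y, rfl⟩)
  exact this hφ

theorem L01.mk_surjective : Function.Surjective (L01.mk ι Rt) :=
  RingQuot.mkAlgHom_surjective ℂ _

/-- Morphisms from the loop algebra are determined on the matrices `M`. -/
theorem L01.hom_ext (hs : HasEnoughLiftings ι) {B : Type} [Semiring B] [Algebra ℂ B]
    {f g : L01 ι Rt →ₐ[ℂ] B}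
    (h : ∀ (n : ℕ) (U : MatRep Ht n), IsLifting ι U → ∀ x y,
      f (L01.M ι Rt U x y) = g (L01.M ι Rt U x y)) : f = g := by
  have h1 : f.comp (L01.mk ι Rt) = g.comp (L01.mk ι Rt) := by
    refine TensorAlgebra.hom_ext (LinearMap.ext fun w => ?_)
    obtain ⟨φ, hφ, rfl⟩ := hs w
    simp only [LinearMap.comp_apply]
    induction hφ using Submodule.span_induction with
    | mem φ hφ =>
      obtain ⟨n, U, hU, x, y, rfl⟩ := hφ
      exact h n U hU x y
    | zero => simp
    | add φ ψ _ _ h1 h2 => simp only [LinearMap.add_comp, map_add, h1, h2]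
    | smul c φ _ h1 => simp only [LinearMap.smul_comp, map_smul, h1]
  ext x
  obtain ⟨x, rfl⟩ := L01.mk_surjective Rt x
  exact AlgHom.congr_fun h1 x

theorem first_scal_second_apply {B : Type} [Ring B] [Algebra ℂ B] {m n : ℕ}
    (X : Matrix (Fin m) (Fin m) B) (Z : Matrix (Fin m × Fin n) (Fin m × Fin n) ℂ)
    (Y : Matrix (Fin n) (Fin n) B) (x y : Fin m) (z w : Fin n) :
    (first n X * scal B Z * second m Y) (x, z) (y, w)
      = ∑ e, ∑ d, Z (e, z) (y, d) • (X x e * Y d w) := by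
  have h1 : ∀ c d, (first n X * scal B Z) (x, z) (c, d) = ∑ e, Z (e, z) (c, d) • X x e := by
    intro c d
    rw [Matrix.mul_apply, Fintype.sum_prod_type]
    refine Finset.sum_congr rfl fun e _ => ?_
    rw [Finset.sum_eq_single z]
    · simp [first, scal, Algebra.smul_def, Algebra.commutes]
    · intro f _ hf; simp [first, hf.symm]
    · simp
  rw [Matrix.mul_apply, Fintype.sum_prod_type, Finset.sum_eq_single y]
  · simp only [h1, Finset.sum_mul]
    rw [Finset.sum_comm]
    refine Finset.sum_congr rfl fun e _ => Finset.sum_congr rfl fun d _ => ?_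
    simp [second]
  · intro c _ hc
    refine Finset.sum_eq_zero fun d _ => ?_
    simp [second, hc]
  · simp

/-- The generators exhaust the loop algebra. -/
theorem L01.exists_eq (R : IsRMatrix a b) (hs : HasEnoughLiftings ι)
    (hRt : Rt = ∑ i, a i ⊗ₜ[ℂ] b i) (w : L01 ι Rt) :
    ∃ f : Dual ℂ H, w = L01.mk ι Rt (TensorAlgebra.ι ℂ f) := by
  let m : Dual ℂ Ht →ₗ[ℂ] L01 ι Rt := (L01.mk ι Rt).toLinearMap ∘ₗ TensorAlgebra.ι ℂ
    ∘ₗ ι.toLinearMap.dualMap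
  let N : Submodule ℂ (L01 ι Rt) := LinearMap.range ((L01.mk ι Rt).toLinearMap ∘ₗ TensorAlgebra.ι ℂ)
  have hmN : ∀ φ, m φ ∈ N := fun φ => ⟨_, rfl⟩
  -- The fusion relation, read entry by entry and extended bilinearly: products of generators
  -- twisted by `R'` between them are combinations of generators.
  have h1 : ∀ φ ∈ liftSpan ι, ∀ ψ ∈ liftSpan ι,
      ∑ j, m (φ ∘ₗ LinearMap.mulRight ℂ (b j)) * m (ψ ∘ₗ LinearMap.mulLeft ℂ (a j)) ∈ N := by
    intro φ hφ ψ hψ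
    induction hφ, hψ using Submodule.span_induction₂ with
    | zero_left => simp
    | zero_right => simp
    | add_left φ φ' ψ _ _ _ h h' =>
      simp only [LinearMap.add_comp, map_add, add_mul, Finset.sum_add_distrib]
      exact N.add_mem h h'
    | add_right φ φ' ψ _ _ _ h h' =>
      simp only [LinearMap.add_comp, map_add, mul_add, Finset.sum_add_distrib]
      exact N.add_mem h h'
    | smul_left c φ ψ _ _ h =>
      simp only [LinearMap.smul_comp, map_smul, smul_mul_assoc, ← Finset.smul_sum]
      exact N.smul_mem _ h
    | smul_right c φ ψ _ _ h =>
      simp only [LinearMap.smul_comp, map_smul, mul_smul_comm, ← Finset.smul_sum]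
      exact N.smul_mem _ h
    | mem_mem φ ψ hφ hψ =>
      obtain ⟨k, U, hU, x, y, rfl⟩ := hφ
      obtain ⟨l, V, hV, z, w, rfl⟩ := hψ
      have h : L01.mk ι Rt _ = L01.mk ι Rt _ :=
        RingQuot.mkAlgHom_rel ℂ (FusionRel.fusion (R := Rt) U V hU hV (x, z) (y, w))
      rw [first_scal_second_apply, Matrix.mul_apply] at h
      have e1 : ∑ j, m (coeff U x y ∘ₗ LinearMap.mulRight ℂ (b j))
            * m (coeff V z w ∘ₗ LinearMap.mulLeft ℂ (a j))
          = L01.mk ι Rt (∑ e, ∑ d, rep₂ U V (tensorFlip Rt) (e, z) (y, d)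
            • (TMat ι U x e * TMat ι V d w)) := by
        have f1 : ∀ j, m (coeff U x y ∘ₗ LinearMap.mulRight ℂ (b j))
            = ∑ e, U (b j) e y • m (coeff U x e) := by
          intro j
          simp only [← map_smul, ← map_sum]
          congr 1; ext h
          simp [coeff, Matrix.mul_apply, mul_comm]
        have f2 : ∀ j, m (coeff V z w ∘ₗ LinearMap.mulLeft ℂ (a j))
            = ∑ d, V (a j) z d • m (coeff V d w) := by
          intro j
          simp only [← map_smul, ← map_sum]
          congr 1; ext h
          simp [coeff, Matrix.mul_apply]
        have f3 : ∀ e d, rep₂ U V (tensorFlip Rt) (e, z) (y, d)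
            = ∑ j, U (b j) e y * V (a j) z d := by
          intro e d
          simp [rep₂, tensorFlip, hRt, coeff]
        simp only [f1, f2, f3, Finset.sum_mul_sum, map_sum, map_smul, map_mul, smul_mul_smul_comm,
          Finset.sum_smul]
        rw [Finset.sum_comm]
        refine Finset.sum_congr rfl fun e _ => ?_
        rw [Finset.sum_comm]
        rfl
      rw [e1, ← h, map_sum]
      refine N.sum_mem fun c _ => ?_
      have e2 : scal (TensorAlgebra ℂ (Dual ℂ H)) (rep₂ U V (tensorFlip Rt)) c (y, w)
          = algebraMap ℂ _ (rep₂ U V (tensorFlip Rt) c (y, w)) := rfl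
      rw [e2, ← Algebra.commutes, ← Algebra.smul_def, map_smul]
      exact N.smul_mem _ ⟨_, rfl⟩
  -- Inverting the twist. Inserting `a_i a_j ⊗ b_j S(b_i)`, whose sum is `1`, writes an untwisted
  -- product as a sum of twisted ones.
  have h2 : ∀ φ ∈ liftSpan ι, ∀ ψ ∈ liftSpan ι, m φ * m ψ ∈ N := by
    intro φ hφ ψ hψ
    let Lφ : Ht →ₗ[ℂ] L01 ι Rt :=
      { toFun := fun t => m (φ ∘ₗ LinearMap.mulRight ℂ t)
        map_add' := fun s t => by rw [← map_add]; congr 1; ext x; simp [mul_add]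
        map_smul' := fun c t => by rw [RingHom.id_apply, ← map_smul]; congr 1; ext x; simp }
    let Lψ : Ht →ₗ[ℂ] L01 ι Rt :=
      { toFun := fun t => m (ψ ∘ₗ LinearMap.mulLeft ℂ t)
        map_add' := fun s t => by rw [← map_add]; congr 1; ext x; simp [add_mul]
        map_smul' := fun c t => by rw [RingHom.id_apply, ← map_smul]; congr 1; ext x; simp }
    have h := congrArg (gel Lψ Lφ) R.mul_antipode_b
    simp only [map_sum, Algebra.TensorProduct.one_def, gel_tmul] at h
    have e1 : Lφ 1 * Lψ 1 = m φ * m ψ := by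
      change m _ * m _ = _
      congr 2 <;> ext x <;> simp
    rw [← e1, ← h]
    refine N.sum_mem fun i _ => ?_
    have := h1 _ (liftSpan_mulRight hφ (antipode ℂ (b i))) _ (liftSpan_mulLeft hψ (a i))
    convert this using 4 with j
    · change m _ = m _
      congr 1; ext x; simp [mul_assoc]
    · change m _ = m _
      congr 1; ext x; simp [mul_assoc]
  have h3 : ∀ x ∈ N, ∀ y ∈ N, x * y ∈ N := by
    rintro _ ⟨f, rfl⟩ _ ⟨f', rfl⟩
    obtain ⟨φ, hφ, rfl⟩ := hs f
    obtain ⟨ψ, hψ, rfl⟩ := hs f'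
    exact h2 φ hφ ψ hψ
  have h4 : (1 : L01 ι Rt) ∈ N := ⟨Coalgebra.counit, by
    have h : L01.mk ι Rt _ = L01.mk ι Rt _ := RingQuot.mkAlgHom_rel ℂ (FusionRel.unit (R := Rt))
    rw [map_one] at h
    exact h⟩
  have h5 : w ∈ N := by
    obtain ⟨t, rfl⟩ := L01.mk_surjective Rt w
    induction t using TensorAlgebra.induction with
    | algebraMap c => rw [Algebra.algebraMap_eq_smul_one, map_smul, map_one]; exact N.smul_mem _ h4
    | ι f => exact ⟨f, rfl⟩
    | mul x y hx hy => rw [map_mul]; exact h3 _ hx _ hy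
    | add x y hx hy => rw [map_add]; exact N.add_mem hx hy
  obtain ⟨f, hf⟩ := h5
  exact ⟨f, hf.symm⟩

theorem sliceR_comp (φ : Dual ℂ Ht) (X : H ⊗[ℂ] H) :
    ι (sliceR (φ ∘ₗ ι.toLinearMap) X)
      = sliceR φ (TensorProduct.map ι.toLinearMap ι.toLinearMap X) := by
  induction X using TensorProduct.induction_on with
  | zero => simp
  | add X X' h h' => simp only [map_add, h, h']
  | tmul p q => simp

/-- Contraction of a tensor with linear forms. -/
def sliceMap (X : H ⊗[ℂ] H) : Dual ℂ H →ₗ[ℂ] H where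
  toFun f := sliceR f X
  map_add' f g := by simp [sliceR, TensorProduct.map_add_right]
  map_smul' c f := by simp [sliceR, TensorProduct.map_smul_right]

omit [HopfAlgebra ℂ H] in
theorem sliceR_comm [HopfAlgebra ℂ H] (φ : Dual ℂ H) (X : H ⊗[ℂ] H) :
    sliceR φ X = sliceL φ (TensorProduct.comm ℂ H H X) := by
  induction X using TensorProduct.induction_on with
  | zero => simp
  | add X X' h h' => simp only [map_add, h, h']
  | tmul p q => simp

theorem comm_Q (R : IsRMatrix a b) : TensorProduct.comm ℂ Ht Ht R.Q
    = (∑ i, a i ⊗ₜ[ℂ] b i) * ∑ i, b i ⊗ₜ[ℂ] a i := by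
  rw [R.Q_eq_sum]
  simp [Finset.sum_mul_sum]

section Morphisms
variable (R : IsRMatrix a b) (hRt : Rt = ∑ i, a i ⊗ₜ[ℂ] b i) (hι : IsHopfIncl ι) {QH : H ⊗[ℂ] H}
  (hQ : TensorProduct.map ι.toLinearMap ι.toLinearMap QH = R.Q)

include hQ in
theorem coeffMat_sliceMap {B κ : Type} [Ring B] [Algebra ℂ B] [Fintype κ] [DecidableEq κ]
    (f : Ht →ₐ[ℂ] B) (P : Ht →ₐ[ℂ] Matrix κ κ ℂ) :
    (coeffMat ι (sliceMap QH) P).map (f.comp ι)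
      = pairing a b (scalHom B P) (diagHom κ f) * pairing a b (diagHom κ f) (scalHom B P) := by
  ext x y
  rw [pairing_mul_pairing_apply, ← comm_Q R, ← sliceR_comm, ← hQ, ← sliceR_comp]
  rfl

include hRt hι hQ in
/-- The morphism from the loop algebra given by the monodromy. -/
theorem exists_monodromy_hom : ∃ Ψ : L01 ι Rt →ₐ[ℂ] H,
    ∀ f, Ψ (L01.mk ι Rt (TensorAlgebra.ι ℂ f)) = sliceR f QH := by
  refine exists_L01_lift Rt hι (sliceMap QH) (hι.injective ?_) fun {m n} U V => ?_
  · have e : (Coalgebra.counit : H →ₗ[ℂ] ℂ) = (Coalgebra.counit : Ht →ₗ[ℂ] ℂ) ∘ₗ ι.toLinearMap := by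
      ext x; exact (hι.counit x).symm
    change ι (sliceR _ QH) = ι 1
    rw [e, sliceR_comp, hQ, R.Q_eq_sum, map_one]
    simp only [map_sum, sliceR_tmul, Bialgebra.counit_mul]
    calc _ = (∑ i, Coalgebra.counit (R := ℂ) (a i) • b i)
          * ∑ i, Coalgebra.counit (R := ℂ) (b i) • a i := by
          rw [Finset.sum_mul_sum]; simp only [smul_mul_smul_comm]
      _ = 1 := by rw [R.counit_a, R.counit_b, one_mul]
  -- The relation is verified after the injective map to the bigger algebra, the only place where
  -- the single legs of `R` make sense.
  · have hinj : Function.Injective (ι.mapMatrix (m := Fin m × Fin n)) :=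
      fun X Y h => Matrix.map_injective hι.injective h
    apply hinj
    have e : ∀ P : Ht →ₐ[ℂ] Matrix (Fin m × Fin n) (Fin m × Fin n) ℂ,
        ι.mapMatrix (coeffMat ι (sliceMap QH) P)
          = pairing a b (scalHom Ht P) (diagHom (Fin m × Fin n) (AlgHom.id ℂ Ht))
            * pairing a b (diagHom (Fin m × Fin n) (AlgHom.id ℂ Ht)) (scalHom Ht P) := fun P =>
      coeffMat_sliceMap R hQ (AlgHom.id ℂ Ht) P
    rw [map_mul, map_mul, map_mul, map_scal, e, e, e, hRt, scal_rep₂_flip, scalHom_tensorHom]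
    exact fusion_pairing R (commute_scalHom (commute_first_second U V))
      (commute_scalHom_diagHom (firstHom n U) (AlgHom.id ℂ Ht))
      (commute_scalHom_diagHom (secondHom m V) (AlgHom.id ℂ Ht))

/-- The element of `Ht ⊗ Ht` through which `B` acts. -/
def convElt (a b : I → Ht) (x : Ht) : Ht ⊗[ℂ] Ht :=
  (∑ i, (a i ⊗ₜ[ℂ] 1) * Coalgebra.comul (R := ℂ) (x * b i)) * ∑ j, b j ⊗ₜ[ℂ] a j

theorem convElt_add (x y : Ht) : convElt a b (x + y) = convElt a b x + convElt a b y := by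
  simp [convElt, add_mul, mul_add, Finset.sum_add_distrib]
theorem convElt_smul (c : ℂ) (x : Ht) : convElt a b (c • x) = c • convElt a b x := by
  simp [convElt, ← Finset.smul_sum]

/-- The operators by which the matrix coefficients act through `B`. -/
def convOp (a b : I → Ht) (φ : Dual ℂ Ht) : End ℂ (Dual ℂ Ht) where
  toFun χ :=
    { toFun := fun x => leg φ χ (convElt a b x)
      map_add' := fun x y => by rw [convElt_add, map_add]
      map_smul' := fun c x => by rw [convElt_smul, map_smul]; rfl }
  map_add' χ χ' := by
    ext x; simp [leg, TensorProduct.map_add_right]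
  map_smul' c χ := by
    ext x; simp [leg, TensorProduct.map_smul_right]

theorem convOp_apply (φ χ : Dual ℂ Ht) (x : Ht) :
    convOp a b φ χ x = leg φ χ (convElt a b x) := rfl

theorem sum_comm₄ {J K : Type} [Fintype J] [Fintype K] (f : J → J → K → K → ℂ) :
    ∑ i, ∑ j, ∑ w, ∑ z, f i j w z = ∑ w, ∑ z, ∑ i, ∑ j, f i j w z := by
  calc ∑ i, ∑ j, ∑ w, ∑ z, f i j w z = ∑ i, ∑ w, ∑ j, ∑ z, f i j w z :=
        Finset.sum_congr rfl fun i _ => Finset.sum_comm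
    _ = ∑ w, ∑ i, ∑ j, ∑ z, f i j w z := Finset.sum_comm
    _ = ∑ w, ∑ i, ∑ z, ∑ j, f i j w z :=
        Finset.sum_congr rfl fun w _ => Finset.sum_congr rfl fun i _ => Finset.sum_comm
    _ = _ := Finset.sum_congr rfl fun w _ => Finset.sum_comm

/-- This explains the shape of `convElt`: the left factor `a_i` and the inner `b_i` come from
`L^(+)`, the coproduct from `T`, and the last factor from the inverse of `L^(-)`. -/
theorem convOp_entry {κ : Type} [Fintype κ] [DecidableEq κ] (P : Ht →ₐ[ℂ] Matrix κ κ ℂ) :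
    Matrix.of (fun x y => convOp a b (entry P x y))
      = pairing a b (scalHom _ P) (diagHom κ (translateHom Ht)) * coeffOp P
        * pairing a b (diagHom κ (translateHom Ht)) (scalHom _ P) := by
  have h1 : ∀ (p q s : Ht) (x y : κ) (χ : Dual ℂ Ht) (Z : Ht ⊗[ℂ] Ht),
      leg (entry P x y) χ ((p ⊗ₜ 1) * Z * (q ⊗ₜ s))
        = ∑ w, ∑ z, P p x z * P q w y * leg (entry P z w) (translateHom Ht s χ) Z := by
    intro p q s x y χ Z
    induction Z using TensorProduct.induction_on with
    | zero => simp
    | add X X' h h' => simp only [mul_add, add_mul, map_add, h, h', Finset.sum_add_distrib]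
    | tmul m n =>
      simp only [Algebra.TensorProduct.tmul_mul_tmul, leg_tmul, entry_apply, map_mul,
        Matrix.mul_apply, Finset.sum_mul, one_mul, translateHom_apply]
      refine Finset.sum_congr rfl fun w _ => Finset.sum_congr rfl fun z _ => ?_
      ring
  refine Matrix.ext fun x y => LinearMap.ext fun χ => LinearMap.ext fun t => ?_
  have hT : ∀ (z w : κ) (ψ : Dual ℂ Ht) (r : Ht),
      coeffOp P z w ψ r = leg (entry P z w) ψ (Coalgebra.comul r) := fun _ _ _ _ => rfl
  rw [Matrix.of_apply, convOp_apply, convElt]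
  simp only [Matrix.mul_apply, pairing_scal_diag_apply, pairing_diag_scal_apply, map_sum,
    sliceL_tmul, map_smul, LinearMap.sum_apply, Module.End.mul_apply, LinearMap.smul_apply,
    translateHom_apply, Finset.sum_mul, Finset.mul_sum, h1, hT, entry_apply, smul_eq_mul]
  rw [sum_comm₄]
  refine Finset.sum_congr rfl fun w _ => ?_
  rw [Finset.sum_comm]
  refine Finset.sum_congr rfl fun j _ => Finset.sum_congr rfl fun z _ =>
    Finset.sum_congr rfl fun i _ => ?_
  ring

/-- An operator on the dual of the bigger algebra induces the given operator on the dual of the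
smaller one. -/
def Induces (ι : H →ₐ[ℂ] Ht) (X : End ℂ (Dual ℂ Ht)) (Y : End ℂ (Dual ℂ H)) : Prop :=
  ∀ ψ : Dual ℂ Ht, X ψ ∘ₗ ι.toLinearMap = Y (ψ ∘ₗ ι.toLinearMap)

section Induces
variable {κ : Type} {X X' : Matrix κ κ (End ℂ (Dual ℂ Ht))}
  {Y Y' : Matrix κ κ (End ℂ (Dual ℂ H))}

theorem induces_mul [Fintype κ] (h : ∀ x y, Induces ι (X x y) (Y x y)) (h' : ∀ x y, Induces ι (X' x y) (Y' x y))
    (x y : κ) : Induces ι ((X * X') x y) ((Y * Y') x y) := by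
  intro ψ
  ext t
  simp only [Matrix.mul_apply, LinearMap.sum_apply, Module.End.mul_apply, ← h' _ _ ψ,
    ← h _ _ (X' _ _ ψ), LinearMap.comp_apply]

theorem induces_scal {m n : ℕ} (Z : Matrix (Fin m × Fin n) (Fin m × Fin n) ℂ) (x y) :
    Induces ι (scal (End ℂ (Dual ℂ Ht)) Z x y) (scal (End ℂ (Dual ℂ H)) Z x y) := fun _ => rfl

/-- Restriction of forms along `ι` is onto, because of the retraction `r`. Hence an identity of
matrices of operators on the big dual forces the identity of the induced ones. -/
theorem induces_unique (r : Ht →ₗ[ℂ] H) (hr : ∀ x, r (ι x) = x)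
    (h : ∀ x y, Induces ι (X x y) (Y x y)) (h' : ∀ x y, Induces ι (X x y) (Y' x y)) : Y = Y' := by
  refine Matrix.ext fun x y => LinearMap.ext fun f => ?_
  have e : f = (f ∘ₗ r) ∘ₗ ι.toLinearMap := by ext x; simp [hr]
  rw [e, ← h, ← h']

end Induces

variable (r : Ht →ₗ[ℂ] H) (hr : ∀ x, r (ι x) = x)
  (hconv : ∀ x : H, ∃ Y : H ⊗[ℂ] H,
    convElt a b (ι x) = TensorProduct.map ι.toLinearMap ι.toLinearMap Y)

/-- The operators by which linear forms on the smaller algebra act through `B`. -/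
def convOpRes (a b : I → Ht) (ι : H →ₐ[ℂ] Ht) (r : Ht →ₗ[ℂ] H) : Dual ℂ H →ₗ[ℂ] End ℂ (Dual ℂ H) where
  toFun f := ι.toLinearMap.dualMap ∘ₗ convOp a b (f ∘ₗ r) ∘ₗ r.dualMap
  map_add' f f' := by
    ext ψ x
    simp [convOp_apply, leg, LinearMap.add_comp, TensorProduct.map_add_left]
  map_smul' c f := by
    ext ψ x
    simp [convOp_apply, leg, LinearMap.smul_comp, TensorProduct.map_smul_left]

-- The element through which `B` acts lies in the tensor square of the smaller algebra, so only the
-- restrictions of the two forms matter and the operator descends.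
include hr hconv in
theorem induces_convOp (φ : Dual ℂ Ht) :
    Induces ι (convOp a b φ) (convOpRes a b ι r (φ ∘ₗ ι.toLinearMap)) := by
  intro ψ
  ext x
  change leg φ ψ (convElt a b (ι x))
    = leg ((φ ∘ₗ ι.toLinearMap) ∘ₗ r) ((ψ ∘ₗ ι.toLinearMap) ∘ₗ r) (convElt a b (ι x))
  obtain ⟨Y, hY⟩ := hconv x
  rw [hY]
  generalize Y = Z
  induction Z using TensorProduct.induction_on with
  | zero => simp
  | add X X' h h' => simp only [map_add, h, h']
  | tmul p q => simp [hr]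

/-- The operators by which linear forms on the smaller algebra act through `A`. -/
def monodromyOp (QH : H ⊗[ℂ] H) : Dual ℂ H →ₗ[ℂ] End ℂ (Dual ℂ H) :=
  (translateHom H).toLinearMap ∘ₗ sliceMap QH

include hQ in
theorem induces_monodromy (φ : Dual ℂ Ht) :
    Induces ι (translateHom Ht (sliceR φ R.Q)) (monodromyOp QH (φ ∘ₗ ι.toLinearMap)) := by
  intro ψ
  ext x
  change ψ (ι x * _) = ψ (ι (x * sliceR _ QH))
  rw [← hQ, ← sliceR_comp]
  exact congrArg ψ (map_mul ι _ _).symm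

theorem dualMulLeft_smul (c : ℂ) (φ : Dual ℂ Ht) : dualMulLeft (c • φ) = c • dualMulLeft φ := by
  refine LinearMap.ext fun χ => LinearMap.ext fun x => ?_
  change dualMul (c • φ) χ x = c • dualMul φ χ x
  simp [dualMul, TensorProduct.map_smul_left]

/-- In the dual there is no R-matrix: coefficients of a tensor product are products of coefficients,
and left multiplications compose by associativity. -/
theorem coeffOp_tensorHom {m n : ℕ} (U : MatRep Ht m) (V : MatRep Ht n) :
    coeffOp (tensorHom U V) = coeffOp (firstHom n U) * coeffOp (secondHom m V) := by
  have h1 : ∀ x z, coeffOp (firstHom n U) x z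
      = (1 : Matrix (Fin n) (Fin n) ℂ) x.2 z.2 • dualMulLeft (coeff U x.1 z.1) := fun x z => by
    rw [← dualMulLeft_smul, ← entry_firstHom]; rfl
  have h2 : ∀ x z, coeffOp (secondHom m V) x z
      = (1 : Matrix (Fin m) (Fin m) ℂ) x.1 z.1 • dualMulLeft (coeff V x.2 z.2) := fun x z => by
    rw [← dualMulLeft_smul, ← entry_secondHom]; rfl
  have h3 : ∀ x z, coeffOp (tensorHom U V) x z
      = dualMulLeft (coeff U x.1 z.1) * dualMulLeft (coeff V x.2 z.2) := fun x z => by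
    refine LinearMap.ext fun χ => ?_
    change dualMul (entry _ _ _) χ = dualMul _ (dualMul _ χ)
    rw [entry_tensorHom, dualMul_assoc]
  refine Matrix.ext fun x y => ?_
  rw [Matrix.mul_apply, Fintype.sum_prod_type, h3, Finset.sum_eq_single y.1,
    Finset.sum_eq_single x.2]
  · rw [h1, h2, Matrix.one_apply_eq, Matrix.one_apply_eq, one_smul, one_smul]
  · intro z _ hz
    rw [h1, Matrix.one_apply_ne hz.symm, zero_smul, zero_mul]
  · exact fun h => absurd (Finset.mem_univ _) h
  · intro z _ hz
    refine Finset.sum_eq_zero fun w _ => ?_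
    rw [h2, Matrix.one_apply_ne hz, zero_smul, mul_zero]
  · exact fun h => absurd (Finset.mem_univ _) h

-- Needed for the relation that makes the trivial representation act as the unit; with a counit in
-- the first leg both R-matrices collapse.
include R in
theorem convOp_counit (χ : Dual ℂ Ht) : convOp a b Coalgebra.counit χ = χ := by
  ext x
  rw [convOp_apply, leg_eq_sliceL]
  congr 1
  have h1 : ∀ (p q s : Ht) (Z : Ht ⊗[ℂ] Ht), sliceL Coalgebra.counit ((p ⊗ₜ 1) * Z * (q ⊗ₜ s))
      = (Coalgebra.counit (R := ℂ) p * Coalgebra.counit (R := ℂ) q)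
        • (sliceL Coalgebra.counit Z * s) := by
    intro p q s Z
    induction Z using TensorProduct.induction_on with
    | zero => simp
    | add X X' h h' => simp only [mul_add, add_mul, map_add, smul_add, h, h']
    | tmul m n => simp [smul_smul, mul_comm, mul_left_comm]
  have h2 : ∀ y : Ht, sliceL Coalgebra.counit (Coalgebra.comul (R := ℂ) y) = y := fun y => by
    have := congrArg (TensorProduct.lid ℂ Ht) (rTensor_counit_comul (R := ℂ) y)
    rw [TensorProduct.lid_tmul, one_smul] at this
    exact this
  simp only [convElt, Finset.sum_mul, Finset.mul_sum, map_sum, h1, h2]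
  calc _ = x * ((∑ i, Coalgebra.counit (R := ℂ) (a i) • b i)
          * ∑ i, Coalgebra.counit (R := ℂ) (b i) • a i) := by
          rw [Finset.sum_mul_sum, Finset.sum_comm, Finset.mul_sum]
          refine Finset.sum_congr rfl fun i _ => ?_
          rw [Finset.mul_sum]
          refine Finset.sum_congr rfl fun j _ => ?_
          rw [smul_mul_smul_comm, mul_smul_comm, mul_assoc]
    _ = x := by rw [R.counit_a, R.counit_b, one_mul, mul_one]

include hRt hι hQ hr hconv in
/-- The action of the handle algebra. -/
theorem exists_handle_hom (Ψ : L01 ι Rt →ₐ[ℂ] H)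
    (hΨ : ∀ f, Ψ (L01.mk ι Rt (TensorAlgebra.ι ℂ f)) = sliceR f QH) :
    ∃ Φ : L10 ι Rt →ₐ[ℂ] End ℂ (Dual ℂ H), Φ.comp (L10.jA ι Rt) = (translateHom H).comp Ψ ∧
      ∀ f, Φ (L10.jB ι Rt (L01.mk ι Rt (TensorAlgebra.ι ℂ f))) = convOpRes a b ι r f := by
  have hB : ∀ {κ : Type} [Fintype κ] [DecidableEq κ] (P : Ht →ₐ[ℂ] Matrix κ κ ℂ) (x y : κ),
      Induces ι ((pairing a b (scalHom _ P) (diagHom κ (translateHom Ht)) * coeffOp P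
        * pairing a b (diagHom κ (translateHom Ht)) (scalHom _ P)) x y)
        (coeffMat ι (convOpRes a b ι r) P x y) := by
    intro κ _ _ P x y
    rw [← convOp_entry]
    exact induces_convOp r hr hconv _
  have hA : ∀ {κ : Type} [Fintype κ] [DecidableEq κ] (P : Ht →ₐ[ℂ] Matrix κ κ ℂ) (x y : κ),
      Induces ι ((pairing a b (scalHom _ P) (diagHom κ (translateHom Ht))
        * pairing a b (diagHom κ (translateHom Ht)) (scalHom _ P)) x y)
        (coeffMat ι (monodromyOp QH) P x y) := by
    intro κ _ _ P x y
    rw [pairing_mul_pairing_apply, ← comm_Q R, ← sliceR_comm]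
    exact induces_monodromy R hQ _
  -- Each relation is proved for the operators on the dual of the bigger algebra, where the factors
  -- exist separately, and then transferred to the induced operators.
  obtain ⟨ΦB, hΦB⟩ := exists_L01_lift Rt hι (convOpRes a b ι r) (by
      refine LinearMap.ext fun f => ?_
      have e : ∀ f : Dual ℂ H, f = (f ∘ₗ r) ∘ₗ ι.toLinearMap := fun f => by ext x; simp [hr]
      have hε : (Coalgebra.counit : H →ₗ[ℂ] ℂ)
          = (Coalgebra.counit : Ht →ₗ[ℂ] ℂ) ∘ₗ ι.toLinearMap := by
        ext x; exact (hι.counit x).symm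
      rw [e f, hε, ← induces_convOp r hr hconv, convOp_counit R]; rfl) (fun {m n} U V => by
      refine induces_unique r hr (induces_mul (hB (tensorHom U V)) (induces_scal _)) ?_
      have := fusion_handle R (B := Matrix (Fin m × Fin n) (Fin m × Fin n) (End ℂ (Dual ℂ Ht)))
        (commute_scalHom (commute_first_second U V))
        (commute_scalHom_diagHom (firstHom n U) (translateHom Ht))
        (commute_scalHom_diagHom (secondHom m V) (translateHom Ht))
        (translate_coeffOp _) (fun h => coeffOp_commute fun x => commute_first_second U V x h)
        (translate_coeffOp _) (fun h => coeffOp_commute fun x => (commute_first_second U V h x).symm)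
      rw [← coeffOp_tensorHom, ← scalHom_tensorHom, ← scal_rep₂_flip, ← hRt] at this
      rw [this]
      exact induces_mul (induces_mul (hB _) (induces_scal _)) (hB _))
  obtain ⟨Φ, h1, h2⟩ := exists_L10_lift Rt ΦB ((translateHom H).comp Ψ) (convOpRes a b ι r)
    (monodromyOp QH) hΦB (fun f => by rw [AlgHom.comp_apply, hΨ]; rfl) (fun {m n} U V => by
      have := exchange_handle R (B := Matrix (Fin m × Fin n) (Fin m × Fin n) (End ℂ (Dual ℂ Ht)))
        (commute_scalHom (commute_first_second U V))
        (commute_scalHom_diagHom (firstHom n U) (translateHom Ht))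
        (commute_scalHom_diagHom (secondHom m V) (translateHom Ht))
        (translate_coeffOp _) (fun h => coeffOp_commute fun x => commute_first_second U V x h)
      rw [← scal_rep₂_flip, ← scal_rep₂, ← hRt] at this
      refine induces_unique r hr (induces_mul (induces_mul (induces_mul (induces_mul
        (induces_scal _) (hB _)) (induces_scal _)) (hA _)) (induces_scal _)) ?_
      rw [this]
      exact induces_mul (induces_mul (hA _) (induces_scal _)) (hB _))
  exact ⟨Φ, h2, fun f => (AlgHom.congr_fun h1 _).trans (hΦB f)⟩

end Morphisms

end Handle
end
end RestrictedQG

open scoped TensorProduct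
namespace RestrictedQG
noncomputable section
open Coalgebra HopfAlgebra Module

/-! ### The action of the twists on symmetric linear forms. -/

section ModularAction
variable {H Ht : Type} [Ring H] [HopfAlgebra ℂ H] [Ring Ht] [HopfAlgebra ℂ Ht]
  {ι : H →ₐ[ℂ] Ht} {I : Type} [Fintype I] {a b : I → Ht} {Rt : Ht ⊗[ℂ] Ht}

theorem IsRSD.ext (hs : HasEnoughLiftings ι) (hι : Function.Injective ι)
    {Ψ Ψ' : L01 ι Rt →ₐ[ℂ] H} (h : IsRSD ι Rt Ψ) (h' : IsRSD ι Rt Ψ') : Ψ = Ψ' :=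
  L01.hom_ext Rt hs fun n U hU x y => hι ((h n U hU x y).trans (h' n U hU x y).symm)

/-- The condition fixes the action on every form that is a restriction, and all forms are; the
coefficients of liftings then determine the two composite morphisms. -/
theorem IsHandleRep.apply_eq (hs : HasEnoughLiftings ι) (r : Ht →ₗ[ℂ] H) (hr : ∀ x, r (ι x) = x)
    {Φ Φ' : L10 ι Rt →ₐ[ℂ] End ℂ (Dual ℂ H)} (h : IsHandleRep ι Rt Φ) (h' : IsHandleRep ι Rt Φ')
    (w : L01 ι Rt) : Φ (L10.jA ι Rt w) = Φ' (L10.jA ι Rt w)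
      ∧ Φ (L10.jB ι Rt w) = Φ' (L10.jB ι Rt w) := by
  have e : ∀ f : Dual ℂ H, f = (f ∘ₗ r) ∘ₗ ι.toLinearMap := fun f => by ext x; simp [hr]
  have hA : Φ.comp (L10.jA ι Rt) = Φ'.comp (L10.jA ι Rt) :=
    L01.hom_ext Rt hs fun n U hU x y => LinearMap.ext fun f => by
      rw [e f]
      exact (h n U hU x y _).2.trans (h' n U hU x y _).2.symm
  have hB : Φ.comp (L10.jB ι Rt) = Φ'.comp (L10.jB ι Rt) :=
    L01.hom_ext Rt hs fun n U hU x y => LinearMap.ext fun f => by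
      rw [e f]
      exact (h n U hU x y _).1.trans (h' n U hU x y _).1.symm
  exact ⟨AlgHom.congr_fun hA w, AlgHom.congr_fun hB w⟩

theorem opLplus_eq (hRt : Rt = ∑ i, a i ⊗ₜ[ℂ] b i) {n : ℕ} (U : MatRep Ht n) :
    opLplus Rt U = pairing a b (scalHom _ U) (diagHom (Fin n) (translateHom Ht)) := by
  refine Matrix.ext fun x y => ?_
  rw [pairing_scal_diag_apply, ← hRt]
  rfl

theorem opLminusInv_eq (hRt : Rt = ∑ i, a i ⊗ₜ[ℂ] b i) {n : ℕ} (U : MatRep Ht n) :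
    opLminusInv Rt U = pairing a b (diagHom (Fin n) (translateHom Ht)) (scalHom _ U) := by
  refine Matrix.ext fun x y => ?_
  have e : ∑ i, b i ⊗ₜ[ℂ] a i = tensorFlip Rt := by simp [tensorFlip, hRt]
  rw [pairing_diag_scal_apply, e]
  rfl

variable (R : IsRMatrix a b) (hRt : Rt = ∑ i, a i ⊗ₜ[ℂ] b i) {QH : H ⊗[ℂ] H}
  (hQ : TensorProduct.map ι.toLinearMap ι.toLinearMap QH = R.Q)

-- The required morphism contracts the first leg of `RR'`, while the constructed one contracts the
-- second leg of `R'R`; these tensors are flips of one another.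
include hRt hQ in
theorem isRSD_of_sliceR {Ψ : L01 ι Rt →ₐ[ℂ] H}
    (hΨ : ∀ f, Ψ (L01.mk ι Rt (TensorAlgebra.ι ℂ f)) = sliceR f QH) : IsRSD ι Rt Ψ := by
  intro n U _ x y
  have e : Rt * tensorFlip Rt = TensorProduct.comm ℂ Ht Ht R.Q := by
    rw [comm_Q, hRt]; simp [tensorFlip]
  have h1 : Ψ (L01.M ι Rt U x y) = sliceR (coeff U x y ∘ₗ ι.toLinearMap) QH := hΨ _
  rw [h1, sliceR_comp, hQ, e, sliceR_comm]
  rfl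

variable (r : Ht →ₗ[ℂ] H) (hr : ∀ x, r (ι x) = x)
  (hconv : ∀ x : H, ∃ Y : H ⊗[ℂ] H,
    convElt a b (ι x) = TensorProduct.map ι.toLinearMap ι.toLinearMap Y)

include hRt hQ hr hconv in
theorem isHandleRep_of_apply {Ψ : L01 ι Rt →ₐ[ℂ] H}
    (hΨ : ∀ f, Ψ (L01.mk ι Rt (TensorAlgebra.ι ℂ f)) = sliceR f QH)
    {Φ : L10 ι Rt →ₐ[ℂ] End ℂ (Dual ℂ H)}
    (hA : Φ.comp (L10.jA ι Rt) = (translateHom H).comp Ψ)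
    (hB : ∀ f, Φ (L10.jB ι Rt (L01.mk ι Rt (TensorAlgebra.ι ℂ f))) = convOpRes a b ι r f) :
    IsHandleRep ι Rt Φ := by
  intro n U _ x y ψ
  rw [opLplus_eq hRt, opLminusInv_eq hRt]
  constructor
  · have h := induces_convOp (ι := ι) r hr hconv (entry U x y) ψ
    have h1 := congrFun (congrFun (convOp_entry (a := a) (b := b) U) x) y
    rw [Matrix.of_apply] at h1
    rw [h1] at h
    exact (LinearMap.congr_fun (hB _) _).trans h.symm
  · rw [pairing_mul_pairing_apply, ← comm_Q R, ← sliceR_comm, induces_monodromy R hQ]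
    exact LinearMap.congr_fun ((AlgHom.congr_fun hA _).trans
      (congrArg (translateHom H) (hΨ _))) _

include hRt hQ hr hconv in
/-- The action of the mapping class group of the torus on symmetric linear forms. -/
theorem exists_modular_action [FiniteDimensional ℂ H] (hι : IsHopfIncl ι)
    (hs : HasEnoughLiftings ι) {g g' v vi Λ : H} (D : IsFactorizable g g' v vi Λ QH)
    (hext : ∀ ψ ∈ SLF H, ψ ∘ₗ r ∈ SLF Ht) (hv : ∀ x, ι v * x = x * ι v)
    (hvi : ∀ x, ι vi * x = x * ι vi) (hw : ι vi = ∑ i, b i * ι g * a i) :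
    ∃ (Ψ : L01 ι Rt ≃ₐ[ℂ] H) (Φ : L10 ι Rt →ₐ[ℂ] End ℂ (Dual ℂ H)) (α β : (End ℂ (SLF H))ˣ),
      IsRSD ι Rt Ψ.toAlgHom ∧ IsHandleRep ι Rt Φ ∧
      (∀ ψ : SLF H, (α.val ψ : Dual ℂ H) = Φ (L10.jA ι Rt (Ψ.symm vi)) (ψ : Dual ℂ H)) ∧
      (∀ ψ : SLF H, (β.val ψ : Dual ℂ H) = Φ (L10.jB ι Rt (Ψ.symm vi)) (ψ : Dual ℂ H)) ∧
      (QuotientGroup.mk α * QuotientGroup.mk β * QuotientGroup.mk α : ProjGL (SLF H))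
        = QuotientGroup.mk β * QuotientGroup.mk α * QuotientGroup.mk β ∧
      ((QuotientGroup.mk α * QuotientGroup.mk β : ProjGL (SLF H))) ^ 3 = 1 := by
  obtain ⟨Ψ, hΨ⟩ := exists_monodromy_hom Rt R hRt hι hQ
  obtain ⟨Φ, hA, hB⟩ := exists_handle_hom Rt R hRt hι hQ r hr hconv Ψ hΨ
  -- Every element of the loop algebra is the class of one linear form, so both halves of
  -- bijectivity reduce to those of the contraction of `QH`.
  have hbij : Function.Bijective Ψ := by
    constructor
    · intro w w' h
      obtain ⟨f, rfl⟩ := L01.exists_eq Rt R hs hRt w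
      obtain ⟨f', rfl⟩ := L01.exists_eq Rt R hs hRt w'
      rw [hΨ, hΨ] at h
      rw [D.bijective.1 h]
    · intro x
      obtain ⟨f, hf⟩ := D.bijective.2 x
      exact ⟨_, (hΨ f).trans hf⟩
  obtain ⟨lam, hl, hlΛ, hμ, hnd⟩ := D.exists_symmetric_integral
  obtain ⟨c, d, α, L, W, hc, hd, hα, hL, hct, h1, h2, h3⟩ := D.modular_relations hl hlΛ hμ hnd
  have hαu : α * IsFactorizable.slfMul D.v_comm = 1 ∧ IsFactorizable.slfMul D.v_comm * α = 1 := by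
    rw [hα]
    constructor
    · ext ψ x
      change ψ.1 (v * (vi * x)) = ψ.1 x
      rw [← mul_assoc, D.v_mul, one_mul]
    · ext ψ x
      change ψ.1 (vi * (v * x)) = ψ.1 x
      rw [← mul_assoc, D.mul_v, one_mul]
  let α' : (End ℂ (SLF H))ˣ := ⟨α, IsFactorizable.slfMul D.v_comm, hαu.1, hαu.2⟩
  obtain ⟨β, hβ, hbr, h6⟩ := exists_twist_units hc hd α' h1 h2 h3
  let Ψ' : L01 ι Rt ≃ₐ[ℂ] H := AlgEquiv.ofBijective Ψ hbij
  refine ⟨Ψ', Φ, α', β, ?_, ?_, fun ψ => ?_, fun ψ => ?_, hbr, h6⟩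
  · exact isRSD_of_sliceR R hRt hQ hΨ
  · exact isHandleRep_of_apply R hRt hQ r hr hconv hΨ hA hB
  · have e : Φ (L10.jA ι Rt (Ψ'.symm vi)) = translateHom H vi :=
      (AlgHom.congr_fun hA _).trans (congrArg (translateHom H) (Ψ'.apply_symm_apply vi))
    rw [e]
    change (α ψ : Dual ℂ H) = _
    rw [hα]
    ext x
    exact congrArg ψ.1 (D.vi_comm x)
  · set lv : Dual ℂ H := lam ∘ₗ LinearMap.mulLeft ℂ v with hlv
    let f₀ : Dual ℂ H := c⁻¹ • (lv ∘ₗ LinearMap.mulLeft ℂ g)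
    -- Since `D(lam(v ·)) = c v⁻¹`, the preimage of `v⁻¹` is the class of an explicit twisted form,
    -- and the action of `v_B⁻¹` becomes one operator `convOpRes`.
    have hf₀ : Ψ'.symm vi = L01.mk ι Rt (TensorAlgebra.ι ℂ f₀) := by
      rw [AlgEquiv.symm_apply_eq]
      change vi = Ψ _
      rw [hΨ]
      change vi = sliceMap QH f₀
      rw [map_smul]
      change vi = c⁻¹ • drinfeldMap g QH lv
      rw [hct, smul_smul, inv_mul_cancel₀ hc, one_smul]
    rw [hf₀, hB]
    have hlvS : lv ∈ SLF H := comp_mulLeft_mem_SLF hl D.v_comm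
    ext x
    obtain ⟨Y, hY⟩ := hconv x
    have e1 : convOpRes a b ι r f₀ ψ.1 x = c⁻¹ * leg ((lv ∘ₗ r) ∘ₗ LinearMap.mulLeft ℂ (ι g))
        (ψ.1 ∘ₗ r) (convElt a b (ι x)) := by
      change leg (f₀ ∘ₗ r) (ψ.1 ∘ₗ r) (convElt a b (ι x)) = _
      rw [hY]
      generalize Y = Z
      induction Z using TensorProduct.induction_on with
      | zero => simp
      | add X X' h h' => simp only [map_add, mul_add, h, h']
      | tmul p q => simp [f₀, hr, ← map_mul, mul_assoc]
    have hQ' : R.Q = Coalgebra.comul (R := ℂ) (ι vi) * (ι v ⊗ₜ ι v) := by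
      rw [← hQ, D.Q_eq, hι.comul]
      exact map_mul (Algebra.TensorProduct.map ι ι) _ _
    have hm : ι v * ι vi = 1 := by rw [← map_mul, D.v_mul, map_one]
    -- On symmetric forms this operator is `ψ ↦ (lam(v ·) * ψ(v ·))(v⁻¹ ·)`, up to `c⁻¹`. This is
    -- `c⁻¹ a L a⁻¹` applied to `ψ`, that is, `β`.
    have e2 := R.sum_conv_twist (hext _ hlvS) (hext _ ψ.2) hv hvi hm hQ' hw (ι x)
    have e3 : (((ψ.1 ∘ₗ r) ∘ₗ LinearMap.mulLeft ℂ (ι v)) ∘ₗ ι.toLinearMap)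
        = ψ.1 ∘ₗ LinearMap.mulLeft ℂ v := by
      ext y; simp [← map_mul, hr]
    have e4 : (lv ∘ₗ r) ∘ₗ ι.toLinearMap = lv := by ext y; simp [hr]
    have e5 := LinearMap.congr_fun (hι.dualMul_comp (lv ∘ₗ r)
      ((ψ.1 ∘ₗ r) ∘ₗ LinearMap.mulLeft ℂ (ι v))) (vi * x)
    rw [e3, e4] at e5
    rw [e1, convElt, e2, ← map_mul]
    refine Eq.trans ?_ (congrArg (c⁻¹ * ·) e5.symm)
    have e6 := LinearMap.congr_fun hβ (IsFactorizable.slfMul D.v_comm ψ)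
    have e7 : α'.val (IsFactorizable.slfMul D.v_comm ψ) = ψ := LinearMap.congr_fun hαu.1 ψ
    rw [Module.End.mul_apply, e7] at e6
    rw [e6]
    change c⁻¹ * (α (L (IsFactorizable.slfMul D.v_comm ψ)) : Dual ℂ H) x = _
    rw [hα, hL]
    rfl

end ModularAction
end
end RestrictedQG

open scoped TensorProduct
namespace RestrictedQG
noncomputable section
open Coalgebra HopfAlgebra Module

/-! ### Commutation with powers, and independence of the ordered monomials. -/

section Commutation
variable {B : Type*} [Ring B] [Algebra ℂ B]

/-- Each passage of `e` past one `f` releases a term in `g` and `h`, and moving these to the right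
yields geometric sums. The hypotheses are general enough that the roles of `E` and `F` can be
exchanged. -/
theorem mul_pow_sub_pow_mul {e f g h : B} {c w w' : ℂ} (h1 : e * f - f * e = c • (g - h))
    (h2 : g * f = w • (f * g)) (h3 : h * f = w' • (f * h)) (m : ℕ) :
    e * f ^ (m + 1) - f ^ (m + 1) * e
      = c • (f ^ m * ((∑ i ∈ Finset.range (m + 1), w ^ i) • g
        - (∑ i ∈ Finset.range (m + 1), w' ^ i) • h)) := by
  induction m with
  | zero => simpa using h1
  | succ m ih =>
    have e1 : e * f ^ (m + 1 + 1) - f ^ (m + 1 + 1) * e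
        = (e * f ^ (m + 1) - f ^ (m + 1) * e) * f + f ^ (m + 1) * (e * f - f * e) := by
      simp only [sub_mul, mul_sub, pow_succ f (m + 1), mul_assoc]; abel
    rw [e1, ih, h1, Finset.sum_range_succ' _ (m + 1), Finset.sum_range_succ' _ (m + 1)]
    have e2 : ∀ u : ℂ, ∑ i ∈ Finset.range (m + 1), u ^ (i + 1)
        = u * ∑ i ∈ Finset.range (m + 1), u ^ i := fun u => by
      rw [Finset.mul_sum]; exact Finset.sum_congr rfl fun i _ => pow_succ' _ _
    rw [e2, e2]
    generalize ∑ i ∈ Finset.range (m + 1), w ^ i = x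
    generalize ∑ i ∈ Finset.range (m + 1), w' ^ i = y
    rw [smul_mul_assoc, mul_assoc, sub_mul, smul_mul_assoc, smul_mul_assoc, h2, h3, mul_smul_comm,
      ← smul_add, pow_succ f m]
    simp only [pow_zero, add_smul, one_smul, mul_sub, mul_smul_comm, smul_smul, mul_assoc, mul_add,
      mul_comm x, mul_comm y]
    congr 1
    abel

end Commutation

namespace QParam
variable (D : QParam)

theorem t_pow_N : D.t ^ (2 * D.p * D.r) = 1 := by
  rw [mul_comm, pow_mul, D.t_pow, ← pow_mul, mul_comm 2, pow_mul, D.prim.pow_eq_one, one_pow]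

theorem q_pow : D.q ^ (2 * D.p) = 1 := D.prim.pow_eq_one

theorem qhat_ne : D.q - D.q⁻¹ ≠ 0 := by
  intro h
  have h1 : D.q ^ 2 = 1 := by
    rw [sub_eq_zero] at h
    calc D.q ^ 2 = D.q * D.q := sq _
      _ = 1 := by nth_rw 2 [h]; exact mul_inv_cancel₀ D.q_ne
  exact D.prim.pow_ne_one_of_pos_of_lt (by norm_num) (by have := D.two_le_p; omega) h1

theorem t_inv_pow : (D.t⁻¹) ^ ((2 * D.p * D.r - 1) * D.r) = D.q ^ 2 := by
  have h : (D.t⁻¹) ^ (2 * D.p * D.r - 1) = D.t := by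
    have h1 : (D.t⁻¹) ^ (2 * D.p * D.r - 1) * D.t⁻¹ = 1 := by
      rw [← pow_succ, Nat.sub_add_cancel D.N_pos, inv_pow, D.t_pow_N, inv_one]
    rw [mul_inv_eq_one₀ D.t_ne] at h1
    exact h1
  rw [pow_mul, h, D.t_pow]

theorem geom_sum : ∑ i ∈ Finset.range D.p, (D.q ^ 2) ^ i = 0 :=
  D.prim_sq.geom_sum_eq_zero D.two_le_p

theorem geom_sum_inv : ∑ i ∈ Finset.range D.p, ((D.q ^ 2)⁻¹) ^ i = 0 :=
  D.prim_sq.inv.geom_sum_eq_zero D.two_le_p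

end QParam

/-! The representations that separate the monomials `K^m F^a E^c`. They are spaces of functions
of `a` and `c`. -/

namespace Coind
variable (D : QParam) (z : ℂ)

/-- The eigenvalues of `K`. -/
def weight (a c : ℕ) : ℂ := z * D.t ^ a * (D.t⁻¹) ^ c

/-- The coefficients of the action of `F`. -/
def fCoeff (a c : ℕ) : ℂ :=
  ∑ j ∈ Finset.range c, (D.q - D.q⁻¹)⁻¹ *
    (weight D z a j ^ D.r - weight D z a j ^ ((2 * D.p * D.r - 1) * D.r))

/-- The action of `E` on functions. -/
def opE : End ℂ (ℕ → ℕ → ℂ) where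
  toFun ψ a c := ψ a (c + 1)
  map_add' _ _ := rfl
  map_smul' _ _ := rfl

/-- The action of `K` on functions. -/
def opK : End ℂ (ℕ → ℕ → ℂ) where
  toFun ψ a c := weight D z a c * ψ a c
  map_add' ψ ψ' := by ext a c; simp [mul_add]
  map_smul' x ψ := by ext a c; simp [mul_left_comm]

/-- The action of `F` on functions. -/
def opF : End ℂ (ℕ → ℕ → ℂ) where
  toFun ψ a c := ψ (a + 1) c + fCoeff D z a c * ψ a (c - 1)
  map_add' ψ ψ' := by ext a c; simp [mul_add]; ring
  map_smul' x ψ := by ext a c; simp [mul_add]; ring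

variable {D z}

theorem opE_apply (ψ : ℕ → ℕ → ℂ) (a c : ℕ) : opE ψ a c = ψ a (c + 1) := rfl
theorem opK_apply (ψ : ℕ → ℕ → ℂ) (a c : ℕ) : opK D z ψ a c = weight D z a c * ψ a c := rfl
theorem opF_apply (ψ : ℕ → ℕ → ℂ) (a c : ℕ) :
    opF D z ψ a c = ψ (a + 1) c + fCoeff D z a c * ψ a (c - 1) := rfl

theorem opK_pow_apply (n : ℕ) (ψ : ℕ → ℕ → ℂ) (a c : ℕ) :
    (opK D z ^ n) ψ a c = weight D z a c ^ n * ψ a c := by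
  induction n with
  | zero => simp
  | succ n ih => rw [pow_succ', Module.End.mul_apply, opK_apply, ih, pow_succ']; ring

theorem opE_pow_apply (n : ℕ) (ψ : ℕ → ℕ → ℂ) (a c : ℕ) : (opE ^ n) ψ a c = ψ a (c + n) := by
  induction n generalizing c with
  | zero => simp
  | succ n ih => rw [pow_succ', Module.End.mul_apply, opE_apply, ih]; congr 1; ring

theorem fCoeff_zero (a : ℕ) : fCoeff D z a 0 = 0 := by simp [fCoeff]

theorem opF_pow_apply_zero (n : ℕ) (ψ : ℕ → ℕ → ℂ) (a : ℕ) :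
    (opF D z ^ n) ψ a 0 = ψ (a + n) 0 := by
  induction n generalizing a with
  | zero => simp
  | succ n ih =>
    rw [pow_succ', Module.End.mul_apply, opF_apply, ih, fCoeff_zero, zero_mul, add_zero]
    congr 1; ring

theorem weight_succ_right (a c : ℕ) : weight D z a c = D.t * weight D z a (c + 1) := by
  have := D.t_ne
  rw [weight, weight, pow_succ]; field_simp

theorem weight_succ_left (a c : ℕ) : weight D z (a + 1) c = D.t * weight D z a c := by
  rw [weight, weight, pow_succ]; ring

/-- The operators imitate right translations `(hψ)(x) = ψ(x h)` on functions with `ψ(K x) = z ψ(x)`,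
recorded by their values at `F^a E^c`; reordering `F^a E^c h` gives the formulas for the weight and
for the coefficients of `F`. -/
theorem K_E : opK D z * opE = D.t • (opE * opK D z) := by
  ext ψ a c
  change weight D z a c * ψ a (c + 1) = D.t * (weight D z a (c + 1) * ψ a (c + 1))
  rw [weight_succ_right]; ring

theorem K_F : opK D z * opF D z = D.t⁻¹ • (opF D z * opK D z) := by
  have := D.t_ne
  ext ψ a c
  change weight D z a c * (ψ (a + 1) c + fCoeff D z a c * ψ a (c - 1))
    = D.t⁻¹ * (weight D z (a + 1) c * ψ (a + 1) c
      + fCoeff D z a c * (weight D z a (c - 1) * ψ a (c - 1)))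
  rw [weight_succ_left]
  cases c with
  | zero => rw [fCoeff_zero]; field_simp; ring
  | succ c => rw [Nat.add_sub_cancel, weight_succ_right a c]; field_simp

theorem E_F : opE * opF D z - opF D z * opE
    = (D.q - D.q⁻¹)⁻¹ • (opK D z ^ D.r - (opK D z ^ (2 * D.p * D.r - 1)) ^ D.r) := by
  ext ψ a c
  rw [← pow_mul]
  simp only [LinearMap.sub_apply, Module.End.mul_apply, LinearMap.smul_apply, Pi.sub_apply,
    Pi.smul_apply, smul_eq_mul, opE_apply, opF_apply, opK_pow_apply]
  have h : fCoeff D z a (c + 1) = fCoeff D z a c + (D.q - D.q⁻¹)⁻¹ *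
      (weight D z a c ^ D.r - weight D z a c ^ ((2 * D.p * D.r - 1) * D.r)) :=
    Finset.sum_range_succ _ _
  rw [h, Nat.add_sub_cancel]
  cases c with
  | zero => rw [fCoeff_zero]; ring
  | succ c => rw [Nat.add_sub_cancel]; ring

/-- The commutator is proportional to the sums of all powers of `q²` and of `q⁻²`, over the `p`-th
roots of unity, which vanish. -/
theorem E_F_pow : opE * opF D z ^ D.p = opF D z ^ D.p * opE := by
  have h := mul_pow_sub_pow_mul (E_F (D := D) (z := z))
    (U.Sat.pow_comm K_F D.r) (by rw [← pow_mul]; exact U.Sat.pow_comm K_F _) (D.p - 1)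
  rw [Nat.sub_add_cancel (by have := D.two_le_p; omega), inv_pow, D.t_pow, D.geom_sum_inv,
    D.t_inv_pow, D.geom_sum, zero_smul, zero_smul, sub_zero, mul_zero, smul_zero] at h
  exact sub_eq_zero.1 h

variable (D) in
/-- The functions with finite support on which `E^p` and `F^p` vanish. -/
def space : Submodule ℂ (ℕ → ℕ → ℂ) where
  carrier := {ψ | ∀ a c, D.p ≤ a ∨ D.p ≤ c → ψ a c = 0}
  add_mem' h h' a c hac := by simp [h a c hac, h' a c hac]
  zero_mem' a c _ := rfl
  smul_mem' x ψ h a c hac := by simp [h a c hac]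

/-- This vanishing is what keeps the functions supported on `a, c < p` stable under `F`: at `c = p`
the value at `c - 1` need not be zero. -/
theorem fCoeff_p (a : ℕ) : fCoeff D z a D.p = 0 := by
  have e : ∀ j n, weight D z a j ^ n = (z * D.t ^ a) ^ n * ((D.t⁻¹) ^ n) ^ j := fun j n => by
    rw [weight, mul_pow, ← pow_mul, ← pow_mul, mul_comm j]
  simp only [fCoeff, e]
  rw [← Finset.mul_sum, Finset.sum_sub_distrib, ← Finset.mul_sum, ← Finset.mul_sum, inv_pow,
    D.t_pow, D.geom_sum_inv, D.t_inv_pow, D.geom_sum]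
  simp

theorem opE_mem : ∀ ψ ∈ space D, opE ψ ∈ space D := fun ψ h a c hac =>
  h a (c + 1) (by omega)
theorem opK_mem : ∀ ψ ∈ space D, opK D z ψ ∈ space D := fun ψ h a c hac => by
  rw [opK_apply, h a c hac, mul_zero]
theorem opF_mem : ∀ ψ ∈ space D, opF D z ψ ∈ space D := fun ψ h a c hac => by
  rw [opF_apply, h (a + 1) c (by omega), zero_add]
  by_cases hc : c = D.p
  · rw [hc, fCoeff_p, zero_mul]
  · rw [h a (c - 1) (by omega), mul_zero]

theorem sat (hz : z ^ (2 * D.p * D.r) = 1) : U.Sat D (opE.restrict opE_mem)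
    ((opF D z).restrict opF_mem) ((opK D z).restrict opK_mem) where
  K_pow := by
    rw [Module.End.pow_restrict]
    ext ψ a c
    change (opK D z ^ (2 * D.p * D.r)) ψ.1 a c = ψ.1 a c
    rw [opK_pow_apply, weight, mul_pow, mul_pow, hz, ← pow_mul, ← pow_mul, mul_comm a, mul_comm c,
      pow_mul _ (2 * D.p * D.r), pow_mul _ (2 * D.p * D.r), inv_pow, D.t_pow_N]
    simp
  E_pow := by
    rw [Module.End.pow_restrict]
    ext ψ a c
    change (opE ^ D.p) ψ.1 a c = 0
    rw [opE_pow_apply, ψ.2 _ _ (by omega)]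
  F_pow := by
    rw [Module.End.pow_restrict]
    ext ψ a c
    change (opF D z ^ D.p) ψ.1 a c = 0
    -- At `c = 0` the power of `F` is a plain shift in `a`. Since `E^c` shifts in `c` and commutes
    -- with `F^p`, the general value reduces to that case.
    have h1 : Commute (opE ^ c) (opF D z ^ D.p) := Commute.pow_left E_F_pow c
    have h2 : (opF D z ^ D.p) ψ.1 a c = (opE ^ c * opF D z ^ D.p) ψ.1 a 0 := by
      rw [Module.End.mul_apply, opE_pow_apply, zero_add]
    rw [h2, h1.eq, Module.End.mul_apply, opF_pow_apply_zero, opE_pow_apply, ψ.2 _ _ (by omega)]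
  K_E := by
    ext ψ a c
    exact congrFun (congrFun (LinearMap.congr_fun (K_E (D := D) (z := z)) ψ.1) a) c
  K_F := by
    ext ψ a c
    exact congrFun (congrFun (LinearMap.congr_fun (K_F (D := D) (z := z)) ψ.1) a) c
  E_F := by
    rw [Module.End.pow_restrict, Module.End.pow_restrict, Module.End.pow_restrict]
    ext ψ a c
    exact congrFun (congrFun (LinearMap.congr_fun (E_F (D := D) (z := z)) ψ.1) a) c

/-- The function equal to one at `(a, c)`. -/
def delta (a c : ℕ) (ha : a < D.p) (hc : c < D.p) : space D :=
  ⟨fun a' c' => if a' = a ∧ c' = c then 1 else 0, fun a' c' h =>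
    if_neg (by omega)⟩

end Coind

namespace U
variable {D : QParam}

/-- Linear forms that separate the monomials. -/
theorem exists_dual_monomial {z : ℂ} (hz : z ^ (2 * D.p * D.r) = 1) {a c : ℕ} (ha : a < D.p)
    (hc : c < D.p) : ∃ f : Dual ℂ (U D), ∀ m a' c',
      f (K D ^ m * F D ^ a' * E D ^ c') = if a' = a ∧ c' = c then z ^ m else 0 := by
  let ev : Dual ℂ (Coind.space D) :=
    { toFun := fun ψ => ψ.1 0 0, map_add' := fun _ _ => rfl, map_smul' := fun _ _ => rfl }
  refine ⟨ev ∘ₗ LinearMap.applyₗ (Coind.delta a c ha hc) ∘ₗ (lift (Coind.sat hz)).toLinearMap,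
    fun m a' c' => ?_⟩
  simp only [LinearMap.comp_apply, AlgHom.toLinearMap_apply, map_mul, map_pow, lift_K, lift_F,
    lift_E, LinearMap.applyₗ_apply_apply]
  rw [Module.End.pow_restrict, Module.End.pow_restrict, Module.End.pow_restrict]
  change (Coind.opK D z ^ m) ((Coind.opF D z ^ a') ((Coind.opE ^ c') _)) 0 0 = _
  rw [Coind.opK_pow_apply, Coind.opF_pow_apply_zero, Coind.opE_pow_apply]
  simp [Coind.delta, Coind.weight]

end U
end
end RestrictedQG

open scoped TensorProduct
namespace RestrictedQG
noncomputable section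
open Coalgebra HopfAlgebra Module

/-! ### Antipode, pivot, spanning monomials and the scaling automorphisms. -/

namespace U
variable {D : QParam}

theorem K_mul_Kinv : K D * Kinv D = 1 := (sat D).k_kinv
theorem Kinv_mul_K : Kinv D * K D = 1 := (sat D).kinv_k

theorem K_pow_mod (m : ℕ) : K D ^ m = K D ^ (m % (2 * D.p * D.r)) := by
  conv_lhs => rw [← Nat.div_add_mod m (2 * D.p * D.r), pow_add, pow_mul, (sat D).K_pow, one_pow,
    one_mul]

theorem comul_Kinv : comul (R := ℂ) (Kinv D) = Kinv D ⊗ₜ Kinv D := by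
  rw [Kinv, Bialgebra.comul_pow, comul_K, Algebra.TensorProduct.tmul_pow]

theorem antipode_E : antipode ℂ (E D) = -(E D * Kinv D ^ D.r) := antipodeLin_E D
theorem antipode_F : antipode ℂ (F D) = -(K D ^ D.r * F D) := antipodeLin_F D
theorem antipode_K : antipode ℂ (K D) = Kinv D := antipodeLin_K D
theorem antipode_pow (x : U D) (n : ℕ) : antipode ℂ (x ^ n) = antipode ℂ x ^ n :=
  antipodeLin_pow D x n

theorem antipode_Kinv : antipode ℂ (Kinv D) = K D := by
  have h1 : antipode ℂ (Kinv D) * Kinv D = 1 := by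
    have h := antipode_mul (K D) (Kinv D)
    rw [K_mul_Kinv, antipode_one, antipode_K] at h
    exact h.symm
  calc antipode ℂ (Kinv D) = antipode ℂ (Kinv D) * (Kinv D * K D) := by rw [Kinv_mul_K, mul_one]
    _ = K D := by rw [← mul_assoc, h1, one_mul]

theorem antipode_algebraMap (c : ℂ) : antipode ℂ (algebraMap ℂ (U D) c) = algebraMap ℂ _ c :=
  antipodeLin_algebraMap D c

theorem comul_antipode (x : U D) : comul (R := ℂ) (antipode ℂ x)
    = TensorProduct.map (antipode ℂ) (antipode ℂ) (TensorProduct.comm ℂ _ _ (comul (R := ℂ) x)) := by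
  induction x using induction with
  | h1 c =>
    rw [antipode_algebraMap, Bialgebra.comul_algebraMap, Algebra.TensorProduct.algebraMap_apply]
    simp [TensorProduct.tmul_smul, Algebra.algebraMap_eq_smul_one,
      TensorProduct.smul_tmul']
  | hE =>
    rw [antipode_E, map_neg, Bialgebra.comul_mul, Bialgebra.comul_pow, comul_Kinv, comul_E]
    simp [antipode_E, antipode_pow, antipode_K, add_mul, TensorProduct.tmul_neg,
      TensorProduct.neg_tmul, Kinv, (sat D).g_ginv]
  | hF =>
    rw [antipode_F, map_neg, Bialgebra.comul_mul, Bialgebra.comul_pow, comul_K, comul_F]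
    have hg : K D ^ D.r * Kinv D ^ D.r = 1 := (sat D).g_ginv
    simp [antipode_F, antipode_pow, antipode_Kinv, mul_add, TensorProduct.tmul_neg,
      TensorProduct.neg_tmul, hg, add_comm]
  | hK => simp [antipode_K, comul_Kinv]
  | hadd x y hx hy => simp only [map_add, hx, hy]
  | hmul x y hx hy =>
    rw [antipode_mul, Bialgebra.comul_mul, hx, hy, Bialgebra.comul_mul]
    generalize comul (R := ℂ) x = X
    generalize comul (R := ℂ) y = Y
    induction X using TensorProduct.induction_on with
    | zero => simp
    | add X X' h h' => simp only [mul_add, add_mul, map_add, h, h']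
    | tmul a b =>
      induction Y using TensorProduct.induction_on with
      | zero => simp
      | add X X' h h' => simp only [mul_add, add_mul, map_add, h, h']
      | tmul c d => simp [antipode_mul]

/-- The grouplike elements `K^(r (p + 1))` and `K^(-r (p + 1))`. -/
theorem isPivot : IsPivot ((K D ^ D.r) ^ (D.p + 1)) ((Kinv D ^ D.r) ^ (D.p + 1)) := by
  have h1 : (K D ^ D.r) ^ (D.p + 1) * (Kinv D ^ D.r) ^ (D.p + 1) = 1 := by
    rw [← Commute.mul_pow, Kinv, (sat D).g_ginv, one_pow]
    exact (Commute.self_pow (K D) _).pow_pow _ _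
  have h2 : (Kinv D ^ D.r) ^ (D.p + 1) * (K D ^ D.r) ^ (D.p + 1) = 1 := by
    rw [← Commute.mul_pow, Kinv, (sat D).ginv_g, one_pow]
    exact (Commute.pow_self (K D) _).pow_pow _ _
  have h3 : ∀ x : U D, antipode ℂ (antipode ℂ x) * (K D ^ D.r) ^ (D.p + 1)
      = (K D ^ D.r) ^ (D.p + 1) * x := by
    -- The factor `K^(r p)` is central because `q^(2p) = 1`, so the exponent `p + 1` implements `S²`
    -- just as the exponent `1` does.
    have hq : (D.q ^ 2) ^ (D.p + 1) = D.q ^ 2 := by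
      rw [pow_succ, ← pow_mul, D.q_pow, one_mul]
    intro x
    induction x using induction with
    | h1 c => rw [antipode_algebraMap, antipode_algebraMap, Algebra.commutes]
    | hE =>
      rw [Sat.pow_comm (sat D).g_e, hq, antipode_E, map_neg, antipode_mul, antipode_pow,
        antipode_Kinv, antipode_E, mul_neg, neg_neg, ← mul_assoc, (sat D).g_e, smul_mul_assoc,
        mul_assoc (E D), Kinv, (sat D).g_ginv, mul_one, smul_mul_assoc]
    | hF =>
      rw [Sat.pow_comm (sat D).g_f, inv_pow, hq, antipode_F, map_neg, antipode_mul, antipode_pow,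
        antipode_K, antipode_F, neg_mul, neg_mul, neg_mul, neg_neg, (sat D).g_f, smul_mul_assoc,
        mul_assoc (F D), Kinv, (sat D).g_ginv, mul_one, smul_mul_assoc]
    | hK =>
      rw [antipode_K, antipode_Kinv]
      exact ((Commute.self_pow (K D) _).pow_right _).eq
    | hadd x y hx hy => rw [map_add, map_add, add_mul, hx, hy, mul_add]
    | hmul x y hx hy => rw [antipode_mul, antipode_mul, mul_assoc, hy, ← mul_assoc, hx, mul_assoc]
  refine ⟨h1, h2, ?_, ?_, fun x => ?_⟩
  · simp [Bialgebra.comul_pow, Algebra.TensorProduct.tmul_pow]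
  · simp [Bialgebra.counit_pow]
  · rw [← h3, mul_assoc, h1, mul_one]

/-! Monomials. -/

theorem E_mul_F_pow (a : ℕ) : E D * F D ^ (a + 1) = F D ^ (a + 1) * E D
    + (D.q - D.q⁻¹)⁻¹ • (F D ^ a * ((∑ i ∈ Finset.range (a + 1), ((D.q ^ 2)⁻¹) ^ i) • K D ^ D.r
      - (∑ i ∈ Finset.range (a + 1), (D.q ^ 2) ^ i) • Kinv D ^ D.r)) := by
  rw [← sub_eq_iff_eq_add']
  exact mul_pow_sub_pow_mul (sat D).E_F (sat D).g_f (sat D).ginv_f a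

/-- The span contains `1` and is stable under left multiplication by each generator; only `E` needs
the commutation formula with `F^(a+1)`. -/
theorem span_monomials : Submodule.span ℂ
    (Set.range fun x : ℕ × ℕ × ℕ => K D ^ x.1 * F D ^ x.2.1 * E D ^ x.2.2) = ⊤ := by
  set M := Submodule.span ℂ
    (Set.range fun x : ℕ × ℕ × ℕ => K D ^ x.1 * F D ^ x.2.1 * E D ^ x.2.2)
  have hm : ∀ m a c, K D ^ m * F D ^ a * E D ^ c ∈ M := fun m a c =>
    Submodule.subset_span ⟨(m, a, c), rfl⟩
  have hFK : ∀ a m, F D ^ a * K D ^ m = ((D.t ^ m) ^ a) • (K D ^ m * F D ^ a) := by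
    intro a m
    refine Sat.pow_comm ?_ a
    rw [Sat.pow_comm (sat D).K_F, smul_smul, inv_pow, mul_inv_cancel₀ (pow_ne_zero _ D.t_ne),
      one_smul]
  have hEK : ∀ m, E D * K D ^ m = (D.t ^ m)⁻¹ • (K D ^ m * E D) := by
    intro m
    rw [Sat.pow_comm (sat D).K_E, smul_smul, inv_mul_cancel₀ (pow_ne_zero _ D.t_ne), one_smul]
  have closed : ∀ x : U D, ∀ y ∈ M, x * y ∈ M := by
    have red : ∀ x : U D, (∀ m a c, x * (K D ^ m * F D ^ a * E D ^ c) ∈ M) →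
        ∀ y ∈ M, x * y ∈ M := by
      intro x h y hy
      induction hy using Submodule.span_induction with
      | mem y hy => obtain ⟨⟨m, a, c⟩, rfl⟩ := hy; exact h m a c
      | zero => rw [mul_zero]; exact M.zero_mem
      | add y y' _ _ h h' => rw [mul_add]; exact M.add_mem h h'
      | smul c y _ h => rw [mul_smul_comm]; exact M.smul_mem _ h
    intro x
    induction x using induction with
    | h1 c =>
      intro y hy
      rw [← Algebra.smul_def]; exact M.smul_mem _ hy
    | hE =>
      refine red _ fun m a c => ?_
      cases a with
      | zero =>
        rw [pow_zero, mul_one, ← mul_assoc, hEK, smul_mul_assoc, mul_assoc, ← pow_succ']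
        refine M.smul_mem _ ?_
        simpa using hm m 0 (c + 1)
      | succ a =>
        rw [← mul_assoc, ← mul_assoc, hEK, smul_mul_assoc, smul_mul_assoc, mul_assoc (K D ^ m),
          E_mul_F_pow]
        refine M.smul_mem _ ?_
        rw [mul_add, add_mul, mul_smul_comm, smul_mul_assoc]
        refine M.add_mem ?_ (M.smul_mem _ ?_)
        · have := hm m (a + 1) (c + 1)
          rwa [pow_succ' (E D), ← mul_assoc, mul_assoc (K D ^ m)] at this
        · simp only [Kinv, ← pow_mul, mul_sub, mul_smul_comm, hFK, ← mul_assoc, ← pow_add, sub_mul,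
            smul_mul_assoc]
          exact M.sub_mem (M.smul_mem _ (M.smul_mem _ (hm _ _ _)))
            (M.smul_mem _ (M.smul_mem _ (hm _ _ _)))
    | hF =>
      refine red _ fun m a c => ?_
      have := hFK 1 m
      rw [pow_one] at this
      rw [← mul_assoc, ← mul_assoc, this, smul_mul_assoc, smul_mul_assoc, mul_assoc (K D ^ m),
        ← pow_succ']
      exact M.smul_mem _ (hm _ _ _)
    | hK =>
      refine red _ fun m a c => ?_
      rw [← mul_assoc, ← mul_assoc, ← pow_succ']
      exact hm _ _ _
    | hadd x x' h h' => intro y hy; rw [add_mul]; exact M.add_mem (h y hy) (h' y hy)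
    | hmul x x' h h' => intro y hy; rw [mul_assoc]; exact h _ (h' y hy)
  refine eq_top_iff.2 fun x _ => ?_
  have := closed x _ (hm 0 0 0)
  simpa using this

theorem monomial_induction {P : U D → Prop}
    (h : ∀ m a c, m < 2 * D.p * D.r → a < D.p → c < D.p → P (K D ^ m * F D ^ a * E D ^ c))
    (hadd : ∀ x y, P x → P y → P (x + y)) (hsmul : ∀ (c : ℂ) x, P x → P (c • x)) (x : U D) :
    P x := by
  have h0 : P 0 := by
    have := D.two_le_p
    simpa using hsmul 0 _ (h 0 0 0 D.N_pos (by omega) (by omega))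
  have hx : x ∈ Submodule.span ℂ
      (Set.range fun x : ℕ × ℕ × ℕ => K D ^ x.1 * F D ^ x.2.1 * E D ^ x.2.2) := by
    rw [span_monomials]; trivial
  induction hx using Submodule.span_induction with
  | mem y hy =>
    obtain ⟨⟨m, a, c⟩, rfl⟩ := hy
    by_cases ha : a < D.p
    · by_cases hc : c < D.p
      · simp only [K_pow_mod m]
        exact h _ a c (Nat.mod_lt _ D.N_pos) ha hc
      · have : E D ^ c = 0 := pow_eq_zero_of_le (not_lt.1 hc) (sat D).E_pow
        simpa [this] using h0
    · have : F D ^ a = 0 := pow_eq_zero_of_le (not_lt.1 ha) (sat D).F_pow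
      simpa [this] using h0
  | zero => exact h0
  | add y y' _ _ h h' => exact hadd _ _ h h'
  | smul c y _ h => exact hsmul c y h

theorem linearMap_ext {V : Type*} [AddCommGroup V] [Module ℂ V] {f g : U D →ₗ[ℂ] V}
    (h : ∀ m a c, a < D.p → c < D.p →
      f (K D ^ m * F D ^ a * E D ^ c) = g (K D ^ m * F D ^ a * E D ^ c)) : f = g := by
  ext x
  induction x using monomial_induction with
  | h m a c _ ha hc => exact h m a c ha hc
  | hadd x y hx hy => rw [map_add, map_add, hx, hy]
  | hsmul c x hx => rw [map_smul, map_smul, hx]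

instance : FiniteDimensional ℂ (U D) := by
  let f : Fin (2 * D.p * D.r) × Fin D.p × Fin D.p → U D :=
    fun x => K D ^ x.1.1 * F D ^ x.2.1.1 * E D ^ x.2.2.1
  refine Module.finite_def.2 ⟨(Set.finite_range f).toFinset, ?_⟩
  refine eq_top_iff.2 fun x _ => ?_
  induction x using monomial_induction with
  | h m a c hm ha hc =>
    exact Submodule.subset_span (by simpa using ⟨⟨m, hm⟩, ⟨a, ha⟩, ⟨c, hc⟩, rfl⟩)
  | hadd x y hx hy => exact Submodule.add_mem _ (hx trivial) (hy trivial)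
  | hsmul c x hx => exact Submodule.smul_mem _ _ (hx trivial)

/-! The automorphisms `E ↦ w E`, `F ↦ w⁻¹ F`. -/

theorem sat_scale {w : ℂ} (hw : w ≠ 0) : Sat D (w • E D) (w⁻¹ • F D) (K D) where
  K_pow := (sat D).K_pow
  E_pow := by rw [smul_pow, (sat D).E_pow, smul_zero]
  F_pow := by rw [smul_pow, (sat D).F_pow, smul_zero]
  K_E := by rw [mul_smul_comm, (sat D).K_E, smul_mul_assoc, smul_comm]
  K_F := by rw [mul_smul_comm, (sat D).K_F, smul_mul_assoc, smul_comm]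
  E_F := by
    rw [smul_mul_smul_comm, smul_mul_smul_comm, mul_inv_cancel₀ hw, inv_mul_cancel₀ hw, one_smul,
      one_smul, (sat D).E_F]

variable (D) in
/-- The morphism `E ↦ w E`, `F ↦ w⁻¹ F`, `K ↦ K`. -/
def scale {w : ℂ} (hw : w ≠ 0) : U D →ₐ[ℂ] U D := lift (sat_scale hw)

@[simp] theorem scale_E {w : ℂ} (hw : w ≠ 0) : scale D hw (E D) = w • E D := lift_E _
@[simp] theorem scale_F {w : ℂ} (hw : w ≠ 0) : scale D hw (F D) = w⁻¹ • F D := lift_F _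
@[simp] theorem scale_K {w : ℂ} (hw : w ≠ 0) : scale D hw (K D) = K D := lift_K _

theorem scale_monomial {w : ℂ} (hw : w ≠ 0) (m a c : ℕ) :
    scale D hw (K D ^ m * F D ^ a * E D ^ c) = ((w⁻¹) ^ a * w ^ c) • (K D ^ m * F D ^ a * E D ^ c) := by
  simp only [map_mul, map_pow, scale_E, scale_F, scale_K, smul_pow, mul_smul_comm, smul_mul_assoc,
    smul_smul]
  rw [mul_comm (w ^ c)]

theorem scale_monomial_diag {w : ℂ} (hw : w ≠ 0) (m a : ℕ) :
    scale D hw (K D ^ m * F D ^ a * E D ^ a) = K D ^ m * F D ^ a * E D ^ a := by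
  rw [scale_monomial, ← mul_pow, inv_mul_cancel₀ hw, one_pow, one_smul]

theorem g_mul_eq_scale (x : U D) :
    K D ^ D.r * x = scale D (pow_ne_zero 2 D.q_ne) x * K D ^ D.r := by
  induction x using induction with
  | h1 c => rw [AlgHom.commutes, Algebra.commutes]
  | hE => rw [scale_E, (sat D).g_e, smul_mul_assoc]
  | hF => rw [scale_F, (sat D).g_f, smul_mul_assoc]
  | hK => rw [scale_K]; exact (Commute.pow_self (K D) _).eq
  | hadd x y hx hy => rw [mul_add, hx, hy, map_add, add_mul]
  | hmul x y hx hy => rw [← mul_assoc, hx, mul_assoc, hy, map_mul, mul_assoc]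

/-- Conjugation by `K^r` preserves a symmetric form and multiplies the monomial by `q^(2(c-a))`,
which is not `1` when `a ≠ c` are below `p`. -/
theorem SLF_monomial {ψ : Dual ℂ (U D)} (hψ : ψ ∈ SLF (U D)) {a c : ℕ} (ha : a < D.p)
    (hc : c < D.p) (hac : a ≠ c) (m : ℕ) : ψ (K D ^ m * F D ^ a * E D ^ c) = 0 := by
  set x := K D ^ m * F D ^ a * E D ^ c with hx
  have h1 : ψ x = (((D.q ^ 2)⁻¹) ^ a * (D.q ^ 2) ^ c) * ψ x := by
    have e : x = x * Kinv D ^ D.r * K D ^ D.r := by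
      rw [mul_assoc, Kinv, (sat D).ginv_g, mul_one]
    calc ψ x = ψ (K D ^ D.r * (x * Kinv D ^ D.r)) := by
          conv_lhs => rw [e]
          rw [hψ]
      _ = ψ (scale D (pow_ne_zero 2 D.q_ne) x) := by
          rw [← mul_assoc, g_mul_eq_scale, mul_assoc, Kinv, (sat D).g_ginv, mul_one]
      _ = _ := by rw [hx, scale_monomial, map_smul, smul_eq_mul]
  by_contra h0
  have h2 : ((D.q ^ 2)⁻¹) ^ a * (D.q ^ 2) ^ c = 1 := by
    rw [← mul_eq_right₀ h0]; exact h1.symm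
  rw [inv_pow, inv_mul_eq_one₀ (pow_ne_zero _ (pow_ne_zero 2 D.q_ne))] at h2
  exact hac (D.prim_sq.pow_inj ha hc h2)

/-- Symmetric linear forms are invariant under the automorphisms `E ↦ w E`, `F ↦ w⁻¹ F`. -/
theorem SLF_scale {ψ : Dual ℂ (U D)} (hψ : ψ ∈ SLF (U D)) {w : ℂ} (hw : w ≠ 0) (x : U D) :
    ψ (scale D hw x) = ψ x := by
  have h : ψ ∘ₗ (scale D hw).toLinearMap = ψ := by
    refine linearMap_ext fun m a c ha hc => ?_
    rw [LinearMap.comp_apply, AlgHom.toLinearMap_apply]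
    by_cases hac : a = c
    · rw [hac, scale_monomial_diag]
    · rw [scale_monomial, map_smul, SLF_monomial hψ ha hc hac, smul_zero]
  exact LinearMap.congr_fun h x

/-- The elements that commute with `K^r` are invariant under the automorphisms `E ↦ w E`,
`F ↦ w⁻¹ F`. -/
theorem scale_eq_of_commute {z : U D} (hz : K D ^ D.r * z = z * K D ^ D.r) {w : ℂ} (hw : w ≠ 0) :
    scale D hw z = z := by
  have hq : D.q ^ 2 ≠ 0 := pow_ne_zero 2 D.q_ne
  -- The sum over the `p` conjugates by powers of `K^r`. It annihilates the monomials with `a ≠ c`,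
  -- and the others are fixed by every scaling; on an element commuting with `K^r` it is
  -- multiplication by `p`.
  let P : U D →ₗ[ℂ] U D := ∑ n ∈ Finset.range D.p, ((scale D hq) ^ n).toLinearMap
  have hP : (scale D hw).toLinearMap ∘ₗ P = P := by
    refine linearMap_ext fun m a c ha hc => ?_
    have h1 : ∀ n, ((scale D hq) ^ n) (K D ^ m * F D ^ a * E D ^ c)
        = (((D.q ^ 2)⁻¹) ^ a * (D.q ^ 2) ^ c) ^ n • (K D ^ m * F D ^ a * E D ^ c) := by
      intro n
      induction n with
      | zero => simp
      | succ n ih => rw [pow_succ', AlgHom.mul_apply, ih, map_smul, scale_monomial, smul_smul, ← pow_succ]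
    have h2 : P (K D ^ m * F D ^ a * E D ^ c) = (∑ n ∈ Finset.range D.p,
        (((D.q ^ 2)⁻¹) ^ a * (D.q ^ 2) ^ c) ^ n) • (K D ^ m * F D ^ a * E D ^ c) := by
      simp only [P, LinearMap.sum_apply, AlgHom.toLinearMap_apply, h1, Finset.sum_smul]
    rw [LinearMap.comp_apply, h2, map_smul, AlgHom.toLinearMap_apply]
    by_cases hac : a = c
    · rw [hac, scale_monomial_diag]
    · have h3 : ∑ n ∈ Finset.range D.p, (((D.q ^ 2)⁻¹) ^ a * (D.q ^ 2) ^ c) ^ n = 0 := by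
        have hne : ((D.q ^ 2)⁻¹) ^ a * (D.q ^ 2) ^ c ≠ 1 := by
          rw [inv_pow, Ne, inv_mul_eq_one₀ (pow_ne_zero _ hq)]
          exact fun h => hac (D.prim_sq.pow_inj ha hc h)
        rw [geom_sum_eq hne, mul_pow, ← pow_mul, ← pow_mul, mul_comm a, mul_comm c, pow_mul,
          pow_mul, inv_pow, D.prim_sq.pow_eq_one]
        simp
      rw [h3, zero_smul, zero_smul]
  have hz' : scale D hq z = z := by
    have : scale D hq z * K D ^ D.r = z * K D ^ D.r := by rw [← g_mul_eq_scale, hz]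
    calc scale D hq z = scale D hq z * K D ^ D.r * Kinv D ^ D.r := by
          rw [mul_assoc, Kinv, (sat D).g_ginv, mul_one]
      _ = z := by rw [this, mul_assoc, Kinv, (sat D).g_ginv, mul_one]
  have hn : ∀ n, ((scale D hq) ^ n) z = z := by
    intro n
    induction n with
    | zero => rfl
    | succ n ih => rw [pow_succ', AlgHom.mul_apply, ih, hz']
  have hPz : P z = (D.p : ℂ) • z := by
    simp only [P, LinearMap.sum_apply, AlgHom.toLinearMap_apply, hn, Finset.sum_const,
      Finset.card_range, Nat.cast_smul_eq_nsmul]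
  have h := LinearMap.congr_fun hP z
  rw [LinearMap.comp_apply, hPz, map_smul, AlgHom.toLinearMap_apply] at h
  have hp : (D.p : ℂ) ≠ 0 := by have := D.two_le_p; exact_mod_cast (by omega : D.p ≠ 0)
  exact smul_right_injective _ hp h

end U
end
end RestrictedQG

open scoped TensorProduct
namespace RestrictedQG
noncomputable section
open Coalgebra HopfAlgebra Module

/-! ### The extension by a square root of `K` as a module over the smaller algebra. -/

section Extension
variable {p : ℕ} {q : ℂ} (hp : 2 ≤ p) (hq : IsPrimitiveRoot q (2 * p))

@[simp] theorem barParam_p : (barParam hp hq).p = p := rfl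
@[simp] theorem barParam_r : (barParam hp hq).r = 1 := rfl
@[simp] theorem barParam_q : (barParam hp hq).q = q := rfl
@[simp] theorem barParam_t : (barParam hp hq).t = q ^ 2 := rfl
@[simp] theorem halfParam_p : (halfParam hp hq).p = p := rfl
@[simp] theorem halfParam_r : (halfParam hp hq).r = 2 := rfl
@[simp] theorem halfParam_q : (halfParam hp hq).q = q := rfl
@[simp] theorem halfParam_t : (halfParam hp hq).t = q := rfl

@[simp] theorem incl_E : incl hp hq (U.E _) = U.E _ := U.lift_E _
@[simp] theorem incl_F : incl hp hq (U.F _) = U.F _ := U.lift_F _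
@[simp] theorem incl_K : incl hp hq (U.K _) = U.K _ ^ 2 := U.lift_K _

theorem incl_Kinv : incl hp hq (U.Kinv _) = U.Kinv _ ^ 2 := by
  have h1 : incl hp hq (U.Kinv _) * U.K (halfParam hp hq) ^ 2 = 1 := by
    rw [← incl_K, ← map_mul, U.Kinv_mul_K, map_one]
  have h2 : U.K (halfParam hp hq) ^ 2 * U.Kinv (halfParam hp hq) ^ 2 = 1 :=
    (U.sat (halfParam hp hq)).g_ginv
  exact left_inv_eq_right_inv h1 h2

/-- The restricted quantum group acts on two copies of itself, together with the square root of
`K`. -/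
theorem sat_double : U.Sat (halfParam hp hq)
    (!![U.E (barParam hp hq), 0; 0, q⁻¹ • U.E (barParam hp hq)])
    (!![U.F (barParam hp hq), 0; 0, q • U.F (barParam hp hq)])
    (!![0, U.K (barParam hp hq); 1, 0]) := by
  have hq0 : q ≠ 0 := (barParam hp hq).q_ne
  have hs := U.sat (barParam hp hq)
  have hdiag : ∀ x y : Ubar hp hq, !![x, 0; 0, y] = Matrix.diagonal ![x, y] := fun x y => by
    ext i j; fin_cases i <;> fin_cases j <;> rfl
  have hk2 : (!![0, U.K (barParam hp hq); 1, 0] : Matrix (Fin 2) (Fin 2) (Ubar hp hq)) ^ 2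
      = Matrix.diagonal (fun _ => U.K (barParam hp hq)) := by
    rw [sq]; ext i j; fin_cases i <;> fin_cases j <;> simp [Matrix.mul_apply]
  have hkpow : ∀ n, (!![0, U.K (barParam hp hq); 1, 0] : Matrix (Fin 2) (Fin 2) (Ubar hp hq)) ^ (2 * n)
      = Matrix.diagonal (fun _ => U.K (barParam hp hq) ^ n) := fun n => by
    rw [pow_mul, hk2, Matrix.diagonal_pow]; rfl
  have hK : U.K (barParam hp hq) ^ (2 * p) = 1 := by simpa using hs.K_pow
  refine ⟨?_, ?_, ?_, ?_, ?_, ?_⟩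
  · change _ ^ (2 * p * 2) = _
    rw [mul_comm (2 * p), hkpow, hK, ← Matrix.diagonal_one]
  · change _ ^ p = _
    rw [hdiag, Matrix.diagonal_pow]
    have h : U.E (barParam hp hq) ^ p = 0 := hs.E_pow
    ext i j; fin_cases i <;> fin_cases j <;> simp [h, smul_pow]
  · change _ ^ p = _
    rw [hdiag, Matrix.diagonal_pow]
    have h : U.F (barParam hp hq) ^ p = 0 := hs.F_pow
    ext i j; fin_cases i <;> fin_cases j <;> simp [h, smul_pow]
  · have h : U.K (barParam hp hq) * U.E _ = q ^ 2 • (U.E _ * U.K _) := hs.K_E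
    change _ = q • _
    ext i j; fin_cases i <;> fin_cases j <;> simp [Matrix.mul_apply, h, smul_smul, sq, hq0]
  · have h : U.K (barParam hp hq) * U.F _ = (q ^ 2)⁻¹ • (U.F _ * U.K _) := hs.K_F
    change _ = q⁻¹ • _
    ext i j; fin_cases i <;> fin_cases j <;> simp [Matrix.mul_apply, h, smul_smul, sq, hq0]
  · have h : U.E (barParam hp hq) * U.F _ - U.F _ * U.E _
        = (q - q⁻¹)⁻¹ • (U.K _ - U.K _ ^ (2 * p - 1)) := by simpa using hs.E_F
    change _ = (q - q⁻¹)⁻¹ • (_ ^ 2 - (_ ^ (2 * p * 2 - 1)) ^ 2)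
    have e : (2 * p * 2 - 1) * 2 = 2 * (2 * p - 1 + 2 * p) := by omega
    rw [← pow_mul, e, hkpow, pow_add, hK, mul_one, hk2]
    ext i j; fin_cases i <;> fin_cases j <;>
      simp [Matrix.mul_apply, ← h, hq0, smul_smul]

/-- The algebra `Uhalf` acts on two copies of the algebra `Ubar`. -/
def doubleHom : Uhalf hp hq →ₐ[ℂ] Matrix (Fin 2) (Fin 2) (Ubar hp hq) := U.lift (sat_double hp hq)

/-- The projection along `k * Ubar`. -/
def retr : Uhalf hp hq →ₗ[ℂ] Ubar hp hq :=
  Matrix.entryLinearMap ℂ _ 0 0 ∘ₗ (doubleHom hp hq).toLinearMap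

theorem retr_apply (x : Uhalf hp hq) : retr hp hq x = doubleHom hp hq x 0 0 := rfl

include hp hq in
theorem root_ne_zero : q ≠ 0 := (barParam hp hq).q_ne

theorem doubleHom_incl (x : Ubar hp hq) : doubleHom hp hq (incl hp hq x)
    = !![x, 0; 0, U.scale _ (inv_ne_zero (root_ne_zero hp hq)) x] := by
  induction x using U.induction with
  | h1 c =>
    rw [AlgHom.commutes, AlgHom.commutes, AlgHom.commutes]
    ext i j; fin_cases i <;> fin_cases j <;> simp [Matrix.algebraMap_matrix_apply]
  | hE => rw [incl_E, doubleHom, U.lift_E, U.scale_E]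
  | hF => rw [incl_F, doubleHom, U.lift_F, U.scale_F, inv_inv]
  | hK =>
    rw [incl_K, map_pow, doubleHom, U.lift_K, U.scale_K, sq]
    ext i j; fin_cases i <;> fin_cases j <;> simp [Matrix.mul_apply]
  | hadd x y hx hy =>
    simp only [map_add, hx, hy]
    ext i j; fin_cases i <;> fin_cases j <;> simp
  | hmul x y hx hy =>
    simp only [map_mul, hx, hy]
    ext i j; fin_cases i <;> fin_cases j <;> simp [Matrix.mul_apply]

@[simp] theorem retr_incl (x : Ubar hp hq) : retr hp hq (incl hp hq x) = x := by
  rw [retr_apply, doubleHom_incl]; rfl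

@[simp] theorem retr_incl_mul (x : Ubar hp hq) (y : Uhalf hp hq) :
    retr hp hq (incl hp hq x * y) = x * retr hp hq y := by
  rw [retr_apply, map_mul, doubleHom_incl, Matrix.mul_apply]; simp [retr_apply]

theorem retr_K_mul (x : Ubar hp hq) : retr hp hq (U.K _ * incl hp hq x) = 0 := by
  rw [retr_apply, map_mul, doubleHom_incl, Matrix.mul_apply, doubleHom, U.lift_K]; simp

theorem K_mul_incl (x : Ubar hp hq) : U.K _ * incl hp hq x
    = incl hp hq (U.scale _ (root_ne_zero hp hq) x) * U.K _ := by
  induction x using U.induction with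
  | h1 c => rw [AlgHom.commutes, AlgHom.commutes, AlgHom.commutes, Algebra.commutes]
  | hE =>
    rw [U.scale_E, map_smul, incl_E, smul_mul_assoc]; exact (U.sat (halfParam hp hq)).K_E
  | hF =>
    rw [U.scale_F, map_smul, incl_F, smul_mul_assoc]; exact (U.sat (halfParam hp hq)).K_F
  | hK => rw [U.scale_K, incl_K]; exact (Commute.self_pow _ _).eq
  | hadd x y hx hy => rw [map_add, mul_add, hx, hy, map_add, map_add, add_mul]
  | hmul x y hx hy => rw [map_mul, ← mul_assoc, hx, mul_assoc, hy, map_mul, map_mul, mul_assoc]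

theorem scale_scale_inv {D : QParam} {w : ℂ} (hw : w ≠ 0) (x : U D) :
    U.scale D hw (U.scale D (inv_ne_zero hw) x) = x := by
  have h : (U.scale D hw).comp (U.scale D (inv_ne_zero hw)) = AlgHom.id ℂ _ := by
    apply U.algHom_ext <;> simp [smul_smul, hw]
  exact AlgHom.congr_fun h x

theorem incl_mul_K (x : Ubar hp hq) : incl hp hq x * U.K _
    = U.K _ * incl hp hq (U.scale _ (inv_ne_zero (root_ne_zero hp hq)) x) := by
  rw [K_mul_incl, scale_scale_inv]

/-- The sum of the small algebra and its translate by `k` is closed under products, because `k`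
normalizes the small algebra and `k² = K`. Everything about the extension reduces to these two
components. -/
theorem exists_incl_add (y : Uhalf hp hq) :
    ∃ x x' : Ubar hp hq, y = incl hp hq x + U.K _ * incl hp hq x' := by
  induction y using U.induction with
  | h1 c => exact ⟨algebraMap ℂ _ c, 0, by rw [map_zero, mul_zero, add_zero, AlgHom.commutes]⟩
  | hE => exact ⟨U.E _, 0, by simp⟩
  | hF => exact ⟨U.F _, 0, by simp⟩
  | hK => exact ⟨0, 1, by simp⟩
  | hadd y z hy hz =>
    obtain ⟨x, x', rfl⟩ := hy
    obtain ⟨w, w', rfl⟩ := hz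
    exact ⟨x + w, x' + w', by simp only [map_add, mul_add]; abel⟩
  | hmul y z hy hz =>
    obtain ⟨x, x', rfl⟩ := hy
    obtain ⟨w, w', rfl⟩ := hz
    set σ := U.scale (barParam hp hq) (inv_ne_zero (root_ne_zero hp hq))
    refine ⟨x * w + U.K _ * (σ x' * w'), x' * w + σ x * w', ?_⟩
    have h1 : incl hp hq x * (U.K _ * incl hp hq w') = U.K _ * (incl hp hq (σ x) * incl hp hq w') := by
      rw [← mul_assoc, incl_mul_K, mul_assoc]
    have h2 : U.K _ * incl hp hq x' * (U.K _ * incl hp hq w')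
        = U.K _ ^ 2 * (incl hp hq (σ x') * incl hp hq w') := by
      rw [← mul_assoc, mul_assoc (U.K _), incl_mul_K, sq]; simp only [mul_assoc]; rfl
    simp only [map_add, map_mul, incl_K, add_mul, mul_add, h1, h2]
    rw [mul_assoc (U.K _) (incl hp hq x')]
    abel

theorem sat_neg : U.Sat (halfParam hp hq) (U.E (halfParam hp hq)) (U.F (halfParam hp hq))
    (-U.K (halfParam hp hq)) where
  K_pow := by
    have h : Even (2 * (halfParam hp hq).p * (halfParam hp hq).r) := ⟨2 * p, by simp; ring⟩
    rw [h.neg_pow]; exact (U.sat _).K_pow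
  E_pow := (U.sat _).E_pow
  F_pow := (U.sat _).F_pow
  K_E := by rw [neg_mul, (U.sat _).K_E, mul_neg, smul_neg]
  K_F := by rw [neg_mul, (U.sat _).K_F, mul_neg, smul_neg]
  E_F := by
    have h : Even (halfParam hp hq).r := even_two
    rw [← pow_mul, h.neg_pow, (h.mul_left _).neg_pow, pow_mul]; exact (U.sat _).E_F

/-- The automorphism `k ↦ -k`. -/
def signHom : Uhalf hp hq →ₐ[ℂ] Uhalf hp hq := U.lift (sat_neg hp hq)

@[simp] theorem signHom_E : signHom hp hq (U.E _) = U.E _ := U.lift_E _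
@[simp] theorem signHom_F : signHom hp hq (U.F _) = U.F _ := U.lift_F _
@[simp] theorem signHom_K : signHom hp hq (U.K _) = -U.K _ := U.lift_K _

@[simp] theorem signHom_incl (x : Ubar hp hq) : signHom hp hq (incl hp hq x) = incl hp hq x := by
  have h : (signHom hp hq).comp (incl hp hq) = incl hp hq := by
    apply U.algHom_ext <;> simp
  exact AlgHom.congr_fun h x

theorem incl_retr (y : Uhalf hp hq) :
    incl hp hq (retr hp hq y) = (2⁻¹ : ℂ) • (y + signHom hp hq y) := by
  obtain ⟨x, x', rfl⟩ := exists_incl_add hp hq y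
  rw [map_add, retr_incl, retr_K_mul, add_zero, map_add, map_mul, signHom_incl, signHom_incl,
    signHom_K, neg_mul, add_add_add_comm, add_neg_cancel, add_zero, ← two_smul ℂ, smul_smul,
    inv_mul_cancel₀ two_ne_zero, one_smul]

theorem incl_retr_of_signHom {y : Uhalf hp hq} (h : signHom hp hq y = y) :
    incl hp hq (retr hp hq y) = y := by
  rw [incl_retr, h, ← two_smul ℂ, smul_smul, inv_mul_cancel₀ two_ne_zero, one_smul]

/-- Inclusion after retraction is the average of the identity and the automorphism `k ↦ -k`.
Invariance in each leg is thus the test for a tensor to come from the small algebra. -/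
theorem map_incl_retr {Y : Uhalf hp hq ⊗[ℂ] Uhalf hp hq}
    (h1 : TensorProduct.map (signHom hp hq).toLinearMap LinearMap.id Y = Y)
    (h2 : TensorProduct.map LinearMap.id (signHom hp hq).toLinearMap Y = Y) :
    TensorProduct.map (incl hp hq).toLinearMap (incl hp hq).toLinearMap
      (TensorProduct.map (retr hp hq) (retr hp hq) Y) = Y := by
  have e : (incl hp hq).toLinearMap ∘ₗ retr hp hq
      = (2⁻¹ : ℂ) • (LinearMap.id + (signHom hp hq).toLinearMap) :=
    LinearMap.ext fun y => incl_retr hp hq y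
  have half : ∀ Z : Uhalf hp hq ⊗[ℂ] Uhalf hp hq, (2⁻¹ : ℂ) • (Z + Z) = Z := fun Z => by
    rw [← two_smul ℂ, smul_smul, inv_mul_cancel₀ two_ne_zero, one_smul]
  have h3 : TensorProduct.map ((incl hp hq).toLinearMap ∘ₗ retr hp hq) LinearMap.id Y = Y := by
    rw [e, TensorProduct.map_smul_left, TensorProduct.map_add_left, TensorProduct.map_id]
    simp only [LinearMap.smul_apply, LinearMap.add_apply, LinearMap.id_apply, h1, half]
  have h4 : TensorProduct.map LinearMap.id ((incl hp hq).toLinearMap ∘ₗ retr hp hq) Y = Y := by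
    rw [e, TensorProduct.map_smul_right, TensorProduct.map_add_right, TensorProduct.map_id]
    simp only [LinearMap.smul_apply, LinearMap.add_apply, LinearMap.id_apply, h2, half]
  rw [← LinearMap.comp_apply, ← TensorProduct.map_comp]
  nth_rw 2 [← h3]
  nth_rw 2 [← h4]
  rw [← LinearMap.comp_apply, ← TensorProduct.map_comp, LinearMap.id_comp, LinearMap.comp_id]

theorem isHopfIncl : IsHopfIncl (incl hp hq) where
  injective := Function.LeftInverse.injective (retr_incl hp hq)
  comul x := by
    have h : (Bialgebra.comulAlgHom ℂ (Uhalf hp hq)).comp (incl hp hq)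
        = (Algebra.TensorProduct.map (incl hp hq) (incl hp hq)).comp
          (Bialgebra.comulAlgHom ℂ (Ubar hp hq)) := by
      apply U.algHom_ext
      · simp
      · simp [incl_Kinv]
      · simp [Bialgebra.comul_pow, Algebra.TensorProduct.tmul_pow]
    exact AlgHom.congr_fun h x
  counit x := by
    have h : (Bialgebra.counitAlgHom ℂ (Uhalf hp hq)).comp (incl hp hq)
        = Bialgebra.counitAlgHom ℂ (Ubar hp hq) := by
      apply U.algHom_ext <;> simp [Bialgebra.counit_pow]
    exact AlgHom.congr_fun h x

theorem antipode_incl (x : Ubar hp hq) :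
    antipode ℂ (incl hp hq x) = incl hp hq (antipode ℂ x) := by
  induction x using U.induction with
  | h1 c => rw [AlgHom.commutes, U.antipode_algebraMap, U.antipode_algebraMap, AlgHom.commutes]
  | hE => rw [incl_E, U.antipode_E, U.antipode_E]; simp [incl_Kinv]
  | hF => rw [incl_F, U.antipode_F, U.antipode_F]; simp
  | hK => rw [incl_K, U.antipode_K, U.antipode_pow, U.antipode_K, incl_Kinv]
  | hadd x y hx hy => simp only [map_add, hx, hy]
  | hmul x y hx hy => rw [map_mul, antipode_mul, antipode_mul, hx, hy, map_mul]

/-- Only `k` is odd and it is grouplike, so the sign of `Δ(k)` may be carried by either leg; the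
coproducts of `E` and `F` contain even powers of `k` only. -/
theorem comul_signHom_left (x : Uhalf hp hq) : comul (R := ℂ) (signHom hp hq x)
    = Algebra.TensorProduct.map (signHom hp hq) (AlgHom.id ℂ _) (comul (R := ℂ) x) := by
  have h : (Bialgebra.comulAlgHom ℂ (Uhalf hp hq)).comp (signHom hp hq)
      = (Algebra.TensorProduct.map (signHom hp hq) (AlgHom.id ℂ _)).comp
        (Bialgebra.comulAlgHom ℂ (Uhalf hp hq)) := by
    have hodd : Odd (2 * p * 2 - 1) := ⟨2 * p - 1, by omega⟩
    have hK : signHom hp hq (U.Kinv _) = -U.Kinv _ := by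
      rw [U.Kinv, map_pow, signHom_K]; exact hodd.neg_pow _
    apply U.algHom_ext
    · simp
    · simp [hK]
    · simp [TensorProduct.neg_tmul]
  exact AlgHom.congr_fun h x

theorem comul_signHom_right (x : Uhalf hp hq) : comul (R := ℂ) (signHom hp hq x)
    = Algebra.TensorProduct.map (AlgHom.id ℂ _) (signHom hp hq) (comul (R := ℂ) x) := by
  have h : (Bialgebra.comulAlgHom ℂ (Uhalf hp hq)).comp (signHom hp hq)
      = (Algebra.TensorProduct.map (AlgHom.id ℂ _) (signHom hp hq)).comp
        (Bialgebra.comulAlgHom ℂ (Uhalf hp hq)) := by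
    apply U.algHom_ext
    · simp
    · simp
    · simp [TensorProduct.tmul_neg]
  exact AlgHom.congr_fun h x

/-- Symmetric linear forms extend to symmetric linear forms. -/
theorem comp_retr_mem_SLF {ψ : Dual ℂ (Ubar hp hq)} (hψ : ψ ∈ SLF (Ubar hp hq)) :
    ψ ∘ₗ retr hp hq ∈ SLF (Uhalf hp hq) := by
  intro y z
  obtain ⟨x, x', rfl⟩ := exists_incl_add hp hq y
  obtain ⟨w, w', rfl⟩ := exists_incl_add hp hq z
  set σ := U.scale (barParam hp hq) (inv_ne_zero (root_ne_zero hp hq)) with hσ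
  have hodd : ∀ u v : Ubar hp hq, incl hp hq u * (U.K _ * incl hp hq v)
      = U.K _ * incl hp hq (σ u * v) := fun u v => by
    rw [← mul_assoc, incl_mul_K, mul_assoc, map_mul]
  have hodd' : ∀ u v : Ubar hp hq, U.K _ * incl hp hq u * incl hp hq v
      = U.K _ * incl hp hq (u * v) := fun u v => by
    rw [mul_assoc, map_mul]
  have heven : ∀ u v : Ubar hp hq, U.K _ * incl hp hq u * (U.K _ * incl hp hq v)
      = incl hp hq (U.K _ * (σ u * v)) := fun u v => by
    rw [mul_assoc, hodd, ← mul_assoc, ← sq, ← incl_K, ← map_mul]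
  simp only [LinearMap.comp_apply, add_mul, mul_add, hodd, hodd', heven, map_add, retr_K_mul,
    map_zero, add_zero, zero_add]
  rw [← map_mul, ← map_mul, retr_incl, retr_incl, retr_incl, retr_incl, hψ x w]
  congr 1
  have hg : ∀ u : Ubar hp hq, U.K _ * u = U.scale _ (pow_ne_zero 2 (root_ne_zero hp hq)) u * U.K _ :=
    fun u => by simpa using U.g_mul_eq_scale (D := barParam hp hq) u
  have hσσ : ∀ u : Ubar hp hq, U.scale _ (pow_ne_zero 2 (root_ne_zero hp hq)) (σ (σ u)) = u := by
    intro u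
    have h : (U.scale (barParam hp hq) (pow_ne_zero 2 (root_ne_zero hp hq))).comp (σ.comp σ)
        = AlgHom.id ℂ _ := by
      have h0 := root_ne_zero hp hq
      have h1 : q⁻¹ * q⁻¹ * (q * q) = 1 := by field_simp
      have h2 : q * q * (q⁻¹ * q⁻¹) = 1 := by field_simp
      apply U.algHom_ext <;> simp [hσ, smul_smul, sq, h1, h2]
    exact AlgHom.congr_fun h u
  have hσK : σ (U.K _) = U.K _ := U.scale_K _
  -- The nontrivial case is the product of two odd elements. Conjugation by `k` contributes a
  -- scaling, harmless for `ψ`, and two such scalings are undone by moving `K` across.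
  rw [← U.SLF_scale hψ (inv_ne_zero (root_ne_zero hp hq)), ← hσ, map_mul σ, map_mul σ, hσK,
    ← mul_assoc, hg (σ (σ x')), hσσ, mul_assoc, hψ, mul_assoc]

/-- Conjugation by `k` is a scaling on the small algebra, and a central element is fixed by all
scalings since it commutes with `K`. -/
theorem incl_comm {z : Ubar hp hq} (hz : ∀ x, z * x = x * z) (y : Uhalf hp hq) :
    incl hp hq z * y = y * incl hp hq z := by
  have h : U.scale _ (inv_ne_zero (root_ne_zero hp hq)) z = z :=
    U.scale_eq_of_commute (hz _).symm _
  have hk : incl hp hq z * U.K _ = U.K _ * incl hp hq z := by rw [incl_mul_K, h]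
  obtain ⟨x, x', rfl⟩ := exists_incl_add hp hq y
  rw [mul_add, add_mul, ← map_mul, hz, map_mul, ← mul_assoc, hk, mul_assoc, ← map_mul _ z, hz x',
    map_mul, mul_assoc]

end Extension
end
end RestrictedQG

open scoped TensorProduct
namespace RestrictedQG
noncomputable section
open Coalgebra HopfAlgebra Module

/-! The coefficients of the R-matrix. -/
section Coefficients

theorem qInt_ne_zero {p : ℕ} {q : ℂ} (hp : 2 ≤ p) (hq : IsPrimitiveRoot q (2 * p)) {m : ℕ}
    (hm : m + 1 < p) : qInt q (m + 1) ≠ 0 := by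
  have h0 : q ≠ 0 := root_ne_zero hp hq
  refine div_ne_zero (fun h => ?_) (barParam hp hq).qhat_ne
  rw [sub_eq_zero, inv_pow, ← mul_eq_one_iff_eq_inv₀ (pow_ne_zero _ h0), ← pow_add] at h
  exact hq.pow_ne_one_of_pos_of_lt (by omega) (by omega) h

/-- The coefficients of the R-matrix. -/
def rCoeff (q : ℂ) (m : ℕ) : ℂ := (q - q⁻¹) ^ m / qFact q m * q ^ (m * (m - 1) / 2)

theorem rCoeff_zero (q : ℂ) : rCoeff q 0 = 1 := by simp [rCoeff, qFact]

variable {p : ℕ} {q : ℂ} (hp : 2 ≤ p) (hq : IsPrimitiveRoot q (2 * p))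
include hp hq

theorem rCoeff_succ {m : ℕ} (hm : m + 1 < p) :
    rCoeff q (m + 1) * qInt q (m + 1) = (q - q⁻¹) * q ^ m * rCoeff q m := by
  have h := qInt_ne_zero hp hq hm
  have hf : qFact q m ≠ 0 := Finset.prod_ne_zero_iff.2 fun i hi =>
    qInt_ne_zero hp hq (by have := Finset.mem_range.1 hi; omega)
  rw [rCoeff, rCoeff, Nat.triangle_succ, qFact, Finset.prod_range_succ, ← qFact, pow_succ, pow_add]
  field_simp

theorem geom_sum_qInt (m : ℕ) :
    ∑ i ∈ Finset.range (m + 1), (q ^ 2) ^ i = q ^ m * qInt q (m + 1) := by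
  have h0 : q ≠ 0 := root_ne_zero hp hq
  have h1 := (barParam hp hq).qhat_ne
  change q - q⁻¹ ≠ 0 at h1
  rw [qInt, mul_div_assoc', eq_div_iff h1]
  induction m with
  | zero => simp
  | succ m ih =>
    rw [Finset.sum_range_succ, add_mul, ih, inv_pow, inv_pow]
    field_simp
    ring

theorem geom_sum_inv_qInt (m : ℕ) :
    q ^ m * ∑ i ∈ Finset.range (m + 1), ((q ^ 2)⁻¹) ^ i = qInt q (m + 1) := by
  have h0 : q ≠ 0 := root_ne_zero hp hq
  have h1 : ∑ i ∈ Finset.range (m + 1), ((q ^ 2)⁻¹) ^ i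
      = ((q ^ 2)⁻¹) ^ m * ∑ i ∈ Finset.range (m + 1), (q ^ 2) ^ i := by
    rw [← Finset.sum_range_reflect, Finset.mul_sum]
    refine Finset.sum_congr rfl fun i hi => ?_
    have hi : i ≤ m := by have := Finset.mem_range.1 hi; omega
    have e : m + 1 - 1 - i + i = m := by omega
    rw [inv_pow, inv_pow, ← pow_mul, ← pow_mul, ← pow_mul]
    rw [eq_inv_mul_iff_mul_eq₀ (pow_ne_zero _ h0), ← div_eq_mul_inv, div_eq_iff (pow_ne_zero _ h0),
      ← pow_add]
    congr 1
    omega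
  rw [h1, geom_sum_qInt hp hq, inv_pow]
  field_simp
  ring

/-- A closed form for the coefficients in which the only term not exponential in `m` is `q^(m²)`. -/
theorem rCoeff_mul_prod {m : ℕ} (hm : m < p) :
    rCoeff q m * ∏ i ∈ Finset.range m, (1 - (q ^ 2) ^ (i + 1))
      = (-(q - q⁻¹) ^ 2) ^ m * q ^ (m ^ 2) := by
  have h0 : q ≠ 0 := root_ne_zero hp hq
  have h1 := (barParam hp hq).qhat_ne
  change q - q⁻¹ ≠ 0 at h1
  induction m with
  | zero => simp [rCoeff_zero]
  | succ m ih =>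
    have h2 := rCoeff_succ hp hq hm
    have h3 : 1 - (q ^ 2) ^ (m + 1) = -(q ^ (m + 1) * (q - q⁻¹)) * qInt q (m + 1) := by
      rw [qInt, neg_mul, mul_assoc, mul_div_cancel₀ _ h1, inv_pow]; field_simp; ring
    rw [Finset.prod_range_succ, h3]
    calc _ = (rCoeff q (m + 1) * qInt q (m + 1)) * (∏ i ∈ Finset.range m, (1 - (q ^ 2) ^ (i + 1)))
            * -(q ^ (m + 1) * (q - q⁻¹)) := by ring
      _ = (rCoeff q m * ∏ i ∈ Finset.range m, (1 - (q ^ 2) ^ (i + 1)))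
            * ((q - q⁻¹) * q ^ m * -(q ^ (m + 1) * (q - q⁻¹))) := by rw [h2]; ring
      _ = _ := by rw [ih (by omega)]; ring

theorem prod_one_sub_ne {m : ℕ} (hm : m < p) :
    ∏ i ∈ Finset.range m, (1 - (q ^ 2) ^ (i + 1)) ≠ 0 := by
  refine Finset.prod_ne_zero_iff.2 fun i hi => ?_
  have hi := Finset.mem_range.1 hi
  rw [sub_ne_zero]
  exact ((barParam hp hq).prim_sq.pow_ne_one_of_pos_of_lt (by omega) (by simp; omega)).symm

/-- From `(m + l)² = m² + 2 m l + l²` in the closed form. It says that the coefficients are those of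
a `q`-exponential. -/
theorem rCoeff_gauss {m l : ℕ} (h : m + l < p) :
    rCoeff q (m + l) * gauss (q ^ 2) (m + l) l = q ^ (2 * l * m) * (rCoeff q m * rCoeff q l) := by
  have h1 := rCoeff_mul_prod hp hq h
  have h2 := rCoeff_mul_prod hp hq (m := m) (by omega)
  have h3 := rCoeff_mul_prod hp hq (m := l) (by omega)
  have n2 := prod_one_sub_ne hp hq (m := m) (by omega)
  have n3 := prod_one_sub_ne hp hq (m := l) (by omega)
  have h4 := gauss_prod (q ^ 2) (m + l) l
  have h5 : ∏ i ∈ Finset.range l, (1 - (q ^ 2) ^ (m + l - i))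
      = ∏ i ∈ Finset.range l, (1 - (q ^ 2) ^ (m + i + 1)) := by
    rw [← Finset.prod_range_reflect]
    refine Finset.prod_congr rfl fun i hi => ?_
    have := Finset.mem_range.1 hi
    congr 2; omega
  rw [Finset.prod_range_add, ← h5, ← h4] at h1
  apply mul_right_cancel₀ (mul_ne_zero n2 n3)
  calc _ = (-(q - q⁻¹) ^ 2) ^ (m + l) * q ^ ((m + l) ^ 2) := by rw [← h1]; ring
    _ = q ^ (2 * l * m) * (((-(q - q⁻¹) ^ 2) ^ m * q ^ (m ^ 2)) * ((-(q - q⁻¹) ^ 2) ^ l * q ^ (l ^ 2))) := by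
      ring
    _ = _ := by rw [← h2, ← h3]; ring

omit hp hq in
theorem sum_range_triangle {V : Type*} [AddCommMonoid V] (f : ℕ → ℕ → V) (n : ℕ)
    (h : ∀ m l, n ≤ m + l → f m l = 0) :
    ∑ m ∈ Finset.range n, ∑ k ∈ Finset.range (m + 1), f k (m - k)
      = ∑ m ∈ Finset.range n, ∑ l ∈ Finset.range n, f m l := by
  rw [Finset.sum_range_diag_flip]
  refine Finset.sum_congr rfl fun m _ => ?_
  refine Finset.sum_subset (Finset.range_mono (Nat.sub_le n m)) fun l _ hl => h m l ?_
  simp only [Finset.mem_range] at hl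
  omega

end Coefficients

/-! The Cartan part. -/
section Cartan
variable {p : ℕ} {q : ℂ} (hp : 2 ≤ p) (hq : IsPrimitiveRoot q (2 * p)) (s : ℂ)

/-- The projector on the eigenspace of `k` for the eigenvalue `s ^ j`. -/
def idem (j : ℕ) : Uhalf hp hq :=
  (1 / (4 * p : ℂ)) • ∑ n ∈ Finset.range (4 * p), (s⁻¹) ^ (n * j) • U.K (halfParam hp hq) ^ n

theorem cartanPart_eq_left : cartanPart hp hq s
    = ∑ j ∈ Finset.range (4 * p), idem hp hq s j ⊗ₜ (U.K (halfParam hp hq) ^ j) := by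
  rw [cartanPart, Finset.sum_comm, Finset.smul_sum]
  refine Finset.sum_congr rfl fun j _ => ?_
  rw [idem, ← TensorProduct.smul_tmul', TensorProduct.sum_tmul]
  simp only [TensorProduct.smul_tmul']

theorem cartanPart_eq_right : cartanPart hp hq s
    = ∑ n ∈ Finset.range (4 * p), (U.K (halfParam hp hq) ^ n) ⊗ₜ idem hp hq s n := by
  rw [cartanPart, Finset.smul_sum]
  refine Finset.sum_congr rfl fun j _ => ?_
  rw [idem, TensorProduct.tmul_smul, TensorProduct.tmul_sum]
  simp only [TensorProduct.tmul_smul, TensorProduct.smul_tmul', mul_comm]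

variable {s} (hs : s ^ 2 = q)
include hp hq hs

-- An odd order of `s` would equal the order of `s² = q`, which is even; so the order of `s` is even
-- and twice that of `q`.
omit hp in
theorem prim_sqrt : IsPrimitiveRoot s (4 * p) := by
  have h := IsPrimitiveRoot.orderOf s
  have h1 : orderOf (s ^ 2) = 2 * p := by rw [hs]; exact hq.eq_orderOf.symm
  have h2 := orderOf_pow_of_dvd (x := s) (n := 2) (by norm_num)
  have h3 : orderOf s ∣ 4 * p := orderOf_dvd_of_pow_eq_one (by
    rw [show 4 * p = 2 * (2 * p) by ring, pow_mul, hs, hq.pow_eq_one])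
  rcases Nat.even_or_odd (orderOf s) with he | ho
  · have := h2 he.two_dvd
    obtain ⟨t, ht⟩ := he.two_dvd
    have : orderOf s = 4 * p := by omega
    rwa [this] at h
  · have h4 : orderOf (s ^ 2) = orderOf s :=
      Nat.Coprime.orderOf_pow (Nat.coprime_two_right.2 ho)
    rw [← h4, h1] at ho
    exact absurd ho (by simp)

theorem sqrt_ne_zero : s ≠ 0 := (prim_sqrt hq hs).ne_zero (by omega)

theorem K_mul_idem (j : ℕ) : U.K _ * idem hp hq s j = s ^ j • idem hp hq s j := by
  have h0 := sqrt_ne_zero hp hq hs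
  have hK : U.K (halfParam hp hq) ^ (4 * p) = 1 := by
    have := (U.sat (halfParam hp hq)).K_pow
    rwa [show 2 * (halfParam hp hq).p * (halfParam hp hq).r = 4 * p by simp; ring] at this
  have hs1 : s⁻¹ ^ (4 * p * j) = 1 := by
    rw [pow_mul, inv_pow, (prim_sqrt hq hs).pow_eq_one, inv_one, one_pow]
  rw [idem, mul_smul_comm, smul_comm]
  congr 1
  -- Multiplication by `k` shifts the sum cyclically; the last term wraps around to the first since
  -- `k^(4p) = 1` and `s^(4p) = 1`.
  obtain ⟨N, hN⟩ : ∃ N, 4 * p = N + 1 := ⟨4 * p - 1, by omega⟩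
  rw [hN] at hK hs1 ⊢
  rw [Finset.mul_sum, Finset.smul_sum, Finset.sum_range_succ, Finset.sum_range_succ' _ N]
  congr 1
  · refine Finset.sum_congr rfl fun n _ => ?_
    rw [mul_smul_comm, ← pow_succ', smul_smul]
    congr 1
    rw [add_mul, one_mul, pow_add, inv_pow, inv_pow]
    field_simp
  · rw [mul_smul_comm, ← pow_succ', hK, smul_smul, pow_zero]
    congr 1
    rw [add_mul, one_mul, pow_add] at hs1
    rw [zero_mul, pow_zero, mul_one]
    rw [mul_eq_one_iff_eq_inv₀ (pow_ne_zero _ (inv_ne_zero h0)), inv_pow s j, inv_inv] at hs1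
    exact hs1

theorem K_pow_mul_idem (n j : ℕ) : U.K _ ^ n * idem hp hq s j = (s ^ j) ^ n • idem hp hq s j := by
  induction n with
  | zero => simp
  | succ n ih => rw [pow_succ', mul_assoc, ih, mul_smul_comm, K_mul_idem hp hq hs, smul_smul, ← pow_succ]

theorem sum_ratio {i j : ℕ} (hi : i < 4 * p) (hj : j < 4 * p) :
    (1 / (4 * p : ℂ)) * ∑ n ∈ Finset.range (4 * p), (s⁻¹) ^ (n * i) * (s ^ j) ^ n
      = if i = j then 1 else 0 := by
  have h0 := sqrt_ne_zero hp hq hs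
  have hp0 : (p : ℂ) ≠ 0 := by exact_mod_cast (by omega : p ≠ 0)
  have hprim := prim_sqrt hq hs
  have e : ∀ n, (s⁻¹) ^ (n * i) * (s ^ j) ^ n = ((s⁻¹) ^ i * s ^ j) ^ n := fun n => by
    rw [mul_pow, mul_comm n i, pow_mul]
  simp only [e]
  split_ifs with h
  · rw [h, ← mul_pow, inv_mul_cancel₀ h0]
    simp
    field_simp
  · have hne : (s⁻¹) ^ i * s ^ j ≠ 1 := by
      rw [inv_pow, Ne, inv_mul_eq_one₀ (pow_ne_zero _ h0)]
      exact fun hh => h (hprim.pow_inj hi hj hh)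
    rw [geom_sum_eq hne, mul_pow, ← pow_mul, ← pow_mul, mul_comm i, mul_comm j, pow_mul _ (4 * p), pow_mul _ (4 * p),
      inv_pow, hprim.pow_eq_one]
    simp

theorem idem_mul_idem {i j : ℕ} (hi : i < 4 * p) (hj : j < 4 * p) :
    idem hp hq s i * idem hp hq s j = if i = j then idem hp hq s j else 0 := by
  conv_lhs => rw [idem]
  rw [smul_mul_assoc, Finset.sum_mul]
  simp only [smul_mul_assoc, K_pow_mul_idem hp hq hs, smul_smul, ← Finset.sum_smul]
  rw [sum_ratio hp hq hs hi hj, ite_smul, one_smul, zero_smul]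

theorem counit_idem {j : ℕ} (hj : j < 4 * p) :
    counit (R := ℂ) (idem hp hq s j) = if j = 0 then 1 else 0 := by
  have := sum_ratio hp hq hs (i := j) (j := 0) hj (by omega)
  simpa [idem, Bialgebra.counit_pow] using this

omit hs in
/-- Commutation of the Cartan part with an eigenvector of `k`, in the right factor. -/
theorem cartanPart_mul_right {x g : Uhalf hp hq} {w : ℂ} (hx : U.K _ * x = w • (x * U.K _))
    (hg : ∀ j, g * idem hp hq s j = w ^ j • idem hp hq s j) :
    cartanPart hp hq s * (1 ⊗ₜ x) = (g ⊗ₜ x) * cartanPart hp hq s := by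
  rw [cartanPart_eq_left, Finset.sum_mul, Finset.mul_sum]
  refine Finset.sum_congr rfl fun j _ => ?_
  rw [Algebra.TensorProduct.tmul_mul_tmul, Algebra.TensorProduct.tmul_mul_tmul, mul_one,
    U.Sat.pow_comm hx, hg, TensorProduct.tmul_smul, TensorProduct.smul_tmul']

omit hs in
/-- Commutation of the Cartan part with an eigenvector of `k`, in the left factor. -/
theorem cartanPart_mul_left {x g : Uhalf hp hq} {w : ℂ} (hx : U.K _ * x = w • (x * U.K _))
    (hg : ∀ j, g * idem hp hq s j = w ^ j • idem hp hq s j) :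
    cartanPart hp hq s * (x ⊗ₜ 1) = (x ⊗ₜ g) * cartanPart hp hq s := by
  rw [cartanPart_eq_right, Finset.sum_mul, Finset.mul_sum]
  refine Finset.sum_congr rfl fun j _ => ?_
  rw [Algebra.TensorProduct.tmul_mul_tmul, Algebra.TensorProduct.tmul_mul_tmul, mul_one,
    U.Sat.pow_comm hx, hg, TensorProduct.tmul_smul, TensorProduct.smul_tmul']

theorem K_sq_mul_idem (j : ℕ) : U.K _ ^ 2 * idem hp hq s j = q ^ j • idem hp hq s j := by
  rw [K_pow_mul_idem hp hq hs, ← pow_mul, mul_comm, pow_mul, hs]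

theorem Kinv_sq_mul_idem (j : ℕ) : U.Kinv _ ^ 2 * idem hp hq s j = (q⁻¹) ^ j • idem hp hq s j := by
  have h1 : U.Kinv (halfParam hp hq) ^ 2 * U.K (halfParam hp hq) ^ 2 = 1 :=
    (U.sat (halfParam hp hq)).ginv_g
  have h2 : q ^ j • (U.Kinv _ ^ 2 * idem hp hq s j) = idem hp hq s j := by
    rw [← mul_smul_comm, ← K_sq_mul_idem hp hq hs, ← mul_assoc, h1, one_mul]
  rw [inv_pow]
  exact (inv_smul_eq_iff₀ (pow_ne_zero _ (root_ne_zero hp hq))).2 h2.symm |>.symm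

theorem cartanPart_mul_E_right : cartanPart hp hq s * (1 ⊗ₜ U.E _)
    = ((U.K _ ^ 2) ⊗ₜ U.E _) * cartanPart hp hq s :=
  cartanPart_mul_right hp hq (U.sat (halfParam hp hq)).K_E (K_sq_mul_idem hp hq hs)
theorem cartanPart_mul_E_left : cartanPart hp hq s * (U.E _ ⊗ₜ 1)
    = (U.E _ ⊗ₜ (U.K _ ^ 2)) * cartanPart hp hq s :=
  cartanPart_mul_left hp hq (U.sat (halfParam hp hq)).K_E (K_sq_mul_idem hp hq hs)
theorem cartanPart_mul_F_right : cartanPart hp hq s * (1 ⊗ₜ U.F _)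
    = ((U.Kinv _ ^ 2) ⊗ₜ U.F _) * cartanPart hp hq s :=
  cartanPart_mul_right hp hq (U.sat (halfParam hp hq)).K_F (Kinv_sq_mul_idem hp hq hs)
theorem cartanPart_mul_F_left : cartanPart hp hq s * (U.F _ ⊗ₜ 1)
    = (U.F _ ⊗ₜ (U.Kinv _ ^ 2)) * cartanPart hp hq s :=
  cartanPart_mul_left hp hq (U.sat (halfParam hp hq)).K_F (Kinv_sq_mul_idem hp hq hs)

end Cartan
end
end RestrictedQG

open scoped TensorProduct
namespace RestrictedQG
noncomputable section
open Coalgebra HopfAlgebra Module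

/-! ### The coproducts of the R-matrix and its commutation with the generators. -/

section RMatrixAxioms
variable {p : ℕ} {q : ℂ} (hp : 2 ≤ p) (hq : IsPrimitiveRoot q (2 * p))

-- The addition formula for the truncated `q`-exponential with parameter `z`. Terms of total degree
-- at least `p` vanish because `z^p = 0`, which turns the triangular sum of the `q`-binomial formula
-- into a square one.
include hp hq in
theorem sum_rCoeff_add_pow {B : Type*} [Ring B] [Algebra ℂ B] {x y z : B}
    (h : y * x = q ^ 2 • (x * y)) (hz : z ^ p = 0) :
    ∑ n ∈ Finset.range p, rCoeff q n • ((x + y) ^ n * z ^ n)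
      = ∑ m ∈ Finset.range p, ∑ l ∈ Finset.range p,
        (rCoeff q m * rCoeff q l) • (y ^ m * x ^ l * z ^ (m + l)) := by
  have h1 := sum_range_triangle (fun k l => (rCoeff q (l + k) * gauss (q ^ 2) (l + k) k) •
    (x ^ k * y ^ l * z ^ (l + k))) p (fun k l hkl => by
      rw [pow_eq_zero_of_le (by omega) hz, mul_zero, smul_zero])
  rw [Finset.sum_comm (s := Finset.range p) (t := Finset.range p)] at h1 ⊢
  rw [Finset.sum_comm (s := Finset.range p) (t := Finset.range p)]
  have h2 : ∀ n ∈ Finset.range p, rCoeff q n • ((x + y) ^ n * z ^ n)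
      = ∑ k ∈ Finset.range (n + 1), (rCoeff q (n - k + k) * gauss (q ^ 2) (n - k + k) k) •
    (x ^ k * y ^ (n - k) * z ^ (n - k + k)) := by
    intro n _
    rw [add_pow_q h, Finset.sum_mul, Finset.smul_sum]
    refine Finset.sum_congr rfl fun k hk => ?_
    have := Finset.mem_range.1 hk
    rw [Nat.sub_add_cancel (by omega), smul_mul_assoc, smul_smul]
  rw [Finset.sum_congr rfl h2, h1]
  refine Finset.sum_congr rfl fun m _ => Finset.sum_congr rfl fun l _ => ?_
  by_cases hml : m + l < p
  · have hyx : y ^ m * x ^ l = q ^ (2 * l * m) • (x ^ l * y ^ m) := by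
      rw [U.Sat.pow_comm (w := (q ^ 2) ^ l) (y_mul_pow h l), ← pow_mul, ← pow_mul, mul_assoc]
    rw [rCoeff_gauss hp hq hml, hyx, smul_mul_assoc, smul_smul, mul_comm (q ^ _)]
  · rw [pow_eq_zero_of_le (by omega) hz, mul_zero, mul_zero, smul_zero, smul_zero]

/-- The part `∑ (q - q⁻¹)^m / [m]! q^(m (m - 1) / 2) E^m ⊗ F^m` of the R-matrix. -/
def thetaPart : Uhalf hp hq ⊗[ℂ] Uhalf hp hq :=
  ∑ m ∈ Finset.range p, rCoeff q m • (U.E (halfParam hp hq) ^ m) ⊗ₜ[ℂ] (U.F (halfParam hp hq) ^ m)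

theorem RMatrix_eq (s : ℂ) : RMatrix hp hq s = cartanPart hp hq s * thetaPart hp hq := rfl

/-- The left components of the R-matrix. -/
def rLeft (s : ℂ) (i : Fin (4 * p) × Fin p) : Uhalf hp hq :=
  rCoeff q i.2 • (idem hp hq s i.1 * U.E (halfParam hp hq) ^ (i.2 : ℕ))

/-- The right components of the R-matrix. -/
def rRight (i : Fin (4 * p) × Fin p) : Uhalf hp hq :=
  U.K (halfParam hp hq) ^ (i.1 : ℕ) * U.F (halfParam hp hq) ^ (i.2 : ℕ)

theorem RMatrix_eq_sum (s : ℂ) :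
    RMatrix hp hq s = ∑ i, rLeft hp hq s i ⊗ₜ[ℂ] rRight hp hq i := by
  rw [RMatrix_eq, cartanPart_eq_left, thetaPart, Finset.sum_mul_sum, Fintype.sum_prod_type,
    ← Fin.sum_univ_eq_sum_range]
  refine Finset.sum_congr rfl fun j _ => ?_
  rw [← Fin.sum_univ_eq_sum_range]
  refine Finset.sum_congr rfl fun m _ => ?_
  rw [mul_smul_comm, Algebra.TensorProduct.tmul_mul_tmul, TensorProduct.smul_tmul']
  rfl

local notation "eA" => U.E (halfParam hp hq)
local notation "fA" => U.F (halfParam hp hq)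
local notation "kA" => U.K (halfParam hp hq)
local notation "gA" => U.K (halfParam hp hq) ^ 2
local notation "hA" => U.Kinv (halfParam hp hq) ^ 2

theorem g_mul_h : gA * hA = 1 := (U.sat (halfParam hp hq)).g_ginv
theorem h_mul_g : hA * gA = 1 := (U.sat (halfParam hp hq)).ginv_g
theorem g_mul_E : gA * eA = q ^ 2 • (eA * gA) := (U.sat (halfParam hp hq)).g_e
theorem g_mul_F : gA * fA = (q ^ 2)⁻¹ • (fA * gA) := (U.sat (halfParam hp hq)).g_f
theorem h_mul_E : hA * eA = (q ^ 2)⁻¹ • (eA * hA) := (U.sat (halfParam hp hq)).ginv_e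
theorem h_mul_F : hA * fA = q ^ 2 • (fA * hA) := (U.sat (halfParam hp hq)).ginv_f
theorem comul_E_half : comul (R := ℂ) eA = 1 ⊗ₜ eA + eA ⊗ₜ gA := U.comul_E _
theorem comul_F_half : comul (R := ℂ) fA = fA ⊗ₜ 1 + hA ⊗ₜ fA := U.comul_F _
theorem E_pow_half : eA ^ p = 0 := (U.sat (halfParam hp hq)).E_pow
theorem F_pow_half : fA ^ p = 0 := (U.sat (halfParam hp hq)).F_pow

variable (s : ℂ)

/-- The Cartan part commutes with elements commuting with `k`. -/
theorem cartanPart_commute {x y : Uhalf hp hq} (hx : Commute kA x) (hy : Commute kA y) :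
    Commute (cartanPart hp hq s) (x ⊗ₜ y) := by
  rw [cartanPart]
  change _ * _ = _ * _
  rw [smul_mul_assoc, mul_smul_comm, Finset.sum_mul, Finset.mul_sum]
  congr 1
  refine Finset.sum_congr rfl fun n _ => ?_
  rw [Finset.sum_mul, Finset.mul_sum]
  refine Finset.sum_congr rfl fun j _ => ?_
  rw [smul_mul_assoc, mul_smul_comm, Algebra.TensorProduct.tmul_mul_tmul, Algebra.TensorProduct.tmul_mul_tmul,
    (hx.pow_left n).eq, (hy.pow_left j).eq]

theorem commute_K_h : Commute kA hA := (Commute.self_pow kA _).pow_right 2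

variable {s} (hs : s ^ 2 = q)
include hs

theorem F_mul_cartanPart : (1 ⊗ₜ fA) * cartanPart hp hq s = cartanPart hp hq s * (gA ⊗ₜ fA) := by
  have h1 := cartanPart_mul_F_right hp hq hs
  have h2 := (cartanPart_commute hp hq s ((Commute.refl kA).pow_right 2) (Commute.one_right _)).eq
  have e : gA ⊗ₜ[ℂ] fA = (gA ⊗ₜ 1) * (1 ⊗ₜ fA) := by simp
  rw [e, ← mul_assoc, h2, mul_assoc, h1, ← mul_assoc, Algebra.TensorProduct.tmul_mul_tmul, g_mul_h,
    one_mul]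

theorem E_mul_cartanPart : (eA ⊗ₜ 1) * cartanPart hp hq s = cartanPart hp hq s * (eA ⊗ₜ hA) := by
  have h1 := cartanPart_mul_E_left hp hq hs
  have h2 := (cartanPart_commute hp hq s (Commute.one_right _) (commute_K_h hp hq)).eq
  have e : eA ⊗ₜ[ℂ] hA = (1 ⊗ₜ hA) * (eA ⊗ₜ 1) := by simp
  rw [e, ← mul_assoc, h2, mul_assoc, h1, ← mul_assoc, Algebra.TensorProduct.tmul_mul_tmul, h_mul_g,
    one_mul]

/-- For the Cartan part this is the orthogonality of the weight projectors in the last leg. For the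
other part it is the `q`-exponential formula applied to the two terms of `Δ(E)`; moving `Θ₁₃` past
the Cartan part in legs `2, 3` supplies the factor `K` between them. -/
theorem comul_left_RMatrix :
    Algebra.TensorProduct.map (Bialgebra.comulAlgHom ℂ (Uhalf hp hq)) (AlgHom.id ℂ _)
      (RMatrix hp hq s)
    = Algebra.TensorProduct.map (Algebra.TensorProduct.includeLeft (R := ℂ) (S := ℂ)
        (A := Uhalf hp hq) (B := Uhalf hp hq)) (AlgHom.id ℂ _) (RMatrix hp hq s)
      * Algebra.TensorProduct.map (Algebra.TensorProduct.includeRight (R := ℂ) (A := Uhalf hp hq))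
        (AlgHom.id ℂ _) (RMatrix hp hq s) := by
  set i13 : Uhalf hp hq ⊗[ℂ] Uhalf hp hq →ₐ[ℂ] (Uhalf hp hq ⊗[ℂ] Uhalf hp hq) ⊗[ℂ] Uhalf hp hq :=
    Algebra.TensorProduct.map Algebra.TensorProduct.includeLeft (AlgHom.id ℂ _)
  set i23 : Uhalf hp hq ⊗[ℂ] Uhalf hp hq →ₐ[ℂ] (Uhalf hp hq ⊗[ℂ] Uhalf hp hq) ⊗[ℂ] Uhalf hp hq :=
    Algebra.TensorProduct.map Algebra.TensorProduct.includeRight (AlgHom.id ℂ _)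
  set Δ := Algebra.TensorProduct.map (Bialgebra.comulAlgHom ℂ (Uhalf hp hq))
    (AlgHom.id ℂ (Uhalf hp hq))
  have h13 : ∀ x y, i13 (x ⊗ₜ y) = (x ⊗ₜ 1) ⊗ₜ y := fun x y => rfl
  have h23 : ∀ x y, i23 (x ⊗ₜ y) = (1 ⊗ₜ x) ⊗ₜ y := fun x y => rfl
  have hΔ : ∀ x y, Δ (x ⊗ₜ y) = comul (R := ℂ) x ⊗ₜ y := fun x y => rfl
  have hC : Δ (cartanPart hp hq s) = i13 (cartanPart hp hq s) * i23 (cartanPart hp hq s) := by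
    rw [cartanPart_eq_right]
    simp only [map_sum, h13, h23, hΔ, Bialgebra.comul_pow, U.comul_K,
      Algebra.TensorProduct.tmul_pow, Finset.sum_mul_sum, Algebra.TensorProduct.tmul_mul_tmul,
      mul_one, one_mul]
    refine Finset.sum_congr rfl fun n hn => ?_
    rw [Finset.sum_eq_single n]
    · rw [idem_mul_idem hp hq hs (Finset.mem_range.1 hn) (Finset.mem_range.1 hn), if_pos rfl]
    · intro m hm hmn
      rw [idem_mul_idem hp hq hs (Finset.mem_range.1 hn) (Finset.mem_range.1 hm), if_neg hmn.symm,
        TensorProduct.tmul_zero]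
    · exact fun h => absurd hn h
  set T' : (Uhalf hp hq ⊗[ℂ] Uhalf hp hq) ⊗[ℂ] Uhalf hp hq :=
    ∑ m ∈ Finset.range p, rCoeff q m • ((eA ^ m) ⊗ₜ[ℂ] ((gA) ^ m)) ⊗ₜ[ℂ] (fA ^ m)
  have hTC : i13 (thetaPart hp hq) * i23 (cartanPart hp hq s)
      = i23 (cartanPart hp hq s) * T' := by
    rw [thetaPart, map_sum, Finset.sum_mul, Finset.mul_sum]
    refine Finset.sum_congr rfl fun m _ => ?_
    rw [map_smul, smul_mul_assoc, mul_smul_comm, h13]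
    congr 1
    have e1 : ((eA ^ m) ⊗ₜ[ℂ] (1 : Uhalf hp hq)) ⊗ₜ[ℂ] (fA ^ m)
        = (((eA ^ m) ⊗ₜ[ℂ] (1 : Uhalf hp hq)) ⊗ₜ[ℂ] 1) * i23 ((1 ⊗ₜ fA) ^ m) := by
      rw [Algebra.TensorProduct.tmul_pow, h23]; simp
    have e2 : ((eA ^ m) ⊗ₜ[ℂ] ((gA) ^ m)) ⊗ₜ[ℂ] (fA ^ m)
        = (((eA ^ m) ⊗ₜ[ℂ] (1 : Uhalf hp hq)) ⊗ₜ[ℂ] 1) * i23 ((gA ⊗ₜ fA) ^ m) := by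
      rw [Algebra.TensorProduct.tmul_pow, h23]; simp
    have e3 : ((1 : Uhalf hp hq) ⊗ₜ[ℂ] fA) ^ m * cartanPart hp hq s
        = cartanPart hp hq s * (gA ⊗ₜ[ℂ] fA) ^ m :=
      (SemiconjBy.pow_right (F_mul_cartanPart hp hq hs).symm m).symm
    have e4 : Commute (((eA ^ m) ⊗ₜ[ℂ] (1 : Uhalf hp hq)) ⊗ₜ[ℂ] (1 : Uhalf hp hq))
        (i23 (cartanPart hp hq s)) := by
      rw [cartanPart_eq_left, map_sum]
      refine Commute.sum_right _ _ _ fun j _ => ?_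
      rw [h23]
      change _ * _ = _ * _
      simp
    rw [e1, e2, mul_assoc, ← map_mul, e3, map_mul, ← mul_assoc, e4.eq, mul_assoc]
  have hT : Δ (thetaPart hp hq) = T' * i23 (thetaPart hp hq) := by
    have h := sum_rCoeff_add_pow hp hq (B := (Uhalf hp hq ⊗[ℂ] Uhalf hp hq) ⊗[ℂ] Uhalf hp hq)
      (x := (1 ⊗ₜ eA) ⊗ₜ 1) (y := (eA ⊗ₜ gA) ⊗ₜ 1) (z := 1 ⊗ₜ fA)
      (by simp [g_mul_E, TensorProduct.tmul_smul, TensorProduct.smul_tmul'])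
      (by rw [Algebra.TensorProduct.tmul_pow, F_pow_half, TensorProduct.tmul_zero])
    rw [thetaPart, map_sum, map_sum, Finset.sum_mul_sum]
    simp only [← TensorProduct.add_tmul, ← comul_E_half] at h
    simp only [Algebra.TensorProduct.tmul_pow, Algebra.TensorProduct.tmul_mul_tmul, one_pow,
      one_mul, mul_one] at h
    simp only [map_smul, hΔ, h23, smul_mul_smul_comm, Algebra.TensorProduct.tmul_mul_tmul, mul_one,
      ← pow_add, Bialgebra.comul_pow]
    exact h
  rw [RMatrix_eq, map_mul, map_mul, map_mul, hC, hT, mul_assoc, ← mul_assoc (i23 _) T', ← hTC]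
  simp only [mul_assoc]

theorem comul_right_RMatrix :
    Algebra.TensorProduct.map (AlgHom.id ℂ _) (Bialgebra.comulAlgHom ℂ (Uhalf hp hq))
      (RMatrix hp hq s)
    = Algebra.TensorProduct.map (AlgHom.id ℂ _) (Algebra.TensorProduct.includeRight (R := ℂ)
        (A := Uhalf hp hq)) (RMatrix hp hq s)
      * Algebra.TensorProduct.map (AlgHom.id ℂ _) (Algebra.TensorProduct.includeLeft (R := ℂ)
        (S := ℂ) (A := Uhalf hp hq) (B := Uhalf hp hq)) (RMatrix hp hq s) := by
  set i13 : Uhalf hp hq ⊗[ℂ] Uhalf hp hq →ₐ[ℂ] Uhalf hp hq ⊗[ℂ] (Uhalf hp hq ⊗[ℂ] Uhalf hp hq) :=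
    Algebra.TensorProduct.map (AlgHom.id ℂ _) Algebra.TensorProduct.includeRight
  set i12 : Uhalf hp hq ⊗[ℂ] Uhalf hp hq →ₐ[ℂ] Uhalf hp hq ⊗[ℂ] (Uhalf hp hq ⊗[ℂ] Uhalf hp hq) :=
    Algebra.TensorProduct.map (AlgHom.id ℂ _) Algebra.TensorProduct.includeLeft
  set Δ := Algebra.TensorProduct.map (AlgHom.id ℂ (Uhalf hp hq))
    (Bialgebra.comulAlgHom ℂ (Uhalf hp hq))
  have h13 : ∀ x y, i13 (x ⊗ₜ y) = x ⊗ₜ (1 ⊗ₜ y) := fun x y => rfl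
  have h12 : ∀ x y, i12 (x ⊗ₜ y) = x ⊗ₜ (y ⊗ₜ 1) := fun x y => rfl
  have hΔ : ∀ x y, Δ (x ⊗ₜ y) = x ⊗ₜ comul (R := ℂ) y := fun x y => rfl
  have hC : Δ (cartanPart hp hq s) = i13 (cartanPart hp hq s) * i12 (cartanPart hp hq s) := by
    rw [cartanPart_eq_left]
    simp only [map_sum, h13, h12, hΔ, Bialgebra.comul_pow, U.comul_K,
      Algebra.TensorProduct.tmul_pow, Finset.sum_mul_sum, Algebra.TensorProduct.tmul_mul_tmul,
      mul_one, one_mul]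
    refine Finset.sum_congr rfl fun n hn => ?_
    rw [Finset.sum_eq_single n]
    · rw [idem_mul_idem hp hq hs (Finset.mem_range.1 hn) (Finset.mem_range.1 hn), if_pos rfl]
    · intro m hm hmn
      rw [idem_mul_idem hp hq hs (Finset.mem_range.1 hn) (Finset.mem_range.1 hm), if_neg hmn.symm,
        TensorProduct.zero_tmul]
    · exact fun h => absurd hn h
  set T' : Uhalf hp hq ⊗[ℂ] (Uhalf hp hq ⊗[ℂ] Uhalf hp hq) :=
    ∑ m ∈ Finset.range p, rCoeff q m • (eA ^ m) ⊗ₜ[ℂ] (((hA) ^ m) ⊗ₜ[ℂ] (fA ^ m))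
  have hTC : i13 (thetaPart hp hq) * i12 (cartanPart hp hq s)
      = i12 (cartanPart hp hq s) * T' := by
    rw [thetaPart, map_sum, Finset.sum_mul, Finset.mul_sum]
    refine Finset.sum_congr rfl fun m _ => ?_
    rw [map_smul, smul_mul_assoc, mul_smul_comm, h13]
    congr 1
    have e1 : (eA ^ m) ⊗ₜ[ℂ] ((1 : Uhalf hp hq) ⊗ₜ[ℂ] (fA ^ m))
        = (1 ⊗ₜ[ℂ] ((1 : Uhalf hp hq) ⊗ₜ[ℂ] (fA ^ m))) * i12 ((eA ⊗ₜ 1) ^ m) := by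
      rw [Algebra.TensorProduct.tmul_pow, h12]; simp
    have e2 : (eA ^ m) ⊗ₜ[ℂ] (((hA) ^ m) ⊗ₜ[ℂ] (fA ^ m))
        = (1 ⊗ₜ[ℂ] ((1 : Uhalf hp hq) ⊗ₜ[ℂ] (fA ^ m))) * i12 ((eA ⊗ₜ hA) ^ m) := by
      rw [Algebra.TensorProduct.tmul_pow, h12]; simp
    have e3 : (eA ⊗ₜ[ℂ] (1 : Uhalf hp hq)) ^ m * cartanPart hp hq s
        = cartanPart hp hq s * (eA ⊗ₜ[ℂ] hA) ^ m :=
      (SemiconjBy.pow_right (E_mul_cartanPart hp hq hs).symm m).symm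
    have e4 : Commute ((1 : Uhalf hp hq) ⊗ₜ[ℂ] ((1 : Uhalf hp hq) ⊗ₜ[ℂ] (fA ^ m)))
        (i12 (cartanPart hp hq s)) := by
      rw [cartanPart_eq_left, map_sum]
      refine Commute.sum_right _ _ _ fun j _ => ?_
      rw [h12]
      change _ * _ = _ * _
      simp
    rw [e1, e2, mul_assoc, ← map_mul, e3, map_mul, ← mul_assoc, e4.eq, mul_assoc]
  have hT : Δ (thetaPart hp hq) = T' * i12 (thetaPart hp hq) := by
    have h := sum_rCoeff_add_pow hp hq (B := Uhalf hp hq ⊗[ℂ] (Uhalf hp hq ⊗[ℂ] Uhalf hp hq))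
      (x := 1 ⊗ₜ (fA ⊗ₜ 1)) (y := 1 ⊗ₜ (hA ⊗ₜ fA)) (z := eA ⊗ₜ 1)
      (by simp [h_mul_F, TensorProduct.tmul_smul, ← TensorProduct.smul_tmul'])
      (by rw [Algebra.TensorProduct.tmul_pow, E_pow_half, TensorProduct.zero_tmul])
    rw [thetaPart, map_sum, map_sum, Finset.sum_mul_sum]
    simp only [← TensorProduct.tmul_add, ← comul_F_half] at h
    simp only [Algebra.TensorProduct.tmul_pow, Algebra.TensorProduct.tmul_mul_tmul, one_pow,
      one_mul, mul_one] at h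
    simp only [map_smul, hΔ, h12, smul_mul_smul_comm, Algebra.TensorProduct.tmul_mul_tmul, mul_one,
      ← pow_add, Bialgebra.comul_pow]
    exact h
  rw [RMatrix_eq, map_mul, map_mul, map_mul, hC, hT, mul_assoc, ← mul_assoc (i12 _) T', ← hTC]
  simp only [mul_assoc]

omit hs in
include hp hq in
theorem rCoeff_mul_geom {m : ℕ} (hm : m + 1 < p) :
    rCoeff q (m + 1) * ((q - q⁻¹)⁻¹ * ∑ i ∈ Finset.range (m + 1), (q ^ 2) ^ i)
      = rCoeff q m * (q ^ 2) ^ m := by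
  have hqh : q - q⁻¹ ≠ 0 := (halfParam hp hq).qhat_ne
  rw [geom_sum_qInt hp hq m]
  calc _ = (rCoeff q (m + 1) * qInt q (m + 1)) * ((q - q⁻¹)⁻¹ * q ^ m) := by ring
    _ = ((q - q⁻¹) * (q - q⁻¹)⁻¹) * rCoeff q m * (q ^ m * q ^ m) := by
      rw [rCoeff_succ hp hq hm]; ring
    _ = _ := by rw [mul_inv_cancel₀ hqh, one_mul, ← mul_pow, sq]

omit hs in
include hp hq in
theorem rCoeff_mul_geom_inv {m : ℕ} (hm : m + 1 < p) :
    rCoeff q (m + 1) * ((q - q⁻¹)⁻¹ * ∑ i ∈ Finset.range (m + 1), ((q ^ 2)⁻¹) ^ i)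
      = rCoeff q m := by
  have hqh : q - q⁻¹ ≠ 0 := (halfParam hp hq).qhat_ne
  apply mul_left_cancel₀ (pow_ne_zero m (root_ne_zero hp hq))
  calc _ = rCoeff q (m + 1) * (q ^ m * ∑ i ∈ Finset.range (m + 1), ((q ^ 2)⁻¹) ^ i)
        * (q - q⁻¹)⁻¹ := by ring
    _ = _ := by
      rw [geom_sum_inv_qInt hp hq m, rCoeff_succ hp hq hm]
      calc _ = ((q - q⁻¹) * (q - q⁻¹)⁻¹) * (q ^ m * rCoeff q m) := by ring
        _ = _ := by rw [mul_inv_cancel₀ hqh, one_mul]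

-- The commutators of `E` with the powers of `F` shift the degree by one, and the recursion for the
-- coefficients makes the resulting sums telescope. The right-hand side is not yet the opposite
-- coproduct: conjugation by the Cartan part turns `E ⊗ K⁻¹` into `E ⊗ 1` and `1 ⊗ E` into `K ⊗ E`.
omit hs in
theorem thetaPart_E : thetaPart hp hq * (1 ⊗ₜ eA + eA ⊗ₜ gA)
    = (eA ⊗ₜ hA + 1 ⊗ₜ eA) * thetaPart hp hq := by
  have key : ∑ m ∈ Finset.range p, rCoeff q m • (eA ^ m) ⊗ₜ[ℂ] (eA * fA ^ m - fA ^ m * eA)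
      = ∑ m ∈ Finset.range p, rCoeff q m • (eA ^ (m + 1)) ⊗ₜ[ℂ] (fA ^ m * gA - hA * fA ^ m) := by
    obtain ⟨N, hN⟩ : ∃ N, p = N + 1 := ⟨p - 1, by omega⟩
    have hE : eA ^ (N + 1) = 0 := by rw [← hN]; exact E_pow_half hp hq
    have hr : Finset.range p = Finset.range (N + 1) := by rw [hN]
    rw [hr, Finset.sum_range_succ', Finset.sum_range_succ]
    rw [hE, TensorProduct.zero_tmul, smul_zero, pow_zero fA, one_mul, mul_one, sub_self,
      TensorProduct.tmul_zero, smul_zero, add_zero, add_zero]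
    refine Finset.sum_congr rfl fun m hm => ?_
    have hm : m + 1 < p := by have := Finset.mem_range.1 hm; omega
    have h1 := mul_pow_sub_pow_mul (U.sat (halfParam hp hq)).E_F (g_mul_F hp hq) (h_mul_F hp hq) m
    have h5 : hA * fA ^ m = (q ^ 2) ^ m • (fA ^ m * hA) := y_mul_pow (h_mul_F hp hq) m
    rw [h1, h5, ← TensorProduct.tmul_smul, ← TensorProduct.tmul_smul]
    congr 1
    change rCoeff q (m + 1) • (q - q⁻¹)⁻¹ • (fA ^ m * (_ • gA - _ • hA)) = _
    rw [mul_sub, mul_smul_comm, mul_smul_comm, smul_sub, smul_sub, smul_sub, smul_smul, smul_smul,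
      smul_smul, smul_smul, smul_smul, mul_assoc, mul_assoc, rCoeff_mul_geom hp hq hm,
      rCoeff_mul_geom_inv hp hq hm]
  simp only [thetaPart, mul_add, add_mul, Finset.sum_mul, Finset.mul_sum, smul_mul_assoc,
    mul_smul_comm, Algebra.TensorProduct.tmul_mul_tmul, one_mul, mul_one, ← pow_succ, ← pow_succ',
    smul_add, Finset.sum_add_distrib]
  simp only [TensorProduct.tmul_sub, smul_sub, Finset.sum_sub_distrib] at key
  rw [sub_eq_sub_iff_add_eq_add] at key
  rw [add_comm, ← key, add_comm]

omit hs in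
theorem thetaPart_F : thetaPart hp hq * (fA ⊗ₜ 1 + hA ⊗ₜ fA)
    = (fA ⊗ₜ 1 + gA ⊗ₜ fA) * thetaPart hp hq := by
  have key : ∑ m ∈ Finset.range p, rCoeff q m • (eA ^ m * fA - fA * eA ^ m) ⊗ₜ[ℂ] (fA ^ m)
      = ∑ m ∈ Finset.range p, rCoeff q m • (gA * eA ^ m - eA ^ m * hA) ⊗ₜ[ℂ] (fA ^ (m + 1)) := by
    obtain ⟨N, hN⟩ : ∃ N, p = N + 1 := ⟨p - 1, by omega⟩
    have hF : fA ^ (N + 1) = 0 := by rw [← hN]; exact F_pow_half hp hq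
    have hr : Finset.range p = Finset.range (N + 1) := by rw [hN]
    rw [hr, Finset.sum_range_succ', Finset.sum_range_succ]
    rw [hF, TensorProduct.tmul_zero, smul_zero, pow_zero eA, one_mul, mul_one, sub_self,
      TensorProduct.zero_tmul, smul_zero, add_zero, add_zero]
    refine Finset.sum_congr rfl fun m hm => ?_
    have hm : m + 1 < p := by have := Finset.mem_range.1 hm; omega
    have h0 : fA * eA - eA * fA = (q - q⁻¹)⁻¹ • (hA - gA) := by
      rw [← neg_sub, (U.sat (halfParam hp hq)).E_F, ← smul_neg, neg_sub]; rfl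
    have h1 := mul_pow_sub_pow_mul h0 (h_mul_E hp hq) (g_mul_E hp hq) m
    have h5 : gA * eA ^ m = (q ^ 2) ^ m • (eA ^ m * gA) := y_mul_pow (g_mul_E hp hq) m
    rw [← neg_sub, h1, h5, TensorProduct.smul_tmul', TensorProduct.smul_tmul']
    congr 1
    rw [mul_sub, mul_smul_comm, mul_smul_comm, ← smul_neg, neg_sub, smul_sub, smul_sub, smul_sub,
      smul_smul, smul_smul, smul_smul, smul_smul, smul_smul, mul_assoc, mul_assoc,
      rCoeff_mul_geom hp hq hm, rCoeff_mul_geom_inv hp hq hm]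
  simp only [thetaPart, mul_add, add_mul, Finset.sum_mul, Finset.mul_sum, smul_mul_assoc,
    mul_smul_comm, Algebra.TensorProduct.tmul_mul_tmul, one_mul, mul_one, ← pow_succ, ← pow_succ',
    smul_add, Finset.sum_add_distrib]
  simp only [TensorProduct.sub_tmul, smul_sub, Finset.sum_sub_distrib] at key
  rw [sub_eq_sub_iff_add_eq_add] at key
  rw [key, add_comm]

end RMatrixAxioms
end
end RestrictedQG

open scoped TensorProduct
namespace RestrictedQG
noncomputable section
open Coalgebra HopfAlgebra Module

/-! ### Quasitriangularity, and the effect of `k ↦ -k` on the R-matrix. -/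

section RMatrixOfHalf
variable {p : ℕ} {q : ℂ} (hp : 2 ≤ p) (hq : IsPrimitiveRoot q (2 * p))

local notation "eA" => U.E (halfParam hp hq)
local notation "fA" => U.F (halfParam hp hq)
local notation "kA" => U.K (halfParam hp hq)
local notation "gA" => U.K (halfParam hp hq) ^ 2
local notation "hA" => U.Kinv (halfParam hp hq) ^ 2

variable {s : ℂ} (hs : s ^ 2 = q)
include hs

theorem RMatrix_mul_comul (x : Uhalf hp hq) : RMatrix hp hq s * comul (R := ℂ) x
    = TensorProduct.comm ℂ _ _ (comul (R := ℂ) x) * RMatrix hp hq s := by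
  let fl : Uhalf hp hq ⊗[ℂ] Uhalf hp hq →ₐ[ℂ] Uhalf hp hq ⊗[ℂ] Uhalf hp hq :=
    (Algebra.TensorProduct.comm ℂ _ _).toAlgHom
  have hfl : ∀ X, TensorProduct.comm ℂ _ _ X = fl X := fun X => rfl
  have hft : ∀ x y, fl (x ⊗ₜ y) = y ⊗ₜ x := fun x y => rfl
  rw [hfl]
  induction x using U.induction with
  | h1 c => rw [Bialgebra.comul_algebraMap, AlgHom.commutes, Algebra.commutes]
  | hE =>
    rw [comul_E_half, map_add, hft, hft, RMatrix_eq, mul_assoc, thetaPart_E, ← mul_assoc, mul_add,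
      ← E_mul_cartanPart hp hq hs, cartanPart_mul_E_right hp hq hs, ← add_mul, mul_assoc]
  | hF =>
    rw [comul_F_half, map_add, hft, hft, RMatrix_eq, mul_assoc, thetaPart_F, ← mul_assoc, mul_add,
      ← F_mul_cartanPart hp hq hs, cartanPart_mul_F_left hp hq hs, ← add_mul, mul_assoc, add_comm]
  | hK =>
    rw [U.comul_K, hft, RMatrix_eq, mul_assoc, ← mul_assoc _ (cartanPart hp hq s),
      ← (cartanPart_commute hp hq s (Commute.refl kA) (Commute.refl kA)).eq, mul_assoc]
    congr 1
    have h0 := root_ne_zero hp hq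
    have hKE := (U.sat (halfParam hp hq)).K_E
    have hKF := (U.sat (halfParam hp hq)).K_F
    rw [thetaPart, Finset.sum_mul, Finset.mul_sum]
    refine Finset.sum_congr rfl fun m _ => ?_
    rw [smul_mul_assoc, mul_smul_comm, Algebra.TensorProduct.tmul_mul_tmul,
      Algebra.TensorProduct.tmul_mul_tmul, y_mul_pow hKE, y_mul_pow hKF, TensorProduct.tmul_smul,
      ← TensorProduct.smul_tmul', smul_smul, smul_smul, mul_assoc, ← mul_pow]
    change _ = (_ * (q⁻¹ * q) ^ m) • _
    rw [inv_mul_cancel₀ h0, one_pow, mul_one]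
  | hadd x y hx hy => rw [map_add, map_add, mul_add, add_mul, hx, hy]
  | hmul x y hx hy =>
    rw [Bialgebra.comul_mul, map_mul, ← mul_assoc, hx, mul_assoc, hy, mul_assoc]

theorem counit_left_RMatrix : TensorProduct.lid ℂ _
    (TensorProduct.map (counit (R := ℂ)) LinearMap.id (RMatrix hp hq s)) = 1 := by
  let φ : Uhalf hp hq ⊗[ℂ] Uhalf hp hq →ₐ[ℂ] Uhalf hp hq :=
    (Algebra.TensorProduct.lid ℂ _).toAlgHom.comp
      (Algebra.TensorProduct.map (Bialgebra.counitAlgHom ℂ _) (AlgHom.id ℂ _))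
  have hφ : ∀ x y, φ (x ⊗ₜ y) = counit (R := ℂ) x • y := fun x y => rfl
  change φ _ = 1
  rw [RMatrix_eq, map_mul, cartanPart_eq_left, thetaPart, map_sum, map_sum,
    Finset.sum_eq_single 0, Finset.sum_eq_single 0, hφ, counit_idem hp hq hs (by omega), if_pos rfl,
    map_smul, hφ, rCoeff_zero]
  · simp
  · intro m _ hm
    rw [map_smul, hφ, Bialgebra.counit_pow, U.counit_E, zero_pow hm, zero_smul, smul_zero]
  · intro h; simp at h; omega
  · intro j hj hj0
    rw [hφ, counit_idem hp hq hs (Finset.mem_range.1 hj), if_neg hj0, zero_smul]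
  · intro h; simp at h; omega

theorem counit_right_RMatrix : TensorProduct.rid ℂ _
    (TensorProduct.map LinearMap.id (counit (R := ℂ)) (RMatrix hp hq s)) = 1 := by
  let φ : Uhalf hp hq ⊗[ℂ] Uhalf hp hq →ₐ[ℂ] Uhalf hp hq :=
    (Algebra.TensorProduct.rid ℂ ℂ _).toAlgHom.comp
      (Algebra.TensorProduct.map (AlgHom.id ℂ _) (Bialgebra.counitAlgHom ℂ _))
  have hφ : ∀ x y, φ (x ⊗ₜ y) = counit (R := ℂ) y • x := fun x y => rfl
  change φ _ = 1
  rw [RMatrix_eq, map_mul, cartanPart_eq_right, thetaPart, map_sum, map_sum,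
    Finset.sum_eq_single 0, Finset.sum_eq_single 0, hφ, counit_idem hp hq hs (by omega), if_pos rfl,
    map_smul, hφ, rCoeff_zero]
  · simp
  · intro m _ hm
    rw [map_smul, hφ, Bialgebra.counit_pow, U.counit_F, zero_pow hm, zero_smul, smul_zero]
  · intro h; simp at h; omega
  · intro j hj hj0
    rw [hφ, counit_idem hp hq hs (Finset.mem_range.1 hj), if_neg hj0, zero_smul]
  · intro h; simp at h; omega

theorem isRMatrix : IsRMatrix (rLeft hp hq s) (rRight hp hq) where
  comul_a := by
    have h := comul_left_RMatrix hp hq hs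
    simpa only [RMatrix_eq_sum, map_sum, Algebra.TensorProduct.map_tmul, Finset.sum_mul_sum,
      Algebra.TensorProduct.tmul_mul_tmul, AlgHom.id_apply, mul_one, one_mul,
      Algebra.TensorProduct.includeLeft_apply, Algebra.TensorProduct.includeRight_apply,
      Bialgebra.comulAlgHom_apply] using h
  comul_b := by
    have h := comul_right_RMatrix hp hq hs
    simpa only [RMatrix_eq_sum, map_sum, Algebra.TensorProduct.map_tmul, Finset.sum_mul_sum,
      Algebra.TensorProduct.tmul_mul_tmul, AlgHom.id_apply, mul_one, one_mul,
      Algebra.TensorProduct.includeLeft_apply, Algebra.TensorProduct.includeRight_apply,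
      Bialgebra.comulAlgHom_apply] using h
  quasi x := by rw [← RMatrix_eq_sum]; exact RMatrix_mul_comul hp hq hs x
  counit_a := by
    have h := counit_left_RMatrix hp hq hs
    simpa [RMatrix_eq_sum] using h
  counit_b := by
    have h := counit_right_RMatrix hp hq hs
    simpa [RMatrix_eq_sum] using h

omit hs in
theorem drinfeldElement_RMatrix : drinfeldElement (RMatrix hp hq s)
    = ∑ i, antipode ℂ (rRight hp hq i) * rLeft hp hq s i := by
  rw [RMatrix_eq_sum, drinfeldElement, tensorFlip, map_sum, map_sum, map_sum]
  rfl

/-- The central involution `k^(2p)`. -/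
def halfTurn : Uhalf hp hq := kA ^ (2 * p)

omit hs in
theorem halfTurn_comm (x : Uhalf hp hq) : halfTurn hp hq * x = x * halfTurn hp hq := by
  have h1 : q ^ (2 * p) = 1 := hq.pow_eq_one
  induction x using U.induction with
  | h1 c => rw [Algebra.commutes]
  | hE =>
    rw [halfTurn, U.Sat.pow_comm (U.sat (halfParam hp hq)).K_E]
    change q ^ (2 * p) • _ = _
    rw [h1, one_smul]
  | hF =>
    rw [halfTurn, U.Sat.pow_comm (U.sat (halfParam hp hq)).K_F]
    change q⁻¹ ^ (2 * p) • _ = _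
    rw [inv_pow, h1, inv_one, one_smul]
  | hK => exact (Commute.pow_self _ _).eq
  | hadd x y hx hy => rw [mul_add, add_mul, hx, hy]
  | hmul x y hx hy => rw [← mul_assoc, hx, mul_assoc, hy, mul_assoc]

omit hs in
theorem halfTurn_mul_self : halfTurn hp hq * halfTurn hp hq = 1 := by
  have := (U.sat (halfParam hp hq)).K_pow
  rw [halfTurn, ← pow_add]
  convert this using 2
  simp; ring

omit hs in
theorem comul_halfTurn : comul (R := ℂ) (halfTurn hp hq) = halfTurn hp hq ⊗ₜ halfTurn hp hq := by
  rw [halfTurn, Bialgebra.comul_pow, U.comul_K, Algebra.TensorProduct.tmul_pow]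

omit hs in
theorem signHom_halfTurn : signHom hp hq (halfTurn hp hq) = halfTurn hp hq := by
  rw [halfTurn, map_pow, signHom_K, Even.neg_pow ⟨p, by ring⟩]

theorem halfTurn_mul_idem (j : ℕ) : halfTurn hp hq * idem hp hq s j = (-1 : ℂ) ^ j • idem hp hq s j := by
  have h : s ^ (2 * p) = -1 := by
    have h2 : q ^ p ≠ 1 := hq.pow_ne_one_of_pos_of_lt (by omega) (by omega)
    have h3 : (q ^ p) ^ 2 = 1 := by rw [← pow_mul, mul_comm]; exact hq.pow_eq_one
    rw [pow_mul, hs]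
    exact (sq_eq_one_iff.1 h3).resolve_left h2
  rw [halfTurn, K_pow_mul_idem hp hq hs, ← pow_mul, mul_comm, pow_mul, h]

omit hs in
theorem neg_pow_smul (x : Uhalf hp hq) (j : ℕ) : (-x) ^ j = (-1 : ℂ) ^ j • x ^ j := by
  rw [← smul_pow, neg_one_smul]

/-- A sign on `k^n` in the first leg multiplies the projector of weight `s^n` in the second leg by
`(-1)^n`, which is the eigenvalue of `k^(2p)` on it. The R-matrix is thus odd only up to this
central involution. -/
theorem signHom_left_RMatrix :
    Algebra.TensorProduct.map (signHom hp hq) (AlgHom.id ℂ _) (RMatrix hp hq s)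
      = RMatrix hp hq s * (1 ⊗ₜ halfTurn hp hq) := by
  have hc : ∀ X : Uhalf hp hq ⊗[ℂ] Uhalf hp hq,
      (1 ⊗ₜ halfTurn hp hq) * X = X * (1 ⊗ₜ halfTurn hp hq) := by
    intro X
    induction X using TensorProduct.induction_on with
    | zero => simp
    | tmul x y => simp [halfTurn_comm]
    | add X Y hX hY => rw [mul_add, add_mul, hX, hY]
  rw [← hc, RMatrix_eq, map_mul, ← mul_assoc]
  congr 1
  · rw [cartanPart_eq_right, map_sum, Finset.mul_sum]
    refine Finset.sum_congr rfl fun j _ => ?_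
    rw [Algebra.TensorProduct.map_tmul, map_pow, signHom_K, neg_pow_smul,
      Algebra.TensorProduct.tmul_mul_tmul, halfTurn_mul_idem hp hq hs, TensorProduct.tmul_smul,
      TensorProduct.smul_tmul', one_mul]
    rfl
  · simp [thetaPart]

theorem signHom_right_RMatrix :
    Algebra.TensorProduct.map (AlgHom.id ℂ _) (signHom hp hq) (RMatrix hp hq s)
      = RMatrix hp hq s * (halfTurn hp hq ⊗ₜ 1) := by
  have hc : ∀ X : Uhalf hp hq ⊗[ℂ] Uhalf hp hq,
      (halfTurn hp hq ⊗ₜ 1) * X = X * (halfTurn hp hq ⊗ₜ 1) := by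
    intro X
    induction X using TensorProduct.induction_on with
    | zero => simp
    | tmul x y => simp [halfTurn_comm]
    | add X Y hX hY => rw [mul_add, add_mul, hX, hY]
  rw [← hc, RMatrix_eq, map_mul, ← mul_assoc]
  congr 1
  · rw [cartanPart_eq_left, map_sum, Finset.mul_sum]
    refine Finset.sum_congr rfl fun j _ => ?_
    rw [Algebra.TensorProduct.map_tmul, map_pow, signHom_K, neg_pow_smul,
      Algebra.TensorProduct.tmul_mul_tmul, halfTurn_mul_idem hp hq hs, TensorProduct.tmul_smul,
      TensorProduct.smul_tmul', one_mul]
    rfl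
  · simp [thetaPart]

theorem sum_signHom_left : ∑ i, signHom hp hq (rLeft hp hq s i) ⊗ₜ[ℂ] rRight hp hq i
    = ∑ i, rLeft hp hq s i ⊗ₜ[ℂ] (rRight hp hq i * halfTurn hp hq) := by
  have h := signHom_left_RMatrix hp hq hs
  simpa [RMatrix_eq_sum, Finset.sum_mul] using h

theorem sum_signHom_right : ∑ i, rLeft hp hq s i ⊗ₜ[ℂ] signHom hp hq (rRight hp hq i)
    = ∑ i, (rLeft hp hq s i * halfTurn hp hq) ⊗ₜ[ℂ] rRight hp hq i := by
  have h := signHom_right_RMatrix hp hq hs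
  simpa [RMatrix_eq_sum, Finset.sum_mul] using h

theorem sum_signHom_both :
    ∑ i, signHom hp hq (rLeft hp hq s i) ⊗ₜ[ℂ] signHom hp hq (rRight hp hq i)
    = ∑ i, (rLeft hp hq s i * halfTurn hp hq) ⊗ₜ[ℂ] (rRight hp hq i * halfTurn hp hq) := by
  have h1 := congrArg (Algebra.TensorProduct.map (AlgHom.id ℂ _) (signHom hp hq))
    (sum_signHom_left hp hq hs)
  have h2 := congrArg (· * (1 ⊗ₜ[ℂ] halfTurn hp hq)) (sum_signHom_right hp hq hs)
  simp only [map_sum, Algebra.TensorProduct.map_tmul, AlgHom.id_apply, map_mul, signHom_halfTurn,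
    Finset.sum_mul, Algebra.TensorProduct.tmul_mul_tmul, mul_one] at h1 h2
  exact h1.trans h2

/-- An element built from the R-matrix by a product of a component with the other one. -/
theorem signHom_sum_mul (T : Uhalf hp hq →ₗ[ℂ] Uhalf hp hq)
    (hT : ∀ x, T (signHom hp hq x) = signHom hp hq (T x))
    (hc : ∀ x, T (x * halfTurn hp hq) = T x * halfTurn hp hq) :
    signHom hp hq (∑ i, T (rRight hp hq i) * rLeft hp hq s i)
      = ∑ i, T (rRight hp hq i) * rLeft hp hq s i := by
  have h := congrArg (LinearMap.mul' ℂ _ ∘ₗ TensorProduct.map T LinearMap.id ∘ₗ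
    (TensorProduct.comm ℂ (Uhalf hp hq) (Uhalf hp hq)).toLinearMap) (sum_signHom_both hp hq hs)
  simp only [map_sum, LinearMap.comp_apply, LinearEquiv.coe_coe, TensorProduct.comm_tmul,
    TensorProduct.map_tmul, LinearMap.mul'_apply, LinearMap.id_apply, hT, hc] at h
  rw [map_sum]
  simp only [map_mul]
  rw [h]
  refine Finset.sum_congr rfl fun i _ => ?_
  rw [mul_assoc, ← mul_assoc (halfTurn hp hq), halfTurn_comm, mul_assoc (rLeft hp hq s i),
    halfTurn_mul_self, mul_one]

omit hs in
theorem halfTurn_tmul_comm (X : Uhalf hp hq ⊗[ℂ] Uhalf hp hq) :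
    (halfTurn hp hq ⊗ₜ 1) * X = X * (halfTurn hp hq ⊗ₜ 1) := by
  induction X using TensorProduct.induction_on with
  | zero => simp
  | tmul x y => simp [halfTurn_comm]
  | add X Y hX hY => rw [mul_add, add_mul, hX, hY]

/-- Changing the sign of `k` in one leg multiplies the separate R-matrices by central involutions
`k^(2p)`, which cancel between `R`, the coproduct and `R'`. Hence the element is invariant in each
leg and comes from the small algebra. -/
theorem exists_convElt_incl (x : Ubar hp hq) : ∃ Y,
    convElt (rLeft hp hq s) (rRight hp hq) (incl hp hq x)
      = TensorProduct.map (incl hp hq).toLinearMap (incl hp hq).toLinearMap Y := by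
  let L : Uhalf hp hq ⊗[ℂ] Uhalf hp hq →ₗ[ℂ] Uhalf hp hq ⊗[ℂ] Uhalf hp hq :=
    LinearMap.mul' ℂ _ ∘ₗ TensorProduct.map
      (Algebra.TensorProduct.includeLeft (R := ℂ) (S := ℂ)).toLinearMap
      (comul ∘ₗ LinearMap.mulLeft ℂ (incl hp hq x))
  have hL : ∀ a b, L (a ⊗ₜ b) = (a ⊗ₜ 1) * comul (R := ℂ) (incl hp hq x * b) := fun a b => rfl
  have hcc : (halfTurn hp hq ⊗ₜ[ℂ] (1 : Uhalf hp hq)) * (halfTurn hp hq ⊗ₜ 1) = 1 := by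
    rw [Algebra.TensorProduct.tmul_mul_tmul, halfTurn_mul_self, one_mul]; rfl
  refine ⟨TensorProduct.map (retr hp hq) (retr hp hq)
    (convElt (rLeft hp hq s) (rRight hp hq) (incl hp hq x)), (map_incl_retr hp hq ?_ ?_).symm⟩
  · change Algebra.TensorProduct.map (signHom hp hq) (AlgHom.id ℂ _) _ = _
    have h1 := congrArg L (sum_signHom_both hp hq hs)
    have h2 := congrArg (TensorProduct.comm ℂ (Uhalf hp hq) (Uhalf hp hq))
      (sum_signHom_right hp hq hs)
    simp only [map_sum, hL, TensorProduct.comm_tmul] at h1 h2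
    rw [convElt, map_mul, map_sum, map_sum]
    simp only [map_mul, Algebra.TensorProduct.map_tmul, AlgHom.id_apply, map_one,
      ← comul_signHom_left, signHom_incl]
    rw [h1, h2]
    have e1 : ∀ i, (((rLeft hp hq s i * halfTurn hp hq) ⊗ₜ[ℂ] 1)
        * comul (R := ℂ) (incl hp hq x * (rRight hp hq i * halfTurn hp hq))
          : Uhalf hp hq ⊗[ℂ] Uhalf hp hq)
        = ((rLeft hp hq s i ⊗ₜ[ℂ] 1) * comul (R := ℂ) (incl hp hq x * rRight hp hq i))
          * (1 ⊗ₜ[ℂ] halfTurn hp hq) := fun i => by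
      have e : (rLeft hp hq s i * halfTurn hp hq) ⊗ₜ[ℂ] (1 : Uhalf hp hq)
          = (rLeft hp hq s i ⊗ₜ[ℂ] 1) * (halfTurn hp hq ⊗ₜ[ℂ] 1) := by simp
      rw [← mul_assoc, Bialgebra.comul_mul, comul_halfTurn, e, mul_assoc, ← mul_assoc _ (comul _),
        halfTurn_tmul_comm, mul_assoc (comul _), Algebra.TensorProduct.tmul_mul_tmul,
        halfTurn_mul_self, one_mul, mul_assoc]
    have e2 : ∀ i, rRight hp hq i ⊗ₜ[ℂ] (rLeft hp hq s i * halfTurn hp hq)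
        = (1 ⊗ₜ[ℂ] halfTurn hp hq) * (rRight hp hq i ⊗ₜ rLeft hp hq s i) := fun i => by
      simp [halfTurn_comm]
    have hcc' : ((1 : Uhalf hp hq) ⊗ₜ[ℂ] halfTurn hp hq) * (1 ⊗ₜ halfTurn hp hq) = 1 := by
      rw [Algebra.TensorProduct.tmul_mul_tmul, halfTurn_mul_self, one_mul]; rfl
    simp only [e1, e2, ← Finset.sum_mul, ← Finset.mul_sum]
    rw [mul_assoc, ← mul_assoc (_ ⊗ₜ[ℂ] halfTurn hp hq), hcc', one_mul]
  · change Algebra.TensorProduct.map (AlgHom.id ℂ _) (signHom hp hq) _ = _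
    have h1 := congrArg L (sum_signHom_right hp hq hs)
    have h2 := congrArg (TensorProduct.comm ℂ (Uhalf hp hq) (Uhalf hp hq))
      (sum_signHom_left hp hq hs)
    simp only [map_sum, hL, TensorProduct.comm_tmul] at h1 h2
    rw [convElt, map_mul, map_sum, map_sum]
    simp only [map_mul (Algebra.TensorProduct.map (AlgHom.id ℂ _) (signHom hp hq)),
      Algebra.TensorProduct.map_tmul, AlgHom.id_apply, map_one,
      ← comul_signHom_right]
    simp only [map_mul (signHom hp hq), signHom_incl]
    rw [h1, h2]
    have e1 : ∀ i, (((rLeft hp hq s i * halfTurn hp hq) ⊗ₜ[ℂ] 1)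
        * comul (R := ℂ) (incl hp hq x * rRight hp hq i) : Uhalf hp hq ⊗[ℂ] Uhalf hp hq)
        = ((rLeft hp hq s i ⊗ₜ[ℂ] 1) * comul (R := ℂ) (incl hp hq x * rRight hp hq i))
          * (halfTurn hp hq ⊗ₜ[ℂ] 1) := fun i => by
      rw [mul_assoc, ← halfTurn_tmul_comm, ← mul_assoc]; simp
    have e2 : ∀ i, (rRight hp hq i * halfTurn hp hq) ⊗ₜ[ℂ] rLeft hp hq s i
        = (halfTurn hp hq ⊗ₜ[ℂ] 1) * (rRight hp hq i ⊗ₜ rLeft hp hq s i) := fun i => by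
      simp [halfTurn_comm]
    simp only [e1, e2, ← Finset.sum_mul, ← Finset.mul_sum]
    rw [mul_assoc, ← mul_assoc (halfTurn hp hq ⊗ₜ[ℂ] _), hcc, one_mul]

end RMatrixOfHalf
end
end RestrictedQG

open scoped TensorProduct
namespace RestrictedQG
noncomputable section
open Coalgebra HopfAlgebra Module

/-! ### Descent of the ribbon and factorizable structure to the small algebra. -/

section Descent
variable {p : ℕ} {q : ℂ} (hp : 2 ≤ p) (hq : IsPrimitiveRoot q (2 * p))

theorem isPivot_bar : IsPivot (U.K (barParam hp hq) ^ (p + 1)) (U.Kinv (barParam hp hq) ^ (p + 1)) := by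
  have h := U.isPivot (D := barParam hp hq)
  simpa using h

theorem incl_pivot : incl hp hq (U.K (barParam hp hq) ^ (p + 1))
    = (U.K (halfParam hp hq) ^ 2) ^ (p + 1) := by
  rw [map_pow, incl_K]

theorem incl_injective : Function.Injective (incl hp hq) := (isHopfIncl hp hq).injective

theorem map_incl_injective :
    Function.Injective (TensorProduct.map (incl hp hq).toLinearMap (incl hp hq).toLinearMap) := by
  refine Function.LeftInverse.injective (g := TensorProduct.map (retr hp hq) (retr hp hq)) fun X => ?_
  have e : retr hp hq ∘ₗ (incl hp hq).toLinearMap = LinearMap.id :=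
    LinearMap.ext fun x => retr_incl hp hq x
  rw [← LinearMap.comp_apply, ← TensorProduct.map_comp, e, TensorProduct.map_id, LinearMap.id_apply]

variable {s : ℂ} (hs : s ^ 2 = q)
include hs

/-- The ribbon element lies in the small algebra. -/
theorem exists_ribbon_bar : ∃ v vi : Ubar hp hq,
    (isRMatrix hp hq hs).elt = incl hp hq (U.K (barParam hp hq) ^ (p + 1) * v) ∧
    (∀ x, v * x = x * v) ∧ (∀ x, vi * x = x * vi) ∧ v * vi = 1 ∧ counit (R := ℂ) v = 1 ∧
    (isRMatrix hp hq hs).Q = comul (R := ℂ) (incl hp hq vi) * (incl hp hq v ⊗ₜ incl hp hq v) ∧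
    incl hp hq vi
      = ∑ i, rRight hp hq i * incl hp hq (U.K (barParam hp hq) ^ (p + 1)) * rLeft hp hq s i := by
  set R := isRMatrix hp hq hs
  obtain ⟨v, vi, h1, h2, h3, h4, h5, h6, h7⟩ :=
    R.exists_ribbon (U.isPivot (D := halfParam hp hq)) U.comul_antipode
  have hg : (U.K (halfParam hp hq) ^ (halfParam hp hq).r) ^ ((halfParam hp hq).p + 1)
      = incl hp hq (U.K (barParam hp hq) ^ (p + 1)) := (incl_pivot hp hq).symm
  rw [hg] at h1 h7
  -- In `∑ b g a` both legs of `R` meet in one product, so the two involutions `k^(2p)` cancel.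
  have t1 : signHom hp hq vi = vi := by
    rw [h7]
    refine signHom_sum_mul hp hq hs (LinearMap.mulRight ℂ (incl hp hq _))
      (fun x => by simp only [LinearMap.mulRight_apply, map_mul, signHom_incl]) fun x => ?_
    simp only [LinearMap.mulRight_apply, mul_assoc, halfTurn_comm]
  have t2 : signHom hp hq v = v := by
    have e := congrArg (signHom hp hq) h4
    rw [map_mul, t1, map_one] at e
    calc signHom hp hq v = signHom hp hq v * (vi * v) := by rw [h3, h4, mul_one]
      _ = v := by rw [← mul_assoc, e, one_mul]
  have e1 := incl_retr_of_signHom hp hq t1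
  have e2 := incl_retr_of_signHom hp hq t2
  refine ⟨retr hp hq v, retr hp hq vi, ?_, fun x => ?_, fun x => ?_, ?_, ?_, ?_, ?_⟩
  · rw [map_mul, e2, h1]
  · apply incl_injective hp hq; rw [map_mul, map_mul, e2, h2]
  · apply incl_injective hp hq; rw [map_mul, map_mul, e1, h3]
  · apply incl_injective hp hq; rw [map_mul, e1, e2, h4, map_one]
  · rw [← (isHopfIncl hp hq).counit, e2, h5]
  · rw [e1, e2, h6]
  · rw [e1, h7]

/-- The monodromy element of the small algebra. -/
theorem map_incl_monodromy {v vi : Ubar hp hq}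
    (hQ : (isRMatrix hp hq hs).Q = comul (R := ℂ) (incl hp hq vi) * (incl hp hq v ⊗ₜ incl hp hq v)) :
    TensorProduct.map (incl hp hq).toLinearMap (incl hp hq).toLinearMap
      (comul (R := ℂ) vi * (v ⊗ₜ v)) = (isRMatrix hp hq hs).Q := by
  rw [hQ, (isHopfIncl hp hq).comul]
  exact map_mul (Algebra.TensorProduct.map (incl hp hq) (incl hp hq)) _ _

/-- The identities involving `R` are transported from the extension. Forms are extended by the
retraction, symmetric ones remaining symmetric and central contractions remaining central, and the
results are pulled back by injectivity of the inclusion. -/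
theorem isFactorizable_of {v vi Λ : Ubar hp hq} (hv : ∀ x, v * x = x * v)
    (hvi : ∀ x, vi * x = x * vi) (hm : v * vi = 1) (hc : counit (R := ℂ) v = 1)
    (hQ : (isRMatrix hp hq hs).Q = comul (R := ℂ) (incl hp hq vi) * (incl hp hq v ⊗ₜ incl hp hq v))
    (hbij : Function.Bijective fun f : Dual ℂ (Ubar hp hq) =>
      sliceR f (comul (R := ℂ) vi * (v ⊗ₜ v)))
    (hSLF : ∀ φ ∈ SLF (Ubar hp hq), φ ∘ₗ antipode ℂ = φ)
    (h1 : ∀ x, x * Λ = counit (R := ℂ) x • Λ) (h2 : ∀ x, Λ * x = counit (R := ℂ) x • Λ)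
    (h0 : Λ ≠ 0) :
    IsFactorizable (U.K (barParam hp hq) ^ (p + 1)) (U.Kinv (barParam hp hq) ^ (p + 1)) v vi Λ
      (comul (R := ℂ) vi * (v ⊗ₜ v)) where
  toIsPivot := isPivot_bar hp hq
  comul_antipode := U.comul_antipode
  v_comm := hv
  vi_comm := hvi
  v_mul := hm
  counit_v := hc
  Q_eq := rfl
  bijective := hbij
  SLF_antipode := hSLF
  mul_int := h1
  int_mul := h2
  int_ne := h0
  slice_comul f hf := by
    set R := isRMatrix hp hq hs
    have hQ' := map_incl_monodromy hp hq hs hQ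
    set QH := comul (R := ℂ) vi * (v ⊗ₜ[ℂ] v)
    have er : (f ∘ₗ retr hp hq) ∘ₗ (incl hp hq).toLinearMap = f :=
      LinearMap.ext fun x => congrArg f (retr_incl hp hq x)
    have hsl : ∀ X : Ubar hp hq ⊗[ℂ] Ubar hp hq, incl hp hq (sliceR f X)
        = sliceR (f ∘ₗ retr hp hq)
          (TensorProduct.map (incl hp hq).toLinearMap (incl hp hq).toLinearMap X) := fun X => by
      rw [← sliceR_comp, er]
    have hf' : ∀ y, sliceR (f ∘ₗ retr hp hq) R.Q * y = y * sliceR (f ∘ₗ retr hp hq) R.Q := by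
      intro y
      rw [← hQ', ← hsl]
      exact incl_comm hp hq hf y
    have h := R.map_comul_Q_of_central hf'
    apply map_incl_injective hp hq
    have e1 : (incl hp hq).toLinearMap ∘ₗ (sliceR f ∘ₗ comul)
        = (sliceR (f ∘ₗ retr hp hq) ∘ₗ comul) ∘ₗ (incl hp hq).toLinearMap :=
      LinearMap.ext fun x => by
        simp only [LinearMap.comp_apply, AlgHom.toLinearMap_apply, (isHopfIncl hp hq).comul, hsl]
    rw [← LinearMap.comp_apply, ← TensorProduct.map_comp, e1]
    have e2 : TensorProduct.map (incl hp hq).toLinearMap (incl hp hq).toLinearMap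
        ((sliceR f QH ⊗ₜ 1) * QH) = (sliceR (f ∘ₗ retr hp hq) R.Q ⊗ₜ 1) * R.Q := by
      refine (map_mul (Algebra.TensorProduct.map (incl hp hq) (incl hp hq)) _ _).trans ?_
      rw [← hQ', ← hsl, Algebra.TensorProduct.map_tmul, map_one]
      rfl
    rw [e2, ← h, ← hQ', ← LinearMap.comp_apply (TensorProduct.map LinearMap.id _),
      ← TensorProduct.map_comp]
    rfl
  slice_inv φ hφ := by
    set R := isRMatrix hp hq hs
    have hQ' := map_incl_monodromy hp hq hs hQ
    set QH := comul (R := ℂ) vi * (v ⊗ₜ[ℂ] v) with hQH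
    set Qi := comul (R := ℂ) v * (vi ⊗ₜ[ℂ] vi) with hQi
    let ιι := Algebra.TensorProduct.map (incl hp hq) (incl hp hq)
    have hii : Qi * QH = 1 := by
      have hm' : vi * v = 1 := by rw [hvi, hm]
      have e : (vi ⊗ₜ[ℂ] vi) * comul (R := ℂ) vi = comul (R := ℂ) vi * (vi ⊗ₜ[ℂ] vi) := by
        generalize comul (R := ℂ) vi = X
        induction X using TensorProduct.induction_on with
        | zero => simp
        | tmul x y => simp [hvi]
        | add X Y hX hY => rw [mul_add, add_mul, hX, hY]
      rw [hQH, hQi, mul_assoc, ← mul_assoc (vi ⊗ₜ[ℂ] vi), e, mul_assoc, ← mul_assoc (comul v),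
        ← Bialgebra.comul_mul, hm, Algebra.TensorProduct.tmul_mul_tmul, hm', Bialgebra.comul_one,
        one_mul]
      rfl
    have hG : IsPivot (incl hp hq (U.K (barParam hp hq) ^ (p + 1)))
        ((U.Kinv (halfParam hp hq) ^ (halfParam hp hq).r) ^ ((halfParam hp hq).p + 1)) := by
      rw [incl_pivot]
      exact U.isPivot (D := halfParam hp hq)
    have hφr := comp_retr_mem_SLF hp hq hφ
    have hdr : ∀ X : Ubar hp hq ⊗[ℂ] Ubar hp hq,
        incl hp hq (drinfeldMap (U.K (barParam hp hq) ^ (p + 1)) X φ)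
          = drinfeldMap (incl hp hq (U.K (barParam hp hq) ^ (p + 1))) (ιι X)
            (φ ∘ₗ retr hp hq) := fun X => by
      have er : ((φ ∘ₗ retr hp hq) ∘ₗ LinearMap.mulLeft ℂ (incl hp hq (U.K (barParam hp hq) ^ (p + 1))))
          ∘ₗ (incl hp hq).toLinearMap = φ ∘ₗ LinearMap.mulLeft ℂ (U.K (barParam hp hq) ^ (p + 1)) := by
        ext x
        simp only [LinearMap.comp_apply, LinearMap.mulLeft_apply, AlgHom.toLinearMap_apply,
          ← map_mul, retr_incl]
      rw [drinfeldMap, drinfeldMap, ← er]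
      exact sliceR_comp _ X
    have hιQ : ιι QH = R.Q := hQ'
    have h := R.antipode_drinfeldMap_inv hG (Qi := ιι Qi)
      (by rw [← hιQ, ← map_mul, hii, map_one]) hφr
    apply incl_injective hp hq
    rw [← antipode_incl, ← antipode_incl, ← antipode_incl, hdr, hdr, h, hιQ]

end Descent
end
end RestrictedQG

open scoped TensorProduct
namespace RestrictedQG
noncomputable section
open Coalgebra HopfAlgebra Module

namespace U
-- The two-sided cointegral.
section Cointegral
variable (D : QParam)

/-- All `p` powers sum to zero, so the first `p - 1` sum to minus the last. The exponent `p - 1` is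
written `p - 2 + 1` throughout to fit the successor form of the commutation formula. -/
theorem geom_sum_pred {w : ℂ} (hw : IsPrimitiveRoot w D.p) :
    ∑ i ∈ Finset.range (D.p - 2 + 1), w ^ i = -w⁻¹ := by
  have h2 := D.two_le_p
  have h := hw.geom_sum_eq_zero (by omega)
  have h0 : w ≠ 0 := hw.ne_zero (by omega)
  rw [show D.p = (D.p - 2 + 1) + 1 by omega, Finset.sum_range_succ] at h
  have h3 : w ^ (D.p - 2 + 1) = w⁻¹ := by
    apply mul_left_cancel₀ h0
    rw [← pow_succ', show D.p - 2 + 1 + 1 = D.p by omega, hw.pow_eq_one, mul_inv_cancel₀ h0]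
  rw [h3] at h
  exact eq_neg_of_add_eq_zero_left h

theorem pow_pred {w : ℂ} (hw : IsPrimitiveRoot w D.p) : w ^ (D.p - 2 + 1) = w⁻¹ := by
  have h2 := D.two_le_p
  have h0 : w ≠ 0 := hw.ne_zero (by omega)
  apply mul_left_cancel₀ h0
  rw [← pow_succ', show D.p - 2 + 1 + 1 = D.p by omega, hw.pow_eq_one, mul_inv_cancel₀ h0]

/-- The sum `∑ w^j K^j`. -/
def cartanSum (w : ℂ) : U D := ∑ j ∈ Finset.range (2 * D.p * D.r), w ^ j • K D ^ j

theorem K_mul_cartanSum {w : ℂ} (hw : w ^ (2 * D.p * D.r) = 1) :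
    K D * cartanSum D w = w⁻¹ • cartanSum D w := by
  have h0 : w ≠ 0 := by
    rintro rfl
    rw [zero_pow D.N_pos.ne'] at hw
    exact zero_ne_one hw
  rw [eq_inv_smul_iff₀ h0, cartanSum, Finset.mul_sum, Finset.smul_sum]
  have h : ∀ j, w • (K D * w ^ j • K D ^ j) = w ^ (j + 1) • K D ^ (j + 1) := fun j => by
    rw [mul_smul_comm, smul_smul, pow_succ', pow_succ' (K D)]
  simp only [h]
  have e := Finset.sum_range_succ (fun j => w ^ j • K D ^ j) (2 * D.p * D.r)
  rw [Finset.sum_range_succ', hw, (sat D).K_pow, pow_zero, pow_zero] at e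
  exact add_right_cancel e

theorem K_commute_cartanSum (w : ℂ) : Commute (K D) (cartanSum D w) :=
  Commute.sum_right _ _ _ fun j _ => by
    change _ * _ = _ * _
    rw [mul_smul_comm, smul_mul_assoc, (Commute.self_pow (K D) j).eq]

theorem cartanSum_mul {x : U D} {t w : ℂ} (h : K D * x = t • (x * K D)) :
    cartanSum D w * x = x * cartanSum D (w * t) := by
  rw [cartanSum, cartanSum, Finset.sum_mul, Finset.mul_sum]
  refine Finset.sum_congr rfl fun j _ => ?_
  rw [smul_mul_assoc, Sat.pow_comm h, mul_smul_comm, smul_smul, mul_pow]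

theorem t_pow_N_eq : D.t ^ (2 * D.p * D.r) = 1 := by
  rw [mul_comm, pow_mul, D.t_pow, ← pow_mul, mul_comm, pow_mul, D.prim.pow_eq_one, one_pow]

theorem g_mul_cartanSum {w : ℂ} (hw : w ^ (2 * D.p * D.r) = 1) :
    K D ^ D.r * cartanSum D w = (w ^ D.r)⁻¹ • cartanSum D w := by
  have h : ∀ n, K D ^ n * cartanSum D w = (w⁻¹) ^ n • cartanSum D w := fun n => by
    induction n with
    | zero => simp
    | succ n ih => rw [pow_succ, mul_assoc, K_mul_cartanSum D hw, mul_smul_comm, ih, smul_smul, pow_succ']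
  rw [h, inv_pow]

theorem h_mul_cartanSum {w : ℂ} (hw : w ^ (2 * D.p * D.r) = 1) :
    Kinv D ^ D.r * cartanSum D w = w ^ D.r • cartanSum D w := by
  have h0 : w ≠ 0 := by
    rintro rfl
    rw [zero_pow D.N_pos.ne'] at hw
    exact zero_ne_one hw
  rw [← inv_smul_eq_iff₀ (pow_ne_zero _ h0), ← mul_smul_comm, ← g_mul_cartanSum D hw, ← mul_assoc]
  exact (congrArg (· * _) (sat D).ginv_g).trans (one_mul _)

/-- The two-sided cointegral. -/
def cointegral : U D := F D ^ (D.p - 2 + 1) * E D ^ (D.p - 2 + 1) * cartanSum D 1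

theorem K_mul_FE (m : ℕ) : K D * (F D ^ m * E D ^ m) = F D ^ m * E D ^ m * K D := by
  rw [← mul_assoc, y_mul_pow (sat D).K_F, smul_mul_assoc, mul_assoc, y_mul_pow (sat D).K_E,
    mul_smul_comm, smul_smul, ← mul_pow, inv_mul_cancel₀ D.t_ne, one_pow, one_smul, mul_assoc]

theorem pow_pred_eq_zero {x : U D} (h : x ^ D.p = 0) : x ^ (D.p - 2 + 1) * x = 0 := by
  rw [← pow_succ, show D.p - 2 + 1 + 1 = D.p by have := D.two_le_p; omega, h]

/-- Only `E` is delicate. Its commutator with `F^(p-1)` leaves terms in `K^r` and `K^(-r)`; both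
become scalars on `E^(p-1)` times the sum of all powers of `K`, and these scalars cancel. `F` and
`K` act directly. -/
theorem mul_cointegral (x : U D) : x * cointegral D = counit (R := ℂ) x • cointegral D := by
  have hw := D.prim_sq
  have hw' := D.prim_sq.inv
  induction x using induction with
  | h1 c => rw [Bialgebra.counit_algebraMap, Algebra.algebraMap_eq_smul_one, smul_mul_assoc, one_mul]
  | hE =>
    have hE : E D * E D ^ (D.p - 2 + 1) = 0 := by
      rw [← pow_succ', pow_succ, pow_pred_eq_zero D (sat D).E_pow]
    have h1 := mul_pow_sub_pow_mul (sat D).E_F (sat D).g_f (sat D).ginv_f (D.p - 2)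
    rw [geom_sum_pred D hw, geom_sum_pred D hw', inv_inv, sub_eq_iff_eq_add] at h1
    rw [counit_E, zero_smul, cointegral, ← mul_assoc, ← mul_assoc, h1, add_mul,
      mul_assoc _ (E D), hE, mul_zero, add_zero,
      smul_mul_assoc, smul_mul_assoc, mul_assoc, mul_assoc, ← mul_assoc _ (E D ^ _), sub_mul,
      smul_mul_assoc, smul_mul_assoc, y_mul_pow (sat D).g_e, y_mul_pow (sat D).ginv_e, pow_pred D hw,
      pow_pred D hw', inv_inv, sub_mul, smul_mul_assoc, smul_mul_assoc, smul_mul_assoc,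
      smul_mul_assoc, mul_assoc, mul_assoc, g_mul_cartanSum D (one_pow _)]
    rw [show (K D ^ (2 * D.p * D.r - 1)) = Kinv D from rfl, h_mul_cartanSum D (one_pow _), one_pow,
      inv_one, one_smul, smul_smul, smul_smul, neg_mul, neg_mul, mul_inv_cancel₀ (pow_ne_zero 2 D.q_ne),
      inv_mul_cancel₀ (pow_ne_zero 2 D.q_ne), sub_self, mul_zero, smul_zero]
  | hF =>
    rw [counit_F, zero_smul, cointegral, ← mul_assoc, ← mul_assoc, ← pow_succ', pow_succ,
      pow_pred_eq_zero D (sat D).F_pow, zero_mul, zero_mul]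
  | hK =>
    rw [counit_K, one_smul, cointegral, ← mul_assoc, K_mul_FE, mul_assoc,
      K_mul_cartanSum D (one_pow _), inv_one, one_smul]
  | hadd x y hx hy => rw [add_mul, hx, hy, map_add, add_smul]
  | hmul x y hx hy => rw [mul_assoc, hy, mul_smul_comm, hx, smul_smul, Bialgebra.counit_mul, mul_comm]

theorem cointegral_mul (x : U D) : cointegral D * x = counit (R := ℂ) x • cointegral D := by
  have hw := D.prim_sq
  have hw' := D.prim_sq.inv
  induction x using induction with
  | h1 c => rw [Bialgebra.counit_algebraMap, Algebra.algebraMap_eq_smul_one, mul_smul_comm, mul_one]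
  | hE =>
    rw [counit_E, zero_smul, cointegral, mul_assoc, cartanSum_mul D (sat D).K_E, mul_assoc,
      ← mul_assoc _ (E D), pow_pred_eq_zero D (sat D).E_pow, zero_mul, mul_zero]
  | hF =>
    have h0 : F D * E D - E D * F D = (D.q - D.q⁻¹)⁻¹ • (Kinv D ^ D.r - K D ^ D.r) := by
      rw [← neg_sub, (sat D).E_F, ← smul_neg, neg_sub]; rfl
    have h1 := mul_pow_sub_pow_mul h0 (sat D).ginv_e (sat D).g_e (D.p - 2)
    have ht : D.t⁻¹ ^ (2 * D.p * D.r) = 1 := by rw [inv_pow, t_pow_N_eq, inv_one]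
    rw [geom_sum_pred D hw, geom_sum_pred D hw', inv_inv, sub_eq_iff_eq_add] at h1
    have h2 := sub_eq_of_eq_add' h1
    rw [counit_F, zero_smul, cointegral, mul_assoc, cartanSum_mul D (sat D).K_F, one_mul, mul_assoc,
      ← mul_assoc _ (F D), ← h2, sub_mul, mul_sub, mul_assoc (F D), ← mul_assoc _ (F D),
      pow_pred_eq_zero D (sat D).F_pow, zero_mul, zero_sub, smul_mul_assoc, mul_assoc, sub_mul,
      smul_mul_assoc, smul_mul_assoc, g_mul_cartanSum D ht, h_mul_cartanSum D ht, inv_pow, D.t_pow,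
      inv_inv, smul_smul, smul_smul, neg_mul, neg_mul, mul_inv_cancel₀ (pow_ne_zero 2 D.q_ne),
      inv_mul_cancel₀ (pow_ne_zero 2 D.q_ne), sub_self, mul_zero, smul_zero, mul_zero, neg_zero]
  | hK =>
    rw [counit_K, one_smul, cointegral, mul_assoc, ← (K_commute_cartanSum D 1).eq,
      K_mul_cartanSum D (one_pow _), inv_one, one_smul]
  | hadd x y hx hy => rw [mul_add, hx, hy, map_add, add_smul]
  | hmul x y hx hy => rw [← mul_assoc, hx, smul_mul_assoc, hy, smul_smul, Bialgebra.counit_mul]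

theorem cointegral_ne_zero : cointegral D ≠ 0 := by
  have h2 := D.two_le_p
  obtain ⟨f, hf⟩ := exists_dual_monomial (D := D) (z := 1) (one_pow _)
    (a := D.p - 2 + 1) (c := D.p - 2 + 1) (by omega) (by omega)
  intro h
  have e : cointegral D = ∑ j ∈ Finset.range (2 * D.p * D.r),
      K D ^ j * F D ^ (D.p - 2 + 1) * E D ^ (D.p - 2 + 1) := by
    rw [cointegral, cartanSum, Finset.mul_sum]
    refine Finset.sum_congr rfl fun j _ => ?_
    have hc : Commute (K D) (F D ^ (D.p - 2 + 1) * E D ^ (D.p - 2 + 1)) := K_mul_FE D _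
    rw [one_pow, one_smul, ← (hc.pow_left j).eq, mul_assoc]
  have h3 := congrArg f e
  rw [h, map_zero, map_sum] at h3
  simp only [hf, and_self, if_true, one_pow, Finset.sum_const, Finset.card_range, nsmul_eq_mul,
    mul_one] at h3
  exact D.N_pos.ne' (by exact_mod_cast h3.symm)

end Cointegral
end U
end
end RestrictedQG

open scoped TensorProduct
namespace RestrictedQG
noncomputable section
open Coalgebra HopfAlgebra Module

namespace U
-- The Casimir element and the invariance of symmetric forms under the antipode.
section Casimir
variable (D : QParam)

/-- The Casimir element. -/
def casimir : U D :=
  (D.q - D.q⁻¹) ^ 2 • (F D * E D) + D.q • K D ^ D.r + D.q⁻¹ • Kinv D ^ D.r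

theorem casimir_eq : casimir D
    = (D.q - D.q⁻¹) ^ 2 • (E D * F D) + D.q⁻¹ • K D ^ D.r + D.q • Kinv D ^ D.r := by
  have hqh := D.qhat_ne
  have h : E D * F D = F D * E D + (D.q - D.q⁻¹)⁻¹ • (K D ^ D.r - Kinv D ^ D.r) := by
    rw [← sub_eq_iff_eq_add']; exact (sat D).E_F
  rw [h, casimir, smul_add, smul_smul, sq, mul_assoc, mul_inv_cancel₀ hqh]
  module

theorem casimir_mul (x : U D) : casimir D * x = x * casimir D := by
  have h0 := D.q_ne
  have e1 : D.q⁻¹ * D.q ^ 2 = D.q := by rw [sq, inv_mul_cancel_left₀ h0]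
  have e2 : D.q * (D.q ^ 2)⁻¹ = D.q⁻¹ := by rw [sq, mul_inv, mul_inv_cancel_left₀ h0]
  induction x using induction with
  | h1 c => rw [Algebra.commutes]
  | hE =>
    have h1 : K D ^ D.r * E D = D.q ^ 2 • (E D * K D ^ D.r) := (sat D).g_e
    have h2 : Kinv D ^ D.r * E D = (D.q ^ 2)⁻¹ • (E D * Kinv D ^ D.r) := (sat D).ginv_e
    conv_lhs => rw [casimir_eq]
    rw [casimir]
    simp only [add_mul, mul_add, smul_mul_assoc, mul_smul_comm, h1, h2, smul_smul, mul_assoc, e1,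
      e2]
  | hF =>
    have h1 : K D ^ D.r * F D = (D.q ^ 2)⁻¹ • (F D * K D ^ D.r) := (sat D).g_f
    have h2 : Kinv D ^ D.r * F D = D.q ^ 2 • (F D * Kinv D ^ D.r) := (sat D).ginv_f
    conv_rhs => rw [casimir_eq]
    rw [casimir]
    simp only [add_mul, mul_add, smul_mul_assoc, mul_smul_comm, h1, h2, smul_smul, mul_assoc, e1,
      e2]
  | hK =>
    have h1 : K D * (F D * E D) = F D * E D * K D := by simpa using K_mul_FE D 1
    rw [casimir]
    simp only [add_mul, mul_add, smul_mul_assoc, mul_smul_comm, h1]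
    have h2 : K D * Kinv D ^ D.r = Kinv D ^ D.r * K D := ((Commute.self_pow (K D) _).pow_right D.r).eq
    rw [(Commute.pow_self (K D) D.r).eq, h2]
  | hadd x y hx hy => rw [mul_add, add_mul, hx, hy]
  | hmul x y hx hy => rw [← mul_assoc, hx, mul_assoc, hy, mul_assoc]

theorem antipode_casimir : antipode ℂ (casimir D) = casimir D := by
  conv_rhs => rw [casimir_eq]
  rw [casimir, map_add, map_add, map_smul, map_smul, map_smul, HopfAlgebra.antipode_mul_antidistrib,
    antipode_E, antipode_F, antipode_pow, antipode_pow, antipode_K, antipode_Kinv]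
  have h : E D * Kinv D ^ D.r * (K D ^ D.r * F D) = E D * F D := by
    rw [mul_assoc, ← mul_assoc (Kinv D ^ D.r)]
    exact congrArg (E D * ·) ((congrArg (· * F D) (sat D).ginv_g).trans (one_mul _))
  rw [neg_mul_neg, h, add_right_comm]

theorem antipode_aeval_casimir (P : Polynomial ℂ) :
    antipode ℂ (Polynomial.aeval (casimir D) P) = Polynomial.aeval (casimir D) P := by
  induction P using Polynomial.induction_on' with
  | add P Q hP hQ => rw [map_add, map_add, hP, hQ]
  | monomial n c =>
    rw [Polynomial.aeval_monomial, ← Algebra.smul_def, map_smul, antipode_pow, antipode_casimir]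

theorem aeval_casimir_mul (P : Polynomial ℂ) (x : U D) :
    Polynomial.aeval (casimir D) P * x = x * Polynomial.aeval (casimir D) P := by
  induction P using Polynomial.induction_on' with
  | add P Q hP hQ => rw [map_add, add_mul, mul_add, hP, hQ]
  | monomial n c =>
    rw [Polynomial.aeval_monomial, ← Algebra.smul_def, smul_mul_assoc, mul_smul_comm,
      (Commute.pow_left (show Commute (casimir D) x from casimir_mul D x) n).eq]

variable {D}

theorem casimir_sub_mul_cartanSum_FE {w : ℂ} (hw : w ^ (2 * D.p * D.r) = 1) :
    (casimir D - algebraMap ℂ _ (D.q * (w ^ D.r)⁻¹ + D.q⁻¹ * w ^ D.r)) * cartanSum D w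
      = (D.q - D.q⁻¹) ^ 2 • (F D * E D * cartanSum D w) := by
  rw [casimir, Algebra.algebraMap_eq_smul_one, sub_mul, add_mul, add_mul, smul_mul_assoc,
    smul_mul_assoc, smul_mul_assoc, smul_mul_assoc, g_mul_cartanSum D hw, h_mul_cartanSum D hw, one_mul]
  module

theorem casimir_sub_mul_cartanSum_EF {w : ℂ} (hw : w ^ (2 * D.p * D.r) = 1) :
    (casimir D - algebraMap ℂ _ (D.q⁻¹ * (w ^ D.r)⁻¹ + D.q * w ^ D.r)) * cartanSum D w
      = (D.q - D.q⁻¹) ^ 2 • (E D * F D * cartanSum D w) := by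
  rw [casimir_eq, Algebra.algebraMap_eq_smul_one, sub_mul, add_mul, add_mul, smul_mul_assoc,
    smul_mul_assoc, smul_mul_assoc, smul_mul_assoc, g_mul_cartanSum D hw, h_mul_cartanSum D hw, one_mul]
  module

/-- On a weight vector `F E` differs from a multiple of the Casimir element by a scalar. Peeling off
the inner `F E` of `F^(a+1) E^(a+1)`, at the weight shifted by `E^a`, adds one linear factor. -/
theorem exists_aeval_casimir (a : ℕ) {w : ℂ} (hw : w ^ (2 * D.p * D.r) = 1) :
    ∃ P : Polynomial ℂ, F D ^ a * E D ^ a * cartanSum D w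
      = Polynomial.aeval (casimir D) P * cartanSum D w := by
  induction a generalizing w with
  | zero => exact ⟨1, by simp⟩
  | succ a ih =>
    have hne : w ≠ 0 := by
      rintro rfl
      rw [zero_pow D.N_pos.ne'] at hw
      exact zero_ne_one hw
    have hqh := pow_ne_zero 2 D.qhat_ne
    have ht0 := pow_ne_zero a D.t_ne
    have hE : E D ^ a * cartanSum D w = cartanSum D (w * (D.t ^ a)⁻¹) * E D ^ a := by
      rw [cartanSum_mul D (y_mul_pow (sat D).K_E a), mul_assoc, inv_mul_cancel₀ ht0, mul_one]
    have hw' : (w * (D.t ^ a)⁻¹) ^ (2 * D.p * D.r) = 1 := by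
      rw [mul_pow, hw, inv_pow, ← pow_mul, mul_comm a, pow_mul, t_pow_N_eq, one_pow, inv_one, mul_one]
    obtain ⟨P, hP⟩ := ih hw
    have h1 := casimir_sub_mul_cartanSum_FE hw'
    set κ := D.q * ((w * (D.t ^ a)⁻¹) ^ D.r)⁻¹ + D.q⁻¹ * (w * (D.t ^ a)⁻¹) ^ D.r
    refine ⟨Polynomial.C (((D.q - D.q⁻¹) ^ 2)⁻¹) * (Polynomial.X - Polynomial.C κ) * P, ?_⟩
    replace h1 := (eq_inv_smul_iff₀ hqh).2 h1.symm
    have hz : ∀ x, (casimir D - algebraMap ℂ _ κ) * x = x * (casimir D - algebraMap ℂ _ κ) := fun x => by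
      rw [sub_mul, mul_sub, casimir_mul, Algebra.commutes]
    calc F D ^ (a + 1) * E D ^ (a + 1) * cartanSum D w
        = F D ^ a * (F D * E D * cartanSum D (w * (D.t ^ a)⁻¹)) * E D ^ a := by
          rw [pow_succ, pow_succ', mul_assoc, mul_assoc (E D), hE]
          simp only [mul_assoc]
      _ = ((D.q - D.q⁻¹) ^ 2)⁻¹ • ((casimir D - algebraMap ℂ _ κ)
          * (F D ^ a * E D ^ a * cartanSum D w)) := by
          rw [h1, mul_smul_comm, smul_mul_assoc, ← mul_assoc, ← hz, mul_assoc, mul_assoc, ← hE]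
          simp only [mul_assoc]
      _ = _ := by
          rw [hP, map_mul, map_mul, map_sub, Polynomial.aeval_C, Polynomial.aeval_X,
            Polynomial.aeval_C, mul_assoc, mul_assoc, ← Algebra.smul_def]

/-- Discrete Fourier inversion for `1`; multiplication by `K` then rescales each weight vector. -/
theorem pow_mem_span_cartanSum (m : ℕ) : K D ^ m ∈ Submodule.span ℂ
    (Set.range fun w : {w : ℂ // w ^ (2 * D.p * D.r) = 1} => cartanSum D w.1) := by
  induction m with
  | zero =>
    set N := 2 * D.p * D.r
    have hN : (N : ℂ) ≠ 0 := by exact_mod_cast D.N_pos.ne'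
    have hζ := Complex.isPrimitiveRoot_exp N D.N_pos.ne'
    set ζ := Complex.exp (2 * Real.pi * Complex.I / N)
    have e : ∑ n ∈ Finset.range N, cartanSum D (ζ ^ n) = (N : ℂ) • K D ^ 0 := by
      simp only [cartanSum]
      rw [Finset.sum_comm]
      simp only [← Finset.sum_smul]
      rw [Finset.sum_eq_single 0]
      · simp
      · intro j hj hj0
        have h1 : ζ ^ j ≠ 1 := hζ.pow_ne_one_of_pos_of_lt hj0 (Finset.mem_range.1 hj)
        have h2 := mul_neg_geom_sum (ζ ^ j) N
        rw [← pow_mul, mul_comm j, pow_mul, hζ.pow_eq_one, one_pow, sub_self] at h2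
        have h3 := (mul_eq_zero.1 h2).resolve_left (sub_ne_zero.2 h1.symm)
        simp only [← pow_mul] at h3
        simp only [← pow_mul, mul_comm _ j, h3, zero_smul]
      · intro h
        exact absurd (Finset.mem_range.2 D.N_pos) h
    rw [← inv_smul_eq_iff₀ hN] at e
    rw [← e]
    refine Submodule.smul_mem _ _ (Submodule.sum_mem _ fun n _ => Submodule.subset_span
      ⟨⟨ζ ^ n, ?_⟩, rfl⟩)
    rw [← pow_mul, mul_comm, pow_mul, hζ.pow_eq_one, one_pow]
  | succ m ih =>
    rw [pow_succ']
    generalize K D ^ m = y at ih ⊢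
    induction ih using Submodule.span_induction with
    | mem x hx =>
      obtain ⟨w, rfl⟩ := hx
      rw [K_mul_cartanSum D w.2]
      exact Submodule.smul_mem _ _ (Submodule.subset_span ⟨w, rfl⟩)
    | zero => rw [mul_zero]; exact zero_mem _
    | add x y _ _ hx hy => rw [mul_add]; exact add_mem hx hy
    | smul c x _ hx => rw [mul_smul_comm]; exact Submodule.smul_mem _ _ hx

theorem mem_SLF_antipode {ψ : Dual ℂ (U D)} (hψ : ψ ∈ SLF (U D)) : ψ ∘ₗ antipode ℂ ∈ SLF (U D) := by
  intro x y
  simp only [LinearMap.comp_apply, HopfAlgebra.antipode_mul_antidistrib]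
  exact hψ _ _

theorem antipode_cartanSum {w : ℂ} (hw : w ^ (2 * D.p * D.r) = 1) :
    antipode ℂ (cartanSum D w) = cartanSum D w⁻¹ := by
  have h0 : w ≠ 0 := by
    rintro rfl
    rw [zero_pow D.N_pos.ne'] at hw
    exact zero_ne_one hw
  rw [cartanSum, cartanSum, map_sum]
  simp only [map_smul, antipode_pow, antipode_K]
  have hKN : Kinv D ^ (2 * D.p * D.r) = 1 := by
    rw [Kinv, ← pow_mul, mul_comm, pow_mul, (sat D).K_pow, one_pow]
  have e := Finset.sum_range_succ (fun j => w ^ j • Kinv D ^ j) (2 * D.p * D.r)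
  rw [Finset.sum_range_succ', hw, hKN, pow_zero, pow_zero] at e
  rw [← add_right_cancel e, ← Finset.sum_range_reflect]
  refine Finset.sum_congr rfl fun j hj => ?_
  have hj := Finset.mem_range.1 hj
  rw [show 2 * D.p * D.r - 1 - j + 1 = 2 * D.p * D.r - j by omega]
  have h1 : w ^ (2 * D.p * D.r - j) = w⁻¹ ^ j := by
    rw [inv_pow]
    exact eq_inv_of_mul_eq_one_left (by rw [← pow_add, Nat.sub_add_cancel hj.le, hw])
  have h2 : Kinv D ^ j * K D ^ j = 1 := by
    rw [← Commute.mul_pow (show Commute (Kinv D) (K D) from Commute.pow_self _ _), Kinv_mul_K,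
      one_pow]
  have h3 : Kinv D ^ (2 * D.p * D.r - j) = K D ^ j := by
    calc _ = Kinv D ^ (2 * D.p * D.r - j) * (Kinv D ^ j * K D ^ j) := by rw [h2, mul_one]
      _ = K D ^ j := by rw [← mul_assoc, ← pow_add, Nat.sub_add_cancel hj.le, hKN, one_mul]
  rw [h1, h3]

/-- A symmetric linear form on the weight spaces, as a functional on the polynomials in the
Casimir element. -/
theorem SLF_casimir_step {ψ : Dual ℂ (U D)} (hψ : ψ ∈ SLF (U D)) {w : ℂ}
    (hw : w ^ (2 * D.p * D.r) = 1) (P : Polynomial ℂ) :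
    ψ (Polynomial.aeval (casimir D)
        ((Polynomial.X - Polynomial.C (D.q⁻¹ * (w ^ D.r)⁻¹ + D.q * w ^ D.r)) * P) * cartanSum D w)
      = ψ (Polynomial.aeval (casimir D)
        ((Polynomial.X - Polynomial.C (D.q⁻¹ * (w ^ D.r)⁻¹ + D.q * w ^ D.r)) * P)
          * cartanSum D (w * D.t)) := by
  have hw' : (w * D.t) ^ (2 * D.p * D.r) = 1 := by rw [mul_pow, hw, t_pow_N_eq, one_mul]
  have h1 := casimir_sub_mul_cartanSum_EF hw
  have h2 := casimir_sub_mul_cartanSum_FE hw'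
  have e : D.q * ((w * D.t) ^ D.r)⁻¹ + D.q⁻¹ * (w * D.t) ^ D.r
      = D.q⁻¹ * (w ^ D.r)⁻¹ + D.q * w ^ D.r := by
    have h0 := D.q_ne
    rw [mul_pow, D.t_pow, mul_inv]
    field_simp
  rw [e] at h2
  set κ := D.q⁻¹ * (w ^ D.r)⁻¹ + D.q * w ^ D.r
  have h3 : ∀ x : U D, Polynomial.aeval (casimir D) ((Polynomial.X - Polynomial.C κ) * P) * x
      = Polynomial.aeval (casimir D) P * ((casimir D - algebraMap ℂ _ κ) * x) := fun x => by
    rw [mul_comm, map_mul, map_sub, Polynomial.aeval_X, Polynomial.aeval_C, mul_assoc]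
  rw [h3, h3, h1, h2, mul_smul_comm, mul_smul_comm, map_smul, map_smul]
  congr 1
  -- Each linear factor turns the two sides into values on `E F e_w` and `F E e_{wt}`, and these are
  -- cyclic rearrangements of one another.
  have hF : F D * cartanSum D w = cartanSum D (w * D.t) * F D := by
    rw [cartanSum_mul D (sat D).K_F, mul_assoc, mul_inv_cancel₀ D.t_ne, mul_one]
  set Z := Polynomial.aeval (casimir D) P with hZ
  calc ψ (Z * (E D * F D * cartanSum D w)) = ψ ((Z * E D * cartanSum D (w * D.t)) * F D) := by
        rw [mul_assoc (E D), hF]; simp only [mul_assoc]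
    _ = ψ (Z * (F D * E D * cartanSum D (w * D.t))) := by
        rw [hψ, ← mul_assoc, ← mul_assoc, hZ, ← aeval_casimir_mul]; simp only [mul_assoc]

/-- Moving along a string of weights. -/
theorem SLF_casimir_string {ψ : Dual ℂ (U D)} (hψ : ψ ∈ SLF (U D)) {w : ℂ}
    (hw : w ^ (2 * D.p * D.r) = 1) (n : ℕ) (P : Polynomial ℂ) :
    ψ (Polynomial.aeval (casimir D) ((∏ j ∈ Finset.range n, (Polynomial.X -
        Polynomial.C (D.q⁻¹ * ((w * D.t ^ j) ^ D.r)⁻¹ + D.q * (w * D.t ^ j) ^ D.r))) * P)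
          * cartanSum D w)
      = ψ (Polynomial.aeval (casimir D) ((∏ j ∈ Finset.range n, (Polynomial.X -
        Polynomial.C (D.q⁻¹ * ((w * D.t ^ j) ^ D.r)⁻¹ + D.q * (w * D.t ^ j) ^ D.r))) * P)
          * cartanSum D (w * D.t ^ n)) := by
  induction n generalizing P with
  | zero => simp
  | succ n ih =>
    have hw' : (w * D.t ^ n) ^ (2 * D.p * D.r) = 1 := by
      rw [mul_pow, hw, ← pow_mul, mul_comm n, pow_mul, t_pow_N_eq, one_pow, one_mul]
    rw [Finset.prod_range_succ, mul_assoc, ih, ← mul_assoc, mul_comm (∏ j ∈ _, _), mul_assoc,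
      SLF_casimir_step hψ hw', mul_assoc, ← pow_succ]

/-- Each root has the form `x + x⁻¹`, with `x = q^(1-n+2j)` in the first string and `x = q^(1+n+2i)`
in the second. A common root would make these equal or inverse, so `q²` to the power `n + i - j` or
`1 + i + j` would be `1`; both exponents lie strictly between `0` and `p`. -/
theorem isCoprime_casimir_strings {n : ℕ} (hn : n ≤ D.p) :
    IsCoprime (∏ j ∈ Finset.range n, (Polynomial.X - Polynomial.C
        (D.q⁻¹ * ((D.q ^ n)⁻¹ * (D.q ^ 2) ^ j)⁻¹ + D.q * ((D.q ^ n)⁻¹ * (D.q ^ 2) ^ j))))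
      (∏ j ∈ Finset.range (D.p - n), (Polynomial.X - Polynomial.C
        (D.q⁻¹ * (D.q ^ n * (D.q ^ 2) ^ j)⁻¹ + D.q * (D.q ^ n * (D.q ^ 2) ^ j)))) := by
  have h0 := D.q_ne
  refine IsCoprime.prod_left fun j hj => IsCoprime.prod_right fun i hi => ?_
  have hj := Finset.mem_range.1 hj
  have hi := Finset.mem_range.1 hi
  refine Polynomial.isCoprime_X_sub_C_of_isUnit_sub (Ne.isUnit (sub_ne_zero.2 fun h => ?_))
  have hne : ∀ k, 0 < k → k < D.p → (D.q ^ 2) ^ k ≠ 1 := fun k h1 h2 =>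
    D.prim_sq.pow_ne_one_of_pos_of_lt h1.ne' h2
  have key : ((D.q ^ 2) ^ (n + i - j) - 1) * ((D.q ^ 2) ^ (1 + i + j) - 1) = 0 := by
    have e1 : (D.q ^ 2) ^ (n + i - j) = (D.q ^ n * D.q ^ n) * (D.q ^ 2) ^ i * ((D.q ^ 2) ^ j)⁻¹ := by
      rw [eq_mul_inv_iff_mul_eq₀ (pow_ne_zero _ (pow_ne_zero _ h0)), ← pow_add,
        Nat.sub_add_cancel (by omega), pow_add, ← pow_mul, ← pow_add, two_mul]
    rw [e1, pow_add, pow_add, pow_one]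
    have hn0 := pow_ne_zero n h0
    have hi0 := pow_ne_zero i (pow_ne_zero 2 h0)
    have hj0 := pow_ne_zero j (pow_ne_zero 2 h0)
    generalize D.q ^ n = x at *
    generalize (D.q ^ 2) ^ i = y at *
    generalize (D.q ^ 2) ^ j = z at *
    generalize D.q = r at *
    field_simp at h ⊢
    linear_combination -h
  rcases mul_eq_zero.1 key with h1 | h1
  · exact hne _ (by omega) (by omega) (sub_eq_zero.1 h1)
  · exact hne _ (by omega) (by omega) (sub_eq_zero.1 h1)

/-- From `q^(-n)`, `n` steps lead to `q^n`, and from there `p - n` further steps close the circle.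
Each path gives the equality for multiples of its product of factors, and a Bézout relation
decomposes any `P` into two such multiples. -/
theorem SLF_cartanSum_inv_of_le (hr : D.r = 1) {ψ : Dual ℂ (U D)} (hψ : ψ ∈ SLF (U D)) {n : ℕ}
    (hn : n ≤ D.p) (P : Polynomial ℂ) :
    ψ (Polynomial.aeval (casimir D) P * cartanSum D (D.q ^ n)⁻¹)
      = ψ (Polynomial.aeval (casimir D) P * cartanSum D (D.q ^ n)) := by
  have h0 := D.q_ne
  have ht : D.t = D.q ^ 2 := by have := D.t_pow; rwa [hr, pow_one] at this
  have hN : (D.q ^ n) ^ (2 * D.p * D.r) = 1 := by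
    rw [hr, mul_one, ← pow_mul, mul_comm, pow_mul, D.prim.pow_eq_one, one_pow]
  have hN' : (D.q ^ n)⁻¹ ^ (2 * D.p * D.r) = 1 := by rw [inv_pow, hN, inv_one]
  have h1 := SLF_casimir_string hψ hN' n
  have h2 := SLF_casimir_string hψ hN (D.p - n)
  have e1 : (D.q ^ n)⁻¹ * (D.q ^ 2) ^ n = D.q ^ n := by
    rw [inv_mul_eq_iff_eq_mul₀ (pow_ne_zero _ h0), ← pow_mul, two_mul, pow_add]
  have e2 : D.q ^ n * (D.q ^ 2) ^ (D.p - n) = (D.q ^ n)⁻¹ := by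
    refine eq_inv_of_mul_eq_one_left ?_
    rw [← pow_mul, ← pow_add, ← pow_add, show n + 2 * (D.p - n) + n = 2 * D.p by omega,
      D.prim.pow_eq_one]
  simp only [hr, pow_one, ht] at h1 h2
  rw [e1] at h1
  rw [e2] at h2
  obtain ⟨a, b, hab⟩ := isCoprime_casimir_strings hn
  have e : P = (∏ j ∈ Finset.range n, (Polynomial.X - Polynomial.C
        (D.q⁻¹ * ((D.q ^ n)⁻¹ * (D.q ^ 2) ^ j)⁻¹ + D.q * ((D.q ^ n)⁻¹ * (D.q ^ 2) ^ j)))) * (a * P)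
      + (∏ j ∈ Finset.range (D.p - n), (Polynomial.X - Polynomial.C
        (D.q⁻¹ * (D.q ^ n * (D.q ^ 2) ^ j)⁻¹ + D.q * (D.q ^ n * (D.q ^ 2) ^ j)))) * (b * P) := by
    linear_combination (-P) * hab
  rw [e, map_add, add_mul, add_mul, map_add, map_add, h1, h2]

theorem SLF_cartanSum_inv (hr : D.r = 1) {ψ : Dual ℂ (U D)} (hψ : ψ ∈ SLF (U D)) {w : ℂ}
    (hw : w ^ (2 * D.p * D.r) = 1) (P : Polynomial ℂ) :
    ψ (Polynomial.aeval (casimir D) P * cartanSum D w⁻¹)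
      = ψ (Polynomial.aeval (casimir D) P * cartanSum D w) := by
  have : NeZero (2 * D.p) := ⟨by have := D.two_le_p; omega⟩
  rw [hr, mul_one] at hw
  obtain ⟨n, hn, rfl⟩ := D.prim.eq_pow_of_pow_eq_one hw
  by_cases h : n ≤ D.p
  · exact SLF_cartanSum_inv_of_le hr hψ h P
  · have e : (D.q ^ n)⁻¹ = D.q ^ (2 * D.p - n) := by
      refine (eq_inv_of_mul_eq_one_left ?_).symm
      rw [← pow_add, Nat.sub_add_cancel hn.le, D.prim.pow_eq_one]
    have e' := congrArg (·⁻¹) e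
    simp only [inv_inv] at e'
    rw [e, e', SLF_cartanSum_inv_of_le hr hψ (by omega)]

/-- Symmetric linear forms are invariant under the antipode. -/
theorem SLF_antipode (hr : D.r = 1) {ψ : Dual ℂ (U D)} (hψ : ψ ∈ SLF (U D)) :
    ψ ∘ₗ antipode ℂ = ψ := by
  refine linearMap_ext fun m a c ha hc => ?_
  -- Off the diagonal both forms vanish, since composing with the antipode preserves symmetry. On
  -- the diagonal, powers of `K` are expanded in weight vectors.
  by_cases hac : a = c
  · subst hac
    have hm := pow_mem_span_cartanSum (D := D) m
    have hK : Commute (K D) (F D ^ a * E D ^ a) := K_mul_FE D a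
    rw [mul_assoc, (hK.pow_left m).eq]
    generalize K D ^ m = y at hm ⊢
    induction hm using Submodule.span_induction with
    | mem x hx =>
      obtain ⟨⟨w, hw⟩, rfl⟩ := hx
      obtain ⟨P, hP⟩ := exists_aeval_casimir a hw
      rw [hP, LinearMap.comp_apply, HopfAlgebra.antipode_mul_antidistrib, antipode_aeval_casimir,
        antipode_cartanSum hw, ← aeval_casimir_mul, SLF_cartanSum_inv hr hψ hw]
    | zero => simp
    | add x y _ _ hx hy => rw [mul_add, map_add, map_add, hx, hy]
    | smul c x _ hx => rw [mul_smul_comm, map_smul, map_smul, hx]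
  · rw [SLF_monomial (mem_SLF_antipode hψ) ha hc hac, SLF_monomial hψ ha hc hac]

end Casimir
end U
end
end RestrictedQG

/-! ### Nondegeneracy of the monodromy. -/

open scoped TensorProduct
namespace RestrictedQG
noncomputable section
open Coalgebra HopfAlgebra Module

theorem exists_mul_pow {B : Type*} [Ring B] [Algebra ℂ B] {x y : B} {w : ℂ} (hw : w ≠ 0)
    (h : y * x = w • (x * y)) (n : ℕ) : ∃ c : ℂ, c ≠ 0 ∧ (x * y) ^ n = c • (x ^ n * y ^ n) := by
  induction n with
  | zero => exact ⟨1, one_ne_zero, by simp⟩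
  | succ n ih =>
    obtain ⟨c, hc, e⟩ := ih
    refine ⟨c * w ^ n, mul_ne_zero hc (pow_ne_zero _ hw), ?_⟩
    rw [pow_succ, e, smul_mul_assoc, mul_assoc, ← mul_assoc (y ^ n), U.Sat.pow_comm h,
      smul_mul_assoc, mul_smul_comm, smul_smul, mul_assoc x, ← pow_succ, ← mul_assoc, ← pow_succ]

namespace U
variable (D : QParam)

theorem Kinv_pow_pred : Kinv D ^ (2 * D.p * D.r - 1) = K D := by
  have h : Kinv D ^ (2 * D.p * D.r - 1) * Kinv D = 1 := by
    rw [← pow_succ, Nat.sub_add_cancel D.N_pos, Kinv, ← pow_mul, mul_comm, pow_mul, (sat D).K_pow,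
      one_pow]
  calc _ = Kinv D ^ (2 * D.p * D.r - 1) * (Kinv D * K D) := by rw [Kinv_mul_K, mul_one]
    _ = K D := by rw [← mul_assoc, h, one_mul]

theorem sat_chevalley : Sat D (F D) (E D) (Kinv D) where
  K_pow := by rw [Kinv, ← pow_mul, mul_comm, pow_mul, (sat D).K_pow, one_pow]
  E_pow := (sat D).F_pow
  F_pow := (sat D).E_pow
  K_E := (sat D).kinv_f
  K_F := (sat D).kinv_e
  E_F := by
    rw [Kinv_pow_pred, ← neg_sub, (sat D).E_F, ← smul_neg, neg_sub]; rfl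

/-- The involution exchanging `E` and `F`. -/
def chevalley : U D →ₐ[ℂ] U D := lift (sat_chevalley D)

theorem chevalley_chevalley (x : U D) : chevalley D (chevalley D x) = x := by
  have hK : chevalley D (K D) = Kinv D := lift_K _
  have h : (chevalley D).comp (chevalley D) = AlgHom.id ℂ _ := by
    refine algHom_ext ?_ ?_ ?_
    · exact (congrArg (chevalley D) (lift_E _)).trans (lift_F _)
    · exact (congrArg (chevalley D) (lift_F _)).trans (lift_E _)
    · refine (congrArg (chevalley D) hK).trans ?_
      rw [Kinv, map_pow, hK, Kinv_pow_pred]; rfl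
  exact AlgHom.congr_fun h x

theorem chevalley_monomial (m a c : ℕ) : chevalley D (K D ^ m * F D ^ a * E D ^ c)
    = K D ^ ((2 * D.p * D.r - 1) * m) * E D ^ a * F D ^ c := by
  rw [map_mul, map_mul, map_pow, map_pow, map_pow, chevalley, lift_K, lift_F, lift_E, Kinv, pow_mul]

end U

section Monodromy
variable {p : ℕ} {q : ℂ} (hp : 2 ≤ p) (hq : IsPrimitiveRoot q (2 * p))

local notation "eA" => U.E (halfParam hp hq)
local notation "fA" => U.F (halfParam hp hq)
local notation "kA" => U.K (halfParam hp hq)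
local notation "gA" => U.K (halfParam hp hq) ^ 2
local notation "hA" => U.Kinv (halfParam hp hq) ^ 2

include hp hq in
theorem rCoeff_ne_zero {m : ℕ} (hm : m < p) : rCoeff q m ≠ 0 := by
  induction m with
  | zero => rw [rCoeff_zero]; exact one_ne_zero
  | succ m ih =>
    have hqh : q - q⁻¹ ≠ 0 := (halfParam hp hq).qhat_ne
    intro h
    have h1 := rCoeff_succ hp hq hm
    rw [h, zero_mul] at h1
    exact mul_ne_zero (mul_ne_zero hqh (pow_ne_zero m (root_ne_zero hp hq))) (ih (by omega)) h1.symm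

variable {s : ℂ} (hs : s ^ 2 = q)
include hs

omit hs in
theorem comm_cartanPart : TensorProduct.comm ℂ _ _ (cartanPart hp hq s) = cartanPart hp hq s := by
  conv_lhs => rw [cartanPart_eq_left]
  rw [cartanPart_eq_right, map_sum]
  simp only [TensorProduct.comm_tmul]

theorem cartanPart_mul_self : cartanPart hp hq s * cartanPart hp hq s
    = ∑ j ∈ Finset.range (4 * p), idem hp hq s j ⊗ₜ[ℂ] ((gA) ^ j) := by
  rw [cartanPart_eq_left, Finset.sum_mul_sum]
  refine Finset.sum_congr rfl fun i hi => ?_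
  simp only [Algebra.TensorProduct.tmul_mul_tmul]
  rw [Finset.sum_eq_single i]
  · rw [idem_mul_idem hp hq hs (Finset.mem_range.1 hi) (Finset.mem_range.1 hi), if_pos rfl, ← pow_add,
      ← two_mul, pow_mul]
  · intro j hj hji
    rw [idem_mul_idem hp hq hs (Finset.mem_range.1 hi) (Finset.mem_range.1 hj), if_neg hji.symm,
      TensorProduct.zero_tmul]
  · exact fun h => absurd hi h

theorem FE_mul_cartanPart : (fA ⊗ₜ eA) * cartanPart hp hq s
    = cartanPart hp hq s * ((fA * hA) ⊗ₜ (gA * eA)) := by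
  have h1 := (cartanPart_commute hp hq s (Commute.one_right _) ((Commute.refl kA).pow_right 2)).eq
  have h2 := (cartanPart_commute hp hq s (commute_K_h hp hq) (Commute.one_right _)).eq
  have e1 : (fA * hA) ⊗ₜ[ℂ] (gA * eA) = (fA ⊗ₜ 1) * (1 ⊗ₜ gA) * (hA ⊗ₜ 1) * (1 ⊗ₜ eA) := by simp
  rw [e1, ← mul_assoc, ← mul_assoc, ← mul_assoc, cartanPart_mul_F_left hp hq hs,
    mul_assoc _ (cartanPart hp hq s), h1, ← mul_assoc, mul_assoc _ (cartanPart hp hq s), h2,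
    ← mul_assoc, mul_assoc _ (cartanPart hp hq s), cartanPart_mul_E_right hp hq hs, ← mul_assoc]
  simp only [Algebra.TensorProduct.tmul_mul_tmul, one_mul, mul_one, h_mul_g, mul_assoc]

/-- After moving the Cartan parts together, `Q` pairs the basis of weight projectors times monomials
in one leg with ordered monomials in the other. Only the nonvanishing of the coefficients matters,
not their values. -/
theorem exists_monodromy_eq : ∃ κ : ℕ → ℕ → ℕ → ℂ, (∀ j l m, l < p → m < p → κ j l m ≠ 0) ∧
    (isRMatrix hp hq hs).Q = ∑ l ∈ Finset.range p, ∑ m ∈ Finset.range p,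
      ∑ j ∈ Finset.range (4 * p), κ j l m • (idem hp hq s j * fA ^ l * eA ^ m) ⊗ₜ[ℂ]
        ((gA) ^ (j + l) * eA ^ l * fA ^ m) := by
  have hq0 := root_ne_zero hp hq
  have hq2 : (q ^ 2) ≠ 0 := pow_ne_zero 2 hq0
  have hfh : fA * hA = (q ^ 2)⁻¹ • (hA * fA) := by
    rw [h_mul_F, smul_smul, inv_mul_cancel₀ hq2, one_smul]
  have heg : eA * gA = (q ^ 2)⁻¹ • (gA * eA) := by
    rw [g_mul_E, smul_smul, inv_mul_cancel₀ hq2, one_smul]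
  choose c1 hc1 e1 using fun n => exists_mul_pow (inv_ne_zero hq2) hfh n
  choose c2 hc2 e2 using fun n => exists_mul_pow (inv_ne_zero hq2) heg n
  have hl : ∀ j l, idem hp hq s j * (fA * hA) ^ l
      = (((q ^ 2)⁻¹) ^ l * c1 l * ((q⁻¹) ^ j) ^ l) • (idem hp hq s j * fA ^ l) := fun j l => by
    have hc : Commute hA (idem hp hq s j) := by
      have : Commute kA (idem hp hq s j) := Commute.smul_right (Commute.sum_right _ _ _ fun n _ =>
        (Commute.self_pow kA n).smul_right _) _
      exact (this.pow_left _).pow_left 2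
    have hjl : idem hp hq s j * (hA) ^ l = ((q⁻¹) ^ j) ^ l • idem hp hq s j := by
      rw [← (hc.pow_left l).eq]
      clear e1 e2
      induction l with
      | zero => simp
      | succ l ih => rw [pow_succ, mul_assoc, Kinv_sq_mul_idem hp hq hs, mul_smul_comm, ih, smul_smul, pow_succ']
    rw [hfh, smul_pow, e1, smul_smul, mul_smul_comm, ← mul_assoc, hjl, smul_mul_assoc, smul_smul]
  refine ⟨fun j l m => rCoeff q l * rCoeff q m * (((q ^ 2)⁻¹) ^ l * c1 l * ((q⁻¹) ^ j) ^ l) * c2 l,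
    fun j l m hl' hm => ?_, ?_⟩
  · exact mul_ne_zero (mul_ne_zero (mul_ne_zero (rCoeff_ne_zero hp hq hl') (rCoeff_ne_zero hp hq hm))
      (mul_ne_zero (mul_ne_zero (pow_ne_zero _ (inv_ne_zero hq2)) (hc1 l))
        (pow_ne_zero _ (pow_ne_zero _ (inv_ne_zero hq0))))) (hc2 l)
  · have hR' : ∑ i, rRight hp hq i ⊗ₜ[ℂ] rLeft hp hq s i = cartanPart hp hq s *
        ∑ l ∈ Finset.range p, rCoeff q l • (fA ^ l) ⊗ₜ[ℂ] (eA ^ l) := by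
      have h := congrArg (Algebra.TensorProduct.comm ℂ _ _) (RMatrix_eq_sum hp hq s)
      rw [map_sum, RMatrix_eq, map_mul] at h
      refine h.symm.trans ?_
      congr 1
      · exact comm_cartanPart hp hq
      · rw [thetaPart, map_sum]
        refine Finset.sum_congr rfl fun m _ => ?_
        rw [map_smul]; rfl
    have hTC : (∑ l ∈ Finset.range p, rCoeff q l • (fA ^ l) ⊗ₜ[ℂ] (eA ^ l)) * cartanPart hp hq s
        = cartanPart hp hq s *
          ∑ l ∈ Finset.range p, rCoeff q l • ((fA * hA) ^ l) ⊗ₜ[ℂ] ((gA * eA) ^ l) := by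
      rw [Finset.sum_mul, Finset.mul_sum]
      refine Finset.sum_congr rfl fun l _ => ?_
      rw [smul_mul_assoc, mul_smul_comm, ← Algebra.TensorProduct.tmul_pow,
        ← Algebra.TensorProduct.tmul_pow]
      congr 1
      exact (SemiconjBy.pow_right (FE_mul_cartanPart hp hq hs).symm l).symm
    rw [IsRMatrix.Q, hR', ← RMatrix_eq_sum, RMatrix_eq, mul_assoc, ← mul_assoc _ (cartanPart hp hq s),
      hTC, mul_assoc, ← mul_assoc, cartanPart_mul_self hp hq hs, thetaPart, Finset.sum_mul_sum,
      Finset.mul_sum]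
    refine Finset.sum_congr rfl fun l _ => ?_
    rw [Finset.mul_sum]
    refine Finset.sum_congr rfl fun m _ => ?_
    rw [Finset.sum_mul]
    refine Finset.sum_congr rfl fun j _ => ?_
    rw [smul_mul_smul_comm, mul_smul_comm, Algebra.TensorProduct.tmul_mul_tmul,
      Algebra.TensorProduct.tmul_mul_tmul, ← mul_assoc (idem hp hq s j), hl, e2]
    simp only [smul_mul_assoc, mul_smul_comm, ← TensorProduct.smul_tmul', TensorProduct.tmul_smul,
      smul_smul, ← mul_assoc, ← pow_add]
    congr 1
    ring

/-- Injectivity suffices by dimension. A functional separating the monomials of the first leg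
isolates each single term of `Q`, so a form whose contraction is zero vanishes on all monomials of
the second leg, and these span. -/
theorem monodromy_bijective {Q : Ubar hp hq ⊗[ℂ] Ubar hp hq}
    (hQ : TensorProduct.map (incl hp hq).toLinearMap (incl hp hq).toLinearMap Q
      = (isRMatrix hp hq hs).Q) :
    Function.Bijective fun f : Dual ℂ (Ubar hp hq) => sliceR f Q := by
  have hfin : finrank ℂ (Dual ℂ (Ubar hp hq)) = finrank ℂ (Ubar hp hq) := Subspace.dual_finrank_eq
  have hinj : Function.Injective (sliceMap Q) := by
    rw [← LinearMap.ker_eq_bot, LinearMap.ker_eq_bot']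
    intro f hf
    have hf : sliceR f Q = 0 := hf
    obtain ⟨κ, hκ, hQe⟩ := exists_monodromy_eq hp hq hs
    have er : (f ∘ₗ retr hp hq) ∘ₗ (incl hp hq).toLinearMap = f :=
      LinearMap.ext fun x => congrArg f (retr_incl hp hq x)
    have h1 : sliceR (f ∘ₗ retr hp hq) (isRMatrix hp hq hs).Q = 0 := by
      rw [← hQ, ← sliceR_comp, er, hf, map_zero]
    rw [hQe] at h1
    simp only [map_sum, map_smul, sliceR_tmul] at h1
    have h2 : ∀ j l m, j < 4 * p → l < p → m < p →
        f (U.K (barParam hp hq) ^ (j + l) * U.E _ ^ l * U.F _ ^ m) = 0 := by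
      intro j₀ l₀ m₀ hj hl hm
      have hz : (s ^ j₀) ^ (2 * (halfParam hp hq).p * (halfParam hp hq).r) = 1 := by
        change (s ^ j₀) ^ (2 * p * 2) = 1
        rw [← pow_mul, mul_comm, pow_mul, show 2 * p * 2 = 2 * (2 * p) by ring, pow_mul, hs,
          hq.pow_eq_one, one_pow]
      obtain ⟨φ, hφ⟩ := U.exists_dual_monomial (D := halfParam hp hq) hz hl hm
      have hφi : ∀ j l m, j < 4 * p → φ (idem hp hq s j * fA ^ l * eA ^ m)
          = if l = l₀ ∧ m = m₀ then (if j = j₀ then 1 else 0) else 0 := fun j l m hj' => by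
        simp only [idem, smul_mul_assoc, Finset.sum_mul, map_smul, map_sum, hφ, smul_eq_mul]
        by_cases h : l = l₀ ∧ m = m₀
        · simp only [if_pos h]
          exact sum_ratio hp hq hs hj' hj
        · simp [if_neg h]
      have h3 := congrArg φ h1
      simp only [map_sum, map_smul, smul_eq_mul, map_zero] at h3
      rw [Finset.sum_eq_single l₀, Finset.sum_eq_single m₀, Finset.sum_eq_single j₀,
        hφi _ _ _ hj, if_pos ⟨rfl, rfl⟩, if_pos rfl, mul_one] at h3
      · have e : (gA) ^ (j₀ + l₀) * eA ^ l₀ * fA ^ m₀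
            = incl hp hq (U.K (barParam hp hq) ^ (j₀ + l₀) * U.E _ ^ l₀ * U.F _ ^ m₀) := by simp
        rw [e, LinearMap.comp_apply, retr_incl] at h3
        exact (mul_eq_zero.1 h3).resolve_left (hκ _ _ _ hl hm)
      · intro j hj' hne
        rw [hφi _ _ _ (Finset.mem_range.1 hj'), if_pos ⟨rfl, rfl⟩, if_neg hne, mul_zero, mul_zero]
      · exact fun h => absurd (Finset.mem_range.2 hj) h
      · intro m _ hne
        refine Finset.sum_eq_zero fun j hj' => ?_
        rw [hφi _ _ _ (Finset.mem_range.1 hj'), if_neg (fun h => hne h.2), mul_zero, mul_zero]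
      · exact fun h => absurd (Finset.mem_range.2 hm) h
      · intro l _ hne
        refine Finset.sum_eq_zero fun m _ => Finset.sum_eq_zero fun j hj' => ?_
        rw [hφi _ _ _ (Finset.mem_range.1 hj'), if_neg (fun h => hne h.1), mul_zero, mul_zero]
      · exact fun h => absurd (Finset.mem_range.2 hl) h
    -- The shift by `l` in the exponent of `K` is harmless, as that exponent only matters modulo
    -- `2p`.
    have h3 : ∀ n l m, l < p → m < p →
        f (U.K (barParam hp hq) ^ n * U.E _ ^ l * U.F _ ^ m) = 0 := by
      intro n l m hl hm
      have e : U.K (barParam hp hq) ^ n = U.K (barParam hp hq) ^ ((n + 2 * p - l) % (2 * p) + l) := by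
        rw [U.K_pow_mod, eq_comm, U.K_pow_mod]
        congr 1
        change ((n + 2 * p - l) % (2 * p) + l) % (2 * p * 1) = n % (2 * p * 1)
        rw [mul_one, Nat.mod_add_mod, Nat.sub_add_cancel (by omega), Nat.add_mod_right]
      rw [e]
      exact h2 _ _ _ ((Nat.mod_lt _ (by omega)).trans (by omega)) hl hm
    -- The monomials have `E` before `F`; the involution exchanging them brings back the spanning
    -- order.
    have h4 : f ∘ₗ (U.chevalley (barParam hp hq)).toLinearMap = 0 := by
      refine U.linearMap_ext fun m a c ha hc => ?_
      rw [LinearMap.comp_apply, AlgHom.toLinearMap_apply, U.chevalley_monomial]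
      exact h3 _ _ _ ha hc
    ext x
    have h5 := LinearMap.congr_fun h4 (U.chevalley _ x)
    rwa [LinearMap.comp_apply, AlgHom.toLinearMap_apply, U.chevalley_chevalley] at h5
  exact ⟨hinj, (LinearMap.injective_iff_surjective_of_finrank_eq_finrank hfin).1 hinj⟩

end Monodromy
end
end RestrictedQG

open scoped TensorProduct
namespace RestrictedQG
noncomputable section
open Coalgebra HopfAlgebra Module

/-! ### Primitive weight idempotents and principal indecomposable modules. -/

section Primitive
variable {H : Type} [Ring H]

theorem mem_span_idempotent {f y : H} (hf : f * f = f) : y ∈ Submodule.span H {f} ↔ y * f = y := by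
  rw [Submodule.mem_span_singleton]
  constructor
  · rintro ⟨a, rfl⟩
    rw [smul_eq_mul, mul_assoc, hf]
  · exact fun h => ⟨y, h⟩

theorem projective_span_idempotent {f : H} (hf : f * f = f) :
    Module.Projective H (Submodule.span H {f}) := by
  refine Module.Projective.of_split (Submodule.subtype _)
    (LinearMap.toSpanSingleton H (Submodule.span H {f}) ⟨f, Submodule.mem_span_singleton_self f⟩) ?_
  ext ⟨y, hy⟩
  exact (mem_span_idempotent hf).1 hy

variable [Algebra ℂ H]

/-- Splitting an idempotent weight vector along a decomposition of its left ideal. -/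
theorem idempotent_split {f k : H} {c : ℂ} (hf : f * f = f) (hk : k * f = c • f)
    (hk' : f * k = c • f) {N N' : Submodule H H} (hN : N ≤ Submodule.span H {f})
    (hd : Disjoint N N') {f₁ f₂ : H} (h₁ : f₁ ∈ N) (h₂ : f₂ ∈ N')
    (h : f₁ + f₂ = f) : f₁ * f₁ = f₁ ∧ k * f₁ = c • f₁ ∧ f₁ * k = c • f₁ := by
  have e₁ := (mem_span_idempotent hf).1 (hN h₁)
  have key : ∀ {a b a' b' : H}, a ∈ N → a' ∈ N → b ∈ N' → b' ∈ N' → a + b = a' + b' → a = a' := by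
    intro a b a' b' ha ha' hb hb' h
    have h1 : a - a' = b' - b := by rw [sub_eq_sub_iff_add_eq_add, h, add_comm]
    have h2 := Submodule.disjoint_def.1 hd (a - a') (N.sub_mem ha ha')
      (h1 ▸ N'.sub_mem hb' hb)
    exact sub_eq_zero.1 h2
  refine ⟨?_, ?_, ?_⟩
  · refine key (b := f₁ * f₂) (b' := 0) (N.smul_mem f₁ h₁) h₁ (N'.smul_mem f₁ h₂) N'.zero_mem ?_
    rw [← mul_add, h, e₁, add_zero]
  · refine key (b := k * f₂) (b' := c • f₂) (N.smul_mem k h₁) (N.smul_of_tower_mem c h₁)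
      (N'.smul_mem k h₂) (N'.smul_of_tower_mem c h₂) ?_
    rw [← mul_add, h, hk, ← smul_add, h]
  · rw [← e₁, mul_assoc, hk', mul_smul_comm]

/-- A weight idempotent not killed by `x` can be taken primitive. -/
theorem exists_isPIM_span [FiniteDimensional ℂ H] {k x e : H} {c : ℂ} (he : e * e = e)
    (hk : k * e = c • e) (hk' : e * k = c • e) (hx : x * e ≠ 0) :
    ∃ f : H, f * f = f ∧ k * f = c • f ∧ f * k = c • f ∧ x * f ≠ 0 ∧
      IsPIM H (Submodule.span H {f}) := by
  let d : H → ℕ := fun f => finrank ℂ ((Submodule.span H {f}).restrictScalars ℂ)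
  -- Primitivity comes from minimal dimension of the left ideal among the weight idempotents not
  -- killed by `x`. In any splitting, one of the two components is again such an idempotent, hence
  -- generates the whole ideal.
  obtain ⟨f, ⟨hf, hkf, hfk, hxf⟩, hmin⟩ := (measure d).wf.has_min
    {f | f * f = f ∧ k * f = c • f ∧ f * k = c • f ∧ x * f ≠ 0} ⟨e, he, hk, hk', hx⟩
  have hmin' : ∀ f' ∈ Submodule.span H {f}, f' * f' = f' → k * f' = c • f' → f' * k = c • f' →
      x * f' ≠ 0 → f ∈ Submodule.span H {f'} := by
    intro f' hm h1 h2 h3 h4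
    have h5 : d f ≤ d f' := not_lt.1 (hmin f' ⟨h1, h2, h3, h4⟩)
    have h6 : (Submodule.span H {f'}).restrictScalars ℂ ≤ (Submodule.span H {f}).restrictScalars ℂ :=
      Submodule.span_le.2 (Set.singleton_subset_iff.2 hm)
    have h7 := Submodule.eq_of_le_of_finrank_le h6 h5
    have h8 : f ∈ (Submodule.span H {f}).restrictScalars ℂ := Submodule.mem_span_singleton_self f
    rwa [← h7] at h8
  set M := Submodule.span H {f}
  refine ⟨f, hf, hkf, hfk, hxf, projective_span_idempotent hf, ?_, fun N N' hNN => ?_⟩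
  · refine ⟨⟨f, Submodule.mem_span_singleton_self f⟩, 0, fun h => hxf ?_⟩
    have : f = 0 := congrArg Subtype.val h
    rw [this, mul_zero]
  · have hd : Disjoint (N.map M.subtype) (N'.map M.subtype) :=
      (Submodule.disjoint_map M.injective_subtype hNN.disjoint)
    have hle : ∀ L : Submodule H M, L.map M.subtype ≤ M := fun L => Submodule.map_subtype_le M L
    obtain ⟨⟨y₁, hy₁⟩, h₁, ⟨y₂, hy₂⟩, h₂, h⟩ := Submodule.mem_sup.1
      (show (⟨f, Submodule.mem_span_singleton_self f⟩ : M) ∈ N ⊔ N' by rw [hNN.sup_eq_top]; trivial)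
    have h : y₁ + y₂ = f := congrArg Subtype.val h
    have m₁ : y₁ ∈ N.map M.subtype := ⟨_, h₁, rfl⟩
    have m₂ : y₂ ∈ N'.map M.subtype := ⟨_, h₂, rfl⟩
    have bot : ∀ {L L' : Submodule H M}, Disjoint (L.map M.subtype) (L'.map M.subtype) →
        f ∈ L.map M.subtype → L' = ⊥ := by
      intro L L' hdis hfL
      have h1 : M ≤ L.map M.subtype := Submodule.span_le.2 (Set.singleton_subset_iff.2 hfL)
      have h2 := hdis.mono_left h1
      have h3 : L'.map M.subtype = ⊥ := by
        rw [← le_bot_iff]; exact h2 (hle L') le_rfl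
      exact Submodule.map_injective_of_injective M.injective_subtype (h3.trans (Submodule.map_bot _).symm)
    by_cases hx1 : x * y₁ = 0
    · obtain ⟨a, b, c'⟩ := idempotent_split hf hkf hfk (hle N') hd.symm m₂ m₁
        (by rw [add_comm, h])
      have h5 : x * y₂ ≠ 0 := fun h0 => hxf (by rw [← h, mul_add, hx1, h0, add_zero])
      have h6 := hmin' y₂ hy₂ a b c' h5
      exact Or.inl (bot hd.symm ((Submodule.span_le.2 (Set.singleton_subset_iff.2 m₂)) h6))
    · obtain ⟨a, b, c'⟩ := idempotent_split hf hkf hfk (hle N) hd m₁ m₂ h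
      have h6 := hmin' y₁ hy₁ a b c' hx1
      exact Or.inr (bot hd ((Submodule.span_le.2 (Set.singleton_subset_iff.2 m₁)) h6))

omit [Algebra ℂ H] in
theorem IsPIM.of_equiv {M M' : Type} [AddCommGroup M] [Module H M] [AddCommGroup M'] [Module H M']
    (e : M ≃ₗ[H] M') (h : IsPIM H M) : IsPIM H M' := by
  obtain ⟨h1, h2, h3⟩ := h
  refine ⟨Module.Projective.of_equiv e, e.toEquiv.nontrivial_congr.1 h2, fun N N' hN => ?_⟩
  have h4 := h3 (N.map e.symm.toLinearMap) (N'.map e.symm.toLinearMap)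
    ((Submodule.orderIsoMapComap e.symm).isCompl hN)
  simpa using h4

end Primitive

/-! ### Liftings to the extension, and separation by their coefficients. -/

section Liftings
variable {p : ℕ} {q : ℂ} (hp : 2 ≤ p) (hq : IsPrimitiveRoot q (2 * p))

/-- The weight projectors of `K` span `1`, so `x` cannot kill all of them from the left. -/
theorem exists_weight_idempotent {x : Ubar hp hq} (hx : x ≠ 0) : ∃ (e : Ubar hp hq) (c : ℂ),
    c ≠ 0 ∧ e * e = e ∧ U.K _ * e = c • e ∧ e * U.K _ = c • e ∧ x * e ≠ 0 := by
  set D := barParam hp hq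
  have hN : ((2 * D.p * D.r : ℕ) : ℂ) ≠ 0 := by exact_mod_cast D.N_pos.ne'
  obtain ⟨w, hw, hxw⟩ : ∃ w : ℂ, w ^ (2 * D.p * D.r) = 1 ∧ x * U.cartanSum D w ≠ 0 := by
    by_contra! h
    have h1 := U.pow_mem_span_cartanSum (D := D) 0
    have h2 : Submodule.span ℂ (Set.range fun w : {w : ℂ // w ^ (2 * D.p * D.r) = 1} =>
        U.cartanSum D w.1) ≤ LinearMap.ker (LinearMap.mulLeft ℂ x) := by
      rw [Submodule.span_le]
      rintro _ ⟨w, rfl⟩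
      exact h w.1 w.2
    have h3 : x * U.K D ^ 0 = 0 := h2 h1
    exact hx (by simpa using h3)
  have h0 : w ≠ 0 := by
    rintro rfl
    rw [zero_pow D.N_pos.ne'] at hw
    exact zero_ne_one hw
  have hK := U.K_mul_cartanSum D hw
  have hKn : ∀ n, U.K D ^ n * U.cartanSum D w = (w⁻¹) ^ n • U.cartanSum D w := fun n => by
    induction n with
    | zero => simp
    | succ n ih => rw [pow_succ, mul_assoc, hK, mul_smul_comm, ih, smul_smul, pow_succ']
  have hsq : U.cartanSum D w * U.cartanSum D w = ((2 * D.p * D.r : ℕ) : ℂ) • U.cartanSum D w := by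
    conv_lhs => enter [1]; rw [U.cartanSum]
    rw [Finset.sum_mul]
    simp only [smul_mul_assoc, hKn, smul_smul, ← mul_pow, mul_inv_cancel₀ h0, one_pow, one_smul]
    rw [Finset.sum_const, Finset.card_range, Nat.cast_smul_eq_nsmul]
  refine ⟨((2 * D.p * D.r : ℕ) : ℂ)⁻¹ • U.cartanSum D w, w⁻¹, inv_ne_zero h0, ?_, ?_, ?_, ?_⟩
  · rw [smul_mul_smul_comm, hsq, smul_smul, mul_assoc, inv_mul_cancel₀ hN, mul_one]
  · rw [mul_smul_comm, hK, smul_comm]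
  · rw [smul_mul_assoc, ← (U.K_commute_cartanSum D w).eq, hK, smul_comm]
  · rw [mul_smul_comm]
    exact smul_ne_zero (inv_ne_zero hN) hxw

/-- Extension of the left ideal of a weight idempotent to the big algebra. -/
theorem exists_lifting {f : Ubar hp hq} {c z : ℂ} (hf : f * f = f) (hz : z ≠ 0) (hzc : z ^ 2 = c)
    (hkf : U.K _ * f = c • f) (hfk : f * U.K _ = c • f) :
    ∃ (n : ℕ) (V : MatRep (Uhalf hp hq) n),
      Nonempty (Submodule.span (Ubar hp hq) {f} ≃ₗ[Ubar hp hq] RepSpace (V.comp (incl hp hq))) ∧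
      ∀ x, x * f ≠ 0 → V (incl hp hq x) ≠ 0 := by
  -- Choosing a square root `z` of the weight makes `f'` an eigenvector of `k` with eigenvalue `z`.
  -- The left ideal it generates in the extension is then generated over the small algebra alone,
  -- and the retraction identifies it with the left ideal of `f`.
  set f' : Uhalf hp hq := incl hp hq f * (1 + z⁻¹ • U.K _) with hf'
  have hscale : U.scale _ (root_ne_zero hp hq) f = f :=
    U.scale_eq_of_commute (D := barParam hp hq) (by
      change U.K (barParam hp hq) ^ 1 * f = f * U.K (barParam hp hq) ^ 1
      rw [pow_one, hkf, hfk]) _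
  have hKf : U.K _ * f' = z • f' := by
    have h1 : incl hp hq f * (U.K (halfParam hp hq) * U.K _) = z ^ 2 • incl hp hq f := by
      rw [← sq, ← incl_K, ← map_mul, hfk, map_smul, hzc]
    rw [hf', ← mul_assoc, K_mul_incl, hscale, mul_assoc, mul_add, mul_one, mul_smul_comm, mul_add,
      mul_smul_comm, h1, mul_add, mul_one, mul_smul_comm, smul_add, smul_smul, smul_smul,
      mul_inv_cancel₀ hz, one_smul, add_comm, sq, inv_mul_cancel_left₀ hz]
  have hff : incl hp hq f * f' = f' := by rw [hf', ← mul_assoc, ← map_mul, hf]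
  have hret : ∀ x, retr hp hq (incl hp hq x * f') = x * f := fun x => by
    have h1 : incl hp hq f * U.K _ = U.K _ * incl hp hq f := by rw [K_mul_incl, hscale]
    rw [retr_incl_mul, hf', mul_add, mul_one, mul_smul_comm, map_add, map_smul, h1, retr_K_mul,
      retr_incl, smul_zero, add_zero]
  have hgen : ∀ y : Uhalf hp hq, ∃ x : Ubar hp hq, y * f' = incl hp hq x * f' := fun y => by
    obtain ⟨x, x', rfl⟩ := exists_incl_add hp hq y
    refine ⟨x + z • U.scale _ (root_ne_zero hp hq) x', ?_⟩
    rw [add_mul, K_mul_incl, mul_assoc, hKf, map_add, map_smul, add_mul, mul_smul_comm, smul_mul_assoc]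
  let M : Submodule (Uhalf hp hq) (Uhalf hp hq) := Submodule.span _ {f'}
  have hM : ∀ x : Ubar hp hq, incl hp hq x * f' ∈ M := fun x =>
    M.smul_mem _ (Submodule.mem_span_singleton_self f')
  let b := Module.finBasis ℂ M
  let V : MatRep (Uhalf hp hq) (finrank ℂ M) :=
    (LinearMap.toMatrixAlgEquiv b).toAlgHom.comp (Algebra.lsmul ℂ ℂ M)
  have hV : ∀ y (m : M), (V y).mulVec (b.repr m) = b.repr (y • m) := fun y m =>
    LinearMap.toMatrix_mulVec_repr b b _ m
  let T : Submodule.span (Ubar hp hq) {f} →ₗ[Ubar hp hq] RepSpace (V.comp (incl hp hq)) :=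
    { toFun := fun y => (b.repr ⟨incl hp hq y.1 * f', hM _⟩ : Fin _ → ℂ)
      map_add' := fun y y' => by
        change ⇑(b.repr _) = ⇑(b.repr _) + ⇑(b.repr _)
        rw [← Finsupp.coe_add, ← map_add]
        congr 2
        ext
        change incl hp hq (y.1 + y'.1) * f' = _
        rw [map_add, add_mul]; rfl
      map_smul' := fun h y => by
        refine Eq.trans ?_ (hV (incl hp hq h) ⟨incl hp hq y.1 * f', hM _⟩).symm
        congr 2
        ext
        change incl hp hq (h * y.1) * f' = incl hp hq h * (incl hp hq y.1 * f')
        rw [map_mul, mul_assoc] }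
  refine ⟨_, V, ⟨LinearEquiv.ofBijective T ⟨?_, ?_⟩⟩, fun x hx h => hx ?_⟩
  · rw [← LinearMap.ker_eq_bot, LinearMap.ker_eq_bot']
    rintro ⟨y, hy⟩ h
    have h1 : b.repr ⟨incl hp hq y * f', hM _⟩ = 0 := DFunLike.coe_injective h
    have h2 : incl hp hq y * f' = 0 := congrArg Subtype.val ((LinearEquiv.map_eq_zero_iff _).1 h1)
    have h3 := hret y
    rw [h2, map_zero, (mem_span_idempotent hf).1 hy] at h3
    exact Subtype.ext h3.symm
  · intro w
    obtain ⟨⟨m, hm⟩, hmw⟩ : ∃ m : M, (⇑(b.repr m) : Fin _ → ℂ) = w :=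
      ⟨b.equivFun.symm w, b.equivFun.apply_symm_apply w⟩
    obtain ⟨y, rfl⟩ := Submodule.mem_span_singleton.1 hm
    obtain ⟨x, hx⟩ := hgen y
    refine ⟨⟨x * f, Submodule.mem_span_singleton.2 ⟨x, rfl⟩⟩, Eq.trans ?_ hmw⟩
    change (⇑(b.repr _) : Fin _ → ℂ) = _
    congr 2
    ext
    change incl hp hq (x * f) * f' = y * f'
    rw [map_mul, mul_assoc, hff, hx]
  · have h1 := hV (incl hp hq x) ⟨incl hp hq 1 * f', hM 1⟩
    rw [h, Matrix.zero_mulVec, eq_comm] at h1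
    have h2 : b.repr (incl hp hq x • (⟨incl hp hq 1 * f', hM 1⟩ : M)) = 0 := DFunLike.coe_injective h1
    have h3 : incl hp hq x * (incl hp hq 1 * f') = 0 :=
      congrArg Subtype.val ((LinearEquiv.map_eq_zero_iff _).1 h2)
    rw [map_one, one_mul] at h3
    rw [← hret, h3, map_zero]

/-- If the restricted coefficients did not span the dual, all would vanish at some `x ≠ 0`. But some
primitive weight idempotent `f` has `x f ≠ 0`, and its left ideal lifts to a representation in which
`x` acts nontrivially. -/
theorem hasEnoughLiftings : HasEnoughLiftings (incl hp hq) := by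
  let ρ : Dual ℂ (Uhalf hp hq) →ₗ[ℂ] Dual ℂ (Ubar hp hq) := (incl hp hq).toLinearMap.dualMap
  suffices h : (liftSpan (incl hp hq)).map ρ = ⊤ by
    intro f
    obtain ⟨φ, h1, h2⟩ := h.ge (Submodule.mem_top (x := f))
    exact ⟨φ, h1, h2⟩
  rw [liftSpan, Submodule.map_span]
  refine Submodule.span_eq_top_of_ne_zero fun x hx => ?_
  by_contra! hall
  obtain ⟨e, c, hc, he, hke, hek, hxe⟩ := exists_weight_idempotent hp hq hx
  obtain ⟨f, hf, hkf, hfk, hxf, hpim⟩ := exists_isPIM_span he hke hek hxe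
  obtain ⟨z, hz⟩ := IsAlgClosed.exists_pow_nat_eq c (n := 2) two_pos
  have hz0 : z ≠ 0 := by rintro rfl; exact hc (by rw [← hz]; simp)
  obtain ⟨n, V, ⟨T⟩, hV⟩ := exists_lifting hp hq hf hz0 hz hkf hfk
  apply hV x hxf
  ext i j
  exact hall _ ⟨_, ⟨n, V, Or.inr (hpim.of_equiv T), i, j, rfl⟩, rfl⟩

end Liftings
end
end RestrictedQG

open scoped TensorProduct MatrixGroups
namespace RestrictedQG
noncomputable section
open Coalgebra HopfAlgebra Module

/-! ### Uniqueness and existence of the projective representation. -/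

section Theta
variable {p : ℕ} {q : ℂ} (hp : 2 ≤ p) (hq : IsPrimitiveRoot q (2 * p)) {s : ℂ} (hs : s ^ 2 = q)

/-- Every auxiliary object is forced: `v` because the pivot is invertible, `Ψ` and the relevant
values of `Φ` by the coefficients of liftings, the two operators by these, and `θ` because the
twists generate. -/
theorem isThetaSLF_ext {θ θ' : SL(2, ℤ) →* ProjGL (SLF (Ubar hp hq))} (h : IsThetaSLF hp hq s θ)
    (h' : IsThetaSLF hp hq s θ') : θ = θ' := by
  obtain ⟨v, Ψ, Φ, a, b, h1, h2, h3, h4, h5, h6, h7⟩ := h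
  obtain ⟨v', Ψ', Φ', a', b', h1', h2', h3', h4', h5', h6', h7'⟩ := h'
  have G := isPivot_bar hp hq
  have hv : v = v' := by
    have e := incl_injective hp hq (h1.symm.trans h1')
    have e' := congrArg (U.Kinv (barParam hp hq) ^ (p + 1) * ·) e
    simp only [← mul_assoc, G.inv_mul, one_mul] at e'
    exact Units.ext e'
  have hs := hasEnoughLiftings hp hq
  have hΨ : Ψ = Ψ' := by
    have e := IsRSD.ext hs (incl_injective hp hq) h2 h2'
    exact AlgEquiv.ext fun x => AlgHom.congr_fun e x
  subst hv hΨ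
  have e := IsHandleRep.apply_eq hs (retr hp hq) (retr_incl hp hq) h3 h3' (Ψ.symm v⁻¹.val)
  have ha : a = a' := Units.ext (LinearMap.ext fun ψ => Subtype.ext (by rw [h4, h4', e.1]))
  have hb : b = b' := Units.ext (LinearMap.ext fun ψ => Subtype.ext (by rw [h5, h5', e.2]))
  exact modular_hom_ext (by rw [h6, h6', ha]) (by rw [h7, h7', hb])

include hs

theorem exists_isFactorizable : ∃ v vi : Ubar hp hq,
    IsFactorizable (U.K (barParam hp hq) ^ (p + 1)) (U.Kinv (barParam hp hq) ^ (p + 1)) v vi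
      (U.cointegral (barParam hp hq)) (comul (R := ℂ) vi * (v ⊗ₜ v)) ∧
    IsRibbon hp hq s v ∧
    TensorProduct.map (incl hp hq).toLinearMap (incl hp hq).toLinearMap
      (comul (R := ℂ) vi * (v ⊗ₜ v)) = (isRMatrix hp hq hs).Q ∧
    incl hp hq vi
      = ∑ i, rRight hp hq i * incl hp hq (U.K (barParam hp hq) ^ (p + 1)) * rLeft hp hq s i := by
  obtain ⟨v, vi, h1, h2, h3, h4, h5, h6, h7⟩ := exists_ribbon_bar hp hq hs
  have hQ := map_incl_monodromy hp hq hs h6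
  refine ⟨v, vi, ?_, (drinfeldElement_RMatrix hp hq).trans h1, hQ, h7⟩
  exact isFactorizable_of hp hq hs h2 h3 h4 h5 h6 (monodromy_bijective hp hq hs hQ)
    (fun φ hφ => U.SLF_antipode rfl hφ) (U.mul_cointegral _) (U.cointegral_mul _)
    (U.cointegral_ne_zero _)

theorem exists_thetaSLF : ∃ θ : SL(2, ℤ) →* ProjGL (SLF (Ubar hp hq)),
    IsThetaSLF hp hq s θ ∧ (θ τa * θ τb) ^ 3 = 1 := by
  obtain ⟨v, vi, D, hr, hQ, hvi⟩ := exists_isFactorizable hp hq hs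
  obtain ⟨Ψ, Φ, α, β, h1, h2, h3, h4, h5, h6⟩ := exists_modular_action (isRMatrix hp hq hs)
    (RMatrix_eq_sum hp hq s) hQ (retr hp hq) (retr_incl hp hq) (exists_convElt_incl hp hq hs)
    (isHopfIncl hp hq) (hasEnoughLiftings hp hq) D (fun ψ hψ => comp_retr_mem_SLF hp hq hψ)
    (incl_comm hp hq D.v_comm) (incl_comm hp hq D.vi_comm) hvi
  obtain ⟨θ, ha, hb⟩ := exists_modular_hom h5 h6
  exact ⟨θ, ⟨⟨v, vi, D.v_mul, D.mul_v⟩, Ψ, Φ, α, β, hr, h1, h2, h3, h4, ha, hb⟩, by rw [ha, hb, h6]⟩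

end Theta
end
end RestrictedQG

theorem proposition6p4 (p : ℕ) (hp : 2 ≤ p) (q s : ℂ) (hq : IsPrimitiveRoot q (2 * p))
    (hs : s ^ 2 = q) :
    (∀ z ∈ Subalgebra.center ℂ (Ubar hp hq), HopfAlgebra.antipode ℂ z = z) ∧
    (∀ ψ ∈ SLF (Ubar hp hq), ψ ∘ₗ HopfAlgebra.antipode ℂ = ψ) ∧
    (∃! θ : SL(2, ℤ) →* ProjGL (SLF (Ubar hp hq)), IsThetaSLF hp hq s θ) ∧
    ∀ θ : SL(2, ℤ) →* ProjGL (SLF (Ubar hp hq)), IsThetaSLF hp hq s θ →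
      ∃ θ' : PSL(2, ℤ) →* ProjGL (SLF (Ubar hp hq)),
        ∀ g : SL(2, ℤ), θ' (QuotientGroup.mk g) = θ g := by
  obtain ⟨v, vi, D, -⟩ := exists_isFactorizable hp hq hs
  obtain ⟨θ, hθ, h6⟩ := exists_thetaSLF hp hq hs
  refine ⟨fun z hz => D.antipode_central fun x => (Subalgebra.mem_center_iff.1 hz x).symm,
    D.SLF_antipode, ⟨θ, hθ, fun θ' h => isThetaSLF_ext hp hq h hθ⟩, fun θ' h => ?_⟩
  rw [isThetaSLF_ext hp hq h hθ]
  exact exists_projective_factor h6
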